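/- Let $m\ge 2$ and let $(M,g,J)$ be a Kähler manifold of complex dimension $m$: $M$ is a smooth (Hausdorff, second countable) manifold of real dimension $2m$, $g$ is a Riemannian metric of class $C^2$, and $J$ is a $C^1$ almost complex structure which is orthogonal for $g$ and parallel for its Levi-Civita connection. Let $\omega=g(J\cdot,\cdot)$ be the Kähler form, $\rho=\mathrm{Ric}(J\cdot,\cdot)$ the Ricci form, $s$ the scalar curvature and $d\mu_g$ the Riemannian volume measure, and assume that $s\in L^1(M,d\mu_g)$. An *asymptotic chart* on an end $M_\infty\subset M$ consists of a finite group $\Gamma\subset \mathbf O(2m)$ acting freely on the unit sphere, a radius $R>0$, and a smooth diffeomorphism $\{x\in\mathbb R^{2m}:|x|>R\}/\Gamma\to M_\infty$ onto an open subset $M_\infty\subset M$ such that for every $r$ the part of $M_\infty$ where $|x|\le r$ is relatively compact in $M$. Two asymptotic charts belong to the same end if the symmetric difference of their images is relatively compact in $M$. An asymptotic chart has *weak fall-off* if, for some $\varepsilon>0$, the components of (the pull-back to $\{|x|>R\}$ of) $g$ satisfy, as $|x|\to\infty$, $$g_{jk}=\delta_{jk}+O(|x|^{1-m-\varepsilon}),\qquad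 g_{jk,\ell}=O(|x|^{-m-\varepsilon}).$$ (Any end of an ALE Kähler manifold is covered; completeness of $M$, and conditions on the other ends, are not needed.) Suppose that $g$ has weak fall-off in some asymptotic chart on an end $M_\infty$. Then: 1. The mass of the end, computed in this chart, exists: with $S_\varrho=\{|x|=\varrho\}$, outward Euclidean unit normal $\mathbf n$ and Euclidean surface measure $d\mathfrak a_E$, the limit $$\mathfrak m=\lim_{\varrho\to\infty}\frac{\boldsymbol\Gamma(m)}{4(2m-1)\pi^m}\int_{S_\varrho/\Gamma}\big[g_{k\ell,k}-g_{kk,\ell}\big]\mathbf n^\ell\,d\mathfrak a_E$$ exists in $\mathbb R$, where $\boldsymbol\Gamma$ is Euler's Gamma function. 2. For every $r\ge R$ and every $1$-form $\theta$ of class $C^1$ on the region $|x|>r$ of the end (in particular, on all of $M_\infty$) with $d\theta=\rho$ there, $$\mathfrak m=\lim_{\varrho\to\infty}\frac{1}{2(2m-1)\pi^m}\int_{S_\varrho/\Gamma}\theta\wedge\omega^{m-1},$$ where $M$ is oriented by $J$ and $S_\varrho/\Gamma$ as the boundary of the region inside it; and such a $\theta$ exists for some $r\ge R$. 3. The mass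 does not depend on the chart: in any other asymptotic chart on the same end in which $g$ has weak fall-off (with a possibly different $\varepsilon'>0$), the mass limit exists and equals the same number $\mathfrak m$. -/

import Mathlib

open Set Filter Topology MeasureTheory Bundle
open scoped Manifold ContDiff

noncomputable section

namespace KahlerMass

/-! ### Local coordinates -/

/-- Euclidean space `ℝⁿ`. -/
abbrev Euc (n : ℕ) : Type := EuclideanSpace ℝ (Fin n)

/-- The `k`-th standard basis vector of `ℝⁿ`. -/
def stdVec {n : ℕ} (k : Fin n) : Euc n := EuclideanSpace.single k 1

/-- The partial derivative `∂f/∂x^k` at `x`. -/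
def pd {n : ℕ} (k : Fin n) (f : Euc n → ℝ) (x : Euc n) : ℝ := fderiv ℝ f x (stdVec k)

/-! ### Curvature of a metric `G = (g_{jk})` given by its components in local coordinates -/

/-- Christoffel symbols
`Γ^l_{jk} = ½ ∑ᵢ g^{li} (∂_j g_{ik} + ∂_k g_{ij} - ∂_i g_{jk})`. -/
def christoffel {n : ℕ} (G : Euc n → Matrix (Fin n) (Fin n) ℝ) (l j k : Fin n) (x : Euc n) : ℝ :=
  (1 / 2) * ∑ i, (G x)⁻¹ l i *
    (pd j (fun y => G y i k) x + pd k (fun y => G y i j) x - pd i (fun y => G y j k) x)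

/-- Ricci curvature
`R_{jk} = ∂_l Γ^l_{jk} - ∂_k Γ^l_{jl} + Γ^l_{le} Γ^e_{jk} - Γ^l_{ke} Γ^e_{jl}` (summed over
repeated indices). -/
def ricci {n : ℕ} (G : Euc n → Matrix (Fin n) (Fin n) ℝ) (j k : Fin n) (x : Euc n) : ℝ :=
  (∑ l, (pd l (christoffel G l j k) x - pd k (christoffel G l j l) x)) +
    ∑ l, ∑ e, (christoffel G l l e x * christoffel G e j k x -
      christoffel G l k e x * christoffel G e j l x)

/-- Scalar curvature `g^{jk} R_{jk}`. -/
def scalarCoord {n : ℕ} (G : Euc n → Matrix (Fin n) (Fin n) ℝ) (x : Euc n) : ℝ :=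
  ∑ j, ∑ k, (G x)⁻¹ j k * ricci G j k x

/-! ### Tensor fields on a manifold and their components in local parametrizations -/

section Manifold

variable {n : ℕ} {M : Type*} [TopologicalSpace M] [ChartedSpace (Euc n) M]

/-- A Riemannian metric of class `C²`. -/
abbrev Metric2 (n : ℕ) (M : Type*) [TopologicalSpace M] [ChartedSpace (Euc n) M]
    [IsManifold 𝓘(ℝ, Euc n) ∞ M] :=
  ContMDiffRiemannianMetric 𝓘(ℝ, Euc n) 2 (Euc n)
    (fun p : M => TangentSpace 𝓘(ℝ, Euc n) p)

/-- A (not yet regular) field of endomorphisms of the tangent spaces. -/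
abbrev EndField (n : ℕ) (M : Type*) [TopologicalSpace M] [ChartedSpace (Euc n) M] :=
  ∀ p : M, TangentSpace 𝓘(ℝ, Euc n) p →L[ℝ] TangentSpace 𝓘(ℝ, Euc n) p

/-- A (not yet regular) field of covectors. -/
abbrev OneForm (n : ℕ) (M : Type*) [TopologicalSpace M] [ChartedSpace (Euc n) M] :=
  ∀ p : M, TangentSpace 𝓘(ℝ, Euc n) p →L[ℝ] ℝ

/-- The coordinate vector `∂/∂x^k` of the local parametrization `Φ` at `x`, a tangent vector of `M`
at `Φ x`. -/
def coordVec (Φ : Euc n → M) (x : Euc n) (k : Fin n) : TangentSpace 𝓘(ℝ, Euc n) (Φ x) :=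
  mfderiv 𝓘(ℝ, Euc n) 𝓘(ℝ, Euc n) Φ x (stdVec k)

/-- The components `g_{jk} = g(∂_j, ∂_k)` in the local parametrization `Φ`. -/
def metricCoeff [IsManifold 𝓘(ℝ, Euc n) ∞ M] (g : Metric2 n M) (Φ : Euc n → M) (x : Euc n) :
    Matrix (Fin n) (Fin n) ℝ :=
  Matrix.of fun j k => g.inner (Φ x) (coordVec Φ x j) (coordVec Φ x k)

/-- The components `J^l_k` (row `l`, column `k`) of an endomorphism field, defined by
`J ∂_k = ∑ J^l_k ∂_l`. -/
def endCoeff (J : EndField n M) (Φ : Euc n → M) (x : Euc n) : Matrix (Fin n) (Fin n) ℝ :=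
  Matrix.of fun l k =>
    (EuclideanSpace.proj l : Euc n →L[ℝ] ℝ)
      ((mfderiv 𝓘(ℝ, Euc n) 𝓘(ℝ, Euc n) Φ x).inverse (J (Φ x) (coordVec Φ x k)))

/-- The components `θ_k = θ(∂_k)` of a one-form. -/
def formCoeff (θ : OneForm n M) (Φ : Euc n → M) (k : Fin n) (x : Euc n) : ℝ :=
  θ (Φ x) (coordVec Φ x k)

variable [IsManifold 𝓘(ℝ, Euc n) ∞ M]

/-- The components `ω_{jk} = g(J ∂_j, ∂_k)` of the Kähler form. -/
def kahlerFormCoeff (g : Metric2 n M) (J : EndField n M) (Φ : Euc n → M) (x : Euc n) :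
    Matrix (Fin n) (Fin n) ℝ :=
  Matrix.of fun j k => g.inner (Φ x) (J (Φ x) (coordVec Φ x j)) (coordVec Φ x k)

/-- The components `ρ_{jk} = Ric(J ∂_j, ∂_k)` of the Ricci form. -/
def ricciFormCoeff (g : Metric2 n M) (J : EndField n M) (Φ : Euc n → M) (j k : Fin n)
    (x : Euc n) : ℝ :=
  ∑ l, endCoeff J Φ x l j * ricci (metricCoeff g Φ) l k x

/-- The scalar curvature function of `g`; it is computed at `p` in the preferred chart at `p`. -/
def scalarCurvature (g : Metric2 n M) (p : M) : ℝ :=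
  scalarCoord (metricCoeff g (chartAt (Euc n) p).symm) (chartAt (Euc n) p p)

/-- The Riemannian volume measure: the smallest Borel measure that dominates
`√(det g_{jk}) dx¹ ⋯ dxⁿ` on the domain of each of the preferred charts. As these densities agree on
overlaps, on a second countable manifold it restricts to `√(det g_{jk}) dx¹ ⋯ dxⁿ` on the domain of
every chart. -/
def riemannianVolume [MeasurableSpace M] [BorelSpace M] (g : Metric2 n M) : Measure M :=
  ⨆ p : M, Measure.map (chartAt (Euc n) p).symm
    ((volume.restrict (chartAt (Euc n) p).target).withDensity
      fun x => ENNReal.ofReal (Real.sqrt (metricCoeff g (chartAt (Euc n) p).symm x).det))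

/-- `(g, J)` is a Kähler structure: `J` is a `C¹` almost complex structure, orthogonal for `g` and
parallel for the Levi-Civita connection, that is, in every smooth chart
`∂_j J^l_k + Γ^l_{je} J^e_k - Γ^e_{jk} J^l_e = 0`. -/
structure IsKahler (g : Metric2 n M) (J : EndField n M) : Prop where
  contMDiff : ContMDiff 𝓘(ℝ, Euc n) (𝓘(ℝ, Euc n).prod 𝓘(ℝ, Euc n →L[ℝ] Euc n)) 1
    (fun p : M => TotalSpace.mk' (Euc n →L[ℝ] Euc n)
      (E := fun p : M => TangentSpace 𝓘(ℝ, Euc n) p →L[ℝ] TangentSpace 𝓘(ℝ, Euc n) p) p (J p))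
  sq_eq_neg : ∀ (p : M) (v : TangentSpace 𝓘(ℝ, Euc n) p), J p (J p v) = -v
  orthogonal : ∀ (p : M) (v w : TangentSpace 𝓘(ℝ, Euc n) p),
    g.inner p (J p v) (J p w) = g.inner p v w
  parallel : ∀ e ∈ IsManifold.maximalAtlas 𝓘(ℝ, Euc n) ∞ M, ∀ x ∈ e.target, ∀ j k l : Fin n,
    pd j (fun y => endCoeff J e.symm y l k) x +
      ∑ i, (christoffel (metricCoeff g e.symm) l j i x * endCoeff J e.symm x i k -
        christoffel (metricCoeff g e.symm) i j k x * endCoeff J e.symm x l i) = 0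

/-- `θ` is, on the open set `U`, a one-form of class `C¹` with `dθ = ρ`, where `ρ` is the Ricci form
of `(g, J)`: in every smooth chart `∂_j θ_k - ∂_k θ_j = ρ_{jk}` at all points of `U`. -/
structure IsRicciPrimitiveOn (g : Metric2 n M) (J : EndField n M) (θ : OneForm n M)
    (U : Set M) : Prop where
  contMDiffOn : ContMDiffOn 𝓘(ℝ, Euc n) (𝓘(ℝ, Euc n).prod 𝓘(ℝ, Euc n →L[ℝ] ℝ)) 1
    (fun p : M => TotalSpace.mk' (Euc n →L[ℝ] ℝ)
      (E := fun p : M => TangentSpace 𝓘(ℝ, Euc n) p →L[ℝ] Bundle.Trivial M ℝ p) p (θ p)) U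
  d_eq : ∀ e ∈ IsManifold.maximalAtlas 𝓘(ℝ, Euc n) ∞ M, ∀ x ∈ e.target, e.symm x ∈ U →
    ∀ j k : Fin n,
      pd j (formCoeff θ e.symm k) x - pd k (formCoeff θ e.symm j) x =
        ricciFormCoeff g J e.symm j k x

end Manifold

/-! ### Asymptotic charts -/

/-- An asymptotic coordinate system on an end of `M`: a finite group `Γ ⊂ O(n)` acting freely on the
unit sphere, and a map `{x ∈ ℝⁿ : |x| > R} → M`, onto the end, that induces a diffeomorphism from
`{x ∈ ℝⁿ : |x| > R} / Γ` to the end. The part of the end where `|x| ≤ r` is relatively compact in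
`M`, so that only `|x| → ∞` leads to infinity. -/
structure AsymptoticChart (n : ℕ) (M : Type*) [TopologicalSpace M] [ChartedSpace (Euc n) M] where
  Γ : Subgroup (Euc n ≃ₗᵢ[ℝ] Euc n)
  finite : Finite Γ
  free : ∀ γ ∈ Γ, ∀ x : Euc n, ‖x‖ = 1 → γ x = x → γ = 1
  R : ℝ
  R_pos : 0 < R
  toFun : Euc n → M
  isLocalDiffeomorphOn :
    IsLocalDiffeomorphOn 𝓘(ℝ, Euc n) 𝓘(ℝ, Euc n) ∞ toFun {x | R < ‖x‖}
  eq_iff : ∀ x y : Euc n, R < ‖x‖ → R < ‖y‖ → (toFun x = toFun y ↔ ∃ γ ∈ Γ, γ x = y)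
  isCompact_closure : ∀ r : ℝ, IsCompact (closure (toFun '' {x | R < ‖x‖ ∧ ‖x‖ ≤ r}))

/-- The integral of `f` over the sphere `S_ϱ = {|x| = ϱ}` in `ℝⁿ` for the Euclidean
`(n-1)`-dimensional volume. -/
def sphereIntegral {n : ℕ} (f : Euc n → ℝ) (ϱ : ℝ) : ℝ :=
  ϱ ^ (n - 1) * ∫ u : Metric.sphere (0 : Euc n) 1, f (ϱ • (u : Euc n))
    ∂(volume : Measure (Euc n)).toSphere

/-- The value of `η_0 ∧ ⋯ ∧ η_{m-1}`, for two-forms `η_i` on `ℝ^{2m}` given by their skew matrices of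
components, on the standard basis of `ℝ^{2m}` taken in the order
`e_0, e_m, e_1, e_{m+1}, …, e_{m-1}, e_{2m-1}`. (The order matters only for the sign.) -/
def topWedge {m : ℕ} (η : Fin m → Matrix (Fin (2 * m)) (Fin (2 * m)) ℝ) : ℝ :=
  (1 / 2 ^ m) * ∑ σ : Equiv.Perm (Fin 2 × Fin m), ((Equiv.Perm.sign σ : ℤ) : ℝ) *
    ∏ i, η i (finProdFinEquiv (σ (0, i))) (finProdFinEquiv (σ (1, i)))

/-- The components of `α ∧ β` for covectors `α` and `β`. -/
def wedgeCovec {n : ℕ} (α β : Fin n → ℝ) : Matrix (Fin n) (Fin n) ℝ :=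
  Matrix.of fun j k => α j * β k - α k * β j

/-- The function `f` with `ν ∧ θ ∧ ω^{m-1} = f · vol`, where `ν` is the covector dual to the outward
Euclidean unit normal of the sphere through `x`, and `vol` is the Euclidean volume form for the
orientation in which `ω^m` is positive; `Ω` is the matrix of components of `ω`. Thus, with this orientation and the spheres oriented as
boundaries of balls, the integral of `θ ∧ ω^{m-1}` over a sphere is that of `f` for the
Euclidean surface measure. -/
def fluxDensity {m : ℕ} (θ : Fin (2 * m) → ℝ) (Ω : Matrix (Fin (2 * m)) (Fin (2 * m)) ℝ)
    (x : Euc (2 * m)) : ℝ :=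
  SignType.sign (topWedge fun _ : Fin m => Ω) *
    topWedge fun i : Fin m => if i.val = 0 then wedgeCovec (fun j => x j / ‖x‖) θ else Ω

namespace AsymptoticChart

variable {n : ℕ} {M : Type*} [TopologicalSpace M] [ChartedSpace (Euc n) M]

/-- The part of the end where `|x| > r`. -/
def tail (c : AsymptoticChart n M) (r : ℝ) : Set M := c.toFun '' {x | r < ‖x‖}

/-- Two asymptotic charts are charts of the same end if their images agree up to a relatively
compact set. -/
def SameEnd (c c' : AsymptoticChart n M) : Prop :=
  IsCompact (closure (symmDiff (c.tail c.R) (c'.tail c'.R)))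

variable [IsManifold 𝓘(ℝ, Euc n) ∞ M]

/-- Fall-off of order `τ` in the given asymptotic chart: `g_{jk} = δ_{jk} + O(|x|^{-τ})` and
`g_{jk,l} = O(|x|^{-τ-1})` as `|x| → ∞`. -/
structure HasFallOff (c : AsymptoticChart n M) (g : Metric2 n M) (τ : ℝ) : Prop where
  metric : ∀ j k : Fin n,
    (fun x => metricCoeff g c.toFun x j k - (1 : Matrix (Fin n) (Fin n) ℝ) j k)
      =O[Bornology.cobounded (Euc n)] fun x => ‖x‖ ^ (-τ)
  deriv : ∀ j k l : Fin n,
    pd l (fun y => metricCoeff g c.toFun y j k)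
      =O[Bornology.cobounded (Euc n)] fun x => ‖x‖ ^ (-τ - 1)

/-- The normalized integral over `S_ϱ / Γ` of `[g_{kl,k} - g_{kk,l}] n^l` in the given asymptotic
chart; an integral over `S_ϱ / Γ` is `1 / |Γ|` times the integral over `S_ϱ` of the pull-back. -/
def massIntegral (c : AsymptoticChart n M) (g : Metric2 n M) (ϱ : ℝ) : ℝ :=
  Real.Gamma ((n : ℝ) / 2) / (4 * ((n : ℝ) - 1) * Real.pi ^ ((n : ℝ) / 2)) *
    ((Nat.card c.Γ : ℝ)⁻¹ * sphereIntegral (fun x =>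
      ∑ l, (∑ k, (pd k (fun y => metricCoeff g c.toFun y k l) x -
        pd l (fun y => metricCoeff g c.toFun y k k) x)) * (x l / ‖x‖)) ϱ)

/-- The mass of `g`, computed in the given asymptotic chart, exists and equals `μ`. -/
def HasMass (c : AsymptoticChart n M) (g : Metric2 n M) (μ : ℝ) : Prop :=
  Tendsto (c.massIntegral g) atTop (𝓝 μ)

end AsymptoticChart

/-- The integral of `θ ∧ ω^{m-1}` over `S_ϱ / Γ`, where `ω` is the Kähler form, `M` carries the
orientation defined by `J`, and `S_ϱ / Γ` is oriented as the boundary of the region inside it. -/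
def AsymptoticChart.formIntegral {m : ℕ} {M : Type*} [TopologicalSpace M]
    [ChartedSpace (Euc (2 * m)) M] [IsManifold 𝓘(ℝ, Euc (2 * m)) ∞ M]
    (c : AsymptoticChart (2 * m) M) (g : Metric2 (2 * m) M) (J : EndField (2 * m) M)
    (θ : OneForm (2 * m) M) (ϱ : ℝ) : ℝ :=
  (Nat.card c.Γ : ℝ)⁻¹ * sphereIntegral (fun x =>
    fluxDensity (fun k => formCoeff θ c.toFun k x) (kahlerFormCoeff g J c.toFun x) x) ϱ

end KahlerMass

end

/-!
# The mass of an end of a Kähler manifold and its Ricci form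

Near infinity in an asymptotic chart, the components of a parallel complex structure `J` converge to a
constant complex structure `J₀`, because their derivatives are of the order of the Christoffel symbols
(`exists_limit_J`). The endomorphism `½ (1 - J J₀)` then intertwines `J` and `J₀` and trivializes the
tangent bundle as a complex vector bundle. In this trivialization half the trace of `J₀` composed with
the Levi-Civita connection matrix is a connection form of the anticanonical bundle, and its exterior
derivative is the Ricci form `ρ` (`pd_ricPrim`). It is invariant under the group of the end, hence
descends to the end (`AsymptoticChart.exists_primitive`).

For a one-form `θ`, the form `θ ∧ ω^{m-1}` corresponds to a vector field, `fluxField`, whose flux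
through a sphere is the integral of the form. If `dθ = ρ`, the divergence of this field is, up to a
constant, the density of scalar curvature, since `dω = 0` and `ρ ∧ ω^{m-1}` is a multiple of
`s ω^m` (`div_fluxField_of_primitive`). As `s` is integrable, the fluxes through large spheres converge
by the divergence theorem (`exists_tendsto_flux`). For the explicit primitive, expanding to first order
shows that the flux field and the vector field defining the mass agree up to a constant factor, up to
the divergence of a skew matrix, which has no flux through closed hypersurfaces, and up to quadratic
terms of order `|x|^{-2τ-1}`, which are negligible for `τ > m - 1` (`decay_fluxField_sub_massField`,
`sphereIntegral_div_skew`, `IsKahlerOn.tendsto_flux_sub`). So the mass exists and is the limit of the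
integrals of `θ ∧ ω^{m-1}` for this `θ`. Two primitives of `ρ` differ by a closed one-form, which is
exact near infinity in dimension at least three, so that its flux vanishes
(`exists_primitive_of_closed`, `IsKahlerOn.sphereFlux_closed`).

To compare two charts of one end, note first that neighbourhoods of infinity in the two charts are
nested in each other. This does not require completeness: by the fall-off of the metric, points
far out in a chart keep away from each point of `M` (`exists_nhds_disjoint_tail`,
`exists_tail_subset`). A single primitive `θ` can then be used in both charts. Averaging the fluxes
with a cut-off function `u` of the radius in one chart gives the integral of `du ∧ θ ∧ ω^{m-1}` over
the end divided by the group, a quantity that does not involve the chart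
(`avgFlux_eq_integral`, `integral_overlap_eq`). In the other chart this integral differs from an
averaged flux at most by the integral of a multiple of `|s|` over a region far out
(`abs_avgFlux_sub_le`), which tends to zero. Hence the limits of the fluxes, divided by the orders of
the groups, agree (`flux_limit_eq`), and so do the masses.
-/

noncomputable section

namespace KahlerMass

/-! ### Partial derivatives of functions and of matrix-valued functions -/

section Calculus

variable {n : ℕ} {ι κ l : Type*}

lemma pd_congr {f h : Euc n → ℝ} {x : Euc n} (H : f =ᶠ[𝓝 x] h) (k : Fin n) : pd k f x = pd k h x := by
  simp [pd, H.fderiv_eq]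

@[simp] lemma pd_const (c : ℝ) (k : Fin n) (x : Euc n) : pd k (fun _ => c) x = 0 := by
  simp [pd]

lemma pd_add {f h : Euc n → ℝ} {x : Euc n} (hf : DifferentiableAt ℝ f x)
    (hh : DifferentiableAt ℝ h x) (k : Fin n) :
    pd k (fun y => f y + h y) x = pd k f x + pd k h x := by
  simp [pd, fderiv_fun_add hf hh]

lemma pd_sub {f h : Euc n → ℝ} {x : Euc n} (hf : DifferentiableAt ℝ f x)
    (hh : DifferentiableAt ℝ h x) (k : Fin n) :
    pd k (fun y => f y - h y) x = pd k f x - pd k h x := by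
  simp [pd, fderiv_fun_sub hf hh]

lemma pd_neg (f : Euc n → ℝ) (x : Euc n) (k : Fin n) :
    pd k (fun y => -f y) x = -pd k f x := by
  simp [pd, fderiv_fun_neg]

lemma pd_mul {f h : Euc n → ℝ} {x : Euc n} (hf : DifferentiableAt ℝ f x)
    (hh : DifferentiableAt ℝ h x) (k : Fin n) :
    pd k (fun y => f y * h y) x = pd k f x * h x + f x * pd k h x := by
  simp [pd, fderiv_fun_mul hf hh]; ring

lemma pd_const_mul {f : Euc n → ℝ} {x : Euc n} (hf : DifferentiableAt ℝ f x) (c : ℝ) (k : Fin n) :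
    pd k (fun y => c * f y) x = c * pd k f x := by
  simp [pd_mul (differentiableAt_const c) hf]

lemma pd_sum {s : Finset ι} {f : ι → Euc n → ℝ} {x : Euc n}
    (hf : ∀ i ∈ s, DifferentiableAt ℝ (f i) x) (k : Fin n) :
    pd k (fun y => ∑ i ∈ s, f i y) x = ∑ i ∈ s, pd k (f i) x := by
  simp [pd, fderiv_fun_sum hf]

lemma fderiv_apply_eq_sum_pd (f : Euc n → ℝ) (x v : Euc n) :
    fderiv ℝ f x v = ∑ k, v k * pd k f x := by
  conv_lhs => rw [show v = ∑ k, v k • stdVec k from by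
    ext i; simp [stdVec, Pi.single_apply]]
  simp [pd]

lemma stdVec_apply (k i : Fin n) : (stdVec k : Euc n) i = if i = k then 1 else 0 := by
  simp [stdVec]

/-- Chain rule for partial derivatives. -/
lemma pd_comp {f : Euc n → ℝ} {φ : Euc n → Euc n} {x : Euc n} (hf : DifferentiableAt ℝ f (φ x))
    (hφ : DifferentiableAt ℝ φ x) (k : Fin n) :
    pd k (fun y => f (φ y)) x = ∑ a, pd k (fun y => φ y a) x * pd a f (φ x) := by
  have h1 : fderiv ℝ (fun y => f (φ y)) x = (fderiv ℝ f (φ x)).comp (fderiv ℝ φ x) :=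
    fderiv_comp x hf hφ
  have h2 : ∀ a, pd k (fun y => φ y a) x = (fderiv ℝ φ x (stdVec k)) a := by
    intro a
    have : HasFDerivAt (fun y => φ y a)
        ((EuclideanSpace.proj a : Euc n →L[ℝ] ℝ).comp (fderiv ℝ φ x)) x :=
      (EuclideanSpace.proj a : Euc n →L[ℝ] ℝ).hasFDerivAt.comp x hφ.hasFDerivAt
    simp [pd, this.fderiv]
  simp only [pd, h1, ContinuousLinearMap.comp_apply]
  rw [fderiv_apply_eq_sum_pd]
  refine Finset.sum_congr rfl fun a _ => ?_
  rw [← h2]; rfl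

lemma contDiffAt_pd {f : Euc n → ℝ} {x : Euc n} {r s : WithTop ℕ∞} (hf : ContDiffAt ℝ s f x)
    (h : r + 1 ≤ s) (k : Fin n) : ContDiffAt ℝ r (pd k f) x :=
  (hf.fderiv_right h).clm_apply contDiffAt_const

lemma pd_comm {f : Euc n → ℝ} {x : Euc n} (hf : ContDiffAt ℝ 2 f x) (j k : Fin n) :
    pd j (pd k f) x = pd k (pd j f) x := by
  have hd : DifferentiableAt ℝ (fderiv ℝ f) x :=
    (hf.fderiv_right (m := 1) (by norm_num)).differentiableAt (by norm_num)
  have key : ∀ a b : Fin n, pd a (pd b f) x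
      = fderiv ℝ (fderiv ℝ f) x (stdVec a) (stdVec b) := by
    intro a b
    have : HasFDerivAt (fun y => fderiv ℝ f y (stdVec b))
        ((ContinuousLinearMap.apply ℝ ℝ (stdVec b)).comp (fderiv ℝ (fderiv ℝ f) x)) x :=
      (ContinuousLinearMap.apply ℝ ℝ (stdVec b)).hasFDerivAt.comp x hd.hasFDerivAt
    have h2 : pd b f = fun y => fderiv ℝ f y (stdVec b) := rfl
    simp only [h2, KahlerMass.pd, this.fderiv]
    rfl
  rw [key, key]
  exact hf.isSymmSndFDerivAt (by simp) _ _

/-- The partial derivative `∂F/∂x^k`, entry by entry, of a matrix-valued function. -/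
def pdM (k : Fin n) (F : Euc n → Matrix ι κ ℝ) (x : Euc n) : Matrix ι κ ℝ :=
  Matrix.of fun i j => pd k (fun y => F y i j) x

/-- The entries of a matrix-valued function are of class `C^r` at `x`. -/
def CMatAt (r : WithTop ℕ∞) (F : Euc n → Matrix ι κ ℝ) (x : Euc n) : Prop :=
  ∀ i j, ContDiffAt ℝ r (fun y => F y i j) x

lemma pdM_apply (k : Fin n) (F : Euc n → Matrix ι κ ℝ) (x : Euc n) (i : ι) (j : κ) :
    pdM k F x i j = pd k (fun y => F y i j) x := rfl

lemma CMatAt.of_le {r s : WithTop ℕ∞} {F : Euc n → Matrix ι κ ℝ} {x : Euc n} (h : CMatAt s F x)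
    (hrs : r ≤ s) : CMatAt r F x := fun i j => (h i j).of_le hrs

lemma CMatAt.diff {r : WithTop ℕ∞} {F : Euc n → Matrix ι κ ℝ} {x : Euc n} (h : CMatAt r F x)
    (hr : r ≠ 0) (i : ι) (j : κ) : DifferentiableAt ℝ (fun y => F y i j) x :=
  (h i j).differentiableAt hr

lemma CMatAt.const {r : WithTop ℕ∞} (A : Matrix ι κ ℝ) (x : Euc n) : CMatAt r (fun _ => A) x :=
  fun _ _ => contDiffAt_const

lemma CMatAt.sub {r : WithTop ℕ∞} {F H : Euc n → Matrix ι κ ℝ} {x : Euc n} (hF : CMatAt r F x)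
    (hH : CMatAt r H x) : CMatAt r (fun y => F y - H y) x :=
  fun i j => (hF i j).sub (hH i j)

lemma CMatAt.smul {r : WithTop ℕ∞} {f : Euc n → ℝ} {F : Euc n → Matrix ι κ ℝ} {x : Euc n}
    (hf : ContDiffAt ℝ r f x) (hF : CMatAt r F x) :
    CMatAt r (fun y => f y • F y) x :=
  fun i j => hf.mul (hF i j)

lemma CMatAt.transpose {r : WithTop ℕ∞} {F : Euc n → Matrix ι κ ℝ} {x : Euc n}
    (hF : CMatAt r F x) : CMatAt r (fun y => (F y).transpose) x :=
  fun i j => hF j i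

lemma CMatAt.mul [Fintype κ] {r : WithTop ℕ∞} {F : Euc n → Matrix ι κ ℝ}
    {H : Euc n → Matrix κ l ℝ} {x : Euc n} (hF : CMatAt r F x) (hH : CMatAt r H x) :
    CMatAt r (fun y => F y * H y) x := fun i j => by
  simp only [Matrix.mul_apply]
  exact ContDiffAt.sum fun a _ => (hF i a).mul (hH a j)

lemma CMatAt.sum {α : Type*} {s : Finset α} {r : WithTop ℕ∞} {F : α → Euc n → Matrix ι κ ℝ}
    {x : Euc n} (hF : ∀ a ∈ s, CMatAt r (F a) x) : CMatAt r (fun y => ∑ a ∈ s, F a y) x :=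
  fun i j => by
    simp only [Matrix.sum_apply]
    exact ContDiffAt.sum fun a ha => hF a ha i j

lemma CMatAt.pdM {r s : WithTop ℕ∞} {F : Euc n → Matrix ι κ ℝ} {x : Euc n} (hF : CMatAt s F x)
    (h : r + 1 ≤ s) (k : Fin n) : CMatAt r (pdM k F) x :=
  fun i j => contDiffAt_pd (hF i j) h k

lemma CMatAt.congr {r : WithTop ℕ∞} {F H : Euc n → Matrix ι κ ℝ} {x : Euc n} (hF : CMatAt r F x)
    (h : H =ᶠ[𝓝 x] F) : CMatAt r H x :=
  fun i j => (hF i j).congr_of_eventuallyEq (h.mono fun y hy => by simp [hy])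

lemma CMatAt.trace [Fintype ι] {r : WithTop ℕ∞} {F : Euc n → Matrix ι ι ℝ} {x : Euc n}
    (hF : CMatAt r F x) : ContDiffAt ℝ r (fun y => (F y).trace) x := by
  simp only [Matrix.trace, Matrix.diag]
  exact ContDiffAt.sum fun a _ => hF a a

lemma CMatAt.det [Fintype ι] [DecidableEq ι] {r : WithTop ℕ∞} {F : Euc n → Matrix ι ι ℝ}
    {x : Euc n} (hF : CMatAt r F x) : ContDiffAt ℝ r (fun y => (F y).det) x := by
  simp only [Matrix.det_apply']
  exact ContDiffAt.sum fun σ _ => contDiffAt_const.mul (contDiffAt_prod fun i _ => hF _ _)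

lemma CMatAt.inv [Fintype ι] [DecidableEq ι] {r : WithTop ℕ∞} {F : Euc n → Matrix ι ι ℝ}
    {x : Euc n} (hF : CMatAt r F x) (h : (F x).det ≠ 0) : CMatAt r (fun y => (F y)⁻¹) x := by
  intro i j
  simp only [Matrix.inv_def, Matrix.smul_apply, smul_eq_mul, Matrix.adjugate_apply,
    Ring.inverse_eq_inv']
  refine (hF.det.inv h).mul (CMatAt.det fun a b => ?_)
  simp only [Matrix.updateRow_apply]
  by_cases hab : a = j
  · simp [hab, contDiffAt_const]
  · simpa [hab] using hF a b

lemma pdM_congr {F H : Euc n → Matrix ι κ ℝ} {x : Euc n} (h : F =ᶠ[𝓝 x] H) (k : Fin n) :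
    pdM k F x = pdM k H x := by
  ext i j
  exact pd_congr (h.mono fun y hy => by simp [hy]) k

@[simp] lemma pdM_const (A : Matrix ι κ ℝ) (k : Fin n) (x : Euc n) : pdM k (fun _ => A) x = 0 := by
  ext i j; simp [pdM_apply]

lemma pdM_add {F H : Euc n → Matrix ι κ ℝ} {x : Euc n} (hF : CMatAt 1 F x)
    (hH : CMatAt 1 H x) (k : Fin n) : pdM k (fun y => F y + H y) x = pdM k F x + pdM k H x := by
  ext i j
  exact pd_add (hF.diff (by simp) i j) (hH.diff (by simp) i j) k

lemma pdM_sub {F H : Euc n → Matrix ι κ ℝ} {x : Euc n} (hF : CMatAt 1 F x)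
    (hH : CMatAt 1 H x) (k : Fin n) : pdM k (fun y => F y - H y) x = pdM k F x - pdM k H x := by
  ext i j
  exact pd_sub (hF.diff (by simp) i j) (hH.diff (by simp) i j) k

lemma pdM_smul {f : Euc n → ℝ} {F : Euc n → Matrix ι κ ℝ} {x : Euc n} (hf : ContDiffAt ℝ 1 f x)
    (hF : CMatAt 1 F x) (k : Fin n) :
    pdM k (fun y => f y • F y) x = pd k f x • F x + f x • pdM k F x := by
  ext i j
  exact pd_mul (hf.differentiableAt (by simp)) (hF.diff (by simp) i j) k

lemma pdM_transpose (F : Euc n → Matrix ι κ ℝ) (x : Euc n) (k : Fin n) :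
    pdM k (fun y => (F y).transpose) x = (pdM k F x).transpose := rfl

lemma pdM_mul [Fintype κ] {F : Euc n → Matrix ι κ ℝ} {H : Euc n → Matrix κ l ℝ} {x : Euc n}
    (hF : CMatAt 1 F x) (hH : CMatAt 1 H x) (k : Fin n) :
    pdM k (fun y => F y * H y) x = pdM k F x * H x + F x * pdM k H x := by
  ext i j
  simp only [pdM_apply, Matrix.mul_apply, Matrix.add_apply]
  rw [← Finset.sum_add_distrib]
  refine (pd_sum (f := fun a y => F y i a * H y a j)
    (fun a _ => (hF.diff (by simp) i a).mul (hH.diff (by simp) a j)) k).trans ?_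
  exact Finset.sum_congr rfl fun a _ => pd_mul (hF.diff (by simp) i a) (hH.diff (by simp) a j) k

lemma pdM_sum {α : Type*} {s : Finset α} {F : α → Euc n → Matrix ι κ ℝ} {x : Euc n}
    (hF : ∀ a ∈ s, CMatAt 1 (F a) x) (k : Fin n) :
    pdM k (fun y => ∑ a ∈ s, F a y) x = ∑ a ∈ s, pdM k (F a) x := by
  ext i j
  simp only [pdM_apply, Matrix.sum_apply]
  exact pd_sum (fun a ha => (hF a ha).diff (by simp) i j) k

lemma pd_trace [Fintype ι] {F : Euc n → Matrix ι ι ℝ} {x : Euc n} (hF : CMatAt 1 F x)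
    (k : Fin n) : pd k (fun y => (F y).trace) x = (pdM k F x).trace := by
  simp only [Matrix.trace, Matrix.diag, pdM_apply]
  exact pd_sum (fun a _ => hF.diff (by simp) a a) k

lemma pdM_comm {F : Euc n → Matrix ι κ ℝ} {x : Euc n} (hF : CMatAt 2 F x) (j k : Fin n) :
    pdM j (pdM k F) x = pdM k (pdM j F) x := by
  ext a b
  exact pd_comm (hF a b) j k

lemma CMatAt.eventually_det_ne [Fintype ι] [DecidableEq ι] {r : WithTop ℕ∞}
    {F : Euc n → Matrix ι ι ℝ} {x : Euc n} (hF : CMatAt r F x) (h : (F x).det ≠ 0) :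
    ∀ᶠ y in 𝓝 x, (F y).det ≠ 0 :=
  hF.det.continuousAt.eventually_ne h

lemma pdM_inv [Fintype ι] [DecidableEq ι] {F : Euc n → Matrix ι ι ℝ} {x : Euc n}
    (hF : CMatAt 1 F x) (h : (F x).det ≠ 0) (k : Fin n) :
    pdM k (fun y => (F y)⁻¹) x = -((F x)⁻¹ * pdM k F x * (F x)⁻¹) := by
  have hu : IsUnit (F x).det := isUnit_iff_ne_zero.2 h
  have h0 : pdM k (fun y => F y * (F y)⁻¹) x = 0 := by
    rw [← pdM_const (1 : Matrix ι ι ℝ) k x]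
    refine pdM_congr ((hF.eventually_det_ne h).mono fun y hy => ?_) k
    exact Matrix.mul_nonsing_inv _ (isUnit_iff_ne_zero.2 hy)
  rw [pdM_mul hF (hF.inv h)] at h0
  have h1 : F x * pdM k (fun y => (F y)⁻¹) x = -(pdM k F x * (F x)⁻¹) :=
    eq_neg_of_add_eq_zero_right h0
  calc pdM k (fun y => (F y)⁻¹) x = (F x)⁻¹ * (F x * pdM k (fun y => (F y)⁻¹) x) := by
        rw [Matrix.nonsing_inv_mul_cancel_left _ _ hu]
    _ = _ := by rw [h1]; simp [Matrix.mul_assoc]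

/-- Chain rule for matrix-valued functions. -/
lemma pdM_comp {F : Euc n → Matrix ι κ ℝ} {φ : Euc n → Euc n} {x : Euc n}
    (hF : CMatAt 1 F (φ x)) (hφ : DifferentiableAt ℝ φ x) (k : Fin n) :
    pdM k (fun y => F (φ y)) x = ∑ a, pd k (fun y => φ y a) x • pdM a F (φ x) := by
  ext i j
  simp only [pdM_apply, Matrix.sum_apply, Matrix.smul_apply, smul_eq_mul]
  exact pd_comp (hF.diff (by simp) i j) hφ k

lemma CMatAt.comp {r : WithTop ℕ∞} {F : Euc n → Matrix ι κ ℝ} {φ : Euc n → Euc n} {x : Euc n}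
    (hF : CMatAt r F (φ x)) (hφ : ContDiffAt ℝ r φ x) : CMatAt r (fun y => F (φ y)) x :=
  fun i j => (hF i j).comp x hφ

end Calculus

/-! ### Levi-Civita connection and curvature in local coordinates -/

/-- Real square matrices. -/
abbrev SqMat (n : ℕ) : Type := Matrix (Fin n) (Fin n) ℝ

section LocalRiemann

variable {n : ℕ}

/-- The connection matrix `(C_j)^l_k = Γ^l_{jk}`. -/
def chrM (G : Euc n → SqMat n) (j : Fin n) (x : Euc n) : SqMat n :=
  Matrix.of fun l k => christoffel G l j k x

/-- The Christoffel symbols of the first kind, `½ (∂_j g_{ik} + ∂_k g_{ij} - ∂_i g_{jk})` in row `i`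
and column `k`. -/
def chrLow (G : Euc n → SqMat n) (j : Fin n) (x : Euc n) : SqMat n :=
  Matrix.of fun i k => (1 / 2) *
    (pd j (fun y => G y i k) x + pd k (fun y => G y i j) x - pd i (fun y => G y j k) x)

/-- The curvature endomorphism `R(∂_j, ∂_k) = ∂_j C_k - ∂_k C_j + [C_j, C_k]`. -/
def curvM (G : Euc n → SqMat n) (j k : Fin n) (x : Euc n) : SqMat n :=
  pdM j (chrM G k) x - pdM k (chrM G j) x + (chrM G j x * chrM G k x - chrM G k x * chrM G j x)

/-- The Jacobian matrix of a map of `ℝⁿ`. -/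
def jac (φ : Euc n → Euc n) (x : Euc n) : SqMat n := Matrix.of fun a k => pd k (fun y => φ y a) x

/-- `G` is a Riemannian metric of class `C²` on the open set `U` of `ℝⁿ`. -/
structure IsMetricOn (G : Euc n → SqMat n) (U : Set (Euc n)) : Prop where
  isOpen : IsOpen U
  smooth : ∀ x ∈ U, CMatAt 2 G x
  posDef : ∀ x ∈ U, (G x).PosDef

lemma chrM_eq (G : Euc n → SqMat n) (j : Fin n) (x : Euc n) : chrM G j x = (G x)⁻¹ * chrLow G j x := by
  ext l k
  simp only [chrM, chrLow, christoffel, Matrix.of_apply, Matrix.mul_apply, Finset.mul_sum]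
  exact Finset.sum_congr rfl fun i _ => by ring

namespace IsMetricOn

variable {G : Euc n → SqMat n} {U : Set (Euc n)} {x : Euc n}

lemma symm (h : IsMetricOn G U) (hx : x ∈ U) : (G x).transpose = G x := by
  rw [← Matrix.conjTranspose_eq_transpose_of_trivial]
  exact (h.posDef x hx).isHermitian

lemma symm_apply (h : IsMetricOn G U) (hx : x ∈ U) (i j : Fin n) : G x i j = G x j i := by
  conv_lhs => rw [← h.symm hx]
  rfl

lemma det_ne (h : IsMetricOn G U) (hx : x ∈ U) : (G x).det ≠ 0 := (h.posDef x hx).det_pos.ne'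

lemma isUnit_det (h : IsMetricOn G U) (hx : x ∈ U) : IsUnit (G x).det :=
  isUnit_iff_ne_zero.2 (h.det_ne hx)

lemma inv_symm (h : IsMetricOn G U) (hx : x ∈ U) : ((G x)⁻¹).transpose = (G x)⁻¹ := by
  rw [Matrix.transpose_nonsing_inv, h.symm hx]

lemma eventually_mem (h : IsMetricOn G U) (hx : x ∈ U) : ∀ᶠ y in 𝓝 x, y ∈ U :=
  h.isOpen.mem_nhds hx

lemma pd_symm (h : IsMetricOn G U) (hx : x ∈ U) (a i j : Fin n) :
    pd a (fun y => G y i j) x = pd a (fun y => G y j i) x :=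
  pd_congr ((h.eventually_mem hx).mono fun _ hy => h.symm_apply hy i j) a

lemma mul_chrM (h : IsMetricOn G U) (hx : x ∈ U) (j : Fin n) : G x * chrM G j x = chrLow G j x := by
  rw [chrM_eq, Matrix.mul_nonsing_inv_cancel_left _ _ (h.isUnit_det hx)]

lemma smooth_chrM (h : IsMetricOn G U) (hx : x ∈ U) (j : Fin n) : CMatAt 1 (chrM G j) x := by
  have h2 := h.smooth x hx
  have : chrM G j = fun y => (G y)⁻¹ * chrLow G j y := funext fun y => chrM_eq G j y
  rw [this]
  refine ((h2.of_le (by norm_num)).inv (h.det_ne hx)).mul fun a b => ?_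
  have e : (1 : WithTop ℕ∞) + 1 ≤ 2 := by norm_num
  exact contDiffAt_const.mul (((contDiffAt_pd (h2 _ _) e _).add (contDiffAt_pd (h2 _ _) e _)).sub
    (contDiffAt_pd (h2 _ _) e _))

/-- The Levi-Civita connection has no torsion. -/
lemma chrM_symm (h : IsMetricOn G U) (hx : x ∈ U) (j k l : Fin n) :
    chrM G j x l k = chrM G k x l j := by
  simp only [chrM, christoffel, Matrix.of_apply]
  congr 1
  refine Finset.sum_congr rfl fun i _ => ?_
  rw [h.pd_symm hx i j k]; ring

/-- The metric is parallel. -/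
lemma pdM_metric (h : IsMetricOn G U) (hx : x ∈ U) (j : Fin n) :
    pdM j G x = (chrM G j x).transpose * G x + G x * chrM G j x := by
  have e : (chrM G j x).transpose * G x = (G x * chrM G j x).transpose := by
    rw [Matrix.transpose_mul, h.symm hx]
  rw [e, h.mul_chrM hx]
  ext i k
  simp only [pdM_apply, chrLow, Matrix.add_apply, Matrix.transpose_apply, Matrix.of_apply]
  rw [h.pd_symm hx k i j, h.pd_symm hx j k i, h.pd_symm hx i k j]
  ring

/-- The Levi-Civita connection is the only torsion-free metric connection. -/
lemma eq_chrM (h : IsMetricOn G U) (hx : x ∈ U) (D : Fin n → SqMat n)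
    (hs : ∀ j k l, D j l k = D k l j)
    (hm : ∀ j, pdM j G x = (D j).transpose * G x + G x * D j) (j : Fin n) :
    D j = chrM G j x := by
  have key : G x * D j = chrLow G j x := by
    have hE : ∀ j i k, pd j (fun y => G y i k) x = (G x * D j) k i + (G x * D j) i k := by
      intro j i k
      have e : (D j).transpose * G x = (G x * D j).transpose := by
        rw [Matrix.transpose_mul, h.symm hx]
      rw [← pdM_apply j G x i k, hm, e]; rfl
    have hEs : ∀ j i k, (G x * D j) i k = (G x * D k) i j := by
      intro j i k
      simp only [Matrix.mul_apply]
      exact Finset.sum_congr rfl fun l _ => by rw [hs]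
    ext i k
    simp only [chrLow, Matrix.of_apply, hE]
    rw [hEs k i j, hEs k j i, hEs i k j]
    ring
  rw [chrM_eq, ← key, Matrix.nonsing_inv_mul_cancel_left _ _ (h.isUnit_det hx)]

lemma ricci_eq_sum (h : IsMetricOn G U) (hx : x ∈ U) (j k : Fin n) :
    ricci G j k x = ∑ l, curvM G l k x l j := by
  have hC : ∀ i j k, christoffel G i j k =ᶠ[𝓝 x] christoffel G i k j := fun i j k =>
    (h.eventually_mem hx).mono fun y hy => h.chrM_symm hy j k i
  have hC' : ∀ i j k, christoffel G i j k x = christoffel G i k j x := fun i j k =>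
    (hC i j k).eq_of_nhds
  simp only [ricci, curvM, chrM, Matrix.add_apply, Matrix.sub_apply, pdM_apply, Matrix.of_apply,
    Matrix.mul_apply]
  rw [← Finset.sum_add_distrib]
  refine Finset.sum_congr rfl fun l _ => ?_
  rw [Finset.sum_sub_distrib, pd_congr (hC l j k), pd_congr (hC l j l)]
  simp only [hC' _ k j, hC' _ j l]

lemma curvM_antisymm (G : Euc n → SqMat n) (j k : Fin n) (x : Euc n) :
    curvM G j k x = -curvM G k j x := by
  simp only [curvM]; abel

/-- The curvature endomorphisms are skew for the metric. -/
lemma curvM_skew (h : IsMetricOn G U) (hx : x ∈ U) (j k : Fin n) :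
    (curvM G j k x).transpose * G x + G x * curvM G j k x = 0 := by
  have hG := (h.smooth x hx).of_le (show (1 : WithTop ℕ∞) ≤ 2 by norm_num)
  have hC := fun j => h.smooth_chrM hx j
  have e : ∀ j k, pdM k (pdM j G) x = (pdM k (chrM G j) x).transpose * G x
      + (chrM G j x).transpose * ((chrM G k x).transpose * G x + G x * chrM G k x)
      + (((chrM G k x).transpose * G x + G x * chrM G k x) * chrM G j x
        + G x * pdM k (chrM G j) x) := by
    intro j k
    rw [pdM_congr ((h.eventually_mem hx).mono fun y hy => h.pdM_metric hy j) k,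
      pdM_add ((hC j).transpose.mul hG) (hG.mul (hC j)), pdM_mul (hC j).transpose hG,
      pdM_mul hG (hC j), pdM_transpose, h.pdM_metric hx k]
  have hs := pdM_comm (h.smooth x hx) j k
  rw [e, e] at hs
  simp only [curvM, Matrix.transpose_add, Matrix.transpose_sub, Matrix.transpose_mul,
    Matrix.add_mul, Matrix.sub_mul, Matrix.mul_add, Matrix.mul_sub, Matrix.mul_assoc] at hs ⊢
  rw [← sub_eq_zero] at hs
  rw [← hs]; abel

/-- The first Bianchi identity. -/
lemma bianchi (h : IsMetricOn G U) (hx : x ∈ U) (j k l a : Fin n) :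
    curvM G j k x a l + curvM G k l x a j + curvM G l j x a k = 0 := by
  have hC : ∀ b i j k, pd b (christoffel G i j k) x = pd b (christoffel G i k j) x := fun b i j k =>
    pd_congr ((h.eventually_mem hx).mono fun y hy => h.chrM_symm hy j k i) b
  have hM : ∀ i j k, (chrM G i x * chrM G j x) a k = (chrM G i x * chrM G k x) a j := by
    intro i j k
    simp only [Matrix.mul_apply]
    exact Finset.sum_congr rfl fun b _ => by rw [h.chrM_symm hx j k b]
  simp only [curvM, Matrix.add_apply, Matrix.sub_apply, pdM_apply]
  have e : ∀ b j k, pd b (fun y => chrM G j y a k) x = pd b (fun y => chrM G k y a j) x :=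
    fun b j k => hC b a j k
  rw [hM j k l, hM k l j, hM l j k, e j k l, e k l j, e l j k]
  ring

/-- The curvature tensor `⟨R(∂_i, ∂_j) ∂_l, ∂_k⟩` is symmetric under the exchange of its two pairs of
arguments. -/
lemma pair_symm (h : IsMetricOn G U) (hx : x ∈ U) (i j k l : Fin n) :
    (G x * curvM G i j x) k l = (G x * curvM G k l x) i j := by
  set T : Fin n → Fin n → Fin n → Fin n → ℝ := fun i j k l => (G x * curvM G i j x) k l with hT
  have h1 : ∀ i j k l, T i j k l = -T j i k l := by
    intro i j k l
    simp only [hT]; rw [curvM_antisymm]; simp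
  have h2 : ∀ i j k l, T i j k l = -T i j l k := by
    intro i j k l
    have := h.curvM_skew hx i j
    have e : (curvM G i j x).transpose * G x = (G x * curvM G i j x).transpose := by
      rw [Matrix.transpose_mul, h.symm hx]
    rw [e] at this
    have := congrFun (congrFun this k) l
    simp only [Matrix.add_apply, Matrix.transpose_apply, Matrix.zero_apply] at this
    simp only [hT]; linarith
  have h3 : ∀ i j k l, T i j k l + T j l k i + T l i k j = 0 := by
    intro i j k l
    simp only [hT, Matrix.mul_apply]
    rw [← Finset.sum_add_distrib, ← Finset.sum_add_distrib]
    refine Finset.sum_eq_zero fun a _ => ?_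
    rw [← mul_add, ← mul_add, h.bianchi hx, mul_zero]
  change T i j k l = T k l i j
  linarith [h3 i j k l, h3 j k l i, h3 k l i j, h3 l i j k, h1 i j k l, h2 i j k l, h1 j l k i,
    h2 j l k i, h1 l i k j, h2 l i k j, h1 j k l i, h2 j k l i, h1 k i l j, h2 k i l j, h1 i j l k,
    h2 i j l k, h1 k l i j, h2 k l i j, h1 l j i k, h2 l j i k, h1 j k i l, h2 j k i l,
    h1 l i j k, h2 l i j k, h1 i k j l, h2 i k j l, h1 k l j i, h2 k l j i]

/-- The Ricci tensor is symmetric. -/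
lemma ricci_symm (h : IsMetricOn G U) (hx : x ∈ U) (j k : Fin n) :
    ricci G j k x = ricci G k j x := by
  have e : ∀ j k, ricci G j k x = ∑ l, ∑ a, (G x)⁻¹ l a * (G x * curvM G l k x) a j := by
    intro j k
    rw [h.ricci_eq_sum hx]
    refine Finset.sum_congr rfl fun l _ => ?_
    rw [← Matrix.mul_apply, Matrix.nonsing_inv_mul_cancel_left _ _ (h.isUnit_det hx)]
  rw [e, e, Finset.sum_comm]
  refine Finset.sum_congr rfl fun a _ => Finset.sum_congr rfl fun l _ => ?_
  rw [h.pair_symm hx]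
  congr 1
  conv_lhs => rw [← h.inv_symm hx]
  rfl

end IsMetricOn

/-! ### Change of coordinates -/

section Transform

variable {G H : Euc n → SqMat n} {U V : Set (Euc n)} {φ : Euc n → Euc n} {x : Euc n}

lemma smooth_jac {r s : WithTop ℕ∞} (hφ : ContDiffAt ℝ s φ x) (h : r + 1 ≤ s) :
    CMatAt r (jac φ) x := fun a k =>
  contDiffAt_pd ((EuclideanSpace.proj a : Euc n →L[ℝ] ℝ).contDiff.contDiffAt.comp x hφ) h k

lemma pd_jac_symm (hφ : ContDiffAt ℝ 2 φ x) (a j k : Fin n) :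
    pdM j (jac φ) x a k = pdM k (jac φ) x a j :=
  pd_comm ((EuclideanSpace.proj a : Euc n →L[ℝ] ℝ).contDiff.contDiffAt.comp x hφ) j k

/-- Transformation of the connection matrices under a change of coordinates `φ`. -/
lemma jac_mul_chrM (hG : IsMetricOn G U) (hH : IsMetricOn H V) (hx : x ∈ U) (hφx : φ x ∈ V)
    (hφ : ContDiffAt ℝ 2 φ x)
    (hGH : G =ᶠ[𝓝 x] fun y => (jac φ y).transpose * H (φ y) * jac φ y) (j : Fin n) :
    jac φ x * chrM G j x =
      (∑ a, jac φ x a j • chrM H a (φ x)) * jac φ x + pdM j (jac φ) x := by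
  set A := jac φ x with hA
  have hdet : IsUnit A.det := by
    have h1 := hG.det_ne hx
    rw [hGH.eq_of_nhds, Matrix.det_mul] at h1
    exact isUnit_iff_ne_zero.2 (right_ne_zero_of_mul h1)
  have hA1 : CMatAt 1 (jac φ) x := smooth_jac hφ (by norm_num)
  have hH1 : CMatAt 1 (fun y => H (φ y)) x :=
    ((hH.smooth _ hφx).of_le (by norm_num)).comp (hφ.of_le (by norm_num))
  have hGx : G x = A.transpose * H (φ x) * A := hGH.eq_of_nhds
  set S : Fin n → SqMat n := fun j => ∑ a, A a j • chrM H a (φ x) with hS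
  have hdH : ∀ j, pdM j (fun y => H (φ y)) x = (S j).transpose * H (φ x) + H (φ x) * S j := by
    intro j
    rw [pdM_comp ((hH.smooth _ hφx).of_le (by norm_num)) (hφ.differentiableAt (by norm_num))]
    simp only [hS, Matrix.transpose_sum, Matrix.transpose_smul, Finset.sum_mul, Finset.mul_sum,
      Matrix.smul_mul, Matrix.mul_smul, ← Finset.sum_add_distrib]
    refine Finset.sum_congr rfl fun a _ => ?_
    rw [hH.pdM_metric hφx, ← smul_add]; rfl
  have hdG : ∀ j, pdM j G x = ((pdM j (jac φ) x).transpose * H (φ x) + A.transpose *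
      ((S j).transpose * H (φ x) + H (φ x) * S j)) * A
      + A.transpose * H (φ x) * pdM j (jac φ) x := by
    intro j
    rw [pdM_congr hGH, pdM_mul (hA1.transpose.mul hH1) hA1, pdM_mul hA1.transpose hH1, hdH,
      pdM_transpose]
  have key := hG.eq_chrM hx (fun j => A⁻¹ * (S j * A + pdM j (jac φ) x)) ?_ ?_ j
  · rw [← key, Matrix.mul_nonsing_inv_cancel_left _ _ hdet]
  · intro j k l
    simp only [Matrix.mul_apply (M := A⁻¹)]
    refine Finset.sum_congr rfl fun b _ => ?_
    congr 1
    rw [Matrix.add_apply, Matrix.add_apply, pd_jac_symm hφ]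
    congr 1
    simp only [hS, Matrix.mul_apply, Matrix.sum_apply, Matrix.smul_apply, smul_eq_mul,
      Finset.sum_mul]
    rw [Finset.sum_comm]
    refine Finset.sum_congr rfl fun c _ => Finset.sum_congr rfl fun d _ => ?_
    rw [hH.chrM_symm hφx]; ring
  · intro j
    rw [hdG, hGx]
    have e1 : A.transpose * (A⁻¹).transpose = 1 := by
      rw [← Matrix.transpose_mul, Matrix.nonsing_inv_mul _ hdet, Matrix.transpose_one]
    have e2 : ∀ B : SqMat n, (A⁻¹).transpose * (A.transpose * B) = B := by
      intro B
      rw [← Matrix.mul_assoc, ← Matrix.transpose_mul, Matrix.mul_nonsing_inv _ hdet,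
        Matrix.transpose_one, Matrix.one_mul]
    simp only [Matrix.transpose_mul, Matrix.transpose_add, Matrix.add_mul, Matrix.mul_add,
      Matrix.mul_assoc, e2, Matrix.mul_nonsing_inv_cancel_left _ _ hdet]
    abel

lemma jac_mul_curvM (hG : IsMetricOn G U) (hH : IsMetricOn H V) (hx : x ∈ U) (hφx : φ x ∈ V)
    (hφ : ContDiffAt ℝ 3 φ x)
    (hGH : G =ᶠ[𝓝 x] fun y => (jac φ y).transpose * H (φ y) * jac φ y) (j k : Fin n) :
    jac φ x * curvM G j k x =
      (∑ a, ∑ b, (jac φ x a j * jac φ x b k) • curvM H a b (φ x)) * jac φ x := by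
  set A := jac φ x with hA
  have hA2 : CMatAt 2 (jac φ) x := smooth_jac hφ (by norm_num)
  have hA1 : CMatAt 1 (jac φ) x := hA2.of_le (by norm_num)
  have hφ2 : ContDiffAt ℝ 2 φ x := hφ.of_le (by norm_num)
  have hCH : ∀ a, CMatAt 1 (fun y => chrM H a (φ y)) x := fun a =>
    (hH.smooth_chrM hφx a).comp (hφ.of_le (by norm_num))
  have ev : ∀ j, (fun y => jac φ y * chrM G j y) =ᶠ[𝓝 x] fun y =>
      (∑ a, jac φ y a j • chrM H a (φ y)) * jac φ y + pdM j (jac φ) y := by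
    intro j
    have hV : ∀ᶠ y in 𝓝 x, φ y ∈ V := hφ.continuousAt.eventually (hH.eventually_mem hφx)
    filter_upwards [hG.eventually_mem hx, hV, hφ2.eventually (by simp),
      hGH.eventuallyEq_nhds] with y h1 h2 h3 h4
    exact jac_mul_chrM hG hH h1 h2 h3 h4 j
  have hAC : ∀ j, A * chrM G j x = (∑ a, A a j • chrM H a (φ x)) * A + pdM j (jac φ) x :=
    fun j => (ev j).eq_of_nhds
  have hsm : ∀ j, CMatAt 1 (fun y => ∑ a, jac φ y a j • chrM H a (φ y)) x := fun j =>
    CMatAt.sum fun a _ => CMatAt.smul (hA1 a j) (hCH a)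
  have hd : ∀ j k, pdM k (jac φ) x * chrM G j x + A * pdM k (chrM G j) x
      = (∑ a, (pdM k (jac φ) x a j • chrM H a (φ x)
          + A a j • ∑ b, A b k • pdM b (chrM H a) (φ x))) * A
        + (∑ a, A a j • chrM H a (φ x)) * pdM k (jac φ) x + pdM k (pdM j (jac φ)) x := by
    intro j k
    have := pdM_congr (ev j) k
    rw [pdM_mul hA1 (hG.smooth_chrM hx j), pdM_add ((hsm j).mul hA1)
      (hA2.pdM (by norm_num) j), pdM_mul (hsm j) hA1, pdM_sum fun a _ =>
      CMatAt.smul (hA1 a j) (hCH a)] at this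
    rw [this]
    congr 3
    refine Finset.sum_congr rfl fun a _ => ?_
    rw [pdM_smul (hA1 a j) (hCH a), pdM_comp (hH.smooth_chrM hφx a)
      (hφ.differentiableAt (by norm_num))]
    rfl
  have hB := fun j k a => pd_jac_symm hφ2 a j k
  set B : Fin n → SqMat n := fun j => pdM j (jac φ) x with hBdef
  set S : Fin n → SqMat n := fun j => ∑ a, A a j • chrM H a (φ x) with hSdef
  set T : Fin n → Fin n → SqMat n := fun k j =>
    ∑ a, A a j • ∑ b, A b k • pdM b (chrM H a) (φ x) with hTdef
  set Q : Fin n → Fin n → SqMat n := fun k j => ∑ a, B k a j • chrM H a (φ x) with hQdef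
  have hQ : ∀ j k, Q k j = Q j k := fun j k => Finset.sum_congr rfl fun a _ => by
    simp only [hBdef]; rw [hB k j]
  have hd' : ∀ j k, A * pdM k (chrM G j) x = (Q k j + T k j) * A + S j * B k
      + pdM k (pdM j (jac φ)) x - B k * chrM G j x := by
    intro j k
    rw [eq_sub_iff_add_eq, add_comm, hd, Finset.sum_add_distrib]
  have hCC : ∀ j k, A * (chrM G j x * chrM G k x)
      = S j * (S k * A + B k) + B j * chrM G k x := by
    intro j k
    rw [← Matrix.mul_assoc, hAC, Matrix.add_mul, Matrix.mul_assoc, hAC]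
  have hR : ∑ a, ∑ b, (A a j * A b k) • curvM H a b (φ x)
      = T j k - T k j + (S j * S k - S k * S j) := by
    simp only [hTdef, hSdef, curvM, smul_add, smul_sub, Finset.sum_add_distrib,
      Finset.sum_sub_distrib, Finset.sum_mul, Finset.mul_sum, Finset.smul_sum, smul_smul,
      Matrix.smul_mul, Matrix.mul_smul]
    congr 1
    · congr 1
      rw [Finset.sum_comm]
      exact Finset.sum_congr rfl fun a _ => Finset.sum_congr rfl fun b _ => by rw [mul_comm]
    · congr 1
      · rw [Finset.sum_comm]
        exact Finset.sum_congr rfl fun a _ => Finset.sum_congr rfl fun b _ => by rw [mul_comm]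
  rw [hR, curvM, Matrix.mul_add, Matrix.mul_sub, Matrix.mul_sub, hd', hd', hCC, hCC,
    pdM_comm hA2 k j, hQ j k]
  simp only [Matrix.add_mul, Matrix.sub_mul, Matrix.mul_add, Matrix.mul_assoc]
  abel

/-- The Ricci tensor is a tensor. -/
lemma ricci_transform (hG : IsMetricOn G U) (hH : IsMetricOn H V) (hx : x ∈ U) (hφx : φ x ∈ V)
    (hφ : ContDiffAt ℝ 3 φ x)
    (hGH : G =ᶠ[𝓝 x] fun y => (jac φ y).transpose * H (φ y) * jac φ y) (j k : Fin n) :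
    ricci G j k x = ∑ a, ∑ b, jac φ x a j * jac φ x b k * ricci H a b (φ x) := by
  set A := jac φ x with hA
  have hdet : IsUnit A.det := by
    have h1 := hG.det_ne hx
    rw [hGH.eq_of_nhds, Matrix.det_mul] at h1
    exact isUnit_iff_ne_zero.2 (right_ne_zero_of_mul h1)
  have h1 : ∀ l, curvM G l k x l j
      = ∑ a, ∑ b, ∑ c, ∑ d, A a l * A⁻¹ l c * (A b k * curvM H a b (φ x) c d * A d j) := by
    intro l
    have := jac_mul_curvM hG hH hx hφx hφ hGH l k
    have e : curvM G l k x = A⁻¹ * ((∑ a, ∑ b, (A a l * A b k) • curvM H a b (φ x)) * A) := by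
      rw [← this, Matrix.nonsing_inv_mul_cancel_left _ _ hdet]
    rw [e]
    simp only [Matrix.mul_apply, Matrix.sum_apply, Matrix.smul_apply, smul_eq_mul, Finset.sum_mul,
      Finset.mul_sum]
    have e2 : ∀ f : Fin n → Fin n → Fin n → Fin n → ℝ, ∑ c, ∑ a, ∑ b, ∑ d, f a b c d
        = ∑ a, ∑ b, ∑ c, ∑ d, f a b c d := by
      intro f
      rw [Finset.sum_comm]
      exact Finset.sum_congr rfl fun _ _ => Finset.sum_comm
    rw [e2]
    refine Finset.sum_congr rfl fun a _ => Finset.sum_congr rfl fun b _ =>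
      Finset.sum_congr rfl fun c _ => Finset.sum_congr rfl fun d _ => ?_
    ring
  have hinv : ∀ a c, ∑ l, A a l * A⁻¹ l c = if a = c then 1 else 0 := by
    intro a c
    rw [← Matrix.mul_apply, Matrix.mul_nonsing_inv _ hdet, Matrix.one_apply]
  rw [hG.ricci_eq_sum hx]
  simp only [h1, hH.ricci_eq_sum hφx]
  calc ∑ l, ∑ a, ∑ b, ∑ c, ∑ d, A a l * A⁻¹ l c * (A b k * curvM H a b (φ x) c d * A d j)
      = ∑ a, ∑ b, ∑ c, ∑ d, (∑ l, A a l * A⁻¹ l c) * (A b k * curvM H a b (φ x) c d * A d j) := by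
        simp only [Finset.sum_mul]
        rw [Finset.sum_comm]
        refine Finset.sum_congr rfl fun a _ => ?_
        rw [Finset.sum_comm]
        refine Finset.sum_congr rfl fun b _ => ?_
        rw [Finset.sum_comm]
        refine Finset.sum_congr rfl fun c _ => ?_
        rw [Finset.sum_comm]
    _ = ∑ a, ∑ b, ∑ d, A b k * curvM H a b (φ x) a d * A d j := by
        simp only [hinv, ite_mul, one_mul, zero_mul]
        refine Finset.sum_congr rfl fun a _ => Finset.sum_congr rfl fun b _ => ?_
        rw [Finset.sum_comm]
        simp
    _ = _ := by
        simp only [Finset.mul_sum]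
        rw [Finset.sum_comm]
        conv_rhs => rw [Finset.sum_comm]
        refine Finset.sum_congr rfl fun b _ => ?_
        rw [Finset.sum_comm]
        refine Finset.sum_congr rfl fun d _ => Finset.sum_congr rfl fun a _ => ?_
        ring

lemma scalarCoord_transform (hG : IsMetricOn G U) (hH : IsMetricOn H V) (hx : x ∈ U)
    (hφx : φ x ∈ V) (hφ : ContDiffAt ℝ 3 φ x)
    (hGH : G =ᶠ[𝓝 x] fun y => (jac φ y).transpose * H (φ y) * jac φ y) :
    scalarCoord G x = scalarCoord H (φ x) := by
  set A := jac φ x with hA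
  have hdet : IsUnit A.det := by
    have h1 := hG.det_ne hx
    rw [hGH.eq_of_nhds, Matrix.det_mul] at h1
    exact isUnit_iff_ne_zero.2 (right_ne_zero_of_mul h1)
  have e : ∀ (G : Euc n → SqMat n) x, scalarCoord G x
      = ((G x)⁻¹ * (Matrix.of fun j k => ricci G j k x).transpose).trace := by
    intro G x
    simp [scalarCoord, Matrix.trace, Matrix.mul_apply]
  have hR : (Matrix.of fun j k => ricci G j k x)
      = A.transpose * (Matrix.of fun j k => ricci H j k (φ x)) * A := by
    ext j k
    rw [Matrix.of_apply, ricci_transform hG hH hx hφx hφ hGH]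
    simp only [Matrix.mul_apply, Matrix.transpose_apply, Matrix.of_apply, Finset.sum_mul]
    rw [Finset.sum_comm]
    exact Finset.sum_congr rfl fun a _ => Finset.sum_congr rfl fun b _ => by ring
  have hdT : IsUnit A.transpose.det := by rwa [Matrix.det_transpose]
  rw [e, e, hR, hGH.eq_of_nhds, Matrix.mul_inv_rev, Matrix.mul_inv_rev, Matrix.transpose_mul,
    Matrix.transpose_mul, Matrix.transpose_transpose]
  set B := (Matrix.of fun j k => ricci H j k (φ x)).transpose
  have : A⁻¹ * ((H (φ x))⁻¹ * A.transpose⁻¹) * (A.transpose * (B * A))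
      = A⁻¹ * ((H (φ x))⁻¹ * B) * A := by
    simp only [Matrix.mul_assoc, Matrix.nonsing_inv_mul_cancel_left _ _ hdT]
  rw [this, Matrix.trace_mul_comm, Matrix.mul_nonsing_inv_cancel_left _ _ hdet]

end Transform

end LocalRiemann

/-! ### Kähler metrics in local coordinates -/

section LocalKahler

variable {n : ℕ}

/-- `(G, J)` is a Kähler structure on the open set `U` of `ℝⁿ`. -/
structure IsKahlerOn (G J : Euc n → SqMat n) (U : Set (Euc n)) : Prop extends IsMetricOn G U where
  smoothJ : ∀ x ∈ U, CMatAt 1 J x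
  sq : ∀ x ∈ U, J x * J x = -1
  orth : ∀ x ∈ U, (J x).transpose * G x * J x = G x
  parallel : ∀ x ∈ U, ∀ j, pdM j J x = J x * chrM G j x - chrM G j x * J x

/-- The components `ρ_{jk} = Ric(J∂_j, ∂_k)` of the Ricci form. -/
def ricForm (G J : Euc n → SqMat n) (j k : Fin n) (x : Euc n) : ℝ := ∑ l, J x l j * ricci G l k x

lemma contDiffAt_two_of_pd {f : Euc n → ℝ} {x : Euc n}
    (hf : ∀ᶠ y in 𝓝 x, DifferentiableAt ℝ f y) (h : ∀ k, ContDiffAt ℝ 1 (pd k f) x) :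
    ContDiffAt ℝ 2 f x := by
  have := (contDiffAt_succ_iff_hasFDerivAt (𝕜 := ℝ) (n := 1) (f := f) (x := x)).2
    ⟨fun y => ∑ k, pd k f y • (EuclideanSpace.proj k : Euc n →L[ℝ] ℝ), ⟨_, hf, ?_⟩, ?_⟩
  · convert this using 1; norm_num
  · intro y hy
    have e : fderiv ℝ f y = ∑ k, pd k f y • (EuclideanSpace.proj k : Euc n →L[ℝ] ℝ) := by
      refine ContinuousLinearMap.ext fun v => ?_
      rw [fderiv_apply_eq_sum_pd]
      simp [mul_comm]
    have hy' : HasFDerivAt f (fderiv ℝ f y) y := DifferentiableAt.hasFDerivAt hy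
    rwa [e] at hy'
  · exact ContDiffAt.sum fun k _ => (h k).smul contDiffAt_const

namespace IsKahlerOn

variable {G J : Euc n → SqMat n} {U : Set (Euc n)} {x : Euc n}

/-- A parallel `C¹` complex structure is as regular as the metric: its first derivatives are
combinations of Christoffel symbols. -/
lemma smoothJ_two (h : IsKahlerOn G J U) (hx : x ∈ U) : CMatAt 2 J x := by
  intro a b
  refine contDiffAt_two_of_pd ((h.eventually_mem hx).mono fun y hy =>
    (h.smoothJ y hy).diff (by simp) a b) fun k => ?_
  have h1 : CMatAt 1 (pdM k J) x :=
    (((h.smoothJ x hx).mul (h.smooth_chrM hx k)).sub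
      ((h.smooth_chrM hx k).mul (h.smoothJ x hx))).congr
        ((h.eventually_mem hx).mono fun y hy => h.parallel y hy k)
  exact h1 a b

/-- The curvature endomorphisms are complex linear. -/
lemma curvM_comm (h : IsKahlerOn G J U) (hx : x ∈ U) (j k : Fin n) :
    curvM G j k x * J x = J x * curvM G j k x := by
  have hJ := h.smoothJ x hx
  have hC := fun j => h.smooth_chrM hx j
  have e : ∀ j k, pdM k (pdM j J) x = (J x * chrM G k x - chrM G k x * J x) * chrM G j x
      + J x * pdM k (chrM G j) x - (pdM k (chrM G j) x * J x
        + chrM G j x * (J x * chrM G k x - chrM G k x * J x)) := by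
    intro j k
    rw [pdM_congr ((h.eventually_mem hx).mono fun y hy => h.parallel y hy j) k,
      pdM_sub (hJ.mul (hC j)) ((hC j).mul hJ), pdM_mul hJ (hC j), pdM_mul (hC j) hJ,
      h.parallel x hx k]
  have hs := pdM_comm (h.smoothJ_two hx) j k
  rw [e, e, ← sub_eq_zero] at hs
  rw [← sub_eq_zero, ← neg_eq_zero, ← hs]
  simp only [curvM, Matrix.add_mul, Matrix.sub_mul, Matrix.mul_add, Matrix.mul_sub,
    Matrix.mul_assoc]
  abel

lemma curvM_J_J (h : IsKahlerOn G J U) (hx : x ∈ U) (j k : Fin n) :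
    ∑ a, ∑ b, (J x a j * J x b k) • curvM G a b x = curvM G j k x := by
  have key : G x * ∑ a, ∑ b, (J x a j * J x b k) • curvM G a b x = G x * curvM G j k x := by
    ext c d
    have e : (J x).transpose * (G x * curvM G c d x) * J x = G x * curvM G c d x := by
      rw [← Matrix.mul_assoc, Matrix.mul_assoc _ (curvM G c d x), h.curvM_comm hx,
        ← Matrix.mul_assoc, h.orth x hx]
    simp only [Finset.mul_sum, Matrix.mul_smul, Matrix.sum_apply, Matrix.smul_apply, smul_eq_mul,
      h.pair_symm hx _ _ c d]
    conv_rhs => rw [← e]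
    simp only [Matrix.mul_apply (M := (J x).transpose * (G x * curvM G c d x)),
      Matrix.mul_apply (M := (J x).transpose), Matrix.transpose_apply, Finset.sum_mul]
    rw [Finset.sum_comm]
    exact Finset.sum_congr rfl fun b _ => Finset.sum_congr rfl fun a _ => by ring
  rw [← Matrix.nonsing_inv_mul_cancel_left (G x) (∑ a, ∑ b, _ • _) (h.isUnit_det hx), key,
    Matrix.nonsing_inv_mul_cancel_left _ _ (h.isUnit_det hx)]

/-- The Ricci tensor is `J`-invariant. -/
lemma ricci_J_J (h : IsKahlerOn G J U) (hx : x ∈ U) (j k : Fin n) :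
    ∑ a, ∑ b, J x a j * J x b k * ricci G a b x = ricci G j k x := by
  have e1 : ∀ l b, ∑ a, J x a j * curvM G l b x l a = ∑ c, J x l c * curvM G l b x c j := by
    intro l b
    have := congrFun (congrFun (h.curvM_comm hx l b) l) j
    simp only [Matrix.mul_apply] at this
    rw [← this]
    exact Finset.sum_congr rfl fun a _ => mul_comm _ _
  calc ∑ a, ∑ b, J x a j * J x b k * ricci G a b x
      = ∑ b, ∑ l, J x b k * ∑ a, J x a j * curvM G l b x l a := by
        simp only [h.ricci_eq_sum hx, Finset.mul_sum]
        rw [Finset.sum_comm]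
        refine Finset.sum_congr rfl fun b _ => ?_
        rw [Finset.sum_comm]
        exact Finset.sum_congr rfl fun l _ => Finset.sum_congr rfl fun a _ => by ring
    _ = ∑ c, (∑ l, ∑ b, (J x l c * J x b k) • curvM G l b x) c j := by
        simp only [e1, Finset.mul_sum, Matrix.sum_apply, Matrix.smul_apply, smul_eq_mul]
        rw [Finset.sum_comm]
        conv_rhs => rw [Finset.sum_comm]
        refine Finset.sum_congr rfl fun l _ => ?_
        rw [Finset.sum_comm]
        exact Finset.sum_congr rfl fun c _ => Finset.sum_congr rfl fun b _ => by ring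
    _ = _ := by
        simp only [h.curvM_J_J hx]
        rw [h.ricci_eq_sum hx]

lemma ricForm_antisymm (h : IsKahlerOn G J U) (hx : x ∈ U) (j k : Fin n) :
    ricForm G J j k x = -ricForm G J k j x := by
  set S : SqMat n := Matrix.of fun a b => ricci G a b x with hS
  have hsym : S.transpose = S := by
    ext a b; exact h.ricci_symm hx b a
  have h1 : (J x).transpose * S * J x = S := by
    ext a b
    conv_rhs => rw [hS, Matrix.of_apply, ← h.ricci_J_J hx]
    simp only [Matrix.mul_apply, Matrix.transpose_apply, Finset.sum_mul, hS, Matrix.of_apply]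
    rw [Finset.sum_comm]
    exact Finset.sum_congr rfl fun _ _ => Finset.sum_congr rfl fun _ _ => by ring
  have h2 : (J x).transpose * S = -(S * J x) := by
    calc (J x).transpose * S = -((J x).transpose * S * (J x * J x)) := by
          rw [h.sq x hx]; simp
      _ = -(S * J x) := by rw [← Matrix.mul_assoc, h1]
  have e : ∀ j k, ricForm G J j k x = ((J x).transpose * S) j k := by
    intro j k; simp [ricForm, Matrix.mul_apply, hS]
  have h3 : ((J x).transpose * S).transpose = S * J x := by
    rw [Matrix.transpose_mul, hsym, Matrix.transpose_transpose]
  have h4 : ((J x).transpose * S) k j = (S * J x) j k := congrFun (congrFun h3 j) k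
  have h5 : ((J x).transpose * S) j k = -(S * J x) j k := congrFun (congrFun h2 j) k
  rw [e, e, h4, h5]

/-- The Ricci form is the curvature of the anticanonical bundle, half the trace of `J ∘ R`. -/
lemma trace_J_curvM (h : IsKahlerOn G J U) (hx : x ∈ U) (j k : Fin n) :
    (J x * curvM G j k x).trace = 2 * ricForm G J j k x := by
  have hρ : ∀ j k, ∑ l, ∑ a, curvM G a k x l j * J x a l = ricForm G J j k x := by
    intro j k
    rw [Finset.sum_comm]
    have : ∀ a, ∑ l, curvM G a k x l j * J x a l = ∑ b, curvM G a k x a b * J x b j := by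
      intro a
      have := congrFun (congrFun (h.curvM_comm hx a k) a) j
      simp only [Matrix.mul_apply] at this
      rw [this]
      exact Finset.sum_congr rfl fun l _ => mul_comm _ _
    simp only [this, ricForm, h.ricci_eq_sum hx, Finset.mul_sum]
    rw [Finset.sum_comm]
    exact Finset.sum_congr rfl fun b _ => Finset.sum_congr rfl fun a _ => mul_comm _ _
  rw [← h.curvM_comm hx, Matrix.trace]
  simp only [Matrix.diag, Matrix.mul_apply]
  have e : ∀ l a, curvM G j k x l a * J x a l
      = curvM G a k x l j * J x a l - curvM G a j x l k * J x a l := by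
    intro l a
    have := h.bianchi hx j k a l
    rw [IsMetricOn.curvM_antisymm G k a] at this
    simp only [Matrix.neg_apply] at this
    rw [← sub_mul]
    congr 1
    linarith
  simp only [e, Finset.sum_sub_distrib, hρ]
  rw [h.ricForm_antisymm hx k j]; ring

end IsKahlerOn

/-! ### A primitive of the Ricci form -/

/-- The endomorphism `½ (1 - J J₀)`, which satisfies `J P = P J₀` if `J² = J₀² = -1`. -/
def gauge (J : Euc n → SqMat n) (J₀ : SqMat n) (x : Euc n) : SqMat n :=
  (1 / 2 : ℝ) • (1 - J x * J₀)

/-- The connection form `½ tr (J₀ (P⁻¹ C_k P + P⁻¹ ∂_k P))` of the anticanonical bundle in the frame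
given by the intertwiner `P` of `J` and the constant `J₀`. As `J P = P J₀`, its first term is
`½ tr (J C_k)`. -/
def ricPrim (G J : Euc n → SqMat n) (J₀ : SqMat n) (k : Fin n) (x : Euc n) : ℝ :=
  (1 / 2) * ((J x * chrM G k x).trace +
    (J₀ * ((gauge J J₀ x)⁻¹ * pdM k (gauge J J₀) x)).trace)

namespace IsKahlerOn

variable {G J : Euc n → SqMat n} {J₀ : SqMat n} {U : Set (Euc n)} {x : Euc n}

lemma J_mul_gauge (h : IsKahlerOn G J U) (hJ₀ : J₀ * J₀ = -1) (hx : x ∈ U) :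
    J x * gauge J J₀ x = gauge J J₀ x * J₀ := by
  simp only [gauge, Matrix.mul_smul, Matrix.smul_mul, Matrix.mul_sub, Matrix.sub_mul,
    ← Matrix.mul_assoc, h.sq x hx]
  rw [Matrix.mul_assoc (J x), hJ₀]
  congr 1
  simp [add_comm]

lemma smooth_gauge (h : IsKahlerOn G J U) (hx : x ∈ U) : CMatAt 2 (gauge J J₀) x :=
  CMatAt.smul contDiffAt_const ((CMatAt.const 1 x).sub
    ((h.smoothJ_two hx).mul (CMatAt.const J₀ x)))

lemma contDiffAt_ricPrim (h : IsKahlerOn G J U) (hx : x ∈ U) (hd : (gauge J J₀ x).det ≠ 0)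
    (k : Fin n) : ContDiffAt ℝ 1 (ricPrim G J J₀ k) x := by
  have hP := h.smooth_gauge (J₀ := J₀) hx
  exact contDiffAt_const.mul (((h.smoothJ x hx).mul (h.smooth_chrM hx k)).trace.add
    ((CMatAt.const J₀ x).mul (((hP.of_le (by norm_num)).inv hd).mul
      (hP.pdM (by norm_num) k))).trace)

/-- The exterior derivative of `ricPrim` is the Ricci form. -/
lemma pd_ricPrim (h : IsKahlerOn G J U) (hJ₀ : J₀ * J₀ = -1) (hx : x ∈ U)
    (hd : (gauge J J₀ x).det ≠ 0) (j k : Fin n) :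
    pd j (ricPrim G J J₀ k) x - pd k (ricPrim G J J₀ j) x = ricForm G J j k x := by
  have hJ := h.smoothJ x hx
  have hC := fun j => h.smooth_chrM hx j
  have hP2 := h.smooth_gauge (J₀ := J₀) hx
  have hP1 : CMatAt 1 (gauge J J₀) x := hP2.of_le (by norm_num)
  have hPi := hP1.inv hd
  have hdP := fun k => hP2.pdM (show (1 : WithTop ℕ∞) + 1 ≤ 2 by norm_num) k
  have hu : IsUnit (gauge J J₀ x).det := isUnit_iff_ne_zero.2 hd
  set P := gauge J J₀ x with hPdef
  set X : Fin n → SqMat n := fun k => P⁻¹ * chrM G k x * P with hX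
  set Q : Fin n → SqMat n := fun k => P⁻¹ * pdM k (gauge J J₀) x with hQ
  -- the connection in the new frame is complex linear
  have hcomm : ∀ k, J₀ * (X k + Q k) = (X k + Q k) * J₀ := by
    intro k
    have e1 := pdM_congr ((h.eventually_mem hx).mono fun y hy => h.J_mul_gauge hJ₀ hy) k
    rw [pdM_mul hJ hP1, pdM_mul hP1 (CMatAt.const J₀ x), pdM_const, Matrix.mul_zero, add_zero,
      h.parallel x hx] at e1
    have e2 : P⁻¹ * J x = J₀ * P⁻¹ := by
      calc P⁻¹ * J x = P⁻¹ * (J x * P) * P⁻¹ := by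
            rw [Matrix.mul_assoc, Matrix.mul_assoc (J x), Matrix.mul_nonsing_inv _ hu,
              Matrix.mul_one]
        _ = _ := by
            rw [hPdef, h.J_mul_gauge hJ₀ hx, ← hPdef, Matrix.nonsing_inv_mul_cancel_left _ _ hu]
    have e3 : P⁻¹ * ((J x * chrM G k x - chrM G k x * J x) * P + J x * pdM k (gauge J J₀) x)
        = P⁻¹ * (pdM k (gauge J J₀) x * J₀) := by rw [← e1]
    have e4 : P⁻¹ * (chrM G k x * (J x * P)) = P⁻¹ * chrM G k x * P * J₀ := by
      rw [hPdef, h.J_mul_gauge hJ₀ hx]; simp only [Matrix.mul_assoc]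
    have e5 : ∀ M : SqMat n, P⁻¹ * (J x * M) = J₀ * (P⁻¹ * M) := by
      intro M; rw [← Matrix.mul_assoc, e2, Matrix.mul_assoc]
    simp only [Matrix.mul_add, Matrix.sub_mul, Matrix.mul_sub, Matrix.mul_assoc, e5] at e3
    rw [e4] at e3
    simp only [hX, hQ, Matrix.mul_add, Matrix.add_mul, Matrix.mul_assoc] at e3 ⊢
    rw [← e3]; abel
  have hα : ∀ j k, pd j (fun y => (J y * chrM G k y).trace) x
      = ((J x * chrM G j x - chrM G j x * J x) * chrM G k x + J x * pdM j (chrM G k) x).trace := by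
    intro j k
    rw [pd_trace (hJ.mul (hC k)), pdM_mul hJ (hC k), h.parallel x hx]
  have hβ : ∀ j k, pd j (fun y => (J₀ * ((gauge J J₀ y)⁻¹ * pdM k (gauge J J₀) y)).trace) x
      = (J₀ * (-(Q j * Q k) + P⁻¹ * pdM j (pdM k (gauge J J₀)) x)).trace := by
    intro j k
    rw [pd_trace ((CMatAt.const J₀ x).mul (hPi.mul (hdP k))),
      pdM_mul (CMatAt.const J₀ x) (hPi.mul (hdP k)), pdM_const, Matrix.zero_mul, zero_add,
      pdM_mul hPi (hdP k), pdM_inv hP1 hd]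
    simp only [hQ, Matrix.mul_assoc, Matrix.neg_mul, ← hPdef]
  have hp : ∀ j k, pd j (ricPrim G J J₀ k) x = (1 / 2) *
      (((J x * chrM G j x - chrM G j x * J x) * chrM G k x + J x * pdM j (chrM G k) x).trace
      + (J₀ * (-(Q j * Q k) + P⁻¹ * pdM j (pdM k (gauge J J₀)) x)).trace) := by
    intro j k
    have d1 := ((hJ.mul (hC k)).trace).differentiableAt (by simp : (1 : WithTop ℕ∞) ≠ 0)
    have d2 := ((CMatAt.const J₀ x).mul (hPi.mul (hdP k))).trace.differentiableAt
      (by simp : (1 : WithTop ℕ∞) ≠ 0)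
    rw [← hα, ← hβ, ← pd_add d1 d2]
    exact pd_const_mul (d1.add d2) _ j
  have hcyc : ∀ A B : SqMat n, J₀ * B = B * J₀ → (J₀ * (A * B)).trace = (J₀ * (B * A)).trace := by
    intro A B hB
    rw [← Matrix.mul_assoc J₀ B, hB, Matrix.mul_assoc B, Matrix.trace_mul_comm B,
      Matrix.mul_assoc]
  have h1 := hcyc (X j) _ (hcomm k)
  have h2 := hcyc (Q k) _ (hcomm j)
  have hconj : ∀ A B : SqMat n, (J x * (A * B)).trace
      = (J₀ * ((P⁻¹ * A * P) * (P⁻¹ * B * P))).trace := by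
    intro A B
    have : J₀ * ((P⁻¹ * A * P) * (P⁻¹ * B * P)) = P⁻¹ * ((J x * (A * B)) * P) := by
      have e2 : J₀ * P⁻¹ = P⁻¹ * J x := by
        calc J₀ * P⁻¹ = P⁻¹ * (P * J₀) * P⁻¹ := by
              rw [Matrix.nonsing_inv_mul_cancel_left _ _ hu]
          _ = _ := by
            rw [hPdef, ← h.J_mul_gauge hJ₀ hx, ← hPdef, Matrix.mul_assoc, Matrix.mul_assoc (J x),
              Matrix.mul_nonsing_inv _ hu, Matrix.mul_one]
      simp only [Matrix.mul_assoc, Matrix.mul_nonsing_inv_cancel_left _ _ hu]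
      rw [← Matrix.mul_assoc J₀, e2, Matrix.mul_assoc]
    rw [this, Matrix.trace_mul_comm P⁻¹, Matrix.mul_assoc, Matrix.mul_nonsing_inv _ hu,
      Matrix.mul_one]
  have h3 := hconj (chrM G j x) (chrM G k x)
  have h4 := hconj (chrM G k x) (chrM G j x)
  have h5 : (chrM G j x * (J x * chrM G k x)).trace = (J x * (chrM G k x * chrM G j x)).trace := by
    rw [Matrix.trace_mul_comm, Matrix.mul_assoc]
  have h6 : (chrM G k x * (J x * chrM G j x)).trace = (J x * (chrM G j x * chrM G k x)).trace := by
    rw [Matrix.trace_mul_comm, Matrix.mul_assoc]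
  have h7 := h.trace_J_curvM hx j k
  rw [hp, hp, pdM_comm hP2 k j]
  simp only [curvM, Matrix.mul_add, Matrix.add_mul, Matrix.mul_sub, Matrix.sub_mul,
    Matrix.trace_add, Matrix.trace_sub, Matrix.mul_neg, Matrix.trace_neg, Matrix.mul_assoc]
    at h1 h2 h3 h4 h5 h6 h7 ⊢
  simp only [hX, Matrix.mul_assoc] at h1 h2
  linarith

end IsKahlerOn

/-- The primitive `ricPrim` is equivariant under maps with constant Jacobian that preserve the
Kähler structure and `J₀`. -/
lemma ricPrim_equivariant {G J : Euc n → SqMat n} {J₀ A : SqMat n} {U : Set (Euc n)} {x : Euc n}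
    {φ : Euc n → Euc n} (h : IsKahlerOn G J U) (hx : x ∈ U) (hφx : φ x ∈ U)
    (hφ : ContDiff ℝ 2 φ) (hA : ∀ y, jac φ y = A)
    (hG : ∀ᶠ y in 𝓝 x, G y = A.transpose * G (φ y) * A)
    (hJ : ∀ᶠ y in 𝓝 x, A * J y = J (φ y) * A) (hJ₀ : A * J₀ = J₀ * A) (k : Fin n) :
    ricPrim G J J₀ k x = ∑ a, A a k * ricPrim G J J₀ a (φ x) := by
  have hdet : IsUnit A.det := by
    have h1 := h.det_ne hx
    rw [hG.self_of_nhds, Matrix.det_mul] at h1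
    exact isUnit_iff_ne_zero.2 (right_ne_zero_of_mul h1)
  have hC : A * chrM G k x = (∑ a, A a k • chrM G a (φ x)) * A := by
    have := jac_mul_chrM h.toIsMetricOn h.toIsMetricOn hx hφx hφ.contDiffAt
      (hG.mono fun y hy => by simp only [hA]; exact hy) k
    rw [pdM_congr (Filter.Eventually.of_forall hA), pdM_const, add_zero, hA] at this
    exact this
  have hP : ∀ᶠ y in 𝓝 x, A * gauge J J₀ y = gauge J J₀ (φ y) * A := by
    filter_upwards [hJ] with y hy
    simp only [gauge, Matrix.mul_smul, Matrix.smul_mul, Matrix.mul_sub, Matrix.sub_mul,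
      Matrix.mul_one, Matrix.one_mul]
    rw [← Matrix.mul_assoc, hy, Matrix.mul_assoc, hJ₀, Matrix.mul_assoc]
  have hPx := hP.self_of_nhds
  have hdP : A * pdM k (gauge J J₀) x = (∑ a, A a k • pdM a (gauge J J₀) (φ x)) * A := by
    have := pdM_congr hP k
    have s1 : CMatAt 1 (gauge J J₀) x := (h.smooth_gauge hx).of_le (by norm_num)
    have s2 : CMatAt 1 (gauge J J₀) (φ x) := (h.smooth_gauge hφx).of_le (by norm_num)
    rw [pdM_mul (CMatAt.const A x) s1, pdM_mul (s2.comp (hφ.contDiffAt.of_le (by norm_num)))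
      (CMatAt.const A x), pdM_const, Matrix.zero_mul, zero_add, Matrix.mul_zero, add_zero,
      pdM_comp s2 (hφ.differentiable (by norm_num) x)] at this
    rw [this]
    congr 1
    refine Finset.sum_congr rfl fun a _ => ?_
    rw [← hA x]; rfl
  have hconj : ∀ B B' : SqMat n, A * B = B' * A → B.trace = B'.trace := by
    intro B B' hB
    rw [← Matrix.nonsing_inv_mul_cancel_left A B hdet, hB, Matrix.trace_mul_comm, Matrix.mul_assoc,
      Matrix.mul_nonsing_inv _ hdet, Matrix.mul_one]
  have hPinv : A * (gauge J J₀ x)⁻¹ = (gauge J J₀ (φ x))⁻¹ * A := by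
    have e : gauge J J₀ (φ x) = A * gauge J J₀ x * A⁻¹ := by
      rw [hPx, Matrix.mul_assoc, Matrix.mul_nonsing_inv _ hdet, Matrix.mul_one]
    rw [e, Matrix.mul_inv_rev, Matrix.mul_inv_rev, Matrix.nonsing_inv_nonsing_inv _ hdet,
      Matrix.mul_assoc, Matrix.mul_assoc, Matrix.nonsing_inv_mul _ hdet, Matrix.mul_one]
  have e1 : (J x * chrM G k x).trace = (J (φ x) * ∑ a, A a k • chrM G a (φ x)).trace := by
    apply hconj
    rw [← Matrix.mul_assoc, hJ.self_of_nhds, Matrix.mul_assoc, hC, Matrix.mul_assoc]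
  have e2 : (J₀ * ((gauge J J₀ x)⁻¹ * pdM k (gauge J J₀) x)).trace
      = (J₀ * ((gauge J J₀ (φ x))⁻¹ * ∑ a, A a k • pdM a (gauge J J₀) (φ x))).trace := by
    apply hconj
    rw [← Matrix.mul_assoc, hJ₀, Matrix.mul_assoc, ← Matrix.mul_assoc A, hPinv, Matrix.mul_assoc,
      hdP, Matrix.mul_assoc, Matrix.mul_assoc]
  simp only [ricPrim, e1, e2, Finset.mul_sum, Matrix.mul_smul, Matrix.trace_sum,
    Matrix.trace_smul, smul_eq_mul]
  rw [← Finset.sum_add_distrib, Finset.mul_sum]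
  exact Finset.sum_congr rfl fun a _ => by ring

end LocalKahler

/-! ### Wedge products of two-forms -/

section TopWedge

variable {m : ℕ}

/-- The sum `∑ sgn σ ∏ η_i(σ(0,i), σ(1,i))` over the permutations of `Fin 2 × Fin m`; it is `2^m`
times the value of `η_0 ∧ ⋯ ∧ η_{m-1}` on the standard basis. -/
def wedgeSum (η : Fin m → Matrix (Fin 2 × Fin m) (Fin 2 × Fin m) ℝ) : ℝ :=
  ∑ σ : Equiv.Perm (Fin 2 × Fin m), ((Equiv.Perm.sign σ : ℤ) : ℝ) * ∏ i, η i (σ (0, i)) (σ (1, i))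

lemma topWedge_eq_wedgeSum (η : Fin m → SqMat (2 * m)) :
    topWedge η = (1 / 2 ^ m) *
      wedgeSum fun i => (η i).submatrix finProdFinEquiv finProdFinEquiv := rfl

lemma prod_fin_two_prod (f : Fin 2 × Fin m → ℝ) : ∏ p, f p = ∏ i, f (0, i) * f (1, i) := by
  rw [Fintype.prod_prod_type, Fin.prod_univ_two, Finset.prod_mul_distrib]

lemma sum_sign_mul_prod_eq_det {ι : Type*} [Fintype ι] [DecidableEq ι] (A : Matrix ι ι ℝ) :
    ∑ σ : Equiv.Perm ι, ((Equiv.Perm.sign σ : ℤ) : ℝ) * ∏ p, A p (σ p) = A.det := by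
  rw [← Matrix.det_transpose, Matrix.det_apply']
  rfl

/-- Summing a function that vanishes off the bijections is summing over permutations. -/
lemma sum_fun_eq_sum_perm {ι : Type*} [Fintype ι] [DecidableEq ι] (g : (ι → ι) → ℝ)
    (hg : ∀ f, ¬ Function.Injective f → g f = 0) : ∑ f, g f = ∑ τ : Equiv.Perm ι, g τ := by
  symm
  refine Fintype.sum_of_injective (fun τ : Equiv.Perm ι => (τ : ι → ι)) DFunLike.coe_injective
    _ g (fun f hf => hg f fun h => hf ?_) fun _ => rfl
  exact ⟨Equiv.ofBijective f (Finite.injective_iff_bijective.1 h), rfl⟩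

lemma det_submatrix_of_not_injective {ι : Type*} [Fintype ι] [DecidableEq ι] (S : Matrix ι ι ℝ)
    {F : ι → ι} (hF : ¬ Function.Injective F) : (S.submatrix F id).det = 0 := by
  simp only [Function.Injective, not_forall] at hF
  obtain ⟨a, b, hab, hne⟩ := hF
  exact Matrix.det_zero_of_row_eq hne (by ext j; simp [hab])

/-- Two-forms pull back to `det S` times their wedge product. -/
lemma wedgeSum_transform (η : Fin m → Matrix (Fin 2 × Fin m) (Fin 2 × Fin m) ℝ)
    (S : Matrix (Fin 2 × Fin m) (Fin 2 × Fin m) ℝ) :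
    wedgeSum (fun i => S.transpose * η i * S) = S.det * wedgeSum η := by
  let e : (Fin m → (Fin 2 × Fin m) × (Fin 2 × Fin m)) ≃ ((Fin 2 × Fin m) → (Fin 2 × Fin m)) :=
    { toFun := fun f p => if p.1 = 0 then (f p.2).1 else (f p.2).2
      invFun := fun F i => (F (0, i), F (1, i))
      left_inv := fun f => by ext i <;> simp
      right_inv := fun F => by
        funext p
        obtain ⟨c, i⟩ := p
        fin_cases c <;> simp }
  have h1 : ∀ σ : Equiv.Perm (Fin 2 × Fin m), ∏ i, (S.transpose * η i * S) (σ (0, i)) (σ (1, i))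
      = ∑ F : (Fin 2 × Fin m) → (Fin 2 × Fin m), (∏ i, η i (F (0, i)) (F (1, i))) * ∏ p, S (F p) (σ p) := by
    intro σ
    have h2 : ∀ i, (S.transpose * η i * S) (σ (0, i)) (σ (1, i))
        = ∑ ab : (Fin 2 × Fin m) × (Fin 2 × Fin m), S ab.1 (σ (0, i)) * η i ab.1 ab.2 * S ab.2 (σ (1, i)) := by
      intro i
      simp only [Matrix.mul_apply, Matrix.transpose_apply, Finset.sum_mul]
      rw [Finset.sum_comm]
      exact (Fintype.sum_prod_type' fun a b => S a (σ (0, i)) * η i a b * S b (σ (1, i))).symm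
    simp only [h2]
    rw [Finset.prod_univ_sum, Fintype.piFinset_univ, ← e.sum_comp]
    refine Finset.sum_congr rfl fun f _ => ?_
    rw [prod_fin_two_prod, ← Finset.prod_mul_distrib]
    refine Finset.prod_congr rfl fun i _ => ?_
    simp only [e, Equiv.coe_fn_mk, if_true, one_ne_zero, if_false]
    ring
  have h3 : wedgeSum (fun i => S.transpose * η i * S)
      = ∑ F : (Fin 2 × Fin m) → (Fin 2 × Fin m), (∏ i, η i (F (0, i)) (F (1, i))) * (S.submatrix F id).det := by
    simp only [wedgeSum, h1, ← sum_sign_mul_prod_eq_det (S.submatrix _ id), Finset.mul_sum]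
    rw [Finset.sum_comm]
    refine Finset.sum_congr rfl fun F _ => Finset.sum_congr rfl fun σ _ => ?_
    simp only [Matrix.submatrix_apply, id]
    ring
  rw [h3, sum_fun_eq_sum_perm _ fun F hF => by rw [det_submatrix_of_not_injective S hF, mul_zero],
    wedgeSum, Finset.mul_sum]
  refine Finset.sum_congr rfl fun τ _ => ?_
  rw [Matrix.det_permute]
  ring

/-- The wedge product of decomposable two-forms is a determinant. -/
lemma wedgeSum_decomposable (A : Matrix (Fin 2 × Fin m) (Fin 2 × Fin m) ℝ) :
    wedgeSum (fun i => Matrix.of fun j k => A (0, i) j * A (1, i) k - A (0, i) k * A (1, i) j)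
      = 2 ^ m * A.det := by
  have h1 : ∀ (σ : Equiv.Perm (Fin 2 × Fin m)) (i : Fin m),
      A (0, i) (σ (0, i)) * A (1, i) (σ (1, i)) - A (0, i) (σ (1, i)) * A (1, i) (σ (0, i))
      = ∑ c : Equiv.Perm (Fin 2), ((Equiv.Perm.sign c : ℤ) : ℝ) *
          (A (0, i) (σ (c 0, i)) * A (1, i) (σ (c 1, i))) := by
    intro σ i
    have : (Finset.univ : Finset (Equiv.Perm (Fin 2))) = {1, Equiv.swap 0 1} := by decide
    rw [this, Finset.sum_pair (by decide)]
    simp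
    ring
  simp only [wedgeSum, Matrix.of_apply, h1]
  simp only [Finset.prod_univ_sum, Fintype.piFinset_univ, Finset.mul_sum]
  rw [Finset.sum_comm]
  have h2 : ∀ c : Fin m → Equiv.Perm (Fin 2), ∑ σ : Equiv.Perm (Fin 2 × Fin m),
      ((Equiv.Perm.sign σ : ℤ) : ℝ) * ∏ i, ((Equiv.Perm.sign (c i) : ℤ) : ℝ) *
          (A (0, i) (σ (c i 0, i)) * A (1, i) (σ (c i 1, i))) = A.det := by
    intro c
    rw [← sum_sign_mul_prod_eq_det]
    refine Fintype.sum_equiv (Equiv.mulRight (Equiv.prodCongrLeft c)) _ _ fun σ => ?_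
    rw [Equiv.coe_mulRight, Equiv.Perm.sign_mul, Equiv.Perm.sign_prodCongrLeft, prod_fin_two_prod,
      Finset.prod_mul_distrib]
    push_cast
    rw [mul_assoc]
    rfl
  simp only [h2]
  simp [Fintype.card_perm]

/-- The standard symplectic form. -/
def stdSympl (m : ℕ) : Matrix (Fin 2 × Fin m) (Fin 2 × Fin m) ℝ := 
  let E : Matrix (Fin 2 × Fin m) (Fin 2 × Fin m) ℝ := 1
  Matrix.of fun p q => ∑ l, (E (0, l) p * E (1, l) q - E (0, l) q * E (1, l) p)

lemma wedgeSum_stdSympl : wedgeSum (fun _ : Fin m => stdSympl m) = 2 ^ m * (m.factorial : ℝ) := by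
  have h1 : wedgeSum (fun _ : Fin m => stdSympl m)
      = ∑ f : Fin m → Fin m, 2 ^ m *
        ((1 : Matrix (Fin 2 × Fin m) (Fin 2 × Fin m) ℝ).submatrix (Prod.map id f) id).det := by
    simp only [← wedgeSum_decomposable, wedgeSum]
    rw [Finset.sum_comm]
    refine Finset.sum_congr rfl fun σ _ => ?_
    simp only [stdSympl, Matrix.of_apply, Finset.prod_univ_sum, Fintype.piFinset_univ,
      ← Finset.mul_sum]
    rfl
  rw [h1, sum_fun_eq_sum_perm]
  · have : ∀ τ : Equiv.Perm (Fin m), ((1 : Matrix (Fin 2 × Fin m) (Fin 2 × Fin m) ℝ).submatrix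
        (Prod.map id τ) id).det = 1 := by
      intro τ
      have e : (Prod.map id τ : Fin 2 × Fin m → Fin 2 × Fin m)
          = (Equiv.prodCongrRight fun _ : Fin 2 => τ) := rfl
      rw [e, Matrix.det_permute, Equiv.Perm.sign_prodCongrRight]
      simp [← sq, Int.units_sq]
    simp [this, Fintype.card_perm, mul_comm]
  · intro f hf
    rw [det_submatrix_of_not_injective, mul_zero]
    intro h
    refine hf fun a b hab => ?_
    have := @h (0, a) (0, b) (by simp [hab])
    simpa using this

lemma wedgeSum_comp_perm (η : Fin m → Matrix (Fin 2 × Fin m) (Fin 2 × Fin m) ℝ)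
    (τ : Equiv.Perm (Fin m)) : wedgeSum (fun i => η (τ i)) = wedgeSum η := by
  refine Fintype.sum_equiv (Equiv.mulRight (Equiv.prodCongrRight fun _ : Fin 2 => τ.symm)) _ _
    fun σ => ?_
  rw [Equiv.coe_mulRight, Equiv.Perm.sign_mul, Equiv.Perm.sign_prodCongrRight]
  congr 1
  · simp [Int.units_sq]
  · rw [← Equiv.prod_comp τ.symm]
    simp

/-- The derivative of the `m`-th exterior power of a two-form. -/
lemma hasDerivAt_wedgeSum {Ω : ℝ → Matrix (Fin 2 × Fin m) (Fin 2 × Fin m) ℝ}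
    {Ω' : Matrix (Fin 2 × Fin m) (Fin 2 × Fin m) ℝ} {t : ℝ} (hm : 0 < m)
    (h : ∀ p q, HasDerivAt (fun s => Ω s p q) (Ω' p q) t) :
    HasDerivAt (fun s => wedgeSum fun _ : Fin m => Ω s)
      (m * wedgeSum fun i : Fin m => if i.val = 0 then Ω' else Ω t) t := by
  have h1 : HasDerivAt (fun s => wedgeSum fun _ : Fin m => Ω s)
      (∑ σ : Equiv.Perm (Fin 2 × Fin m), ((Equiv.Perm.sign σ : ℤ) : ℝ) *
        ∑ i, (∏ j ∈ Finset.univ.erase i, Ω t (σ (0, j)) (σ (1, j))) •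
          Ω' (σ (0, i)) (σ (1, i))) t :=
    HasDerivAt.fun_sum fun σ _ => (HasDerivAt.fun_finsetProd fun i _ => h _ _).const_mul _
  convert h1 using 1
  have h2 : ∀ i : Fin m, wedgeSum (fun j => if j = i then Ω' else Ω t)
      = wedgeSum fun i : Fin m => if i.val = 0 then Ω' else Ω t := by
    intro i
    rw [← wedgeSum_comp_perm _ (Equiv.swap i ⟨0, hm⟩)]
    congr 1
    funext j
    congr 1
    rw [Equiv.swap_apply_eq_iff, Equiv.swap_apply_left, Fin.ext_iff]
  have h3 : (m : ℝ) * wedgeSum (fun i : Fin m => if i.val = 0 then Ω' else Ω t)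
      = ∑ i, wedgeSum (fun j => if j = i then Ω' else Ω t) := by
    simp [h2]
  rw [h3]
  simp only [wedgeSum, Finset.mul_sum]
  rw [Finset.sum_comm]
  refine Finset.sum_congr rfl fun σ _ => Finset.sum_congr rfl fun i _ => ?_
  congr 1
  rw [← Finset.mul_prod_erase _ _ (Finset.mem_univ i), if_pos rfl, smul_eq_mul, mul_comm]
  congr 1
  exact Finset.prod_congr rfl fun j hj => by rw [if_neg (Finset.ne_of_mem_erase hj)]

lemma hasDerivAt_topWedge {Ω : ℝ → SqMat (2 * m)} {Ω' : SqMat (2 * m)} {t : ℝ} (hm : 0 < m)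
    (h : ∀ p q, HasDerivAt (fun s => Ω s p q) (Ω' p q) t) :
    HasDerivAt (fun s => topWedge fun _ : Fin m => Ω s)
      (m * topWedge fun i : Fin m => if i.val = 0 then Ω' else Ω t) t := by
  have := (hasDerivAt_wedgeSum (m := m)
    (Ω := fun s => (Ω s).submatrix finProdFinEquiv finProdFinEquiv)
    (Ω' := Ω'.submatrix finProdFinEquiv finProdFinEquiv) hm fun p q => h _ _).const_mul
      (1 / 2 ^ m : ℝ)
  refine HasDerivAt.congr_deriv this ?_
  rw [topWedge_eq_wedgeSum, mul_left_comm]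
  congr 3
  funext i
  split_ifs <;> rfl

lemma topWedge_transform (η : Fin m → SqMat (2 * m)) (S : SqMat (2 * m)) :
    topWedge (fun i => S.transpose * η i * S) = S.det * topWedge η := by
  rw [topWedge_eq_wedgeSum, topWedge_eq_wedgeSum, mul_left_comm,
    ← Matrix.det_submatrix_equiv_self finProdFinEquiv S, ← wedgeSum_transform]
  congr 2
  funext i
  rw [Matrix.transpose_submatrix, Matrix.submatrix_mul_equiv, Matrix.submatrix_mul_equiv]

/-- The wedge product of a two-form `N` with a power of a symplectic form, by comparing the
infinitesimal actions of `gl(2m)` on both sides of `topWedge_transform`. -/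
lemma topWedge_first (hm : 0 < m) {Ω N : SqMat (2 * m)} (hΩ : IsUnit Ω.det)
    (hΩs : Ω.transpose = -Ω) (hN : N.transpose = -N) :
    (m : ℝ) * topWedge (fun i : Fin m => if i.val = 0 then N else Ω)
      = (1 / 2) * (Ω⁻¹ * N).trace * topWedge fun _ : Fin m => Ω := by
  set A : SqMat (2 * m) := (1 / 2 : ℝ) • (Ω⁻¹ * N) with hA
  have e1 : Ω * A = (1 / 2 : ℝ) • N := by
    rw [hA, Matrix.mul_smul, Matrix.mul_nonsing_inv_cancel_left _ _ hΩ]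
  have e2 : A.transpose * Ω = (1 / 2 : ℝ) • N := by
    have : (Ω * A).transpose = (1 / 2 : ℝ) • N.transpose := by rw [e1, Matrix.transpose_smul]
    rw [Matrix.transpose_mul, hΩs, hN, Matrix.mul_neg, smul_neg, neg_inj] at this
    exact this
  set Ωt : ℝ → SqMat (2 * m) := fun t => (1 + t • A).transpose * Ω * (1 + t • A) with hΩt
  have e3 : ∀ t, Ωt t = Ω + t • N + (t * t) • (A.transpose * Ω * A) := by
    intro t
    simp only [hΩt, Matrix.transpose_add, Matrix.transpose_one, Matrix.transpose_smul,
      Matrix.add_mul, Matrix.mul_add, Matrix.one_mul, Matrix.mul_one, Matrix.smul_mul,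
      Matrix.mul_smul, e1, e2, smul_smul]
    module
  have h1 : HasDerivAt (fun t => topWedge fun _ : Fin m => Ωt t)
      (m * topWedge fun i : Fin m => if i.val = 0 then N else Ωt 0) 0 := by
    refine hasDerivAt_topWedge hm fun p q => ?_
    simp only [e3, Matrix.add_apply, Matrix.smul_apply, smul_eq_mul]
    exact ((((hasDerivAt_id' (0 : ℝ)).mul_const (N p q)).const_add (Ω p q)).fun_add
      (((hasDerivAt_id' (0 : ℝ)).fun_mul (hasDerivAt_id' (0 : ℝ))).mul_const
        ((A.transpose * Ω * A) p q))).congr_deriv (by simp)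
  have h2 : (fun t => topWedge fun _ : Fin m => Ωt t)
      = fun t : ℝ => (1 + t • A).det * topWedge fun _ : Fin m => Ω := by
    funext t
    exact topWedge_transform (fun _ => Ω) (1 + t • A)
  have h3 : HasDerivAt (fun t : ℝ => (1 + t • A).det) A.trace 0 := by
    set q := (Matrix.det (1 + (Polynomial.X : Polynomial ℝ) • A.map Polynomial.C)).divX.divX with hq
    have e : (fun t : ℝ => (1 + t • A).det) = fun t => 1 + A.trace * t + q.eval t * t ^ 2 :=
      funext fun t => Matrix.det_one_add_smul t A
    rw [e]
    exact (((hasDerivAt_id' (0 : ℝ)).const_mul A.trace).const_add 1).fun_add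
      ((q.hasDerivAt 0).fun_mul ((hasDerivAt_id' (0 : ℝ)).fun_pow 2)) |>.congr_deriv (by simp)
  rw [h2] at h1
  have h4 := h1.unique (h3.mul_const _)
  have h5 : Ωt 0 = Ω := by simp [e3]
  rw [h5] at h4
  rw [h4, hA, Matrix.trace_smul, smul_eq_mul]

/-- The wedge product of a two-form `N` with a power of a symplectic form. -/
lemma fluxDensity_eq (hm : 0 < m) {Ω : SqMat (2 * m)} (hΩ : IsUnit Ω.det)
    (hΩs : Ω.transpose = -Ω) (θ : Fin (2 * m) → ℝ) (x : Euc (2 * m)) :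
    fluxDensity θ Ω x = ∑ j, x j / ‖x‖ *
      ∑ k, (|topWedge fun _ : Fin m => Ω| / m) * Ω⁻¹ k j * θ k := by
  set N := wedgeCovec (fun j => x j / ‖x‖) θ with hNdef
  have hN : N.transpose = -N := by
    ext j k; simp [hNdef, wedgeCovec]
  have hm' : (m : ℝ) ≠ 0 := by positivity
  have h1 := topWedge_first hm hΩ hΩs hN
  have hinv : (Ω⁻¹).transpose = -Ω⁻¹ := by
    rw [Matrix.transpose_nonsing_inv, hΩs]
    refine Matrix.inv_eq_left_inv ?_
    rw [neg_mul_neg, Matrix.nonsing_inv_mul _ hΩ]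
  have h2 : (Ω⁻¹ * N).trace = 2 * ∑ j, x j / ‖x‖ * ∑ k, Ω⁻¹ k j * θ k := by
    have e : ∀ j k, Ω⁻¹ j k = -Ω⁻¹ k j := fun j k => congrFun (congrFun hinv k) j
    simp only [Matrix.trace, Matrix.diag, Matrix.mul_apply, hNdef, wedgeCovec, Matrix.of_apply,
      mul_sub, Finset.sum_sub_distrib, Finset.mul_sum]
    have a1 : ∑ k, ∑ j, Ω⁻¹ k j * (x j / ‖x‖ * θ k) = ∑ j, ∑ k, x j / ‖x‖ * (Ω⁻¹ k j * θ k) := by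
      rw [Finset.sum_comm]
      exact Finset.sum_congr rfl fun j _ => Finset.sum_congr rfl fun k _ => by ring
    have a2 : ∑ k, ∑ j, Ω⁻¹ k j * (x k / ‖x‖ * θ j)
        = -∑ j, ∑ k, x j / ‖x‖ * (Ω⁻¹ k j * θ k) := by
      rw [← Finset.sum_neg_distrib]
      refine Finset.sum_congr rfl fun j _ => ?_
      rw [← Finset.sum_neg_distrib]
      exact Finset.sum_congr rfl fun k _ => by rw [e j k]; ring
    rw [a1, a2, sub_neg_eq_add, ← two_mul, Finset.mul_sum]
    refine Finset.sum_congr rfl fun j _ => ?_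
    rw [Finset.mul_sum]
  have h3 : topWedge (fun i : Fin m => if i.val = 0 then N else Ω)
      = (1 / m) * (∑ j, x j / ‖x‖ * ∑ k, Ω⁻¹ k j * θ k) * topWedge fun _ : Fin m => Ω := by
    rw [h2] at h1
    rw [← mul_right_inj' hm', h1]
    field_simp
  rw [fluxDensity, h3, ← sign_mul_self (topWedge fun _ : Fin m => Ω)]
  simp only [Finset.mul_sum, Finset.sum_mul]
  refine Finset.sum_congr rfl fun j _ => Finset.sum_congr rfl fun k _ => ?_
  ring

end TopWedge

/-! ### The Kähler form and the volume -/

section KahlerVolume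

variable {m : ℕ}

open Matrix in
/-- A Hermitian vector space has unitary frames: vectors `v_i` such that the `v_i` and the `J v_i`
are orthonormal. -/
lemma exists_unitary_family {G J : SqMat (2 * m)} (hG : G.PosDef) (hsq : J * J = -1)
    (horth : J.transpose * G * J = G) (k : ℕ) (hk : k ≤ m) :
    ∃ v : Fin k → Fin (2 * m) → ℝ, ∀ i j,
      v i ⬝ᵥ G *ᵥ v j = (if i = j then 1 else 0) ∧ v i ⬝ᵥ G *ᵥ (J *ᵥ v j) = 0 := by
  have hGs : G.transpose = G := by
    rw [← Matrix.conjTranspose_eq_transpose_of_trivial]; exact hG.isHermitian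
  have hsymm : ∀ a b, a ⬝ᵥ G *ᵥ b = b ⬝ᵥ G *ᵥ a := by
    intro a b
    rw [Matrix.dotProduct_mulVec, ← Matrix.mulVec_transpose, hGs, dotProduct_comm]
  have hJJ : ∀ a b, (J *ᵥ a) ⬝ᵥ G *ᵥ (J *ᵥ b) = a ⬝ᵥ G *ᵥ b := by
    intro a b
    rw [← Matrix.vecMul_transpose, ← Matrix.dotProduct_mulVec, Matrix.mulVec_mulVec,
      Matrix.mulVec_mulVec, horth]
  have hJ2 : ∀ a, J *ᵥ (J *ᵥ a) = -a := by
    intro a; rw [Matrix.mulVec_mulVec, hsq, Matrix.neg_mulVec, Matrix.one_mulVec]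
  have hskew : ∀ a b, a ⬝ᵥ G *ᵥ (J *ᵥ b) = -((J *ᵥ a) ⬝ᵥ G *ᵥ b) := by
    intro a b
    rw [← hJJ a (J *ᵥ b), hJ2, Matrix.mulVec_neg, dotProduct_neg]
  induction k with
  | zero => exact ⟨fun i => i.elim0, fun i => i.elim0⟩
  | succ k ih =>
    obtain ⟨v, hv⟩ := ih (by omega)
    let L : (Fin (2 * m) → ℝ) →ₗ[ℝ] (Fin k → ℝ) × (Fin k → ℝ) :=
      { toFun := fun w => (fun i => v i ⬝ᵥ G *ᵥ w, fun i => (J *ᵥ v i) ⬝ᵥ G *ᵥ w)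
        map_add' := fun a b => by
          ext i <;> simp [Matrix.mulVec_add, dotProduct_add]
        map_smul' := fun c a => by
          ext i <;> simp [Matrix.mulVec_smul, dotProduct_smul] }
    have hker : LinearMap.ker L ≠ ⊥ := by
      apply LinearMap.ker_ne_bot_of_finrank_lt
      simp; omega
    obtain ⟨w, hw, hw0⟩ := (Submodule.ne_bot_iff _).1 hker
    have hw1 : ∀ i, v i ⬝ᵥ G *ᵥ w = 0 := fun i => congrFun (congrArg Prod.fst hw) i
    have hw2 : ∀ i, (J *ᵥ v i) ⬝ᵥ G *ᵥ w = 0 := fun i => congrFun (congrArg Prod.snd hw) i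
    have hpos : 0 < w ⬝ᵥ G *ᵥ w := by
      have := hG.dotProduct_mulVec_pos hw0
      simpa using this
    set r := Real.sqrt (w ⬝ᵥ G *ᵥ w) with hr
    have hr0 : r ≠ 0 := (Real.sqrt_pos.2 hpos).ne'
    have hrr : r * r = w ⬝ᵥ G *ᵥ w := Real.mul_self_sqrt hpos.le
    have hww : w ⬝ᵥ G *ᵥ (J *ᵥ w) = 0 := by
      have h1 := hskew w w
      rw [hsymm (J *ᵥ w) w] at h1
      linarith
    refine ⟨Fin.snoc v (r⁻¹ • w), fun i j => ?_⟩
    refine Fin.lastCases ?_ (fun i => ?_) i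
    · refine Fin.lastCases ?_ (fun j => ?_) j
      · simp only [Fin.snoc_last, Matrix.mulVec_smul, smul_dotProduct, dotProduct_smul, hww,
          smul_eq_mul, ← hrr, if_true]
        refine ⟨by field_simp, by simp⟩
      · simp only [Fin.snoc_last, Fin.snoc_castSucc, smul_dotProduct, hsymm w, hw1, hw2,
          smul_zero, (Fin.castSucc_lt_last j).ne', if_false, and_self]
    · refine Fin.lastCases ?_ (fun j => ?_) j
      · simp only [Fin.snoc_last, Fin.snoc_castSucc, Matrix.mulVec_smul, dotProduct_smul, hw1,
          hskew, hw2, smul_zero, neg_zero, (Fin.castSucc_lt_last i).ne, if_false, and_self]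
      · simpa using hv i j

lemma stdSympl_apply (p q : Fin 2 × Fin m) : stdSympl m p q =
    (if p.1 = 0 ∧ q.1 = 1 ∧ p.2 = q.2 then 1 else 0) -
      (if p.1 = 1 ∧ q.1 = 0 ∧ p.2 = q.2 then 1 else 0) := by
  obtain ⟨c, i⟩ := p
  obtain ⟨d, j⟩ := q
  fin_cases c <;> fin_cases d <;>
    simp [stdSympl, Matrix.one_apply, Prod.ext_iff, eq_comm]

open Matrix in
/-- The top power of the Kähler form is `m!` times the Riemannian volume form, up to orientation. -/
lemma abs_topWedge_kahler {G J : SqMat (2 * m)} (hG : G.PosDef) (hsq : J * J = -1)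
    (horth : J.transpose * G * J = G) :
    |topWedge fun _ : Fin m => J.transpose * G| = m.factorial * Real.sqrt G.det := by
  obtain ⟨v, hv⟩ := exists_unitary_family hG hsq horth m le_rfl
  have hGs : G.transpose = G := by
    rw [← Matrix.conjTranspose_eq_transpose_of_trivial]; exact hG.isHermitian
  have hsymm : ∀ a b, a ⬝ᵥ G *ᵥ b = b ⬝ᵥ G *ᵥ a := by
    intro a b
    rw [Matrix.dotProduct_mulVec, ← Matrix.mulVec_transpose, hGs, dotProduct_comm]
  have hJJ : ∀ a b, (J *ᵥ a) ⬝ᵥ G *ᵥ (J *ᵥ b) = a ⬝ᵥ G *ᵥ b := by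
    intro a b
    rw [← Matrix.vecMul_transpose, ← Matrix.dotProduct_mulVec, Matrix.mulVec_mulVec,
      Matrix.mulVec_mulVec, horth]
  have hJ2 : ∀ a, J *ᵥ (J *ᵥ a) = -a := by
    intro a; rw [Matrix.mulVec_mulVec, hsq, Matrix.neg_mulVec, Matrix.one_mulVec]
  let b : Fin 2 × Fin m → Fin (2 * m) → ℝ := fun p => if p.1 = 0 then v p.2 else J *ᵥ v p.2
  let B : SqMat (2 * m) := Matrix.of fun q p => b (finProdFinEquiv.symm p) q
  have hB : ∀ (M : SqMat (2 * m)) p q, (B.transpose * M * B).submatrix finProdFinEquiv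
      finProdFinEquiv p q = b p ⬝ᵥ M *ᵥ b q := by
    intro M p q
    have hcol : ∀ p q, B q (finProdFinEquiv p) = b p q := by
      intro p q
      change b (finProdFinEquiv.symm (finProdFinEquiv p)) q = b p q
      rw [Equiv.symm_apply_apply]
    simp only [Matrix.submatrix_apply, Matrix.mul_apply, Matrix.transpose_apply, hcol, dotProduct,
      Matrix.mulVec, Finset.sum_mul, Finset.mul_sum]
    rw [Finset.sum_comm]
    exact Finset.sum_congr rfl fun _ _ => Finset.sum_congr rfl fun _ _ => by ring
  have hvJ : ∀ i j, (J *ᵥ v i) ⬝ᵥ G *ᵥ v j = 0 := fun i j => by rw [hsymm, (hv j i).2]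
  have h1 : B.transpose * G * B = 1 := by
    have : (B.transpose * G * B).submatrix finProdFinEquiv finProdFinEquiv
        = (1 : SqMat (2 * m)).submatrix finProdFinEquiv finProdFinEquiv := by
      ext p q
      rw [hB, Matrix.submatrix_one_equiv, Matrix.one_apply]
      obtain ⟨c, i⟩ := p
      obtain ⟨d, j⟩ := q
      fin_cases c <;> fin_cases d <;> simp [b, hv, hvJ, hJJ, Prod.ext_iff,
        -Matrix.mulVec_mulVec]
    exact (Matrix.reindex finProdFinEquiv.symm finProdFinEquiv.symm).injective this
  have h2 : (B.transpose * (J.transpose * G) * B).submatrix finProdFinEquiv finProdFinEquiv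
      = stdSympl m := by
    ext p q
    rw [hB, ← Matrix.mulVec_mulVec, Matrix.dotProduct_mulVec, Matrix.vecMul_transpose,
      stdSympl_apply]
    obtain ⟨c, i⟩ := p
    obtain ⟨d, j⟩ := q
    fin_cases c <;> fin_cases d <;> simp [b, hv, hvJ, hJJ, hJ2, -Matrix.mulVec_mulVec]
  have h3 := topWedge_transform (fun _ : Fin m => J.transpose * G) B
  rw [topWedge_eq_wedgeSum] at h3
  simp only [h2] at h3
  rw [wedgeSum_stdSympl] at h3
  have h4 : B.det * B.det * G.det = 1 := by
    have := congrArg Matrix.det h1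
    rw [Matrix.det_mul, Matrix.det_mul, Matrix.det_transpose, Matrix.det_one] at this
    linarith
  have hB0 : B.det ≠ 0 := by
    intro h; rw [h] at h4; simp at h4
  have h5 : Real.sqrt G.det = |B.det|⁻¹ := by
    have : G.det = (|B.det|⁻¹) ^ 2 := by
      rw [inv_pow, sq_abs]
      refine eq_inv_of_mul_eq_one_left ?_
      linarith
    rw [this, Real.sqrt_sq (by positivity)]
  have h6 : (m.factorial : ℝ) = B.det * topWedge fun _ : Fin m => J.transpose * G := by
    rw [← h3]; field_simp
  have h7 : (m.factorial : ℝ) = |B.det| * |topWedge fun _ : Fin m => J.transpose * G| := by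
    rw [← abs_mul, ← h6, abs_of_nonneg (by positivity)]
  rw [h5, h7]
  field_simp
  
/-- The matrix `B` with `ν ∧ θ ∧ ω^{m-1} = (∑ B_{kj} ν_j θ_k) vol`, for the Euclidean volume form in
the orientation of `ω^m`; here `ω = g(J·,·)`. It is skew, and divergence-free as `ω^{m-1}` is closed. -/
def fluxMat (G J : Euc (2 * m) → SqMat (2 * m)) (x : Euc (2 * m)) : SqMat (2 * m) :=
  (|topWedge fun _ : Fin m => (J x).transpose * G x| / m) • ((J x).transpose * G x)⁻¹

/-- The vector field `W` with `ν ∧ θ ∧ ω^{m-1} = ν(W) vol`. -/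
def fluxField (G J : Euc (2 * m) → SqMat (2 * m)) (θ : Fin (2 * m) → Euc (2 * m) → ℝ)
    (j : Fin (2 * m)) (x : Euc (2 * m)) : ℝ :=
  ∑ k, fluxMat G J x k j * θ k x

namespace IsKahlerOn

variable {G J : Euc (2 * m) → SqMat (2 * m)} {U : Set (Euc (2 * m))} {x : Euc (2 * m)}

lemma abs_topWedge (h : IsKahlerOn G J U) (hx : x ∈ U) :
    |topWedge fun _ : Fin m => (J x).transpose * G x| = m.factorial * Real.sqrt (G x).det :=
  abs_topWedge_kahler (h.posDef x hx) (h.sq x hx) (h.orth x hx)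

lemma topWedge_ne (h : IsKahlerOn G J U) (hx : x ∈ U) :
    (topWedge fun _ : Fin m => (J x).transpose * G x) ≠ 0 := by
  rw [← abs_pos, h.abs_topWedge hx]
  have := Real.sqrt_pos.2 (h.posDef x hx).det_pos
  positivity

lemma transpose_J (h : IsKahlerOn G J U) (hx : x ∈ U) :
    (J x).transpose * G x = -(G x * J x) := by
  calc (J x).transpose * G x = -((J x).transpose * G x * (J x * J x)) := by
        rw [h.sq x hx]; simp
    _ = _ := by rw [← Matrix.mul_assoc, h.orth x hx]

lemma kahler_skew (h : IsKahlerOn G J U) (hx : x ∈ U) :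
    ((J x).transpose * G x).transpose = -((J x).transpose * G x) := by
  rw [Matrix.transpose_mul, Matrix.transpose_transpose, h.symm hx, h.transpose_J hx, neg_neg]

lemma kahler_inv (h : IsKahlerOn G J U) (hx : x ∈ U) :
    ((J x).transpose * G x)⁻¹ = -((G x)⁻¹ * (J x).transpose) := by
  refine Matrix.inv_eq_left_inv ?_
  rw [Matrix.neg_mul, Matrix.mul_assoc, ← Matrix.mul_assoc (J x).transpose, ← Matrix.transpose_mul,
    h.sq x hx]
  simp [Matrix.nonsing_inv_mul _ (h.isUnit_det hx)]

lemma kahler_isUnit (h : IsKahlerOn G J U) (hx : x ∈ U) :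
    IsUnit ((J x).transpose * G x).det := by
  refine (Matrix.isUnit_iff_isUnit_det _).1 (IsUnit.of_mul_eq_one (-((G x)⁻¹ * (J x).transpose)) ?_)
  rw [mul_neg, Matrix.mul_assoc, Matrix.mul_nonsing_inv_cancel_left _ _ (h.isUnit_det hx),
    ← Matrix.transpose_mul, h.sq x hx]
  simp

lemma pdM_kahler (h : IsKahlerOn G J U) (hx : x ∈ U) (l : Fin (2 * m)) :
    pdM l (fun y => (J y).transpose * G y) x
      = (chrM G l x).transpose * ((J x).transpose * G x)
        + (J x).transpose * G x * chrM G l x := by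
  rw [pdM_mul (h.smoothJ x hx).transpose ((h.smooth x hx).of_le (by norm_num)), pdM_transpose,
    h.parallel x hx, h.pdM_metric hx]
  simp only [Matrix.transpose_sub, Matrix.transpose_mul, Matrix.sub_mul, Matrix.mul_add,
    Matrix.mul_assoc]
  abel

lemma smooth_kahler (h : IsKahlerOn G J U) (hx : x ∈ U) :
    CMatAt 1 (fun y => (J y).transpose * G y) x :=
  (h.smoothJ x hx).transpose.mul ((h.smooth x hx).of_le (by norm_num))

lemma smooth_topWedge (h : IsKahlerOn G J U) (hx : x ∈ U) :
    ContDiffAt ℝ 1 (fun y => topWedge fun _ : Fin m => (J y).transpose * G y) x := by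
  unfold topWedge
  exact contDiffAt_const.mul (ContDiffAt.sum fun σ _ => contDiffAt_const.mul
    (contDiffAt_prod fun i _ => h.smooth_kahler hx _ _))

lemma pd_topWedge (h : IsKahlerOn G J U) (hm : 0 < m) (hx : x ∈ U) (l : Fin (2 * m)) :
    pd l (fun y => topWedge fun _ : Fin m => (J y).transpose * G y) x
      = (chrM G l x).trace * topWedge fun _ : Fin m => (J x).transpose * G x := by
  set Ω : Euc (2 * m) → SqMat (2 * m) := fun y => (J y).transpose * G y with hΩ
  have hline : ∀ f : Euc (2 * m) → ℝ, DifferentiableAt ℝ f x →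
      HasDerivAt (fun t : ℝ => f (x + t • stdVec l)) (pd l f x) 0 := by
    intro f hf
    have h1 : HasDerivAt (fun t : ℝ => x + t • (stdVec l : Euc (2 * m))) (stdVec l) 0 := by
      simpa using ((hasDerivAt_id (0 : ℝ)).smul_const (stdVec l : Euc (2 * m))).const_add x
    have h2 : HasFDerivAt f (fderiv ℝ f x) (x + (0 : ℝ) • (stdVec l : Euc (2 * m))) := by
      simpa using hf.hasFDerivAt
    exact h2.comp_hasDerivAt 0 h1
  have h1 := hline _ ((h.smooth_topWedge hx).differentiableAt (by simp))
  have h2 := hasDerivAt_topWedge (m := m) (Ω := fun t : ℝ => Ω (x + t • stdVec l))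
    (Ω' := pdM l Ω x) (t := 0) hm fun p q => hline _ ((h.smooth_kahler hx).diff (by simp) p q)
  rw [h1.unique h2]
  simp only [zero_smul, add_zero]
  have hs : (pdM l Ω x).transpose = -pdM l Ω x := by
    rw [hΩ, h.pdM_kahler hx, Matrix.transpose_add, Matrix.transpose_mul (chrM G l x).transpose,
      Matrix.transpose_mul _ (chrM G l x), h.kahler_skew hx, Matrix.transpose_transpose]
    simp only [Matrix.neg_mul, Matrix.mul_neg]
    abel
  rw [topWedge_first hm (h.kahler_isUnit hx) (h.kahler_skew hx) hs, hΩ, h.pdM_kahler hx]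
  congr 1
  rw [Matrix.mul_add, Matrix.trace_add,
    Matrix.nonsing_inv_mul_cancel_left _ _ (h.kahler_isUnit hx), Matrix.trace_mul_comm,
    Matrix.mul_assoc, Matrix.mul_nonsing_inv _ (h.kahler_isUnit hx), Matrix.mul_one,
    Matrix.trace_transpose]
  ring

lemma eventually_abs_topWedge (h : IsKahlerOn G J U) (hx : x ∈ U) :
    (fun y => |topWedge fun _ : Fin m => (J y).transpose * G y|) =ᶠ[𝓝 x] fun y =>
      (SignType.sign (topWedge fun _ : Fin m => (J x).transpose * G x) : ℝ) *
        topWedge fun _ : Fin m => (J y).transpose * G y := by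
  have hc := (h.smooth_topWedge hx).continuousAt
  rcases lt_or_gt_of_ne (h.topWedge_ne hx) with h0 | h0
  · filter_upwards [hc.eventually_lt continuousAt_const h0] with y hy
    rw [abs_of_neg hy, sign_neg h0]; simp
  · filter_upwards [continuousAt_const.eventually_lt hc h0] with y hy
    rw [abs_of_pos hy, sign_pos h0]; simp

lemma smooth_fluxMat (h : IsKahlerOn G J U) (hx : x ∈ U) : CMatAt 1 (fluxMat G J) x := by
  refine CMatAt.smul ?_ ((h.smooth_kahler hx).inv (h.kahler_isUnit hx).ne_zero)
  exact ((contDiffAt_const.mul (h.smooth_topWedge hx)).congr_of_eventuallyEq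
    (h.eventually_abs_topWedge hx)).div_const _

lemma fluxMat_skew (h : IsKahlerOn G J U) (hx : x ∈ U) (j k : Fin (2 * m)) :
    fluxMat G J x j k = -fluxMat G J x k j := by
  have : (((J x).transpose * G x)⁻¹).transpose = -((J x).transpose * G x)⁻¹ := by
    rw [Matrix.transpose_nonsing_inv, h.kahler_skew hx]
    refine Matrix.inv_eq_left_inv ?_
    rw [neg_mul_neg, Matrix.nonsing_inv_mul _ (h.kahler_isUnit hx)]
  have := congrFun (congrFun this k) j
  simp only [Matrix.transpose_apply, Matrix.neg_apply] at this
  simp only [fluxMat, Matrix.smul_apply, this, smul_eq_mul]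
  ring

lemma fluxMat_eq (h : IsKahlerOn G J U) (hm : 0 < m) (hx : x ∈ U) :
    fluxMat G J x = -(((m - 1).factorial * Real.sqrt (G x).det) •
      ((G x)⁻¹ * (J x).transpose)) := by
  rw [fluxMat, h.abs_topWedge hx, h.kahler_inv hx, smul_neg]
  congr 2
  obtain ⟨k, rfl⟩ : ∃ k, m = k + 1 := ⟨m - 1, by omega⟩
  rw [Nat.add_sub_cancel, Nat.factorial_succ]
  push_cast
  field_simp

/-- The form `ω^{m-1}` is closed. -/
lemma div_fluxMat (h : IsKahlerOn G J U) (hm : 0 < m) (hx : x ∈ U) (k : Fin (2 * m)) :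
    ∑ l, pd l (fun y => fluxMat G J y k l) x = 0 := by
  set Ω : Euc (2 * m) → SqMat (2 * m) := fun y => (J y).transpose * G y with hΩ
  set c : ℝ := (SignType.sign (topWedge fun _ : Fin m => Ω x) : ℝ) with hc
  set P : Euc (2 * m) → ℝ := fun y => c * topWedge fun _ : Fin m => Ω y with hP
  have hPs : ContDiffAt ℝ 1 P x := contDiffAt_const.mul (h.smooth_topWedge hx)
  have hΩs := h.smooth_kahler hx
  have hu := h.kahler_isUnit hx
  have hΩi := hΩs.inv hu.ne_zero
  have hPd : ∀ l, pd l P x = (chrM G l x).trace * P x := by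
    intro l
    rw [hP, pd_const_mul ((h.smooth_topWedge hx).differentiableAt (by simp)),
      h.pd_topWedge hm hx]
    simp only [hΩ]; ring
  have hM : fluxMat G J =ᶠ[𝓝 x] fun y => (P y / m) • (Ω y)⁻¹ := by
    filter_upwards [h.eventually_abs_topWedge hx] with y hy
    simp only [fluxMat, hP, hΩ, hy, hc]
  have hd : ∀ l, pdM l (fluxMat G J) x = (P x / m) • ((chrM G l x).trace • (Ω x)⁻¹
      - (Ω x)⁻¹ * (chrM G l x).transpose - chrM G l x * (Ω x)⁻¹) := by
    intro l
    rw [pdM_congr hM, pdM_smul (hPs.div_const _) hΩi, pdM_inv hΩs hu.ne_zero, h.pdM_kahler hx]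
    have e1 : pd l (fun y => P y / m) x = (chrM G l x).trace * (P x / m) := by
      simp only [div_eq_inv_mul]
      rw [pd_const_mul (hPs.differentiableAt (by simp)), hPd]
      ring
    have e2 : (Ω x)⁻¹ * ((chrM G l x).transpose * ((J x).transpose * G x)
        + (J x).transpose * G x * chrM G l x) * (Ω x)⁻¹
        = (Ω x)⁻¹ * (chrM G l x).transpose + chrM G l x * (Ω x)⁻¹ := by
      rw [Matrix.mul_add, Matrix.add_mul, Matrix.nonsing_inv_mul_cancel_left _ _ hu,
        Matrix.mul_assoc, Matrix.mul_assoc, Matrix.mul_nonsing_inv _ hu, Matrix.mul_one]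
    rw [e1, e2, mul_comm (chrM G l x).trace, mul_smul, ← smul_add]
    congr 1
    abel
  have hskew : ∀ a b, (Ω x)⁻¹ a b = -(Ω x)⁻¹ b a := by
    intro a b
    have : ((Ω x)⁻¹).transpose = -(Ω x)⁻¹ := by
      rw [Matrix.transpose_nonsing_inv, h.kahler_skew hx]
      refine Matrix.inv_eq_left_inv ?_
      rw [neg_mul_neg, Matrix.nonsing_inv_mul _ hu]
    exact congrFun (congrFun this b) a
  have e : ∀ l, pd l (fun y => fluxMat G J y k l) x = pdM l (fluxMat G J) x k l := fun _ => rfl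
  simp only [e, hd, Matrix.smul_apply, smul_eq_mul, ← Finset.mul_sum, Matrix.sub_apply,
    Finset.sum_sub_distrib]
  have s1 : ∑ l, (chrM G l x * (Ω x)⁻¹) k l = 0 := by
    simp only [Matrix.mul_apply]
    have : ∑ l, ∑ a, chrM G l x k a * (Ω x)⁻¹ a l = -∑ l, ∑ a, chrM G l x k a * (Ω x)⁻¹ a l := by
      conv_lhs => rw [Finset.sum_comm]
      rw [← Finset.sum_neg_distrib]
      refine Finset.sum_congr rfl fun l _ => ?_
      rw [← Finset.sum_neg_distrib]
      refine Finset.sum_congr rfl fun a _ => ?_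
      rw [h.chrM_symm hx, hskew l a]; ring
    linarith
  have s2 : ∑ l, ((Ω x)⁻¹ * (chrM G l x).transpose) k l
      = ∑ l, (chrM G l x).trace * (Ω x)⁻¹ k l := by
    simp only [Matrix.mul_apply, Matrix.trace, Matrix.diag, Matrix.transpose_apply, Finset.sum_mul]
    rw [Finset.sum_comm]
    refine Finset.sum_congr rfl fun a _ => Finset.sum_congr rfl fun l _ => ?_
    rw [h.chrM_symm hx l a l]; ring
  rw [s1, s2]; simp

lemma fluxDensity_eq_fluxField (h : IsKahlerOn G J U) (hm : 0 < m) (hx : x ∈ U)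
    (θ : Fin (2 * m) → Euc (2 * m) → ℝ) :
    fluxDensity (fun k => θ k x) ((J x).transpose * G x) x
      = ∑ j, x j / ‖x‖ * fluxField G J θ j x := by
  rw [fluxDensity_eq hm (h.kahler_isUnit hx) (h.kahler_skew hx)]
  rfl

lemma smooth_fluxField (h : IsKahlerOn G J U) (hx : x ∈ U)
    {θ : Fin (2 * m) → Euc (2 * m) → ℝ} (hθ : ∀ k, ContDiffAt ℝ 1 (θ k) x) (j : Fin (2 * m)) :
    ContDiffAt ℝ 1 (fluxField G J θ j) x :=
  ContDiffAt.sum fun k _ => (h.smooth_fluxMat hx k j).mul (hθ k)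

lemma div_fluxField (h : IsKahlerOn G J U) (hm : 0 < m) (hx : x ∈ U)
    {θ : Fin (2 * m) → Euc (2 * m) → ℝ} (hθ : ∀ k, ContDiffAt ℝ 1 (θ k) x) :
    ∑ j, pd j (fluxField G J θ j) x
      = ∑ j, ∑ k, (1 / 2) * fluxMat G J x k j * (pd j (θ k) x - pd k (θ j) x) := by
  have hB := h.smooth_fluxMat hx
  have e1 : ∀ j, pd j (fluxField G J θ j) x
      = ∑ k, (pd j (fun y => fluxMat G J y k j) x * θ k x + fluxMat G J x k j * pd j (θ k) x) := by
    intro j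
    refine (pd_sum (f := fun k y => fluxMat G J y k j * θ k y) (fun k _ =>
      (hB.diff (by simp) k j).mul ((hθ k).differentiableAt (by simp))) j).trans ?_
    exact Finset.sum_congr rfl fun k _ =>
      pd_mul (hB.diff (by simp) k j) ((hθ k).differentiableAt (by simp)) j
  simp only [e1, Finset.sum_add_distrib]
  have e2 : ∑ j, ∑ k, pd j (fun y => fluxMat G J y k j) x * θ k x = 0 := by
    rw [Finset.sum_comm]
    refine Finset.sum_eq_zero fun k _ => ?_
    rw [← Finset.sum_mul, h.div_fluxMat hm hx, zero_mul]
  rw [e2, zero_add]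
  have e3 : ∑ j, ∑ k, fluxMat G J x k j * pd j (θ k) x
      = -∑ j, ∑ k, fluxMat G J x k j * pd k (θ j) x := by
    rw [Finset.sum_comm, ← Finset.sum_neg_distrib]
    refine Finset.sum_congr rfl fun j _ => ?_
    rw [← Finset.sum_neg_distrib]
    refine Finset.sum_congr rfl fun k _ => ?_
    rw [h.fluxMat_skew hx j k]; ring
  have e4 : ∑ j, ∑ k, (1 / 2) * fluxMat G J x k j * (pd j (θ k) x - pd k (θ j) x)
      = (1 / 2) * (∑ j, ∑ k, fluxMat G J x k j * pd j (θ k) x)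
        - (1 / 2) * ∑ j, ∑ k, fluxMat G J x k j * pd k (θ j) x := by
    simp only [Finset.mul_sum, ← Finset.sum_sub_distrib]
    exact Finset.sum_congr rfl fun j _ => Finset.sum_congr rfl fun k _ => by ring
  rw [e4]; linarith

/-- `ρ ∧ ω^{m-1}` is, up to a constant, the scalar curvature times the volume form. -/
lemma div_fluxField_of_primitive (h : IsKahlerOn G J U) (hm : 0 < m) (hx : x ∈ U)
    {θ : Fin (2 * m) → Euc (2 * m) → ℝ} (hθ : ∀ k, ContDiffAt ℝ 1 (θ k) x)
    (hd : ∀ j k, pd j (θ k) x - pd k (θ j) x = ricForm G J j k x) :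
    ∑ j, pd j (fluxField G J θ j) x
      = (m - 1).factorial / 2 * (scalarCoord G x * Real.sqrt (G x).det) := by
  rw [h.div_fluxField hm hx hθ]
  simp only [hd, h.fluxMat_eq hm hx]
  set c : ℝ := (m - 1).factorial * Real.sqrt (G x).det with hc
  set S : SqMat (2 * m) := Matrix.of fun a b => ricci G a b x with hS
  have hρ : ∀ j k, ricForm G J j k x = ((J x).transpose * S) j k := by
    intro j k; simp [ricForm, Matrix.mul_apply, hS]
  have hs : scalarCoord G x = ((G x)⁻¹ * S).trace := by
    simp only [scalarCoord, Matrix.trace, Matrix.diag, Matrix.mul_apply, hS, Matrix.of_apply]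
    refine Finset.sum_congr rfl fun j _ => Finset.sum_congr rfl fun k _ => ?_
    rw [h.ricci_symm hx]
  have e : ∑ j, ∑ k, (1 / 2) * (-(c • ((G x)⁻¹ * (J x).transpose))) k j * ricForm G J j k x
      = -(c / 2) * ((G x)⁻¹ * (J x).transpose * ((J x).transpose * S)).trace := by
    rw [Finset.sum_comm]
    simp only [Matrix.trace, Matrix.diag, Matrix.mul_apply (M := (G x)⁻¹ * (J x).transpose),
      Finset.mul_sum, hρ, Matrix.neg_apply, Matrix.smul_apply, smul_eq_mul]
    exact Finset.sum_congr rfl fun k _ => Finset.sum_congr rfl fun j _ => by ring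
  rw [e, Matrix.mul_assoc, ← Matrix.mul_assoc (J x).transpose, ← Matrix.transpose_mul, h.sq x hx, hs]
  simp [hc]
  ring

end IsKahlerOn

end KahlerVolume

/-! ### Integration by parts and fluxes through spheres -/

section Integration

variable {n : ℕ}

lemma continuousAt_pd {f : Euc n → ℝ} {x : Euc n} (hf : ContDiffAt ℝ 1 f x) (k : Fin n) :
    ContinuousAt (pd k f) x :=
  (contDiffAt_pd (r := 0) hf (by simp) k).continuousAt

lemma integral_pd_eq_zero {f : Euc n → ℝ} (hf : ContDiff ℝ 1 f) (hc : HasCompactSupport f)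
    (k : Fin n) : ∫ x, pd k f x = 0 := by
  have hi : Integrable (fun x => fderiv ℝ f x (stdVec k)) := by
    refine Continuous.integrable_of_hasCompactSupport
      ((hf.continuous_fderiv (by simp)).clm_apply continuous_const) ?_
    exact (hc.fderiv (𝕜 := ℝ)).comp_left (g := fun L : Euc n →L[ℝ] ℝ => L (stdVec k)) rfl
  have := integral_mul_fderiv_eq_neg_fderiv_mul_of_integrable (μ := (volume : Measure (Euc n)))
    (f := fun _ : Euc n => (1 : ℝ)) (g := f) (v := stdVec k) (by simp) (by simpa using hi)
    (by simpa using hf.continuous.integrable_of_hasCompactSupport hc)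
    (fun x _ => differentiableAt_const _)
    (fun x _ => hf.differentiable (by simp) x)
  simpa [pd] using this

section CutOff

variable {χ V : Euc n → ℝ} {U : Set (Euc n)}

lemma pd_eq_zero_of_notMem_tsupport {f : Euc n → ℝ} {x : Euc n} (hx : x ∉ tsupport f) (k : Fin n) :
    pd k f x = 0 := by
  rw [pd_congr (notMem_tsupport_iff_eventuallyEq.1 hx) k]
  exact pd_const 0 k x

lemma tsupport_pd_subset (f : Euc n → ℝ) (k : Fin n) : tsupport (pd k f) ⊆ tsupport f :=
  closure_minimal (fun x hx => by
    by_contra h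
    exact hx (pd_eq_zero_of_notMem_tsupport h k)) (isClosed_tsupport f)

lemma integrable_mul_of_tsupport (hχ : Continuous χ) (hc : HasCompactSupport χ)
    (hU : tsupport χ ⊆ U) (hV : ∀ x ∈ U, ContinuousAt V x) : Integrable fun x => χ x * V x := by
  have hs : tsupport (fun x => χ x * V x) ⊆ tsupport χ := tsupport_mul_subset_left
  refine Continuous.integrable_of_hasCompactSupport
    (continuous_of_tsupport fun x hx => ?_) (hc.mul_right)
  exact hχ.continuousAt.mul (hV x (hU (hs hx)))

lemma contDiff_of_forall_tsupport {f : Euc n → ℝ} {r : WithTop ℕ∞}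
    (hf : ∀ x ∈ tsupport f, ContDiffAt ℝ r f x) : ContDiff ℝ r f := by
  refine contDiff_iff_contDiffAt.2 fun x => ?_
  by_cases hx : x ∈ tsupport f
  · exact hf x hx
  · exact contDiffAt_const.congr_of_eventuallyEq (notMem_tsupport_iff_eventuallyEq.1 hx)

/-- Integration by parts against a cut-off function. -/
lemma integral_mul_pd (hχ : ContDiff ℝ 1 χ) (hc : HasCompactSupport χ)
    (hU : tsupport χ ⊆ U) (hV : ∀ x ∈ U, ContDiffAt ℝ 1 V x) (k : Fin n) :
    ∫ x, χ x * pd k V x = -∫ x, pd k χ x * V x := by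
  have hs : tsupport (fun x => χ x * V x) ⊆ tsupport χ := tsupport_mul_subset_left
  have h1 : ContDiff ℝ 1 fun x => χ x * V x :=
    contDiff_of_forall_tsupport fun x hx => hχ.contDiffAt.mul (hV x (hU (hs hx)))
  have h2 := integral_pd_eq_zero h1 hc.mul_right k
  have h3 : ∀ x, pd k (fun y => χ y * V y) x = pd k χ x * V x + χ x * pd k V x := by
    intro x
    by_cases hx : x ∈ tsupport χ
    · exact pd_mul (hχ.differentiable (by simp) x) ((hV x (hU hx)).differentiableAt (by simp)) k
    · rw [pd_eq_zero_of_notMem_tsupport hx, image_eq_zero_of_notMem_tsupport hx,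
        pd_eq_zero_of_notMem_tsupport fun h => hx (hs h)]
      ring
  have hpc : Continuous (pd k χ) := (hχ.continuous_fderiv (by simp)).clm_apply continuous_const
  have hcpd : HasCompactSupport (pd k χ) := hc.of_isClosed_subset (isClosed_tsupport _)
    (tsupport_pd_subset χ k)
  have i1 : Integrable fun x => pd k χ x * V x := integrable_mul_of_tsupport hpc hcpd
    ((tsupport_pd_subset χ k).trans hU) fun x hx => (hV x hx).continuousAt
  have i2 : Integrable fun x => χ x * pd k V x := integrable_mul_of_tsupport hχ.continuous hc hU
    fun x hx => continuousAt_pd (hV x hx) k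
  simp only [h3] at h2
  rw [integral_add i1 i2] at h2
  linarith

end CutOff

/-! ### Polar coordinates -/

lemma integrable_polar (hn : 0 < n) {f : Euc n → ℝ} (hf : Integrable f) :
    IntegrableOn (sphereIntegral f) (Ioi 0) ∧
      ∫ x, f x = ∫ t in Ioi (0 : ℝ), sphereIntegral f t := by
  have : Nonempty (Fin n) := ⟨⟨0, hn⟩⟩
  have hdim : Module.finrank ℝ (Euc n) = n := by simp
  set μS := (volume : Measure (Euc n)).toSphere
  set ν := Measure.volumeIoiPow (n - 1)
  have hmp := (volume : Measure (Euc n)).measurePreserving_homeomorphUnitSphereProd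
  rw [hdim] at hmp
  set e := homeomorphUnitSphereProd (Euc n)
  set G : Metric.sphere (0 : Euc n) 1 × Ioi (0 : ℝ) → ℝ := fun p => f (p.2.1 • p.1.1) with hG
  have hGe : ∀ x : ({0}ᶜ : Set (Euc n)), G (e x) = f x.1 := by
    intro x
    have : (e.symm (e x)).1 = (e x).2.1 • (e x).1.1 := rfl
    simp only [hG]
    rw [← this, Homeomorph.symm_apply_apply]
  have i1 : Integrable G (μS.prod ν) := by
    rw [← hmp.integrable_comp_emb e.measurableEmbedding]
    have : G ∘ e = fun x : ({0}ᶜ : Set (Euc n)) => f x.1 := funext hGe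
    rw [this]
    have h2 := (integrableOn_iff_comap_subtypeVal (μ := (volume : Measure (Euc n)))
      (s := ({0}ᶜ : Set (Euc n))) (f := f) (by measurability)).1 hf.integrableOn
    exact h2
  have e1 : ∫ x, f x = ∫ p, G p ∂(μS.prod ν) := by
    rw [← hmp.integral_comp e.measurableEmbedding]
    simp only [hGe]
    rw [integral_subtype_comap (measurableSet_singleton _).compl f, restrict_compl_singleton]
  have i2 := i1.integral_prod_right
  have e2 := integral_prod_symm _ i1
  have hsph : ∀ t : Ioi (0 : ℝ), sphereIntegral f t = t.1 ^ (n - 1) * ∫ u, G (u, t) ∂μS :=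
    fun t => rfl
  have hmeas : Measurable fun r : Ioi (0 : ℝ) => Real.toNNReal (r.1 ^ (n - 1)) :=
    (measurable_subtype_coe.pow_const _).real_toNNReal
  have hν : ν = (Measure.comap Subtype.val volume).withDensity
      fun r : Ioi (0 : ℝ) => (Real.toNNReal (r.1 ^ (n - 1)) : ENNReal) := rfl
  have hsm : ∀ t : Ioi (0 : ℝ), Real.toNNReal (t.1 ^ (n - 1)) • ∫ u, G (u, t) ∂μS
      = sphereIntegral f t := by
    intro t
    rw [hsph, NNReal.smul_def, Real.coe_toNNReal _ (pow_nonneg t.2.out.le _), smul_eq_mul]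
  constructor
  · rw [integrableOn_iff_comap_subtypeVal measurableSet_Ioi]
    rw [hν, integrable_withDensity_iff_integrable_smul hmeas] at i2
    simp only [hsm] at i2
    exact i2
  · rw [e1, e2, hν, integral_withDensity_eq_integral_smul hmeas]
    simp only [hsm]
    rw [integral_subtype_comap measurableSet_Ioi (sphereIntegral f)]

lemma norm_smul_sphere {t : ℝ} (ht : 0 ≤ t) (u : Metric.sphere (0 : Euc n) 1) :
    ‖t • (u : Euc n)‖ = t := by
  rw [norm_smul, norm_eq_of_mem_sphere, mul_one, Real.norm_of_nonneg ht]

lemma sphereIntegral_congr {f h : Euc n → ℝ} {t : ℝ} (ht : 0 ≤ t) (H : ∀ x, ‖x‖ = t → f x = h x) :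
    sphereIntegral f t = sphereIntegral h t := by
  unfold sphereIntegral
  congr 1
  exact integral_congr_ae (Eventually.of_forall fun u => H _ (norm_smul_sphere ht u))

lemma sphereIntegral_radial_mul (ψ : ℝ → ℝ) (f : Euc n → ℝ) {t : ℝ} (ht : 0 ≤ t) :
    sphereIntegral (fun x => ψ ‖x‖ * f x) t = ψ t * sphereIntegral f t := by
  unfold sphereIntegral
  simp only [norm_smul_sphere ht]
  rw [integral_const_mul]
  ring

lemma continuous_on_sphere {f : Euc n → ℝ} {r t : ℝ} (hr : 0 ≤ r) (hrt : r < t)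
    (hf : ∀ x, r < ‖x‖ → ContinuousAt f x) :
    Continuous fun u : Metric.sphere (0 : Euc n) 1 => f (t • (u : Euc n)) := by
  refine continuous_iff_continuousAt.2 fun u => ?_
  refine ContinuousAt.comp (f := fun u : Metric.sphere (0 : Euc n) 1 => t • (u : Euc n)) (hf _ ?_) ?_
  · rw [norm_smul_sphere (hr.trans hrt.le)]; exact hrt
  · fun_prop

lemma integrable_on_sphere {f : Euc n → ℝ} {r t : ℝ} (hr : 0 ≤ r) (hrt : r < t)
    (hf : ∀ x, r < ‖x‖ → ContinuousAt f x) :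
    Integrable (fun u : Metric.sphere (0 : Euc n) 1 => f (t • (u : Euc n)))
      (volume : Measure (Euc n)).toSphere :=
  (continuous_on_sphere hr hrt hf).integrable_of_hasCompactSupport
    (HasCompactSupport.of_compactSpace _)

lemma sphereIntegral_add {f h : Euc n → ℝ} {r t : ℝ} (hr : 0 ≤ r) (hrt : r < t)
    (hf : ∀ x, r < ‖x‖ → ContinuousAt f x) (hh : ∀ x, r < ‖x‖ → ContinuousAt h x) :
    sphereIntegral (fun x => f x + h x) t = sphereIntegral f t + sphereIntegral h t := by
  unfold sphereIntegral
  rw [integral_add (integrable_on_sphere hr hrt hf) (integrable_on_sphere hr hrt hh)]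
  ring

lemma sphereIntegral_const_mul (c : ℝ) (f : Euc n → ℝ) (t : ℝ) :
    sphereIntegral (fun x => c * f x) t = c * sphereIntegral f t := by
  unfold sphereIntegral
  rw [integral_const_mul]
  ring

lemma continuousOn_sphereIntegral {f : Euc n → ℝ} {r : ℝ} (hr : 0 ≤ r)
    (hf : ∀ x, r < ‖x‖ → ContinuousAt f x) : ContinuousOn (sphereIntegral f) (Ioi r) := by
  unfold sphereIntegral
  refine (continuousOn_id.pow _).mul ?_
  rw [continuousOn_iff_continuous_domRestrict]
  have : LocallyCompactSpace (Ioi r) := isOpen_Ioi.locallyCompactSpace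
  have : Continuous (Function.uncurry fun (t : Ioi r) (u : Metric.sphere (0 : Euc n) 1) =>
      f (t.1 • (u : Euc n))) := by
    refine continuous_iff_continuousAt.2 fun p => ?_
    refine ContinuousAt.comp
      (f := fun p : Ioi r × Metric.sphere (0 : Euc n) 1 => p.1.1 • (p.2 : Euc n)) (hf _ ?_) ?_
    · rw [norm_smul_sphere (hr.trans p.1.2.out.le)]; exact p.1.2
    · fun_prop
  have h2 := continuous_parametric_integral_of_continuous
    (μ := (volume : Measure (Euc n)).toSphere) this isCompact_univ
  simp only [Measure.restrict_univ] at h2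
  exact h2

lemma pd_coord (a j : Fin n) (x : Euc n) : pd j (fun y : Euc n => y a) x = if a = j then 1 else 0 := by
  have : HasFDerivAt (fun y : Euc n => y a) (EuclideanSpace.proj a : Euc n →L[ℝ] ℝ) x :=
    (EuclideanSpace.proj a : Euc n →L[ℝ] ℝ).hasFDerivAt
  rw [pd, this.fderiv]
  simpa using stdVec_apply j a

lemma contDiff_coord {r : WithTop ℕ∞} (a : Fin n) : ContDiff ℝ r fun y : Euc n => y a :=
  (EuclideanSpace.proj a : Euc n →L[ℝ] ℝ).contDiff

/-- Partial derivatives of radial functions. -/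
lemma pd_radial {h : ℝ → ℝ} {x : Euc n} (hx : x ≠ 0) (hh : DifferentiableAt ℝ h ‖x‖) (j : Fin n) :
    pd j (fun y => h ‖y‖) x = deriv h ‖x‖ * (x j / ‖x‖) := by
  have h1 : HasFDerivAt (fun y : Euc n => ‖y‖) (‖x‖⁻¹ • innerSL ℝ x) x := by
    have h2 := (hasStrictFDerivAt_norm_sq x).hasFDerivAt.sqrt (by positivity)
    simp only [Real.sqrt_sq (norm_nonneg _)] at h2
    have h4 : (1 / (2 * ‖x‖)) • 2 • innerSL ℝ x = ‖x‖⁻¹ • innerSL ℝ x := by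
      rw [two_smul, ← two_smul ℝ, smul_smul]
      congr 1
      field_simp
    exact h4 ▸ h2
  have h3 : HasFDerivAt (fun y : Euc n => h ‖y‖) (deriv h ‖x‖ • (‖x‖⁻¹ • innerSL ℝ x)) x :=
    hh.hasDerivAt.comp_hasFDerivAt x h1
  rw [pd, h3.fderiv]
  have : inner ℝ x (stdVec j) = x j := by simp [stdVec, EuclideanSpace.inner_single_right]
  simp only [smul_apply, innerSL_apply_apply, this, smul_eq_mul]
  ring

/-- A radial function that vanishes near the ball of radius `r` is as smooth as its profile, although
the norm is not smooth at the origin. -/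
lemma radial_cutoff {h : ℝ → ℝ} {r : ℝ} (hr : 0 ≤ r) {k : ℕ∞} (hk : 1 ≤ k)
    (hh : ContDiff ℝ k h) (h0 : ∀ s ≤ r, h =ᶠ[𝓝 s] fun _ => 0) :
    ContDiff ℝ k (fun x : Euc n => h ‖x‖) ∧
      ∀ (x : Euc n) (j : Fin n), pd j (fun y => h ‖y‖) x = deriv h ‖x‖ * (x j / ‖x‖) := by
  have hz : ∀ x : Euc n, ‖x‖ ≤ r → (fun y : Euc n => h ‖y‖) =ᶠ[𝓝 x] fun _ => 0 := fun x hx =>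
    continuous_norm.continuousAt.eventually (h0 _ hx)
  have hne : ∀ x : Euc n, ¬ ‖x‖ ≤ r → x ≠ 0 := fun x hx =>
    norm_pos_iff.1 (hr.trans_lt (not_le.1 hx))
  constructor
  · refine contDiff_iff_contDiffAt.2 fun x => ?_
    by_cases hx : ‖x‖ ≤ r
    · exact contDiffAt_const.congr_of_eventuallyEq (hz x hx)
    · exact hh.contDiffAt.comp x (contDiffAt_norm ℝ (hne x hx))
  · intro x j
    by_cases hx : ‖x‖ ≤ r
    · rw [pd_congr (hz x hx), pd_const, (h0 _ hx).deriv_eq]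
      simp
    · exact pd_radial (hne x hx) (hh.differentiable (by
        intro h1; have : k = 0 := by exact_mod_cast h1
        simp [this] at hk) _) j

/-- The divergence of a skew matrix has no flux through spheres. -/
lemma sphereIntegral_div_skew (hn : 0 < n) {Z : Euc n → SqMat n} {r : ℝ} (hr : 0 < r)
    (hZ : ∀ x, r < ‖x‖ → CMatAt 1 Z x) (hs : ∀ x, r < ‖x‖ → ∀ j k, Z x j k = -Z x k j)
    {t : ℝ} (ht : r < t) :
    sphereIntegral (fun x => ∑ a, x a / ‖x‖ * ∑ j, pd j (fun y => Z y j a) x) t = 0 := by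
  set f : Euc n → ℝ := fun x => ∑ a, x a / ‖x‖ * ∑ j, pd j (fun y => Z y j a) x with hf
  have hne : ∀ x : Euc n, r < ‖x‖ → x ≠ 0 := fun x hx => norm_pos_iff.1 (hr.trans hx)
  have hfc : ∀ x, r < ‖x‖ → ContinuousAt f x := by
    intro x hx
    refine tendsto_finsetSum _ fun a _ => Tendsto.mul ?_ (tendsto_finsetSum _ fun j _ =>
      continuousAt_pd (hZ x hx j a) j)
    exact ((contDiff_coord (r := 0) a).continuous.continuousAt).div continuous_norm.continuousAt
      (norm_ne_zero_iff.2 (hne x hx))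
  have hFc := continuousOn_sphereIntegral hr.le hfc
  have key : ∀ ψ : ℝ → ℝ, ContDiff ℝ ∞ ψ → HasCompactSupport ψ → tsupport ψ ⊆ Ioi r →
      ∫ s, ψ s • sphereIntegral f s = 0 := by
    intro ψ hψ hψc hψs
    have hψ0 : ∀ s ≤ r, ψ =ᶠ[𝓝 s] fun _ => 0 := fun s hs =>
      notMem_tsupport_iff_eventuallyEq.1 fun h => absurd (hψs h) (by simpa using hs)
    set h : ℝ → ℝ := fun s => ψ s / s with hh
    have hh0 : ∀ s ≤ r, h =ᶠ[𝓝 s] fun _ => 0 := fun s hs => by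
      filter_upwards [hψ0 s hs] with y hy
      simp [hh, hy]
    have hhd : ContDiff ℝ 1 h := by
      refine contDiff_iff_contDiffAt.2 fun s => ?_
      rcases le_or_gt s r with hs | hs
      · exact contDiffAt_const.congr_of_eventuallyEq (hh0 s hs)
      · exact (hψ.contDiffAt.of_le (by simp)).div contDiffAt_id (hr.trans hs).ne'
    obtain ⟨hηd, hηpd⟩ := radial_cutoff (n := n) hr.le (k := 1) le_rfl hhd hh0
    set η : Euc n → ℝ := fun x => h ‖x‖ with hη
    have hts0 : tsupport (fun x : Euc n => ψ ‖x‖) ⊆ {x | ‖x‖ ∈ tsupport ψ} :=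
      closure_minimal (fun x hx => subset_tsupport _ hx)
        ((isClosed_tsupport ψ).preimage continuous_norm)
    have hψcomp : HasCompactSupport fun x : Euc n => ψ ‖x‖ := by
      obtain ⟨R, hR⟩ := hψc.isBounded.subset_closedBall 0
      refine HasCompactSupport.of_support_subset_isCompact (isCompact_closedBall (0 : Euc n) R) ?_
      intro x hx
      have := hR (subset_tsupport _ hx)
      simpa using this
    have hts : tsupport η ⊆ {x | ‖x‖ ∈ tsupport ψ} := by
      refine (closure_mono fun x hx => ?_).trans hts0
      refine fun h0 => hx ?_
      simp only at h0
      simp [hη, hh, h0]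
    have hηU : tsupport η ⊆ {x : Euc n | r < ‖x‖} := fun x hx => hψs (hts hx)
    have hηc : HasCompactSupport η := by
      refine hψcomp.mono fun x hx h0 => hx ?_
      simp only at h0
      simp [hη, hh, h0]
    have e1 : ∫ s, ψ s • sphereIntegral f s = ∫ x, ψ ‖x‖ * f x := by
      have hi : Integrable fun x => ψ ‖x‖ * f x :=
        integrable_mul_of_tsupport (U := {x : Euc n | r < ‖x‖})
          (hψ.continuous.comp continuous_norm) hψcomp (hts0.trans fun x hx => hψs hx) hfc
      rw [(integrable_polar hn hi).2, ← integral_indicator measurableSet_Ioi]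
      refine integral_congr_ae (Eventually.of_forall fun s => ?_)
      by_cases hs : 0 < s
      · simp only [indicator_of_mem (mem_Ioi.2 hs), smul_eq_mul]
        rw [sphereIntegral_radial_mul _ _ hs.le]
      · simp only [indicator_of_notMem (show s ∉ Ioi (0 : ℝ) from hs), smul_eq_mul]
        rw [(hψ0 s (by linarith)).eq_of_nhds, zero_mul]
    have e2 : ∀ x, ψ ‖x‖ * f x = ∑ a, ∑ j, η x * x a * pd j (fun y => Z y j a) x := by
      intro x
      simp only [hf, Finset.mul_sum, hη, hh]
      exact Finset.sum_congr rfl fun a _ => Finset.sum_congr rfl fun j _ => by ring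
    have hχ : ∀ a, ContDiff ℝ 1 fun x => η x * x a := fun a => hηd.mul (contDiff_coord a)
    have hχc : ∀ a : Fin n, HasCompactSupport fun x => η x * x a := fun a => hηc.mul_right
    have hχs : ∀ a : Fin n, tsupport (fun x => η x * x a) ⊆ {x : Euc n | r < ‖x‖} := fun a =>
      (tsupport_mul_subset_left).trans hηU
    have hpd : ∀ a j x, pd j (fun y => η y * y a) x
        = deriv h ‖x‖ / ‖x‖ * (x j * x a) + η x * if a = j then 1 else 0 := by
      intro a j x
      rw [pd_mul (hηd.differentiable (by simp) x) ((contDiff_coord (r := 1) a).differentiable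
        (by simp) x), pd_coord, hηpd]
      ring
    have hI1 : ∀ a j, Integrable fun x => η x * x a * pd j (fun y => Z y j a) x := fun a j =>
      integrable_mul_of_tsupport (hχ a).continuous (hχc a) (hχs a) fun x hx =>
        continuousAt_pd (hZ x hx j a) j
    have hI2 : ∀ a j, Integrable fun x => pd j (fun y => η y * y a) x * Z x j a := fun a j =>
      integrable_mul_of_tsupport (((hχ a).continuous_fderiv (by simp)).clm_apply continuous_const)
        ((hχc a).of_isClosed_subset (isClosed_tsupport _) (tsupport_pd_subset _ j))
        ((tsupport_pd_subset _ j).trans (hχs a)) fun x hx => (hZ x hx j a).continuousAt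
    rw [e1]
    simp only [e2]
    rw [integral_finsetSum _ fun a _ => integrable_finsetSum _ fun j _ => hI1 a j]
    simp_rw [integral_finsetSum _ fun j _ => hI1 _ j,
      fun a j => integral_mul_pd (hχ a) (hχc a) (hχs a) (fun x hx => hZ x hx j a) j,
      Finset.sum_neg_distrib]
    simp_rw [← integral_finsetSum _ fun j _ => hI2 _ j]
    rw [← integral_finsetSum _ fun a _ => integrable_finsetSum _ fun j _ => hI2 a j, neg_eq_zero]
    refine integral_eq_zero_of_ae (Eventually.of_forall fun x => ?_)
    simp only [hpd, Pi.zero_apply]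
    by_cases hx : r < ‖x‖
    · -- the coefficients are symmetric in the two indices
      have h1 : ∀ b c : Fin n → Fin n → ℝ, (∀ a j, b a j = b j a) → (∀ a j, c a j = -c j a) →
          ∑ a, ∑ j, b a j * c j a = 0 := by
        intro b c hb hc
        have h2 : ∑ a, ∑ j, b a j * c j a = -∑ a, ∑ j, b a j * c j a := by
          conv_lhs => rw [Finset.sum_comm]
          rw [← Finset.sum_neg_distrib]
          refine Finset.sum_congr rfl fun a _ => ?_
          rw [← Finset.sum_neg_distrib]
          refine Finset.sum_congr rfl fun j _ => ?_
          rw [hb, hc]; ring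
        linarith
      refine h1 (fun a j => _) (fun j a => Z x j a) (fun a j => ?_) fun a j => hs x hx a j
      simp only [eq_comm (a := a)]
      ring
    · have h2 : η x = 0 := (hh0 _ (not_lt.1 hx)).eq_of_nhds
      have h3 : deriv h ‖x‖ = 0 := by rw [(hh0 _ (not_lt.1 hx)).deriv_eq]; simp
      simp [h2, h3]
  have h1 := isOpen_Ioi.ae_eq_zero_of_integral_contDiff_smul_eq_zero
    (hFc.locallyIntegrableOn measurableSet_Ioi) key
  have h2 := Measure.eqOn_open_of_ae_eq (μ := (volume : Measure ℝ)) (U := Ioi r)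
    (f := sphereIntegral f) (g := fun _ => 0)
    ((ae_restrict_iff' measurableSet_Ioi).2 h1) isOpen_Ioi hFc continuousOn_const
  exact h2 ht

end Integration

/-! ### The divergence theorem on spheres -/

section Divergence

variable {n : ℕ}

/-- The flux of the vector field `V` through the sphere of radius `t`. -/
def sphereFlux (V : Fin n → Euc n → ℝ) (t : ℝ) : ℝ :=
  sphereIntegral (fun x => ∑ a, x a / ‖x‖ * V a x) t

lemma sphereFlux_congr {V W : Fin n → Euc n → ℝ} {t : ℝ} (ht : 0 ≤ t)
    (h : ∀ a x, ‖x‖ = t → V a x = W a x) : sphereFlux V t = sphereFlux W t :=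
  sphereIntegral_congr ht fun x hx => Finset.sum_congr rfl fun a _ => by rw [h a x hx]

lemma continuousAt_normal_sum {V : Fin n → Euc n → ℝ} {x : Euc n} (hx : x ≠ 0)
    (hV : ∀ a, ContinuousAt (V a) x) : ContinuousAt (fun x => ∑ a, x a / ‖x‖ * V a x) x :=
  tendsto_finsetSum _ fun a _ => Tendsto.mul
    (((contDiff_coord (r := 0) a).continuous.continuousAt).div continuous_norm.continuousAt
      (norm_ne_zero_iff.2 hx)) (hV a)

lemma sphereFlux_add {V W : Fin n → Euc n → ℝ} {r t : ℝ} (hr : 0 ≤ r) (hrt : r < t)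
    (hV : ∀ a x, r < ‖x‖ → ContinuousAt (V a) x) (hW : ∀ a x, r < ‖x‖ → ContinuousAt (W a) x) :
    sphereFlux (fun a x => V a x + W a x) t = sphereFlux V t + sphereFlux W t := by
  unfold sphereFlux
  rw [← sphereIntegral_add hr hrt
    (fun x hx => continuousAt_normal_sum (norm_pos_iff.1 (hr.trans_lt hx)) fun a => hV a x hx)
    (fun x hx => continuousAt_normal_sum (norm_pos_iff.1 (hr.trans_lt hx)) fun a => hW a x hx)]
  simp only [mul_add, Finset.sum_add_distrib]

lemma sphereFlux_const_mul (c : ℝ) (V : Fin n → Euc n → ℝ) (t : ℝ) :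
    sphereFlux (fun a x => c * V a x) t = c * sphereFlux V t := by
  unfold sphereFlux
  rw [← sphereIntegral_const_mul]
  congr 1
  funext x
  rw [Finset.mul_sum]
  exact Finset.sum_congr rfl fun a _ => by ring

/-- Differentiation under the integral sign of a flux, along rays. -/
lemma hasDerivAt_sphereFlux_aux (hn : 0 < n) {V : Fin n → Euc n → ℝ} {r : ℝ} (hr : 0 < r)
    (hV : ∀ a x, r < ‖x‖ → ContDiffAt ℝ 1 (V a) x) {t : ℝ} (ht : r < t) :
    HasDerivAt (sphereFlux V) (sphereIntegral (fun x => ((n : ℝ) - 1) / ‖x‖ *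
      (∑ a, x a / ‖x‖ * V a x) + ∑ a, ∑ j, x a / ‖x‖ * (x j / ‖x‖) * pd j (V a) x) t) t := by
  set S := Metric.sphere (0 : Euc n) 1
  set μS := (volume : Measure (Euc n)).toSphere
  set g : ℝ → S → ℝ := fun s u => s ^ (n - 1) * ∑ a, (u : Euc n) a * V a (s • (u : Euc n)) with hg
  set g' : ℝ → S → ℝ := fun s u =>
    ((n - 1 : ℕ) : ℝ) * s ^ (n - 1 - 1) * ∑ a, (u : Euc n) a * V a (s • (u : Euc n)) +
      s ^ (n - 1) * ∑ a, (u : Euc n) a * ∑ j, (u : Euc n) j * pd j (V a) (s • (u : Euc n)) with hg'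
  have hnm : ∀ s, r < s → ∀ u : S, ‖s • (u : Euc n)‖ = s := fun s hs u =>
    norm_smul_sphere (hr.trans hs).le u
  have hder : ∀ (u : S) s, r < s → HasDerivAt (fun s => g s u) (g' s u) s := by
    intro u s hs
    refine (hasDerivAt_pow (n - 1) s).mul (HasDerivAt.fun_sum fun a _ => HasDerivAt.const_mul _ ?_)
    have h1 : HasFDerivAt (V a) (fderiv ℝ (V a) (s • (u : Euc n))) (s • (u : Euc n)) :=
      ((hV a _ (by rw [hnm s hs]; exact hs)).differentiableAt (by simp)).hasFDerivAt
    have h2 : HasDerivAt (fun s : ℝ => s • (u : Euc n)) (u : Euc n) s := by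
      simpa using (hasDerivAt_id s).smul_const (u : Euc n)
    have h3 := h1.comp_hasDerivAt s h2
    rwa [fderiv_apply_eq_sum_pd] at h3
  have hcoord : ∀ a, Continuous fun p : ℝ × S => (p.2 : Euc n) a := fun a =>
    (contDiff_coord (r := 0) a).continuous.comp (continuous_subtype_val.comp continuous_snd)
  have hcomp : ∀ f : Euc n → ℝ, (∀ x, r < ‖x‖ → ContinuousAt f x) → ContinuousOn
      (fun p : ℝ × S => f (p.1 • (p.2 : Euc n))) (Ioi r ×ˢ univ) := by
    intro f hf p hp
    refine ContinuousAt.continuousWithinAt ?_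
    refine ContinuousAt.comp (f := fun p : ℝ × S => p.1 • (p.2 : Euc n)) (hf _ ?_) (by fun_prop)
    rw [hnm _ hp.1]; exact hp.1
  have hg'c : ContinuousOn (Function.uncurry g') (Ioi r ×ˢ univ) := by
    refine ContinuousOn.add (ContinuousOn.mul ?_ ?_) (ContinuousOn.mul ?_ ?_)
    · exact (by fun_prop : Continuous fun p : ℝ × S =>
        ((n - 1 : ℕ) : ℝ) * p.1 ^ (n - 1 - 1)).continuousOn
    · exact continuousOn_finsetSum _ fun a _ => (hcoord a).continuousOn.mul
        (hcomp _ fun x hx => (hV a x hx).continuousAt)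
    · exact (by fun_prop : Continuous fun p : ℝ × S => p.1 ^ (n - 1)).continuousOn
    · exact continuousOn_finsetSum _ fun a _ => (hcoord a).continuousOn.mul
        (continuousOn_finsetSum _ fun j _ => (hcoord j).continuousOn.mul
        (hcomp _ fun x hx => continuousAt_pd (hV a x hx) j))
  have hslice : ∀ s, r < s → Continuous (g' s) := fun s hs => by
    have := hg'c.comp_continuous (f := fun u : S => (s, u)) (by fun_prop) fun u => ⟨hs, mem_univ _⟩
    exact this
  have hgslice : ∀ s, r < s → Continuous (g s) := fun s hs => by
    refine continuous_const.mul (continuous_finsetSum _ fun a _ => Continuous.mul ?_ ?_)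
    · exact (contDiff_coord (r := 0) a).continuous.comp continuous_subtype_val
    · exact continuous_on_sphere hr.le hs fun x hx => (hV a x hx).continuousAt
  obtain ⟨δ, hδ, hball⟩ : ∃ δ > 0, Icc (t - δ) (t + δ) ⊆ Ioi r :=
    ⟨(t - r) / 2, by linarith, fun s hs => by have := hs.1; simp only [mem_Ioi]; linarith⟩
  obtain ⟨C, hC⟩ := (isCompact_Icc.prod isCompact_univ).exists_bound_of_continuousOn
    (hg'c.mono (prod_mono hball (subset_univ (univ : Set S))))
  have hIcc : ∀ s ∈ Metric.ball t δ, s ∈ Icc (t - δ) (t + δ) := fun s hs => by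
    rw [Real.ball_eq_Ioo] at hs
    exact ⟨hs.1.le, hs.2.le⟩
  have hmain := (hasDerivAt_integral_of_dominated_loc_of_deriv_le (μ := μS) (F := g) (F' := g')
    (x₀ := t) (bound := fun _ => C) (Metric.ball_mem_nhds t hδ) ?_ ?_ ?_ ?_ ?_ ?_).2
  rotate_left
  · filter_upwards [Ioi_mem_nhds ht] with s hs
    exact (hgslice s hs).aestronglyMeasurable
  · exact (hgslice t ht).integrable_of_hasCompactSupport (HasCompactSupport.of_compactSpace _)
  · exact (hslice t ht).aestronglyMeasurable
  · exact Eventually.of_forall fun u s hs => hC (s, u) ⟨hIcc s hs, mem_univ _⟩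
  · exact integrable_const _
  · exact Eventually.of_forall fun u s hs => hder u s (hball (hIcc s hs))
  have e1 : ∀ s, r < s → sphereFlux V s = ∫ u, g s u ∂μS := by
    intro s hs
    have hs0 := (hr.trans hs).ne'
    unfold sphereFlux sphereIntegral
    rw [← integral_const_mul]
    refine integral_congr_ae (Eventually.of_forall fun u => ?_)
    simp only [hg, hnm s hs]
    congr 1
    refine Finset.sum_congr rfl fun a _ => ?_
    simp only [PiLp.smul_apply, smul_eq_mul]
    field_simp
  have e2 : ∫ u, g' t u ∂μS = sphereIntegral (fun x => ((n : ℝ) - 1) / ‖x‖ *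
      (∑ a, x a / ‖x‖ * V a x) + ∑ a, ∑ j, x a / ‖x‖ * (x j / ‖x‖) * pd j (V a) x) t := by
    have ht0 := (hr.trans ht).ne'
    unfold sphereIntegral
    rw [← integral_const_mul]
    refine integral_congr_ae (Eventually.of_forall fun u => ?_)
    have hdiv : ∀ a, (t • (u : Euc n)) a / t = (u : Euc n) a := fun a => by
      simp only [PiLp.smul_apply, smul_eq_mul]
      field_simp
    simp only [hg', hnm t ht, hdiv]
    rw [mul_add]
    congr 1
    · rw [← mul_assoc]
      congr 1
      obtain ⟨k, rfl⟩ : ∃ k, n = k + 1 := ⟨n - 1, by omega⟩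
      rcases k with _ | k
      · simp
      · simp only [Nat.add_sub_cancel]
        push_cast
        field_simp
        ring
    · congr 1
      refine Finset.sum_congr rfl fun a _ => ?_
      rw [Finset.mul_sum]
      exact Finset.sum_congr rfl fun j _ => by ring
  rw [← e2]
  refine hmain.congr_of_eventuallyEq ?_
  filter_upwards [Ioi_mem_nhds ht] with s hs using e1 s hs

/-- The derivative of a flux is the integral of the divergence. The tangential part of the
divergence is, up to curvature terms, the divergence of the skew matrix `V_j x_a - V_a x_j`. -/
lemma hasDerivAt_sphereFlux (hn : 0 < n) {V : Fin n → Euc n → ℝ} {r : ℝ} (hr : 0 < r)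
    (hV : ∀ a x, r < ‖x‖ → ContDiffAt ℝ 1 (V a) x) {t : ℝ} (ht : r < t) :
    HasDerivAt (sphereFlux V) (sphereIntegral (fun x => ∑ j, pd j (V j) x) t) t := by
  convert hasDerivAt_sphereFlux_aux hn hr hV ht using 1
  have hne : ∀ x : Euc n, r < ‖x‖ → x ≠ 0 := fun x hx => norm_pos_iff.1 (hr.trans hx)
  set Z : Euc n → SqMat n := fun x => Matrix.of fun j a => V j x * x a - V a x * x j with hZ
  set E : Euc n → ℝ := fun x => ((n : ℝ) - 1) / ‖x‖ *
      (∑ a, x a / ‖x‖ * V a x) + ∑ a, ∑ j, x a / ‖x‖ * (x j / ‖x‖) * pd j (V a) x with hE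
  have h0 := sphereIntegral_div_skew hn (Z := Z) hr
    (fun x hx j a => ((hV j x hx).mul (contDiff_coord a).contDiffAt).sub
      ((hV a x hx).mul (contDiff_coord j).contDiffAt))
    (fun x hx j k => by simp only [hZ, Matrix.of_apply]; ring) ht
  have hEc : ∀ x, r < ‖x‖ → ContinuousAt E x := by
    intro x hx
    have hx0 := norm_ne_zero_iff.2 (hne x hx)
    refine ContinuousAt.add (ContinuousAt.mul (continuousAt_const.div
      continuous_norm.continuousAt hx0) (continuousAt_normal_sum (hne x hx) fun a =>
      (hV a x hx).continuousAt)) ?_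
    have hd : ∀ a : Fin n, ContinuousAt (fun x : Euc n => x a / ‖x‖) x := fun a =>
      ((contDiff_coord (r := 0) a).continuous.continuousAt).div continuous_norm.continuousAt hx0
    exact tendsto_finsetSum _ fun a _ => tendsto_finsetSum _ fun j _ =>
      ((hd a).mul (hd j)).mul (continuousAt_pd (hV a x hx) j)
  have hDc : ∀ x, r < ‖x‖ → ContinuousAt (fun x => ∑ j, pd j (V j) x) x := fun x hx =>
    tendsto_finsetSum _ fun j _ => continuousAt_pd (hV j x hx) j
  have hp : sphereIntegral (fun x => ∑ a, x a / ‖x‖ * ∑ j, pd j (fun y => Z y j a) x) t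
      = sphereIntegral (fun x => t * (∑ j, pd j (V j) x) + (-t) * E x) t := by
    refine sphereIntegral_congr (hr.trans ht).le fun x hx => ?_
    have hxr : r < ‖x‖ := by rw [hx]; exact ht
    have hx0 : ‖x‖ ≠ 0 := norm_ne_zero_iff.2 (hne x hxr)
    have hdV : ∀ a, DifferentiableAt ℝ (V a) x := fun a => (hV a x hxr).differentiableAt (by simp)
    have hdx : ∀ a, DifferentiableAt ℝ (fun y : Euc n => y a) x := fun a =>
      (contDiff_coord (r := 1) a).differentiable (by simp) x
    have hZpd : ∀ j a, pd j (fun y => Z y j a) x = pd j (V j) x * x a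
        + V j x * (if a = j then 1 else 0) - (pd j (V a) x * x j + V a x) := by
      intro j a
      simp only [hZ, Matrix.of_apply]
      rw [pd_sub (f := fun y => V j y * y a) (h := fun y => V a y * y j) ((hdV j).mul (hdx a))
        ((hdV a).mul (hdx j)), pd_mul (hdV j) (hdx a),
        pd_mul (hdV a) (hdx j), pd_coord, pd_coord]
      simp
    have hsq : ∑ a, x a / ‖x‖ * x a = ‖x‖ := by
      have : ∑ a, x a * x a = ‖x‖ ^ 2 := by
        rw [EuclideanSpace.norm_sq_eq]
        exact Finset.sum_congr rfl fun a _ => by rw [Real.norm_eq_abs, sq_abs, sq]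
      have h2 : ∑ a, x a / ‖x‖ * x a = (∑ a, x a * x a) / ‖x‖ := by
        rw [Finset.sum_div]
        exact Finset.sum_congr rfl fun a _ => by ring
      rw [h2, this]
      field_simp
    have hsum : ∀ a, ∑ j, pd j (fun y => Z y j a) x
        = (∑ j, pd j (V j) x) * x a - ∑ j, pd j (V a) x * x j - ((n : ℝ) - 1) * V a x := by
      intro a
      simp only [hZpd, Finset.sum_sub_distrib, Finset.sum_add_distrib, mul_ite, mul_one, mul_zero,
        Finset.sum_ite_eq, Finset.mem_univ, if_true, Finset.sum_const, Finset.card_univ,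
        Fintype.card_fin, nsmul_eq_mul, ← Finset.sum_mul]
      ring
    simp only [hsum, hE, ← hx]
    have h1 : ∑ a, x a / ‖x‖ * ((∑ j, pd j (V j) x) * x a - ∑ j, pd j (V a) x * x j
        - ((n : ℝ) - 1) * V a x) = (∑ j, pd j (V j) x) * (∑ a, x a / ‖x‖ * x a)
        - ∑ a, ∑ j, x a / ‖x‖ * x j * pd j (V a) x
        - ((n : ℝ) - 1) * ∑ a, x a / ‖x‖ * V a x := by
      simp only [mul_sub, Finset.sum_sub_distrib, Finset.mul_sum]
      congr 1
      · congr 1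
        · exact Finset.sum_congr rfl fun a _ => by
            rw [Finset.sum_mul, Finset.sum_mul, Finset.mul_sum]
            exact Finset.sum_congr rfl fun j _ => by ring
        · exact Finset.sum_congr rfl fun a _ => Finset.sum_congr rfl fun j _ => by ring
      · exact Finset.sum_congr rfl fun a _ => by ring
    have h2 : ∑ a, ∑ j, x a / ‖x‖ * x j * pd j (V a) x
        = ‖x‖ * ∑ a, ∑ j, x a / ‖x‖ * (x j / ‖x‖) * pd j (V a) x := by
      simp only [Finset.mul_sum]
      refine Finset.sum_congr rfl fun a _ => Finset.sum_congr rfl fun j _ => ?_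
      field_simp
    rw [h1, hsq, h2]
    field_simp
    ring
  rw [hp, sphereIntegral_add (f := fun x => t * ∑ j, pd j (V j) x) (h := fun x => -t * E x)
    hr.le ht (fun x hx => continuousAt_const.mul (hDc x hx))
    (fun x hx => continuousAt_const.mul (hEc x hx)), sphereIntegral_const_mul,
    sphereIntegral_const_mul] at h0
  have ht0 := (hr.trans ht).ne'
  have : t * (sphereIntegral (fun x => ∑ j, pd j (V j) x) t - sphereIntegral E t) = 0 := by
    linarith
  rcases mul_eq_zero.1 this with h | h
  · exact absurd h ht0
  · linarith

/-- The fluxes of a vector field with integrable divergence have a limit at infinity. -/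
lemma exists_tendsto_sphereFlux (hn : 0 < n) {V : Fin n → Euc n → ℝ} {r : ℝ} (hr : 0 < r)
    (hV : ∀ a x, r < ‖x‖ → ContDiffAt ℝ 1 (V a) x)
    (hi : IntegrableOn (fun x => ∑ j, pd j (V j) x) {x | r < ‖x‖}) :
    ∃ l, Tendsto (sphereFlux V) atTop (𝓝 l) := by
  have hm : MeasurableSet {x : Euc n | r < ‖x‖} := measurableSet_lt measurable_const measurable_norm
  set f : Euc n → ℝ := {x : Euc n | r < ‖x‖}.indicator fun x => ∑ j, pd j (V j) x with hf
  have hfi : Integrable f := (integrable_indicator_iff hm).2 hi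
  have h1 := (integrable_polar hn hfi).1
  refine ⟨_, tendsto_limUnder_of_hasDerivAt_of_integrableOn_Ioi (a := r)
    (f' := sphereIntegral f) (fun t ht => ?_) (h1.mono_set (Ioi_subset_Ioi hr.le))⟩
  have : sphereIntegral f t = sphereIntegral (fun x => ∑ j, pd j (V j) x) t := by
    refine sphereIntegral_congr (hr.trans ht).le fun x hx => ?_
    rw [hf, indicator_of_mem]
    simp only [mem_ofPred_eq, hx]
    exact ht
  rw [this]
  exact hasDerivAt_sphereFlux hn hr hV ht

/-- Integrals over large spheres of functions that decay faster than `|x|^{1-n}` tend to zero. -/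
lemma tendsto_sphereIntegral_zero (hn : 0 < n) {f : Euc n → ℝ} {p : ℝ} (hp : (n : ℝ) - 1 < p)
    (hf : f =O[Bornology.cobounded (Euc n)] fun x => ‖x‖ ^ (-p)) :
    Tendsto (sphereIntegral f) atTop (𝓝 0) := by
  obtain ⟨C, hC⟩ := hf.bound
  rw [← comap_norm_atTop, eventually_comap] at hC
  set μS := (volume : Measure (Euc n)).toSphere
  have hlim : Tendsto (fun t : ℝ => (C * μS.real univ) * t ^ (-(p - ((n : ℝ) - 1)))) atTop (𝓝 0) := by
    simpa using (tendsto_rpow_neg_atTop (sub_pos.2 hp)).const_mul (C * μS.real univ)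
  refine squeeze_zero_norm' ?_ hlim
  filter_upwards [hC, eventually_gt_atTop 0] with t ht ht0
  unfold sphereIntegral
  rw [norm_mul]
  have h1 : ‖∫ u : Metric.sphere (0 : Euc n) 1, f (t • (u : Euc n)) ∂μS‖
      ≤ (C * t ^ (-p)) * μS.real univ := by
    refine norm_integral_le_of_norm_le_const (Eventually.of_forall fun u => ?_)
    have h2 := ht (t • (u : Euc n)) (norm_smul_sphere ht0.le u)
    rwa [norm_smul_sphere ht0.le, Real.norm_of_nonneg (Real.rpow_nonneg ht0.le _)] at h2
  have h3 : ‖t ^ (n - 1)‖ = t ^ ((n : ℝ) - 1) := by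
    rw [Real.norm_of_nonneg (pow_nonneg ht0.le _), ← Real.rpow_natCast, Nat.cast_sub hn]
    simp
  rw [h3]
  calc t ^ ((n : ℝ) - 1) * ‖∫ u : Metric.sphere (0 : Euc n) 1, f (t • (u : Euc n)) ∂μS‖
      ≤ t ^ ((n : ℝ) - 1) * ((C * t ^ (-p)) * μS.real univ) :=
        mul_le_mul_of_nonneg_left h1 (Real.rpow_nonneg ht0.le _)
    _ = (C * μS.real univ) * (t ^ ((n : ℝ) - 1) * t ^ (-p)) := by ring
    _ = _ := by
      rw [← Real.rpow_add ht0]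
      congr 2
      ring

end Divergence

/-! ### Decay at infinity -/

section Decay

variable {n : ℕ} {ι κ l : Type*}

/-- `f = O(|x|^{-p})` as `|x| → ∞`. -/
def Decay (p : ℝ) (f : Euc n → ℝ) : Prop := f =O[Bornology.cobounded (Euc n)] fun x => ‖x‖ ^ (-p)

/-- The entries of `F` are `O(|x|^{-p})` as `|x| → ∞`. -/
def DecayM (p : ℝ) (F : Euc n → Matrix ι κ ℝ) : Prop := ∀ i j, Decay p fun x => F x i j

lemma eventually_lt_norm (r : ℝ) : ∀ᶠ x in Bornology.cobounded (Euc n), r < ‖x‖ :=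
  tendsto_norm_cobounded_atTop.eventually_gt_atTop r

namespace Decay

variable {p q : ℝ} {f h : Euc n → ℝ}

lemma congr (hf : Decay p f) (e : ∀ᶠ x in Bornology.cobounded (Euc n), f x = h x) : Decay p h :=
  Asymptotics.IsBigO.congr' hf e (EventuallyEq.refl _ _)

lemma add (hf : Decay p f) (hh : Decay p h) : Decay p fun x => f x + h x :=
  Asymptotics.IsBigO.add hf hh

lemma sub (hf : Decay p f) (hh : Decay p h) : Decay p fun x => f x - h x :=
  Asymptotics.IsBigO.sub hf hh

lemma neg (hf : Decay p f) : Decay p fun x => -f x := Asymptotics.IsBigO.neg_left hf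

lemma const_mul (hf : Decay p f) (c : ℝ) : Decay p fun x => c * f x :=
  Asymptotics.IsBigO.const_mul_left hf c

lemma sum {α : Type*} {s : Finset α} {f : α → Euc n → ℝ} (hf : ∀ a ∈ s, Decay p (f a)) :
    Decay p fun x => ∑ a ∈ s, f a x := by
  have := Asymptotics.IsBigO.sum hf
  simpa only [Decay, Finset.sum_fn] using this

lemma mul (hf : Decay p f) (hh : Decay q h) : Decay (p + q) fun x => f x * h x := by
  refine (Asymptotics.IsBigO.mul hf hh).congr' (EventuallyEq.refl _ _) ?_
  filter_upwards [eventually_lt_norm 0] with x hx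
  rw [← Real.rpow_add hx]
  congr 1
  ring

lemma of_le (hf : Decay p f) (hqp : q ≤ p) : Decay q f := by
  refine Asymptotics.IsBigO.trans hf (Asymptotics.IsBigO.of_bound 1 ?_)
  filter_upwards [eventually_lt_norm 1] with x hx
  have h0 : 0 ≤ ‖x‖ := by linarith
  rw [Real.norm_of_nonneg (Real.rpow_nonneg h0 _), Real.norm_of_nonneg (Real.rpow_nonneg h0 _),
    one_mul]
  exact Real.rpow_le_rpow_of_exponent_le hx.le (by linarith)

lemma of_bounded (C : ℝ) (hf : ∀ᶠ x in Bornology.cobounded (Euc n), |f x| ≤ C) : Decay 0 f := by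
  refine Asymptotics.IsBigO.of_bound C ?_
  filter_upwards [hf] with x hx
  simpa using hx

lemma zero (c : ℝ) : Decay 0 fun _ : Euc n => c :=
  of_bounded |c| (Eventually.of_forall fun _ => le_rfl)

lemma tendsto_zero (hf : Decay p f) (hp : 0 < p) : Tendsto f (Bornology.cobounded (Euc n)) (𝓝 0) :=
  Asymptotics.IsBigO.trans_tendsto hf
    ((tendsto_rpow_neg_atTop hp).comp tendsto_norm_cobounded_atTop)

lemma tendsto {c : ℝ} (hf : Decay p fun x => f x - c) (hp : 0 < p) :
    Tendsto f (Bornology.cobounded (Euc n)) (𝓝 c) := by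
  simpa using (hf.tendsto_zero hp).add_const c

end Decay

namespace DecayM

variable {p q : ℝ} {F H : Euc n → Matrix ι κ ℝ}

lemma congr (hF : DecayM p F) (e : ∀ᶠ x in Bornology.cobounded (Euc n), F x = H x) : DecayM p H :=
  fun i j => (hF i j).congr (e.mono fun x hx => by simp only [hx])

lemma add (hF : DecayM p F) (hH : DecayM p H) : DecayM p fun x => F x + H x :=
  fun i j => (hF i j).add (hH i j)

lemma sub (hF : DecayM p F) (hH : DecayM p H) : DecayM p fun x => F x - H x :=
  fun i j => (hF i j).sub (hH i j)

lemma neg (hF : DecayM p F) : DecayM p fun x => -F x := fun i j => (hF i j).neg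

lemma transpose (hF : DecayM p F) : DecayM p fun x => (F x).transpose := fun i j => hF j i

lemma of_le (hF : DecayM p F) (hqp : q ≤ p) : DecayM q F := fun i j => (hF i j).of_le hqp

lemma const (A : Matrix ι κ ℝ) : DecayM 0 fun _ : Euc n => A := fun i j => Decay.zero (A i j)

lemma mul [Fintype κ] {H : Euc n → Matrix κ l ℝ} (hF : DecayM p F) (hH : DecayM q H) :
    DecayM (p + q) fun x => F x * H x := fun i j => by
  simp only [Matrix.mul_apply]
  exact Decay.sum fun a _ => (hF i a).mul (hH a j)

lemma const_mul [Fintype ι] (A : Matrix l ι ℝ) (hF : DecayM p F) : DecayM p fun x => A * F x := by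
  simpa using (DecayM.const A).mul hF

lemma mul_const [Fintype κ] (A : Matrix κ l ℝ) (hF : DecayM p F) : DecayM p fun x => F x * A := by
  simpa using hF.mul (DecayM.const A)

lemma const_smul (c : ℝ) (hF : DecayM p F) : DecayM p fun x => c • F x :=
  fun i j => (hF i j).const_mul c

lemma trace [Fintype ι] {F : Euc n → Matrix ι ι ℝ} (hF : DecayM p F) :
    Decay p fun x => (F x).trace := Decay.sum fun a _ => hF a a

lemma tendsto {A : Matrix ι κ ℝ} (hF : DecayM p fun x => F x - A) (hp : 0 < p) :
    Tendsto F (Bornology.cobounded (Euc n)) (𝓝 A) :=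
  tendsto_pi_nhds.2 fun i => tendsto_pi_nhds.2 fun j => (hF i j).tendsto hp

/-- A matrix function with a limit is bounded. -/
lemma bounded_of_sub {A : Matrix ι κ ℝ} (hF : DecayM p fun x => F x - A) (hp : 0 ≤ p) :
    DecayM 0 F := by
  simpa using (hF.of_le hp).add (DecayM.const A)

end DecayM

lemma tendsto_matrix_inv [Fintype ι] [DecidableEq ι] {F : Euc n → Matrix ι ι ℝ} {A : Matrix ι ι ℝ}
    {L : Filter (Euc n)} (h : Tendsto F L (𝓝 A)) (hA : A.det ≠ 0) :
    Tendsto (fun x => (F x)⁻¹) L (𝓝 A⁻¹) := by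
  simp only [Matrix.inv_def, Ring.inverse_eq_inv']
  have h1 : Tendsto (fun x => (F x).det) L (𝓝 A.det) :=
    (Continuous.matrix_det continuous_id).continuousAt.tendsto.comp h
  have h2 : Tendsto (fun x => (F x).adjugate) L (𝓝 A.adjugate) :=
    (Continuous.matrix_adjugate continuous_id).continuousAt.tendsto.comp h
  exact (h1.inv₀ hA).smul h2

lemma decay_inv [Fintype ι] [DecidableEq ι] {p : ℝ} (hp : 0 < p) {F : Euc n → Matrix ι ι ℝ}
    (hF : DecayM p fun x => F x - 1) : DecayM p fun x => (F x)⁻¹ - 1 := by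
  have ht := hF.tendsto hp
  have h1 : Tendsto (fun x => (F x).det) (Bornology.cobounded (Euc n)) (𝓝 1) := by
    have := (Continuous.matrix_det continuous_id).continuousAt.tendsto.comp ht
    simpa [Function.comp_def] using this
  have h2 := tendsto_matrix_inv ht (by simp)
  rw [inv_one] at h2
  have hb : DecayM 0 fun x => (F x)⁻¹ := by
    intro i j
    have h3 := tendsto_pi_nhds.1 (tendsto_pi_nhds.1 h2 i) j
    refine Decay.of_bounded (|(1 : Matrix ι ι ℝ) i j| + 1) ?_
    exact (h3.abs.eventually_lt_const (lt_add_one _)).mono fun x hx => le_of_lt hx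
  have h4 := (hb.mul hF).neg
  rw [zero_add] at h4
  refine h4.congr ?_
  filter_upwards [h1.eventually_ne one_ne_zero] with x hx
  rw [Matrix.mul_sub, Matrix.nonsing_inv_mul _ (isUnit_iff_ne_zero.2 hx), mul_one, neg_sub]

lemma decay_sqrt_det [Fintype ι] [DecidableEq ι] {p : ℝ} (hp : 0 < p) {F : Euc n → Matrix ι ι ℝ}
    (hF : DecayM p fun x => F x - 1) : Decay p fun x => Real.sqrt (F x).det - 1 := by
  have hd : DifferentiableAt ℝ (fun A : ι → ι → ℝ => Real.sqrt (Matrix.of A).det)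
      (fun i j => (1 : Matrix ι ι ℝ) i j) := by
    refine DifferentiableAt.sqrt ?_ ?_
    · simp only [Matrix.det_apply', Matrix.of_apply]
      fun_prop
    · have : Matrix.of (fun i j => (1 : Matrix ι ι ℝ) i j) = 1 := rfl
      rw [this]; simp
  have h1 := hd.isBigO_sub
  have ht : Tendsto (fun x => (fun i j => F x i j : ι → ι → ℝ)) (Bornology.cobounded (Euc n))
      (𝓝 fun i j => (1 : Matrix ι ι ℝ) i j) :=
    tendsto_pi_nhds.2 fun i => tendsto_pi_nhds.2 fun j => (hF i j).tendsto hp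
  have h2 := h1.comp_tendsto ht
  have h3 : (fun A : ι → ι → ℝ => Real.sqrt (Matrix.of A).det)
      (fun i j => (1 : Matrix ι ι ℝ) i j) = 1 := by
    have : Matrix.of (fun i j => (1 : Matrix ι ι ℝ) i j) = 1 := rfl
    simp only [this]; simp
  simp only [h3, Function.comp_def] at h2
  refine Asymptotics.IsBigO.trans h2 ?_
  refine Asymptotics.isBigO_pi.2 fun i => Asymptotics.isBigO_pi.2 fun j => ?_
  exact hF i j

/-! ### Functions with decaying derivatives have a limit -/

/-- Along a ray the derivative is integrable near infinity. -/
lemma exists_limit_along_ray {f : Euc n → ℝ} {r K τ : ℝ} (hr : 0 < r) (hτ : 0 < τ)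
    (hf : ∀ x, r < ‖x‖ → DifferentiableAt ℝ f x)
    (hd : ∀ x, r < ‖x‖ → ‖fderiv ℝ f x‖ ≤ K * ‖x‖ ^ (-τ - 1)) {u : Euc n} (hu : ‖u‖ = 1) :
    ∃ a, ∀ t, r < t → |f (t • u) - a| ≤ K / τ * t ^ (-τ) := by
  set g : ℝ → ℝ := fun t => f (t • u)
  have hnm : ∀ t, r < t → ‖t • u‖ = t := fun t ht => by
    rw [norm_smul, hu, mul_one, Real.norm_of_nonneg (hr.trans ht).le]
  have hg : ∀ t, r < t → HasDerivAt g (fderiv ℝ f (t • u) u) t := by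
    intro t ht
    have h1 := (hf (t • u) (by rw [hnm t ht]; exact ht)).hasFDerivAt
    have h2 : HasDerivAt (fun s : ℝ => s • u) u t := by
      simpa using (hasDerivAt_id t).smul_const u
    exact h1.comp_hasDerivAt t h2
  have hg' : ∀ t, r < t → |deriv g t| ≤ K * t ^ (-τ - 1) := by
    intro t ht
    rw [(hg t ht).deriv]
    have h1 := (fderiv ℝ f (t • u)).le_opNorm u
    rw [hu, mul_one, Real.norm_eq_abs] at h1
    have h2 := hd (t • u) (by rw [hnm t ht]; exact ht)
    rw [hnm t ht] at h2
    exact h1.trans h2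
  have hint : ∀ t, r < t → IntegrableOn (fun s : ℝ => K * s ^ (-τ - 1)) (Ioi t) := fun t ht =>
    (integrableOn_Ioi_rpow_of_lt (by linarith) (hr.trans ht)).const_mul K
  have hgi : ∀ t, r < t → IntegrableOn (deriv g) (Ioi t) := by
    intro t ht
    refine Integrable.mono' (hint t ht) (measurable_deriv g).aestronglyMeasurable ?_
    refine (ae_restrict_iff' measurableSet_Ioi).2 (Eventually.of_forall fun s hs => ?_)
    exact hg' s (ht.trans hs)
  have hgd : ∀ t, r < t → HasDerivAt g (deriv g t) t := fun t ht => (hg t ht).differentiableAt.hasDerivAt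
  have hlim := tendsto_limUnder_of_hasDerivAt_of_integrableOn_Ioi (a := r + 1) (f := g)
    (f' := deriv g) (fun t ht => hgd t (by linarith [mem_Ioi.1 ht])) (hgi _ (by linarith))
  refine ⟨limUnder atTop g, fun t ht => ?_⟩
  have h1 := integral_Ioi_of_hasDerivAt_of_tendsto (hgd t ht).continuousAt.continuousWithinAt
    (fun s hs => hgd s (ht.trans hs)) (hgi t ht) hlim
  have h2 : |f (t • u) - limUnder atTop g| = ‖∫ s in Ioi t, deriv g s‖ := by
    rw [h1, Real.norm_eq_abs, abs_sub_comm]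
  have ht0 := hr.trans ht
  rw [h2]
  calc ‖∫ s in Ioi t, deriv g s‖ ≤ ∫ s in Ioi t, K * s ^ (-τ - 1) := by
        refine norm_integral_le_of_norm_le (hint t ht) ?_
        refine (ae_restrict_iff' measurableSet_Ioi).2 (Eventually.of_forall fun s hs => ?_)
        exact hg' s (ht.trans hs)
    _ = K / τ * t ^ (-τ) := by
        rw [integral_const_mul, integral_Ioi_rpow_of_lt (by linarith) ht0]
        have : -τ - 1 + 1 = -τ := by ring
        rw [this]
        field_simp

lemma norm_segment_ge {u v : Euc n} (hu : ‖u‖ = 1) (hv : ‖v‖ = 1) (huv : 0 ≤ inner ℝ u v)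
    {s : ℝ} (h0 : 0 ≤ s) (h1 : s ≤ 1) : 1 / 2 ≤ ‖(1 - s) • u + s • v‖ := by
  have h2 : ‖(1 - s) • u + s • v‖ ^ 2
      = (1 - s) ^ 2 + 2 * ((1 - s) * s * inner ℝ u v) + s ^ 2 := by
    rw [norm_add_sq_real, norm_smul, norm_smul, hu, hv, inner_smul_left, inner_smul_right,
      Real.norm_eq_abs, Real.norm_eq_abs, mul_one, mul_one, sq_abs, sq_abs]
    simp only [conj_trivial]
    ring
  have h3 : 0 ≤ (1 - s) * s * inner ℝ u v := mul_nonneg (mul_nonneg (by linarith) h0) huv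
  have h4 : (1 / 2 : ℝ) ^ 2 ≤ ‖(1 - s) • u + s • v‖ ^ 2 := by
    rw [h2]; nlinarith [sq_nonneg (s - 1 / 2)]
  exact (sq_le_sq₀ (by norm_num) (norm_nonneg _)).1 h4

/-- A function whose derivative is `O(|x|^{-τ-1})` with `τ > 0` has a limit at infinity, which it
approaches at the rate `|x|^{-τ}`; in dimension at least `2` the limits along all rays agree. -/
lemma exists_limit_of_decay (hn : 2 ≤ n) {f : Euc n → ℝ} {r τ : ℝ} (hτ : 0 < τ)
    (hf : ∀ x, r < ‖x‖ → DifferentiableAt ℝ f x) (hd : ∀ k, Decay (τ + 1) (pd k f)) :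
    ∃ a, Decay τ fun x => f x - a := by
  -- the partial derivatives bound the norm of the derivative
  obtain ⟨K, r₁, hr₁, hr₁r, hK⟩ : ∃ K r₁ : ℝ, 0 < r₁ ∧ r ≤ r₁ ∧
      ∀ x, r₁ < ‖x‖ → ‖fderiv ℝ f x‖ ≤ K * ‖x‖ ^ (-τ - 1) := by
    choose C hC using fun k => (hd k).bound
    have hall := eventually_all.2 hC
    rw [← comap_norm_atTop, eventually_comap] at hall
    obtain ⟨b, hb⟩ := eventually_atTop.1 hall
    refine ⟨∑ k, C k, max b (max r 1), by positivity, (le_max_left _ _).trans (le_max_right _ _),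
      fun x hx => ?_⟩
    have hxb := hb ‖x‖ ((le_max_left _ _).trans hx.le) x rfl
    have hnn : 0 ≤ ‖x‖ ^ (-τ - 1) := Real.rpow_nonneg (norm_nonneg _) _
    have e : -(τ + 1) = -τ - 1 := by ring
    simp only [e, Real.norm_of_nonneg hnn] at hxb
    refine ContinuousLinearMap.opNorm_le_bound _ ?_ fun v => ?_
    · refine mul_nonneg (Finset.sum_nonneg fun k _ => ?_) hnn
      have h1 := (norm_nonneg _).trans (hxb k)
      have hxp : 0 < ‖x‖ := lt_of_lt_of_le (by positivity : (0 : ℝ) < max b (max r 1)) hx.le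
      exact nonneg_of_mul_nonneg_left h1 (Real.rpow_pos_of_pos hxp _)
    · rw [fderiv_apply_eq_sum_pd, Finset.sum_mul, Finset.sum_mul]
      refine (norm_sum_le _ _).trans (Finset.sum_le_sum fun k _ => ?_)
      rw [norm_mul, mul_comm ‖v k‖]
      exact mul_le_mul (hxb k) (PiLp.norm_apply_le v k) (norm_nonneg _) ((norm_nonneg _).trans (hxb k))
  have hf' : ∀ x, r₁ < ‖x‖ → DifferentiableAt ℝ f x := fun x hx => hf x (hr₁r.trans_lt hx)
  have hray : ∀ u : Euc n, ‖u‖ = 1 → ∃ a, ∀ t, r₁ < t → |f (t • u) - a| ≤ K / τ * t ^ (-τ) :=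
    fun u hu => exists_limit_along_ray hr₁ hτ hf' hK hu
  have h0 : Tendsto (fun t : ℝ => t ^ (-τ)) atTop (𝓝 0) := tendsto_rpow_neg_atTop hτ
  have htend : ∀ (u : Euc n) (a : ℝ), (∀ t, r₁ < t → |f (t • u) - a| ≤ K / τ * t ^ (-τ)) →
      Tendsto (fun t : ℝ => f (t • u)) atTop (𝓝 a) := by
    intro u a ha
    rw [tendsto_iff_norm_sub_tendsto_zero]
    refine squeeze_zero' (Eventually.of_forall fun t => norm_nonneg _) ?_
      (by simpa using h0.const_mul (K / τ))
    filter_upwards [eventually_gt_atTop r₁] with t ht using ha t ht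
  -- limits along directions at an angle at most `π / 2` agree
  have hacute : ∀ u v : Euc n, ‖u‖ = 1 → ‖v‖ = 1 → 0 ≤ inner ℝ u v →
      Tendsto (fun t : ℝ => f (t • u) - f (t • v)) atTop (𝓝 0) := by
    intro u v hu hv huv
    have hK0 : 0 ≤ K := by
      have h1 := (norm_nonneg _).trans (hK ((r₁ + 1) • u) (by
        rw [norm_smul, hu, mul_one, Real.norm_of_nonneg (by linarith)]; linarith))
      refine nonneg_of_mul_nonneg_left h1 (Real.rpow_pos_of_pos ?_ _)
      rw [norm_smul, hu, mul_one, Real.norm_of_nonneg (by linarith)]; linarith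
    have hlim : Tendsto (fun t : ℝ => K * (1 / 2) ^ (-τ - 1) * 2 * t ^ (-τ)) atTop (𝓝 0) := by
      simpa using h0.const_mul (K * (1 / 2) ^ (-τ - 1) * 2)
    refine squeeze_zero_norm' ?_ hlim
    filter_upwards [eventually_gt_atTop (2 * r₁)] with t ht
    have ht0 : 0 < t := by linarith
    have hseg : ∀ y ∈ segment ℝ (t • v) (t • u), t / 2 ≤ ‖y‖ := by
      intro y hy
      rw [segment_eq_image] at hy
      obtain ⟨s, hs, rfl⟩ := hy
      have h1 := norm_segment_ge hv hu (by rwa [real_inner_comm]) hs.1 hs.2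
      have h2 : (1 - s) • t • v + s • t • u = t • ((1 - s) • v + s • u) := by
        rw [smul_add, smul_comm (1 - s), smul_comm s]
      simp only [h2]
      rw [norm_smul, Real.norm_of_nonneg ht0.le]
      nlinarith
    have h3 := (convex_segment (𝕜 := ℝ) (t • v) (t • u)).norm_image_sub_le_of_norm_hasFDerivWithin_le
      (f := f) (f' := fun y => fderiv ℝ f y) (C := K * (t / 2) ^ (-τ - 1))
      (fun y hy => ((hf' y (by linarith [hseg y hy])).hasFDerivAt).hasFDerivWithinAt)
      (fun y hy => (hK y (by linarith [hseg y hy])).trans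
        (mul_le_mul_of_nonneg_left (Real.rpow_le_rpow_of_nonpos (by linarith) (hseg y hy)
          (by linarith)) hK0))
      (left_mem_segment ℝ _ _) (right_mem_segment ℝ _ _)
    have h4 : ‖t • u - t • v‖ ≤ t * 2 := by
      rw [← smul_sub, norm_smul, Real.norm_of_nonneg ht0.le]
      refine mul_le_mul_of_nonneg_left ((norm_sub_le _ _).trans ?_) ht0.le
      rw [hu, hv]; norm_num
    refine h3.trans ((mul_le_mul_of_nonneg_left h4 (mul_nonneg hK0
      (Real.rpow_nonneg (by linarith) _))).trans (le_of_eq ?_))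
    rw [show t / 2 = t * (1 / 2) by ring, Real.mul_rpow ht0.le (by norm_num)]
    have : t ^ (-τ) = t ^ (-τ - 1) * t := by
      rw [← Real.rpow_add_one ht0.ne']; congr 1; ring
    rw [this]; ring
  choose! a ha using hray
  have haeq : ∀ u v : Euc n, ‖u‖ = 1 → ‖v‖ = 1 → 0 ≤ inner ℝ u v → a u = a v := by
    intro u v hu hv huv
    have h1 := (htend u _ (ha u hu)).sub (htend v _ (ha v hv))
    exact sub_eq_zero.1 (tendsto_nhds_unique h1 (hacute u v hu hv huv))
  have hst : ∀ k : Fin n, ‖(stdVec k : Euc n)‖ = 1 := fun k => by simp [stdVec]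
  have hin : ∀ (u : Euc n) k, inner ℝ u (stdVec k) = u k := fun u k => by
    simp [stdVec, EuclideanSpace.inner_single_right]
  set i0 : Fin n := ⟨0, by omega⟩
  set i1 : Fin n := ⟨1, by omega⟩
  have h01 : i1 ≠ i0 := by simp [i0, i1]
  have hneg : a (-stdVec i0) = a (stdVec i0) := by
    rw [haeq (-stdVec i0) (stdVec i1) (by rw [norm_neg, hst]) (hst _) (by
      rw [inner_neg_left, hin, stdVec_apply, if_neg (fun h => h01 h)]
      simp)]
    refine haeq _ _ (hst _) (hst _) ?_
    rw [hin, stdVec_apply]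
    split_ifs <;> norm_num
  have hall : ∀ u : Euc n, ‖u‖ = 1 → a u = a (stdVec i0) := by
    intro u hu
    rcases le_total 0 (u i0) with h | h
    · exact haeq u _ hu (hst _) (by rwa [hin])
    · rw [haeq u (-stdVec i0) hu (by rw [norm_neg, hst]) (by rw [inner_neg_right, hin]; linarith), hneg]
  refine ⟨a (stdVec i0), Asymptotics.IsBigO.of_bound (K / τ) ?_⟩
  filter_upwards [eventually_lt_norm r₁] with x hx
  have hx0 : 0 < ‖x‖ := hr₁.trans hx
  have hun : ‖‖x‖⁻¹ • x‖ = 1 := by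
    rw [norm_smul, norm_inv, norm_norm]; field_simp
  have h1 := ha _ hun ‖x‖ hx
  rw [hall _ hun, smul_smul, mul_inv_cancel₀ hx0.ne', one_smul] at h1
  rwa [Real.norm_of_nonneg (Real.rpow_nonneg hx0.le _)]

end Decay

/-! ### Asymptotically flat Kähler metrics -/

section AsymptoticKahler

lemma IsKahlerOn.mono {n : ℕ} {G J : Euc n → SqMat n} {U V : Set (Euc n)} (h : IsKahlerOn G J U)
    (hV : IsOpen V) (hVU : V ⊆ U) : IsKahlerOn G J V where
  isOpen := hV
  smooth x hx := h.smooth x (hVU hx)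
  posDef x hx := h.posDef x (hVU hx)
  smoothJ x hx := h.smoothJ x (hVU hx)
  sq x hx := h.sq x (hVU hx)
  orth x hx := h.orth x (hVU hx)
  parallel x hx := h.parallel x (hVU hx)

lemma isOpen_lt_norm {n : ℕ} (r : ℝ) : IsOpen {x : Euc n | r < ‖x‖} :=
  isOpen_lt continuous_const continuous_norm

/-- The vector field `∑ⱼ (∂_j g_{ja} - ∂_a g_{jj})` whose fluxes define the mass. -/
def massField {n : ℕ} (G : Euc n → SqMat n) (a : Fin n) (x : Euc n) : ℝ :=
  ∑ j, (pd j (fun y => G y j a) x - pd a (fun y => G y j j) x)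

variable {n : ℕ} {G J : Euc n → SqMat n} {J₀ : SqMat n} {r τ : ℝ}

lemma decay_gauge {n : ℕ} {J : Euc n → SqMat n} {J₀ : SqMat n} {τ : ℝ}
    (hJ : DecayM τ fun x => J x - J₀) (hJ₀ : J₀ * J₀ = -1) :
    DecayM τ fun x => gauge J J₀ x - 1 := by
  refine ((hJ.mul_const J₀).const_smul (-(1 / 2))).congr (Eventually.of_forall fun x => ?_)
  rw [Matrix.sub_mul, hJ₀, gauge]
  module

lemma eventually_det_gauge {n : ℕ} {J : Euc n → SqMat n} {J₀ : SqMat n} {τ : ℝ} (hτ : 0 < τ)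
    (hJ : DecayM τ fun x => J x - J₀) (hJ₀ : J₀ * J₀ = -1) :
    ∀ᶠ x in Bornology.cobounded (Euc n), (gauge J J₀ x).det ≠ 0 := by
  have ht := (decay_gauge hJ hJ₀).tendsto hτ
  have h1 := (Continuous.matrix_det continuous_id).continuousAt.tendsto.comp ht
  exact h1.eventually_ne (by simp)

section Connection

variable (hdG : ∀ l, DecayM (τ + 1) (pdM l G))
include hdG

lemma decay_chrLow (j : Fin n) : DecayM (τ + 1) (chrLow G j) := fun i k =>
  (((hdG j i k).add (hdG k i j)).sub (hdG i j k)).const_mul (1 / 2)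

lemma decay_chrM_sub (hτ : 0 < τ) (hG : DecayM τ fun x => G x - 1) (j : Fin n) :
    DecayM (2 * τ + 1) fun x => chrM G j x - chrLow G j x := by
  have := (decay_inv hτ hG).mul (decay_chrLow hdG j)
  rw [show τ + (τ + 1) = 2 * τ + 1 by ring] at this
  refine this.congr (Eventually.of_forall fun x => ?_)
  rw [Matrix.sub_mul, chrM_eq, one_mul]

lemma decay_chrM (hτ : 0 < τ) (hG : DecayM τ fun x => G x - 1) (j : Fin n) :
    DecayM (τ + 1) (chrM G j) := by
  refine (((decay_chrM_sub hdG hτ hG j).of_le (q := τ + 1) (by linarith)).add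
    (decay_chrLow hdG j)).congr (Eventually.of_forall fun x => ?_)
  simp

end Connection

namespace IsKahlerOn

lemma pdM_gauge (h : IsKahlerOn G J {x | r < ‖x‖}) (J₀ : SqMat n) {x : Euc n} (hx : r < ‖x‖) (k : Fin n) :
    pdM k (gauge J J₀) x = -(1 / 2 : ℝ) • (pdM k J x * J₀) := by
  have hs : CMatAt 1 (fun y => J y * J₀) x := (h.smoothJ x hx).mul (CMatAt.const J₀ x)
  have h1 : pdM k (gauge J J₀) x = pdM k (fun y => (1 / 2 : ℝ) • (1 - J y * J₀)) x := rfl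
  rw [h1, pdM_smul contDiffAt_const ((CMatAt.const 1 x).sub hs), pd_const, pdM_sub (CMatAt.const 1 x) hs,
    pdM_mul (h.smoothJ x hx) (CMatAt.const J₀ x), pdM_const, pdM_const]
  simp

lemma trace_pdM_J (h : IsKahlerOn G J {x | r < ‖x‖}) {x : Euc n} (hx : r < ‖x‖) (k : Fin n) : (pdM k J x).trace = 0 := by
  rw [h.parallel x hx, Matrix.trace_sub, Matrix.trace_mul_comm, sub_self]

variable (h : IsKahlerOn G J {x | r < ‖x‖}) (hτ : 0 < τ) (hG : DecayM τ fun x => G x - 1)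
  (hdG : ∀ l, DecayM (τ + 1) (pdM l G))
include h hτ hG

lemma decay_J : DecayM 0 J := by
  have hsmall : ∀ᶠ x in Bornology.cobounded (Euc n), ∀ a b, |(G x - 1) a b| ≤ 1 / (2 * (n + 1)) := by
    refine eventually_all.2 fun a => eventually_all.2 fun b => ?_
    have := ((hG a b).tendsto_zero hτ).abs
    rw [abs_zero] at this
    exact (this.eventually_lt_const (by positivity)).mono fun x hx => le_of_lt hx
  have hbd : ∀ᶠ x in Bornology.cobounded (Euc n), ∀ l k, |J x l k| ≤ 2 := by
    filter_upwards [hsmall, eventually_lt_norm r] with x hx hxr l k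
    set S := ∑ a, J x a k ^ 2 with hS
    have hS0 : 0 ≤ S := Finset.sum_nonneg fun a _ => sq_nonneg _
    have e1 : G x k k = S + ∑ a, ∑ b, J x a k * (G x - 1) a b * J x b k := by
      have h1 := congrFun (congrFun (h.orth x hxr) k) k
      rw [← h1]
      have h2 : G x = 1 + (G x - 1) := by abel
      conv_lhs => rw [h2]
      rw [Matrix.mul_add, Matrix.add_mul, Matrix.add_apply, mul_one]
      congr 1
      · simp only [Matrix.mul_apply, Matrix.transpose_apply, hS, pow_two]
      · simp only [Matrix.mul_apply, Matrix.transpose_apply, Finset.sum_mul]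
        rw [Finset.sum_comm]
    have e2 : |∑ a, ∑ b, J x a k * (G x - 1) a b * J x b k|
        ≤ ∑ a, ∑ b, 1 / (2 * ((n : ℝ) + 1)) * ((J x a k ^ 2 + J x b k ^ 2) / 2) := by
      refine (Finset.abs_sum_le_sum_abs _ _).trans (Finset.sum_le_sum fun a _ =>
        (Finset.abs_sum_le_sum_abs _ _).trans (Finset.sum_le_sum fun b _ => ?_))
      have h1 : |J x a k * (G x - 1) a b * J x b k|
          = |(G x - 1) a b| * (|J x a k| * |J x b k|) := by rw [abs_mul, abs_mul]; ring
      rw [h1]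
      refine mul_le_mul (hx a b) ?_ (by positivity) (by positivity)
      nlinarith [sq_nonneg (|J x a k| - |J x b k|), sq_abs (J x a k), sq_abs (J x b k)]
    have e3 : ∑ a, ∑ b, 1 / (2 * ((n : ℝ) + 1)) * ((J x a k ^ 2 + J x b k ^ 2) / 2)
        = n / (2 * (n + 1)) * S := by
      simp only [← Finset.mul_sum, ← Finset.sum_div, Finset.sum_add_distrib, Finset.sum_const,
        Finset.card_univ, Fintype.card_fin, nsmul_eq_mul, ← hS]
      field_simp
      ring
    have e4 : (n : ℝ) / (2 * (n + 1)) ≤ 1 / 2 := by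
      rw [div_le_div_iff₀ (by positivity) (by norm_num)]; linarith
    have e5 : G x k k ≤ 3 / 2 := by
      have h1 := (abs_le.1 (hx k k)).2
      have h2 : 1 / (2 * ((n : ℝ) + 1)) ≤ 1 / 2 := by
        rw [div_le_div_iff₀ (by positivity) (by norm_num)]
        linarith [(Nat.cast_nonneg n : (0 : ℝ) ≤ n)]
      rw [Matrix.sub_apply, Matrix.one_apply_eq] at h1
      linarith
    have e6 := (abs_le.1 (e2.trans e3.le)).1
    have e7 : (n : ℝ) / (2 * (n + 1)) * S ≤ 1 / 2 * S := mul_le_mul_of_nonneg_right e4 hS0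
    have e8 : S ≤ 3 := by linarith
    have e9 : J x l k ^ 2 ≤ S := Finset.single_le_sum (f := fun a => J x a k ^ 2)
      (fun a _ => sq_nonneg _) (Finset.mem_univ l)
    exact abs_le_of_sq_le_sq (by linarith) (by norm_num)
  exact fun l k => Decay.of_bounded 2 (hbd.mono fun x hx => hx l k)

include hdG

lemma decay_pdM_J (j : Fin n) : DecayM (τ + 1) (pdM j J) := by
  have hC := decay_chrM hdG hτ hG j
  have h1 := (h.decay_J hτ hG).mul hC
  have h2 := hC.mul (h.decay_J hτ hG)
  rw [zero_add] at h1
  rw [add_zero] at h2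
  exact (h1.sub h2).congr ((eventually_lt_norm r).mono fun x hx => (h.parallel x hx j).symm)

/-- The complex structure has a limit at infinity, which is an orthogonal complex structure of
Euclidean space. -/
lemma exists_limit_J (hn : 2 ≤ n) :
    ∃ J₀ : SqMat n, (DecayM τ fun x => J x - J₀) ∧ J₀ * J₀ = -1 ∧ J₀.transpose * J₀ = 1 := by
  have h1 := fun l k => exists_limit_of_decay hn hτ (f := fun x => J x l k)
    (fun x hx => (h.smoothJ x hx).diff (by simp) l k) fun j => h.decay_pdM_J hτ hG hdG j l k
  choose J₀ hJ₀ using h1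
  have hJ : DecayM τ fun x => J x - Matrix.of J₀ := fun l k => hJ₀ l k
  have ht := hJ.tendsto hτ
  have hGt := hG.tendsto hτ
  have : Nonempty (Fin n) := ⟨⟨0, by omega⟩⟩
  have : NeBot (Bornology.cobounded (Euc n)) := by
    have : Nontrivial (Euc n) := inferInstance
    infer_instance
  refine ⟨Matrix.of J₀, hJ, ?_, ?_⟩
  · refine tendsto_nhds_unique ((ht.mul ht).congr' ?_) tendsto_const_nhds
    exact (eventually_lt_norm r).mono fun x hx => h.sq x hx
  · have htr : Tendsto (fun x => (J x).transpose) (Bornology.cobounded (Euc n))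
        (𝓝 (Matrix.of J₀).transpose) :=
      (Continuous.matrix_transpose continuous_id).continuousAt.tendsto.comp ht
    have h2 := (htr.mul hGt).mul ht
    rw [mul_one] at h2
    refine tendsto_nhds_unique (h2.congr' ?_) hGt
    exact (eventually_lt_norm r).mono fun x hx => h.orth x hx

/-- To leading order, the primitive of the Ricci form is `½ tr (J₀ L_k)` with `L_k` the Christoffel
symbols of the first kind. -/
lemma decay_ricPrim (hJ : DecayM τ fun x => J x - J₀) (hJ₀ : J₀ * J₀ = -1) (k : Fin n) :
    Decay (2 * τ + 1) fun x => ricPrim G J J₀ k x - (1 / 2) * (J₀ * chrLow G k x).trace := by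
  have hC := decay_chrM hdG hτ hG k
  have hCL := decay_chrM_sub hdG hτ hG k
  have h1 := (hJ.mul hC).trace
  have h2 := (hCL.const_mul J₀).trace
  have h3 := ((((decay_inv hτ (decay_gauge hJ hJ₀)).mul
    (((h.decay_pdM_J hτ hG hdG k).mul_const J₀).const_smul (-(1 / 2)))).const_mul J₀)).trace
  rw [show τ + (τ + 1) = 2 * τ + 1 by ring] at h1 h3
  refine (((h1.add h2).add h3).const_mul (1 / 2)).congr ?_
  filter_upwards [eventually_lt_norm r] with x hx
  rw [ricPrim, h.pdM_gauge J₀ hx, Matrix.sub_mul, Matrix.mul_sub, Matrix.sub_mul, one_mul,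
    Matrix.mul_sub, Matrix.trace_sub, Matrix.trace_sub, Matrix.trace_sub]
  -- the trace of `J₀ ∂_k P` vanishes
  have h4 : (J₀ * -(1 / 2 : ℝ) • (pdM k J x * J₀)).trace = 0 := by
    rw [Matrix.mul_smul, Matrix.trace_smul, Matrix.trace_mul_comm, Matrix.mul_assoc, hJ₀,
      Matrix.mul_neg, mul_one, Matrix.trace_neg, h.trace_pdM_J hx]
    simp
  rw [h4]
  ring

end IsKahlerOn

/-- The algebraic identity behind the comparison of the two fluxes: here `D l i k` stands for
`∂_l g_{ik}`, and `L j` for the Christoffel symbols of the first kind. -/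
lemma flux_identity (D : Fin n → Fin n → Fin n → ℝ) (hD : ∀ l i k, D l i k = D l k i)
    (hJ₀ : J₀.transpose = -J₀) (L : Fin n → SqMat n)
    (hL : ∀ j i k, L j i k = (1 / 2) * (D j i k + D k i j - D i j k)) (a : Fin n) :
    ∑ k, J₀ k a * (J₀ * L k).trace = ∑ j, (D j j a - D a j j) +
      ∑ j, (L j - (L j).transpose - J₀.transpose * (L j - (L j).transpose) * J₀) j a := by
  have hsk : ∀ i k, J₀ k i = -J₀ i k := fun i k => congrFun (congrFun hJ₀ i) k
  have hA : ∀ j i k, (L j - (L j).transpose) i k = D k i j - D i j k := by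
    intro j i k
    rw [Matrix.sub_apply, Matrix.transpose_apply, hL, hL, hD j i k, hD k j i, hD i k j]
    ring
  have h1 : ∀ k, (J₀ * L k).trace = ∑ l, ∑ i, J₀ l i * D l i k := by
    intro k
    have e1 : (J₀ * L k).trace = ∑ l, ∑ i, (1 / 2) * (J₀ l i * D k i l)
        + ∑ l, ∑ i, (1 / 2) * (J₀ l i * D l i k) - ∑ l, ∑ i, (1 / 2) * (J₀ l i * D i k l) := by
      simp only [Matrix.trace, Matrix.diag, Matrix.mul_apply, hL, ← Finset.sum_add_distrib,
        ← Finset.sum_sub_distrib]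
      exact Finset.sum_congr rfl fun l _ => Finset.sum_congr rfl fun i _ => by ring
    have e2 : ∑ l, ∑ i, (1 / 2) * (J₀ l i * D k i l) = 0 := by
      have e3 : ∑ l, ∑ i, (1 / 2) * (J₀ l i * D k i l)
          = -∑ l, ∑ i, (1 / 2) * (J₀ l i * D k i l) := by
        conv_lhs => rw [Finset.sum_comm]
        simp only [← Finset.sum_neg_distrib]
        exact Finset.sum_congr rfl fun l _ => Finset.sum_congr rfl fun i _ => by
          rw [hsk l i, hD k l i]; ring
      linarith
    have e4 : ∑ l, ∑ i, (1 / 2) * (J₀ l i * D i k l)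
        = -∑ l, ∑ i, (1 / 2) * (J₀ l i * D l i k) := by
      rw [Finset.sum_comm]
      simp only [← Finset.sum_neg_distrib]
      exact Finset.sum_congr rfl fun l _ => Finset.sum_congr rfl fun i _ => by
        rw [hsk l i, hD l k i]; ring
    rw [e1, e2, e4, sub_neg_eq_add, zero_add, ← Finset.sum_add_distrib]
    simp only [← Finset.sum_add_distrib]
    exact Finset.sum_congr rfl fun l _ => Finset.sum_congr rfl fun i _ => by ring
  have h2 : ∑ j, (J₀.transpose * (L j - (L j).transpose) * J₀) j a
      = -∑ k, J₀ k a * (J₀ * L k).trace := by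
    have e1 : ∀ j, (J₀.transpose * (L j - (L j).transpose) * J₀) j a
        = ∑ q, ∑ p, J₀ p j * D q p j * J₀ q a - ∑ q, ∑ p, J₀ p j * D p j q * J₀ q a := by
      intro j
      simp only [Matrix.mul_apply (M := J₀.transpose * _), Matrix.mul_apply (M := J₀.transpose),
        Matrix.transpose_apply (M := J₀), hA, Finset.sum_mul, ← Finset.sum_sub_distrib]
      exact Finset.sum_congr rfl fun l _ => Finset.sum_congr rfl fun i _ => by ring
    simp only [e1, Finset.sum_sub_distrib]
    have e2 : ∑ j, ∑ q, ∑ p, J₀ p j * D q p j * J₀ q a = 0 := by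
      rw [Finset.sum_comm]
      refine Finset.sum_eq_zero fun q _ => ?_
      have e3 : ∑ j, ∑ p, J₀ p j * D q p j * J₀ q a = -∑ j, ∑ p, J₀ p j * D q p j * J₀ q a := by
        conv_lhs => rw [Finset.sum_comm]
        simp only [← Finset.sum_neg_distrib]
        exact Finset.sum_congr rfl fun l _ => Finset.sum_congr rfl fun i _ => by
          rw [hsk i l, hD q i l]; ring
      linarith
    have e3 : ∑ j, ∑ q, ∑ p, J₀ p j * D p j q * J₀ q a = ∑ k, J₀ k a * (J₀ * L k).trace := by
      rw [Finset.sum_comm]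
      refine Finset.sum_congr rfl fun q _ => ?_
      rw [h1, Finset.sum_comm, Finset.mul_sum]
      refine Finset.sum_congr rfl fun p _ => ?_
      rw [Finset.mul_sum]
      exact Finset.sum_congr rfl fun j _ => by ring
    rw [e2, e3, zero_sub]
  simp only [Matrix.sub_apply (A := L _ - (L _).transpose), Finset.sum_sub_distrib, h2]
  simp only [hA, Finset.sum_sub_distrib]
  have h3 : ∑ x, D a x x = ∑ j, D a j j := rfl
  ring

namespace IsKahlerOn

lemma decay_fluxMat {m : ℕ} {G J : Euc (2 * m) → SqMat (2 * m)} {J₀ : SqMat (2 * m)} {r τ : ℝ}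
    (hm : 0 < m) (h : IsKahlerOn G J {x | r < ‖x‖}) (hτ : 0 < τ) (hG : DecayM τ fun x => G x - 1)
    (hJ : DecayM τ fun x => J x - J₀) (hJ₀ : J₀.transpose = -J₀) :
    DecayM τ fun x => fluxMat G J x - ((m - 1).factorial : ℝ) • J₀ := by
  have h0 := decay_inv hτ hG
  have hJb := (h.decay_J hτ hG).transpose
  have h1 := h0.mul hJb
  rw [add_zero] at h1
  have h2 := (h0.bounded_of_sub hτ.le).mul hJb
  rw [add_zero] at h2
  have h3 : DecayM τ fun x => (Real.sqrt (G x).det - 1) • ((G x)⁻¹ * (J x).transpose) := by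
    intro i j
    have := (decay_sqrt_det hτ hG).mul (h2 i j)
    rwa [add_zero] at this
  refine (((h3.add h1).add hJ.transpose).const_smul (-((m - 1).factorial : ℝ))).congr ?_
  filter_upwards [eventually_lt_norm r] with x hx
  rw [h.fluxMat_eq hm hx, Matrix.sub_mul, one_mul, Matrix.transpose_sub, hJ₀]
  module

/-- Up to the divergence of a skew matrix and to terms that decay faster than `|x|^{1-2m}`, the
vector field whose flux is the integral of `θ ∧ ω^{m-1}` is a multiple of the one defining the
mass. The skew matrix is `J₀ᵗ J - Jᵗ J₀`, which vanishes at infinity and whose derivatives are, as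
`J` is parallel, combinations of Christoffel symbols. -/
lemma decay_fluxField_sub_massField {m : ℕ} {G J : Euc (2 * m) → SqMat (2 * m)}
    {J₀ : SqMat (2 * m)} {r τ : ℝ}
    (hm : 0 < m) (h : IsKahlerOn G J {x | r < ‖x‖}) (hτ : 0 < τ) (hG : DecayM τ fun x => G x - 1)
    (hdG : ∀ l, DecayM (τ + 1) (pdM l G)) (hJ : DecayM τ fun x => J x - J₀) (hJsq : J₀ * J₀ = -1)
    (hJ₀ : J₀.transpose = -J₀) (a : Fin (2 * m)) :
    Decay (2 * τ + 1) fun x => fluxField G J (ricPrim G J J₀) a x - (m - 1).factorial / 2 *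
      (massField G a x + ∑ j, pd j (fun y => (J₀.transpose * J y - (J y).transpose * J₀) j a) x) := by
  set c : ℝ := ((m - 1).factorial : ℝ)
  have hL := decay_chrLow hdG
  have hC := decay_chrM hdG hτ hG
  have hCL := decay_chrM_sub hdG hτ hG
  have hθ := h.decay_ricPrim hτ hG hdG hJ hJsq
  -- to first order, `fluxMat` is a multiple of `J₀`
  have h1 : ∀ k, Decay (τ + 1) fun x => ricPrim G J J₀ k x := by
    intro k
    have := (((hL k).const_mul J₀).trace.const_mul (1 / 2))
    exact (((hθ k).of_le (by linarith)).add this).congr (Eventually.of_forall fun x => by ring)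
  have h2 : Decay (2 * τ + 1) fun x => fluxField G J (ricPrim G J J₀) a x
      - ∑ k, c * J₀ k a * ((1 / 2) * (J₀ * chrLow G k x).trace) := by
    have e1 := fun k => (h.decay_fluxMat hm hτ hG hJ hJ₀ k a).mul (h1 k)
    have e2 := fun k => (hθ k).const_mul (c * J₀ k a)
    have e3 : Decay (2 * τ + 1) fun x => ∑ k, ((fluxMat G J x - c • J₀) k a * ricPrim G J J₀ k x +
        c * J₀ k a * (ricPrim G J J₀ k x - (1 / 2) * (J₀ * chrLow G k x).trace)) :=
      Decay.sum fun k _ => ((e1 k).of_le (by linarith)).add (e2 k)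
    refine e3.congr (Eventually.of_forall fun x => ?_)
    rw [fluxField, ← Finset.sum_sub_distrib]
    refine Finset.sum_congr rfl fun k _ => ?_
    rw [Matrix.sub_apply, Matrix.smul_apply, smul_eq_mul]
    ring
  -- by parallelism, the derivatives of the skew matrix are of first order in `chrLow`
  have h3 : ∀ j, DecayM (2 * τ + 1) fun x =>
      pdM j (fun y => J₀.transpose * J y - (J y).transpose * J₀) x -
        (chrLow G j x - (chrLow G j x).transpose
          - J₀.transpose * (chrLow G j x - (chrLow G j x).transpose) * J₀) := by
    intro j
    have e1 := hJ.mul (hC j)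
    have e2 := (hC j).mul hJ
    rw [show τ + (τ + 1) = 2 * τ + 1 by ring] at e1
    rw [show τ + 1 + τ = 2 * τ + 1 by ring] at e2
    have e3 := ((e1.add ((hCL j).const_mul J₀)).sub e2).sub ((hCL j).mul_const J₀)
    have e4 : DecayM (2 * τ + 1) fun x => pdM j J x
        - (J₀ * chrLow G j x - chrLow G j x * J₀) := by
      refine e3.congr ?_
      filter_upwards [eventually_lt_norm r] with x hx
      rw [h.parallel x hx, Matrix.sub_mul, Matrix.mul_sub, Matrix.mul_sub, Matrix.sub_mul]
      abel
    refine ((e4.const_mul J₀.transpose).sub (e4.transpose.mul_const J₀)).congr ?_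
    filter_upwards [eventually_lt_norm r] with x hx
    have hJs := h.smoothJ x hx
    rw [pdM_sub ((CMatAt.const _ x).mul hJs) (hJs.transpose.mul (CMatAt.const _ x)),
      pdM_mul (CMatAt.const _ x) hJs, pdM_mul hJs.transpose (CMatAt.const _ x), pdM_const, pdM_const,
      pdM_transpose]
    have e5 : ∀ A : SqMat (2 * m), J₀.transpose * (J₀ * A) = A := fun A => by
      rw [← Matrix.mul_assoc, hJ₀, Matrix.neg_mul, hJsq]; simp
    simp only [Matrix.transpose_sub, Matrix.transpose_mul, Matrix.mul_sub, Matrix.sub_mul, e5,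
      Matrix.zero_mul, Matrix.mul_zero]
    have e6 : (chrLow G j x).transpose * J₀.transpose * J₀ = (chrLow G j x).transpose := by
      rw [Matrix.mul_assoc, hJ₀, Matrix.neg_mul, hJsq]; simp
    rw [e6]
    simp only [Matrix.mul_assoc]
    abel
  have h4 : Decay (2 * τ + 1) fun x => ∑ j,
      (pdM j (fun y => J₀.transpose * J y - (J y).transpose * J₀) x -
        (chrLow G j x - (chrLow G j x).transpose
          - J₀.transpose * (chrLow G j x - (chrLow G j x).transpose) * J₀)) j a :=
    Decay.sum fun j _ => h3 j j a
  refine (h2.sub (h4.const_mul (c / 2))).congr ?_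
  filter_upwards [eventually_lt_norm r] with x hx
  have h5 := flux_identity (J₀ := J₀) (fun l i k => pd l (fun y => G y i k) x)
    (fun l i k => h.toIsMetricOn.pd_symm hx l i k) hJ₀ (fun j => chrLow G j x) (fun j i k => rfl) a
  have h6 : ∑ k, c * J₀ k a * ((1 / 2) * (J₀ * chrLow G k x).trace)
      = c / 2 * ∑ k, J₀ k a * (J₀ * chrLow G k x).trace := by
    rw [Finset.mul_sum]
    exact Finset.sum_congr rfl fun k _ => by ring
  have h7 : ∀ A B : Fin (2 * m) → SqMat (2 * m),
      ∑ j, (A j - B j) j a = ∑ j, A j j a - ∑ j, B j j a := fun A B => by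
    rw [← Finset.sum_sub_distrib]; rfl
  have h8 := h7 (fun j => pdM j (fun y => J₀.transpose * J y - (J y).transpose * J₀) x)
    (fun j => chrLow G j x - (chrLow G j x).transpose
          - J₀.transpose * (chrLow G j x - (chrLow G j x).transpose) * J₀)
  rw [h6, h5, h8]
  simp only [pdM_apply, massField]
  ring

end IsKahlerOn

/-- The mass flux and the flux of `θ ∧ ω^{m-1}` differ asymptotically by a constant factor only. -/
lemma IsKahlerOn.tendsto_flux_sub {m : ℕ} {G J : Euc (2 * m) → SqMat (2 * m)}
    {J₀ : SqMat (2 * m)} {r τ : ℝ} (hr : 0 < r)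
    (hm : 0 < m) (h : IsKahlerOn G J {x | r < ‖x‖}) (hτ : 0 < τ) (hτm : (m : ℝ) - 1 < τ)
    (hG : DecayM τ fun x => G x - 1)
    (hdG : ∀ l, DecayM (τ + 1) (pdM l G)) (hJ : DecayM τ fun x => J x - J₀) (hJsq : J₀ * J₀ = -1)
    (hJ₀ : J₀.transpose = -J₀) (hdet : ∀ x, r < ‖x‖ → (gauge J J₀ x).det ≠ 0) :
    Tendsto (fun t => sphereFlux (fluxField G J (ricPrim G J J₀)) t
      - (m - 1).factorial / 2 * sphereFlux (massField G) t) atTop (𝓝 0) := by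
  set c : ℝ := (m - 1).factorial / 2
  set Z : Euc (2 * m) → SqMat (2 * m) := fun y => J₀.transpose * J y - (J y).transpose * J₀ with hZ
  set E : Fin (2 * m) → Euc (2 * m) → ℝ := fun a x => fluxField G J (ricPrim G J J₀) a x - c *
      (massField G a x + ∑ j, pd j (fun y => Z y j a) x) with hE
  have hEd : ∀ a, Decay (2 * τ + 1) (E a) := fun a =>
    h.decay_fluxField_sub_massField hm hτ hG hdG hJ hJsq hJ₀ a
  have hZs : ∀ x, r < ‖x‖ → CMatAt 1 Z x := fun x hx =>
    ((CMatAt.const _ x).mul (h.smoothJ x hx)).sub ((h.smoothJ x hx).transpose.mul (CMatAt.const _ x))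
  have hZc : ∀ a x, r < ‖x‖ → ContinuousAt (fun x => ∑ j, pd j (fun y => Z y j a) x) x :=
    fun a x hx => tendsto_finsetSum _ fun j _ => continuousAt_pd (hZs x hx j a) j
  have hGs : ∀ x, r < ‖x‖ → CMatAt 1 G x := fun x hx => (h.smooth x hx).of_le (by norm_num)
  have hMc : ∀ a x, r < ‖x‖ → ContinuousAt (massField G a) x := fun a x hx =>
    tendsto_finsetSum _ fun j _ =>
      (continuousAt_pd (hGs x hx j a) j).sub (continuousAt_pd (hGs x hx j j) a)
  have hFc : ∀ a x, r < ‖x‖ → ContinuousAt (fluxField G J (ricPrim G J J₀) a) x := fun a x hx =>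
    (h.smooth_fluxField hx (fun k => h.contDiffAt_ricPrim hx (hdet x hx) k) a).continuousAt
  have hEc : ∀ a x, r < ‖x‖ → ContinuousAt (E a) x := fun a x hx =>
    (hFc a x hx).sub (continuousAt_const.mul ((hMc a x hx).add (hZc a x hx)))
  have hn : 0 < 2 * m := by omega
  have h1 : Tendsto (sphereFlux E) atTop (𝓝 0) := by
    refine tendsto_sphereIntegral_zero hn (p := 2 * τ + 1) (by push_cast; linarith) ?_
    refine Decay.sum fun a _ => ?_
    have h2 : Decay 0 fun x : Euc (2 * m) => x a / ‖x‖ := by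
      refine Decay.of_bounded 1 (Eventually.of_forall fun x => ?_)
      rw [abs_div, abs_norm]
      exact div_le_one_of_le₀ (PiLp.norm_apply_le x a) (norm_nonneg _)
    have h3 := h2.mul (hEd a)
    rwa [zero_add] at h3
  refine h1.congr' ?_
  filter_upwards [eventually_gt_atTop r] with t ht
  have hskew : sphereFlux (fun a x => ∑ j, pd j (fun y => Z y j a) x) t = 0 := by
    refine sphereIntegral_div_skew hn hr hZs (fun x hx j k => ?_) ht
    simp only [hZ, Matrix.sub_apply]
    have h2 : ∀ j k, ((J x).transpose * J₀) j k = (J₀.transpose * J x) k j := fun j k => by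
      simp only [Matrix.mul_apply, Matrix.transpose_apply]
      exact Finset.sum_congr rfl fun a _ => mul_comm _ _
    rw [h2, h2]; ring
  have e1 : sphereFlux E t = sphereFlux (fun a x => fluxField G J (ricPrim G J J₀) a x +
      (-c) * (massField G a x + ∑ j, pd j (fun y => Z y j a) x)) t :=
    sphereFlux_congr (hr.trans ht).le fun a x _ => by simp only [hE]; ring
  rw [e1, sphereFlux_add (V := fluxField G J (ricPrim G J J₀))
      (W := fun a x => (-c) * (massField G a x + ∑ j, pd j (fun y => Z y j a) x)) hr.le ht hFc
      (fun a x hx => continuousAt_const.mul ((hMc a x hx).add (hZc a x hx))),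
    sphereFlux_const_mul, sphereFlux_add (V := massField G)
      (W := fun a x => ∑ j, pd j (fun y => Z y j a) x) hr.le ht hMc hZc, hskew]
  ring

end AsymptoticKahler

/-! ### Closed one-forms near infinity -/

section Exactness

variable {n : ℕ}

/-- The half-space `{± x_i > r}`, for `p = (i, ±)`. -/
def halfSpace (r : ℝ) (p : Fin n × Bool) : Set (Euc n) :=
  {x | r < (if p.2 then 1 else -1) * x p.1}

lemma isOpen_halfSpace (r : ℝ) (p : Fin n × Bool) : IsOpen (halfSpace r p) :=
  isOpen_lt continuous_const (continuous_const.mul (contDiff_coord (r := 0) p.1).continuous)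

lemma convex_halfSpace (r : ℝ) (p : Fin n × Bool) : Convex ℝ (halfSpace r p) := by
  have : halfSpace r p = {x | r < ((if p.2 then (1 : ℝ) else -1) •
      (EuclideanSpace.proj p.1 : Euc n →L[ℝ] ℝ)) x} := by
    ext x
    simp only [halfSpace, mem_ofPred_eq]
    split_ifs <;> simp
  rw [this]
  exact convex_halfSpace_gt (LinearMap.isLinear (ContinuousLinearMap.toLinearMap _)) r

lemma lt_norm_of_mem_halfSpace {r : ℝ} {p : Fin n × Bool} {x : Euc n} (hx : x ∈ halfSpace r p) :
    r < ‖x‖ := by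
  refine lt_of_lt_of_le hx ((le_abs_self _).trans ?_)
  rw [abs_mul]
  have : |(if p.2 then (1 : ℝ) else -1)| = 1 := by split_ifs <;> simp
  rw [this, one_mul]
  exact PiLp.norm_apply_le x p.1

lemma exists_mem_halfSpace {r : ℝ} (hr : 0 ≤ r) {x : Euc n} (hx : Real.sqrt n * r < ‖x‖) :
    ∃ p, x ∈ halfSpace r p := by
  by_contra! hcon
  have h1 : ∀ i, |x i| ≤ r := by
    intro i
    have h2 := hcon (i, true)
    have h3 := hcon (i, false)
    simp only [halfSpace, mem_ofPred_eq, not_lt, if_true, one_mul] at h2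
    simp only [halfSpace, mem_ofPred_eq, not_lt, Bool.false_eq_true, if_false] at h3
    exact abs_le.2 ⟨by linarith, h2⟩
  have h4 : ‖x‖ ^ 2 ≤ (Real.sqrt n * r) ^ 2 := by
    rw [EuclideanSpace.norm_sq_eq, mul_pow, Real.sq_sqrt (Nat.cast_nonneg n)]
    calc ∑ i, ‖x i‖ ^ 2 ≤ ∑ _i : Fin n, r ^ 2 := Finset.sum_le_sum fun i _ =>
          pow_le_pow_left₀ (norm_nonneg _) (h1 i) 2
      _ = n * r ^ 2 := by simp
  exact absurd (abs_le_of_sq_le_sq' h4 (by positivity)).2 (not_le.2 hx)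

/-- Half-spaces belonging to three different axes have a common point. -/
lemma exists_mem_three_halfSpaces {r : ℝ} {p q s : Fin n × Bool} (hpq : p.1 ≠ q.1)
    (hps : p.1 ≠ s.1) (hqs : q.1 ≠ s.1) :
    ∃ x, x ∈ halfSpace r p ∧ x ∈ halfSpace r q ∧ x ∈ halfSpace r s := by
  refine ⟨WithLp.toLp 2 fun k => (if k = p.1 then (if p.2 then 1 else -1)
    else if k = q.1 then (if q.2 then 1 else -1) else (if s.2 then 1 else -1)) * (r + 1), ?_, ?_, ?_⟩
  · simp only [halfSpace, mem_ofPred_eq, if_true]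
    split_ifs <;> linarith
  · simp only [halfSpace, mem_ofPred_eq, hpq.symm, if_true, if_false]
    split_ifs <;> linarith
  · simp only [halfSpace, mem_ofPred_eq, hps.symm, hqs.symm, if_false]
    split_ifs <;> linarith

/-- A closed one-form of class `C¹` near infinity of `ℝⁿ`, `n ≥ 3`, is exact near infinity. The
region is covered by half-spaces `{± x_i > r}`, which are convex, so that the form has a primitive on
each. The constants can be chosen consistently, since three half-spaces belonging to different axes
have a common point. -/
lemma exists_primitive_of_closed (hn : 3 ≤ n) {β : Fin n → Euc n → ℝ} {r : ℝ} (hr : 0 < r)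
    (hβ : ∀ k x, r < ‖x‖ → ContDiffAt ℝ 1 (β k) x)
    (hc : ∀ j k x, r < ‖x‖ → pd j (β k) x = pd k (β j) x) :
    ∃ f : Euc n → ℝ, ∀ x, Real.sqrt n * r < ‖x‖ →
      ContDiffAt ℝ 2 f x ∧ ∀ k, pd k f x = β k x := by
  set B : Euc n → Euc n →L[ℝ] ℝ := fun x => ∑ k, β k x • (EuclideanSpace.proj k : Euc n →L[ℝ] ℝ)
    with hB0
  have hBd : ∀ x, r < ‖x‖ → HasFDerivAt B (∑ k, (fderiv ℝ (β k) x).smulRight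
      (EuclideanSpace.proj k : Euc n →L[ℝ] ℝ)) x := by
    intro x hx
    refine HasFDerivAt.fun_sum fun k _ => ?_
    exact ((hβ k x hx).differentiableAt (by simp)).hasFDerivAt.smul_const
      (EuclideanSpace.proj k : Euc n →L[ℝ] ℝ)
  have hBs : ∀ x, r < ‖x‖ → ∀ v w, fderiv ℝ B x v w = fderiv ℝ B x w v := by
    intro x hx v w
    rw [(hBd x hx).fderiv]
    have hp : ∀ (k : Fin n) (v : Euc n), (EuclideanSpace.proj k : Euc n →L[ℝ] ℝ) v = v k :=
      fun k v => rfl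
    have hs : ∀ (L : Euc n →L[ℝ] ℝ) (c : ℝ) (v : Euc n), (c • L) v = c * L v := fun L c v => rfl
    simp only [sum_apply, ContinuousLinearMap.smulRight_apply, hs, hp,
      fderiv_apply_eq_sum_pd, Finset.sum_mul]
    rw [Finset.sum_comm]
    refine Finset.sum_congr rfl fun j _ => Finset.sum_congr rfl fun k _ => ?_
    rw [hc j k x hx]; ring
  have hex : ∀ p, ∃ f : Euc n → ℝ, ∀ x ∈ halfSpace r p, HasFDerivAt f (B x) x := fun p =>
    (convex_halfSpace r p).exists_forall_hasFDerivAt_of_fderiv_symmetric (isOpen_halfSpace r p)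
      (fun x hx => (hBd x (lt_norm_of_mem_halfSpace hx)).differentiableAt.differentiableWithinAt)
      (fun x hx => hBs x (lt_norm_of_mem_halfSpace hx))
  -- two primitives differ by a constant on the intersection of their domains
  have hconst : ∀ p q (f g : Euc n → ℝ), (∀ x ∈ halfSpace r p, HasFDerivAt f (B x) x) →
      (∀ x ∈ halfSpace r q, HasFDerivAt g (B x) x) →
      ∃ a, ∀ x ∈ halfSpace r p ∩ halfSpace r q, f x - g x = a := by
    intro p q f g hf hg
    have h1 : ∀ x ∈ halfSpace r p ∩ halfSpace r q,
        HasFDerivAt (fun x => f x - g x) (0 : Euc n →L[ℝ] ℝ) x := by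
      intro x hx
      have := (hf x hx.1).sub (hg x hx.2)
      rwa [sub_self] at this
    exact ((isOpen_halfSpace r p).inter (isOpen_halfSpace r q)).exists_is_const_of_fderiv_eq_zero
      ((convex_halfSpace r p).inter (convex_halfSpace r q)).isPreconnected
      (fun x hx => (h1 x hx).differentiableAt.differentiableWithinAt) fun x hx => (h1 x hx).fderiv
  have hshift : ∀ p q (f : Euc n → ℝ), (∀ x ∈ halfSpace r p, HasFDerivAt f (B x) x) →
      ∃ g : Euc n → ℝ, (∀ x ∈ halfSpace r q, HasFDerivAt g (B x) x) ∧
        ∀ x ∈ halfSpace r p ∩ halfSpace r q, f x = g x := by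
    intro p q f hf
    obtain ⟨g, hg⟩ := hex q
    obtain ⟨a, ha⟩ := hconst p q f g hf hg
    exact ⟨fun x => g x + a, fun x hx => (hg x hx).add_const a, fun x hx => by
      linarith [ha x hx]⟩
  set i0 : Fin n := ⟨0, by omega⟩
  set i1 : Fin n := ⟨1, by omega⟩
  set i2 : Fin n := ⟨2, by omega⟩
  have h01 : i0 ≠ i1 := by simp [i0, i1]
  have h02 : i0 ≠ i2 := by simp [i0, i2]
  have h12 : i1 ≠ i2 := by simp [i1, i2]
  obtain ⟨f0, hf0⟩ := hex (i0, true)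
  choose f1 hf1 hf1' using fun q => hshift (i0, true) q f0 hf0
  obtain ⟨f2, hf2, hf2'⟩ := hshift (i1, true) (i0, false) (f1 (i1, true)) (hf1 _)
  set F : Fin n × Bool → Euc n → ℝ := fun p => if p = (i0, false) then f2 else f1 p with hF
  have hFd : ∀ p, ∀ x ∈ halfSpace r p, HasFDerivAt (F p) (B x) x := by
    intro p x hx
    simp only [hF]
    split_ifs with h
    · subst h; exact hf2 x hx
    · exact hf1 p x hx
  -- agreement is transitive along triples of half-spaces with distinct axes
  have htrans : ∀ p q s, p.1 ≠ q.1 → p.1 ≠ s.1 → q.1 ≠ s.1 →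
      (∀ x ∈ halfSpace r p ∩ halfSpace r q, F p x = F q x) →
      (∀ x ∈ halfSpace r q ∩ halfSpace r s, F q x = F s x) →
      ∀ x ∈ halfSpace r p ∩ halfSpace r s, F p x = F s x := by
    intro p q s h1 h2 h3 hpq hqs x hx
    obtain ⟨a, ha⟩ := hconst p s _ _ (hFd p) (hFd s)
    obtain ⟨y, hy1, hy2, hy3⟩ := exists_mem_three_halfSpaces (r := r) h1 h2 h3
    have h4 := ha y ⟨hy1, hy3⟩
    have h5 := hpq y ⟨hy1, hy2⟩
    have h6 := hqs y ⟨hy2, hy3⟩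
    linarith [ha x hx]
  have hbase : ∀ q, q.1 ≠ i0 → ∀ x ∈ halfSpace r (i0, true) ∩ halfSpace r q,
      F (i0, true) x = F q x := by
    intro q hq x hx
    have e1 : F (i0, true) = f1 (i0, true) := by simp [hF]
    have e2 : F q = f1 q := by
      have : q ≠ (i0, false) := fun h => hq (by rw [h])
      simp [hF, this]
    rw [e1, e2, ← hf1' q x hx, hf1' (i0, true) x ⟨hx.1, hx.1⟩]
  have hA : ∀ p q, p.1 ≠ i0 → q.1 ≠ i0 → p.1 ≠ q.1 →
      ∀ x ∈ halfSpace r p ∩ halfSpace r q, F p x = F q x := fun p q hp hq hpq =>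
    htrans p (i0, true) q hp hpq hq.symm (fun x hx => (hbase p hp x hx.symm).symm) (hbase q hq)
  have hneg1 : ∀ x ∈ halfSpace r (i0, false) ∩ halfSpace r (i1, true),
      F (i0, false) x = F (i1, true) x := by
    intro x hx
    have e1 : F (i0, false) = f2 := by simp [hF]
    have e2 : F (i1, true) = f1 (i1, true) := by simp [hF]
    rw [e1, e2, hf2' x hx.symm]
  have hneg2 : ∀ q, q.1 ≠ i0 → q.1 ≠ i1 → ∀ x ∈ halfSpace r (i0, false) ∩ halfSpace r q,
      F (i0, false) x = F q x := fun q hq0 hq1 =>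
    htrans (i0, false) (i1, true) q h01 hq0.symm hq1.symm hneg1
      (hA _ _ h01.symm hq0 hq1.symm)
  have hneg : ∀ q, q.1 ≠ i0 → ∀ x ∈ halfSpace r (i0, false) ∩ halfSpace r q,
      F (i0, false) x = F q x := by
    intro q hq
    by_cases hq1 : q.1 = i1
    · exact htrans (i0, false) (i2, true) q h02 hq.symm (by rw [hq1]; exact h12.symm)
        (hneg2 (i2, true) h02.symm h12.symm) (hA _ _ h02.symm hq (by rw [hq1]; exact h12.symm))
    · exact hneg2 q hq hq1
  have hzero : ∀ b q, q.1 ≠ i0 → ∀ x ∈ halfSpace r (i0, b) ∩ halfSpace r q,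
      F (i0, b) x = F q x := by
    intro b q hq
    cases b
    · exact hneg q hq
    · exact hbase q hq
  have hagree : ∀ p q x, x ∈ halfSpace r p → x ∈ halfSpace r q → F p x = F q x := by
    rintro ⟨i, b⟩ ⟨j, c⟩ x hx hy
    by_cases hij : i = j
    · subst hij
      have : b = c := by
        simp only [halfSpace, mem_ofPred_eq] at hx hy
        cases b <;> cases c <;> simp only [if_true, if_false, Bool.false_eq_true] at hx hy ⊢
        all_goals exact absurd hx (by linarith)
      rw [this]
    · by_cases hi : i = i0
      · subst hi; exact hzero b _ (Ne.symm hij) x ⟨hx, hy⟩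
      · by_cases hj : j = i0
        · subst hj; exact (hzero c _ hi x ⟨hy, hx⟩).symm
        · exact hA _ _ hi hj hij x ⟨hx, hy⟩
  classical
  set f : Euc n → ℝ := fun x =>
    if h : ∃ p, x ∈ halfSpace r p then F h.choose x else 0 with hf
  have hfF : ∀ p x, x ∈ halfSpace r p → f x = F p x := by
    intro p x hx
    have h : ∃ p, x ∈ halfSpace r p := ⟨p, hx⟩
    simp only [hf, dif_pos h]
    exact hagree _ _ x h.choose_spec hx
  have hfd : ∀ p, ∀ x ∈ halfSpace r p, HasFDerivAt f (B x) x := fun p x hx =>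
    (hFd p x hx).congr_of_eventuallyEq
      (Filter.mem_of_superset ((isOpen_halfSpace r p).mem_nhds hx) fun y hy => hfF p y hy)
  have hpd : ∀ p, ∀ x ∈ halfSpace r p, ∀ k, pd k f x = β k x := by
    intro p x hx k
    rw [pd, (hfd p x hx).fderiv]
    simp [hB0, stdVec_apply]
  refine ⟨f, fun x hx => ?_⟩
  obtain ⟨p, hp⟩ := exists_mem_halfSpace hr.le hx
  have hev : ∀ᶠ y in 𝓝 x, y ∈ halfSpace r p := (isOpen_halfSpace r p).mem_nhds hp
  exact ⟨contDiffAt_two_of_pd (hev.mono fun y hy => (hfd p y hy).differentiableAt) fun k =>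
    (hβ k x (lt_norm_of_mem_halfSpace hp)).congr_of_eventuallyEq
      (hev.mono fun y hy => hpd p y hy k), hpd p x hp⟩

/-- The flux of `β ∧ ω^{m-1}` through large spheres vanishes for closed `β`. -/
lemma IsKahlerOn.sphereFlux_closed {m : ℕ} (hm : 2 ≤ m) {G J : Euc (2 * m) → SqMat (2 * m)}
    {r : ℝ} (hr : 0 < r) (h : IsKahlerOn G J {x | r < ‖x‖}) {β : Fin (2 * m) → Euc (2 * m) → ℝ}
    (hβ : ∀ k x, r < ‖x‖ → ContDiffAt ℝ 1 (β k) x)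
    (hc : ∀ j k x, r < ‖x‖ → pd j (β k) x = pd k (β j) x) :
    ∀ᶠ t in atTop, sphereFlux (fluxField G J β) t = 0 := by
  have hm0 : 0 < m := by omega
  obtain ⟨f, hf⟩ := exists_primitive_of_closed (by omega) hr hβ hc
  set R' := max r (Real.sqrt ((2 * m : ℕ) : ℝ) * r)
  have hR'r : r ≤ R' := le_max_left _ _
  have hR' : ∀ x : Euc (2 * m), R' < ‖x‖ → Real.sqrt ((2 * m : ℕ) : ℝ) * r < ‖x‖ := fun x hx =>
    (le_max_right _ _).trans_lt hx
  filter_upwards [eventually_gt_atTop R'] with t ht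
  have hB : ∀ x, R' < ‖x‖ → CMatAt 1 (fluxMat G J) x := fun x hx =>
    h.smooth_fluxMat (hR'r.trans_lt hx)
  have hfs : ∀ x, R' < ‖x‖ → ContDiffAt ℝ 1 f x := fun x hx => (hf x (hR' x hx)).1.of_le (by norm_num)
  have h0 := sphereIntegral_div_skew (by omega) (Z := fun x => f x • fluxMat G J x)
    (hr.trans_le hR'r) (fun x hx => CMatAt.smul (hfs x hx) (hB x hx))
    (fun x hx j k => by
      simp only [Matrix.smul_apply, smul_eq_mul]
      rw [h.fluxMat_skew (hR'r.trans_lt hx) j k]; ring) ht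
  rw [← h0]
  refine sphereIntegral_congr ((hr.le.trans hR'r).trans ht.le) fun x hx => ?_
  have hxR : R' < ‖x‖ := by rw [hx]; exact ht
  have hxr : x ∈ {x : Euc (2 * m) | r < ‖x‖} := hR'r.trans_lt hxR
  refine Finset.sum_congr rfl fun a _ => ?_
  congr 1
  have h1 : ∀ j, pd j (fun y => (f y • fluxMat G J y) j a) x
      = β j x * fluxMat G J x j a + f x * pd j (fun y => fluxMat G J y j a) x := by
    intro j
    have : (fun y => (f y • fluxMat G J y) j a) = fun y => f y * fluxMat G J y j a := rfl
    rw [this, pd_mul ((hfs x hxR).differentiableAt (by simp)) ((hB x hxR).diff (by simp) j a),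
      (hf x (hR' x hxR)).2 j]
  have h2 : ∑ j, pd j (fun y => fluxMat G J y j a) x = 0 := by
    have h3 := h.div_fluxMat hm0 hxr a
    rw [← neg_eq_zero, ← h3, ← Finset.sum_neg_distrib]
    refine Finset.sum_congr rfl fun l _ => ?_
    rw [← pd_neg]
    exact pd_congr ((h.eventually_mem hxr).mono fun y hy => by
      exact (h.fluxMat_skew hy a l).symm) l
  simp only [h1, Finset.sum_add_distrib, ← Finset.mul_sum, h2, mul_zero, add_zero, fluxField]
  exact Finset.sum_congr rfl fun j _ => mul_comm _ _

end Exactness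

/-! ### Local parametrizations of a manifold -/

section Parametrization

variable {n : ℕ} {M : Type*} [TopologicalSpace M] [ChartedSpace (Euc n) M]

/-- `Φ` is a smooth local parametrization of the manifold `M` near `x`. -/
abbrev IsParam (Φ : Euc n → M) (x : Euc n) : Prop :=
  IsLocalDiffeomorphAt 𝓘(ℝ, Euc n) 𝓘(ℝ, Euc n) ∞ Φ x

/-- The differential of a map `ℝⁿ → M`; the tangent spaces of `M` are copies of `ℝⁿ`. -/
def dPar (Φ : Euc n → M) (x : Euc n) : Euc n →L[ℝ] Euc n :=
  mfderiv 𝓘(ℝ, Euc n) 𝓘(ℝ, Euc n) Φ x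

lemma dPar_congr {Φ Ψ : Euc n → M} {x : Euc n} (h : Φ =ᶠ[𝓝 x] Ψ) : dPar Φ x = dPar Ψ x :=
  h.mfderiv_eq

lemma IsParam.eventually {Φ : Euc n → M} {x : Euc n} (h : IsParam Φ x) :
    ∀ᶠ y in 𝓝 x, IsParam Φ y := by
  obtain ⟨Ξ, hx, he⟩ := h
  filter_upwards [Ξ.open_source.mem_nhds hx] with y hy using ⟨Ξ, hy, he⟩

lemma IsParam.exists_equiv {Φ : Euc n → M} {x : Euc n} (h : IsParam Φ x) :
    ∃ E : Euc n ≃L[ℝ] Euc n, dPar Φ x = E :=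
  ⟨h.mfderivToContinuousLinearEquiv (by simp), rfl⟩

lemma isParam_symm_of_mem_maximalAtlas {e : OpenPartialHomeomorph M (Euc n)}
    (he : e ∈ IsManifold.maximalAtlas 𝓘(ℝ, Euc n) ∞ M) {x : Euc n} (hx : x ∈ e.target) :
    IsParam e.symm x :=
  ⟨{ toPartialEquiv := e.symm.toPartialEquiv
     open_source := e.open_target
     open_target := e.open_source
     contMDiffOn_toFun := contMDiffOn_symm_of_mem_maximalAtlas he
     contMDiffOn_invFun := contMDiffOn_of_mem_maximalAtlas he }, hx, fun _ _ => rfl⟩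

section Smooth

variable [IsManifold 𝓘(ℝ, Euc n) ∞ M]

/-- Local parametrizations are inverse to charts of the maximal atlas. -/
lemma IsParam.exists_chart {Φ : Euc n → M} {x : Euc n} (h : IsParam Φ x) :
    ∃ e ∈ IsManifold.maximalAtlas 𝓘(ℝ, Euc n) ∞ M, x ∈ e.target ∧ EqOn Φ e.symm e.target := by
  obtain ⟨Ξ, hx, he⟩ := h
  refine ⟨Ξ.toOpenPartialHomeomorph.symm, ?_, hx, he⟩
  refine mem_maximalAtlas_iff.2 fun e' he' => ?_
  have h1 := contMDiffOn_of_mem_maximalAtlas (I := 𝓘(ℝ, Euc n)) (n := ∞)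
    (IsManifold.subset_maximalAtlas he')
  have h2 := contMDiffOn_symm_of_mem_maximalAtlas (I := 𝓘(ℝ, Euc n)) (n := ∞)
    (IsManifold.subset_maximalAtlas he')
  have h3 : ContMDiffOn 𝓘(ℝ, Euc n) 𝓘(ℝ, Euc n) ∞ (Ξ.toOpenPartialHomeomorph ≫ₕ e')
      (Ξ.toOpenPartialHomeomorph ≫ₕ e').source :=
    h1.comp (Ξ.contMDiffOn_toFun.mono fun y hy => hy.1) fun y hy => hy.2
  have h4 : ContMDiffOn 𝓘(ℝ, Euc n) 𝓘(ℝ, Euc n) ∞ (Ξ.toOpenPartialHomeomorph ≫ₕ e').symm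
      (Ξ.toOpenPartialHomeomorph ≫ₕ e').target :=
    Ξ.contMDiffOn_invFun.comp (h2.mono fun y hy => hy.1) fun y hy => hy.2
  have key : Ξ.toOpenPartialHomeomorph ≫ₕ e' ∈ contDiffGroupoid ∞ 𝓘(ℝ, Euc n) := by
    rw [contDiffGroupoid, mem_groupoid_of_pregroupoid]
    simp only [contDiffPregroupoid, modelWithCornersSelf_coe, modelWithCornersSelf_coe_symm,
      Function.id_comp, Function.comp_id, preimage_id, range_id, inter_univ]
    exact ⟨contMDiffOn_iff_contDiffOn.1 h3, contMDiffOn_iff_contDiffOn.1 h4⟩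
  refine ⟨by rwa [OpenPartialHomeomorph.symm_symm], ?_⟩
  have := (contDiffGroupoid ∞ 𝓘(ℝ, Euc n)).symm key
  rwa [OpenPartialHomeomorph.trans_symm_eq_symm_trans_symm] at this

end Smooth

/-- The transition map between two local parametrizations. -/
lemma IsParam.exists_transition {Φ Ψ : Euc n → M} {x y : Euc n} (hΦ : IsParam Φ x)
    (hΨ : IsParam Ψ y) (hxy : Φ x = Ψ y) :
    ∃ φ : Euc n → Euc n, φ x = y ∧ ContDiffAt ℝ ∞ φ x ∧ ∀ᶠ z in 𝓝 x, Φ z = Ψ (φ z) := by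
  refine ⟨hΨ.localInverse ∘ Φ, ?_, ?_, ?_⟩
  · simp only [Function.comp_apply, hxy]
    exact hΨ.localInverse_left_inv hΨ.localInverse_mem_target
  · rw [← contMDiffAt_iff_contDiffAt]
    refine ContMDiffAt.comp x ?_ hΦ.contMDiffAt
    rw [hxy]
    exact hΨ.localInverse_contMDiffAt
  · have h1 : Ψ ∘ hΨ.localInverse =ᶠ[𝓝 (Φ x)] id := by
      rw [hxy]; exact hΨ.localInverse_eventuallyEq_right
    exact (hΦ.contMDiffAt.continuousAt.eventually h1).mono fun z hz => hz.symm

/-- The chain rule for a change of parametrization. -/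
lemma dPar_comp {Φ Ψ : Euc n → M} {φ : Euc n → Euc n} {x : Euc n}
    (hΨ : IsParam Ψ (φ x)) (hφ : DifferentiableAt ℝ φ x) (h : ∀ᶠ z in 𝓝 x, Φ z = Ψ (φ z)) :
    dPar Φ x = (dPar Ψ (φ x)).comp (fderiv ℝ φ x) := by
  have h1 : Φ =ᶠ[𝓝 x] Ψ ∘ φ := h
  rw [dPar_congr h1]
  have h2 := mfderiv_comp x (I := 𝓘(ℝ, Euc n)) (I' := 𝓘(ℝ, Euc n)) (I'' := 𝓘(ℝ, Euc n))
    (hΨ.mdifferentiableAt (by simp)) hφ.mdifferentiableAt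
  rw [mfderiv_eq_fderiv] at h2
  exact h2

lemma sum_smul_stdVec (v : Euc n) : ∑ k, v k • stdVec k = v := by
  ext j
  simp [stdVec_apply]

lemma clm_apply_eq_sum {F : Type*} [AddCommMonoid F] [Module ℝ F] [TopologicalSpace F]
    (T : Euc n →L[ℝ] F) (v : Euc n) : T v = ∑ k, v k • T (stdVec k) := by
  conv_lhs => rw [← sum_smul_stdVec v]
  simp

lemma fderiv_stdVec_apply {φ : Euc n → Euc n} {x : Euc n} (hφ : DifferentiableAt ℝ φ x)
    (a k : Fin n) : (fderiv ℝ φ x (stdVec k)) a = jac φ x a k := by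
  have h1 := (EuclideanSpace.proj a : Euc n →L[ℝ] ℝ).hasFDerivAt.comp x hφ.hasFDerivAt
  have h2 : fderiv ℝ (fun y => φ y a) x
      = (EuclideanSpace.proj a : Euc n →L[ℝ] ℝ).comp (fderiv ℝ φ x) := h1.fderiv
  simp [jac, pd, h2]

/-- The coordinate vectors of two parametrizations that differ by the transition map `φ`. -/
lemma dPar_comp_stdVec {Φ Ψ : Euc n → M} {φ : Euc n → Euc n} {x : Euc n}
    (hΨ : IsParam Ψ (φ x)) (hφ : DifferentiableAt ℝ φ x) (h : ∀ᶠ z in 𝓝 x, Φ z = Ψ (φ z))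
    (k : Fin n) : dPar Φ x (stdVec k) = ∑ a, jac φ x a k • dPar Ψ (φ x) (stdVec a) := by
  rw [dPar_comp hΨ hφ h, ContinuousLinearMap.comp_apply, clm_apply_eq_sum (dPar Ψ (φ x))]
  simp only [fderiv_stdVec_apply hφ]

lemma jac_det_ne {Φ Ψ : Euc n → M} {φ : Euc n → Euc n} {x : Euc n} (hΦ : IsParam Φ x)
    (hΨ : IsParam Ψ (φ x)) (hφ : DifferentiableAt ℝ φ x) (h : ∀ᶠ z in 𝓝 x, Φ z = Ψ (φ z)) :
    (jac φ x).det ≠ 0 := by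
  obtain ⟨E, hE⟩ := hΦ.exists_equiv
  obtain ⟨E', hE'⟩ := hΨ.exists_equiv
  have h1 := dPar_comp hΨ hφ h
  rw [hE, hE'] at h1
  refine Matrix.det_ne_zero_of_left_inverse
    (B := Matrix.of fun k a => (E.symm (E' (stdVec a))) k) ?_
  ext k j
  have h2 : E.symm (E' (fderiv ℝ φ x (stdVec j))) = stdVec j := by
    have h3 : E (stdVec j) = E' (fderiv ℝ φ x (stdVec j)) :=
      congrArg (fun T : Euc n →L[ℝ] Euc n => T (stdVec j)) h1
    rw [← h3, ContinuousLinearEquiv.symm_apply_apply]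
  have h4 := clm_apply_eq_sum ((E.symm : Euc n →L[ℝ] Euc n).comp (E' : Euc n →L[ℝ] Euc n))
    (fderiv ℝ φ x (stdVec j))
  simp only [ContinuousLinearMap.comp_apply, ContinuousLinearEquiv.coe_coe, h2,
    fderiv_stdVec_apply hφ] at h4
  have h5 := congrArg (fun v : Euc n => v k) h4
  simp only [stdVec_apply, WithLp.ofLp_sum, Finset.sum_apply, PiLp.smul_apply, smul_eq_mul] at h5
  simp only [Matrix.mul_apply, Matrix.of_apply, Matrix.one_apply]
  rw [eq_comm] at h5
  convert h5 using 1
  · exact Finset.sum_congr rfl fun a _ => mul_comm _ _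

lemma bilin_sum_sum (B : Euc n →L[ℝ] Euc n →L[ℝ] ℝ) (c d : Fin n → ℝ) (v w : Fin n → Euc n) :
    B (∑ a, c a • v a) (∑ b, d b • w b) = ∑ a, ∑ b, c a * d b * B (v a) (w b) := by
  have hs : ∀ (L : Euc n →L[ℝ] ℝ) (c : ℝ) (v : Euc n), (c • L) v = c * L v := fun L c v => rfl
  have h1 : B (∑ a, c a • v a) = ∑ a, c a • B (v a) := by
    rw [map_sum]; exact Finset.sum_congr rfl fun a _ => map_smul _ _ _
  rw [h1, sum_apply]
  refine Finset.sum_congr rfl fun a _ => ?_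
  rw [hs, map_sum, Finset.mul_sum]
  refine Finset.sum_congr rfl fun b _ => ?_
  rw [map_smul, smul_eq_mul, mul_assoc]

/-! ### Components of tensor fields -/

/-- A one-form at a point, as a linear form on `ℝⁿ`. -/
def formAt (θ : OneForm n M) (p : M) : Euc n →L[ℝ] ℝ := θ p

/-- An endomorphism field at a point, as an endomorphism of `ℝⁿ`. -/
def endAt (J : EndField n M) (p : M) : Euc n →L[ℝ] Euc n := J p

lemma formCoeff_apply (θ : OneForm n M) (Φ : Euc n → M) (k : Fin n) (x : Euc n) :
    formCoeff θ Φ k x = formAt θ (Φ x) (dPar Φ x (stdVec k)) := rfl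

lemma endCoeff_apply (J : EndField n M) (Φ : Euc n → M) (x : Euc n) (l k : Fin n) :
    endCoeff J Φ x l k = ((dPar Φ x).inverse (endAt J (Φ x) (dPar Φ x (stdVec k)))) l := rfl

lemma formCoeff_comp (θ : OneForm n M) {Φ Ψ : Euc n → M} {φ : Euc n → Euc n} {x : Euc n}
    (hΨ : IsParam Ψ (φ x)) (hφ : DifferentiableAt ℝ φ x) (h : ∀ᶠ z in 𝓝 x, Φ z = Ψ (φ z))
    (k : Fin n) : formCoeff θ Φ k x = ∑ a, jac φ x a k * formCoeff θ Ψ a (φ x) := by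
  rw [formCoeff_apply, h.self_of_nhds, dPar_comp_stdVec hΨ hφ h, map_sum]
  simp only [map_smul, smul_eq_mul, formCoeff_apply]

lemma IsParam.apply_dPar (J : EndField n M) {Φ : Euc n → M} {x : Euc n} (h : IsParam Φ x)
    (k : Fin n) : endAt J (Φ x) (dPar Φ x (stdVec k))
      = ∑ l, endCoeff J Φ x l k • dPar Φ x (stdVec l) := by
  obtain ⟨E, hE⟩ := h.exists_equiv
  set w : Euc n := endAt J (Φ x) (dPar Φ x (stdVec k))
  have h1 : ∀ l, endCoeff J Φ x l k = ((dPar Φ x).inverse w) l := fun l => rfl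
  have h2 : dPar Φ x ((dPar Φ x).inverse w) = w := by
    rw [hE, ContinuousLinearMap.inverse_equiv]
    exact E.apply_symm_apply w
  simp only [h1]
  rw [← clm_apply_eq_sum (dPar Φ x), h2]

lemma IsParam.linearIndependent {Φ : Euc n → M} {x : Euc n} (h : IsParam Φ x) {c d : Fin n → ℝ}
    (hcd : ∑ l, c l • dPar Φ x (stdVec l) = ∑ l, d l • dPar Φ x (stdVec l)) : c = d := by
  obtain ⟨E, hE⟩ := h.exists_equiv
  have h1 : ∀ c : Fin n → ℝ, ∑ l, c l • dPar Φ x (stdVec l) = E (WithLp.toLp 2 c) := by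
    intro c
    have := clm_apply_eq_sum (dPar Φ x) (WithLp.toLp 2 c)
    rw [← this, hE]; rfl
  rw [h1, h1] at hcd
  have := E.injective hcd
  exact (WithLp.toLp_injective 2) this

lemma endCoeff_congr (J : EndField n M) {Φ Ψ : Euc n → M} {x : Euc n} (h : Φ =ᶠ[𝓝 x] Ψ) :
    endCoeff J Φ x = endCoeff J Ψ x := by
  ext l k
  rw [endCoeff_apply, endCoeff_apply, dPar_congr h, h.eq_of_nhds]

lemma endCoeff_comp (J : EndField n M) {Φ Ψ : Euc n → M} {φ : Euc n → Euc n} {x : Euc n}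
    (hΦ : IsParam Φ x)
    (hΨ : IsParam Ψ (φ x)) (hφ : DifferentiableAt ℝ φ x) (h : ∀ᶠ z in 𝓝 x, Φ z = Ψ (φ z)) :
    jac φ x * endCoeff J Φ x = endCoeff J Ψ (φ x) * jac φ x := by
  ext a k
  have e1 := hΦ.apply_dPar J k
  rw [h.self_of_nhds, dPar_comp_stdVec hΨ hφ h, map_sum] at e1
  simp only [map_smul, dPar_comp_stdVec hΨ hφ h, hΨ.apply_dPar J, Finset.smul_sum, smul_smul] at e1
  rw [Finset.sum_comm, Finset.sum_comm (f := fun l b => (endCoeff J Φ x l k * jac φ x b l) •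
    dPar Ψ (φ x) (stdVec b))] at e1
  simp only [← Finset.sum_smul] at e1
  have e2 := congrFun (hΨ.linearIndependent e1) a
  simp only [Matrix.mul_apply]
  rw [eq_comm]
  convert e2 using 2
  · exact mul_comm _ _
  · exact mul_comm _ _

section Metric

variable [IsManifold 𝓘(ℝ, Euc n) ∞ M] (g : Metric2 n M) (J : EndField n M)

/-- The metric at a point, as a bilinear form on `ℝⁿ`. -/
def metricAt (p : M) : Euc n →L[ℝ] Euc n →L[ℝ] ℝ := g.inner p

lemma metricCoeff_apply (Φ : Euc n → M) (x : Euc n) (j k : Fin n) :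
    metricCoeff g Φ x j k = metricAt g (Φ x) (dPar Φ x (stdVec j)) (dPar Φ x (stdVec k)) := rfl

lemma metricAt_symm (p : M) (v w : Euc n) : metricAt g p v w = metricAt g p w v := g.symm p v w

lemma metricCoeff_congr {Φ Ψ : Euc n → M} {x : Euc n} (h : Φ =ᶠ[𝓝 x] Ψ) :
    metricCoeff g Φ x = metricCoeff g Ψ x := by
  ext j k
  rw [metricCoeff_apply, metricCoeff_apply, dPar_congr h, h.eq_of_nhds]

lemma metricCoeff_comp {Φ Ψ : Euc n → M} {φ : Euc n → Euc n} {x : Euc n}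
    (hΨ : IsParam Ψ (φ x)) (hφ : DifferentiableAt ℝ φ x) (h : ∀ᶠ z in 𝓝 x, Φ z = Ψ (φ z)) :
    metricCoeff g Φ x = (jac φ x).transpose * metricCoeff g Ψ (φ x) * jac φ x := by
  ext j k
  rw [metricCoeff_apply, dPar_comp_stdVec hΨ hφ h, dPar_comp_stdVec hΨ hφ h, h.self_of_nhds]
  rw [bilin_sum_sum, Finset.sum_comm]
  simp only [Matrix.mul_apply, Matrix.transpose_apply, metricCoeff_apply, Finset.sum_mul]
  exact Finset.sum_congr rfl fun a _ => Finset.sum_congr rfl fun b _ => by ring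

lemma IsParam.kahlerFormCoeff_eq {Φ : Euc n → M} {x : Euc n} (h : IsParam Φ x) :
    kahlerFormCoeff g J Φ x = (endCoeff J Φ x).transpose * metricCoeff g Φ x := by
  ext j k
  have h1 : kahlerFormCoeff g J Φ x j k = metricAt g (Φ x)
    (endAt J (Φ x) (dPar Φ x (stdVec j))) (dPar Φ x (stdVec k)) := rfl
  rw [h1, h.apply_dPar]
  simp only [map_sum, map_smul, sum_apply, Matrix.mul_apply, Matrix.transpose_apply,
    metricCoeff_apply]
  exact Finset.sum_congr rfl fun a _ => rfl

lemma IsParam.posDef_metricCoeff {Φ : Euc n → M} {x : Euc n} (h : IsParam Φ x) :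
    (metricCoeff g Φ x).PosDef := by
  rw [Matrix.posDef_iff_dotProduct_mulVec]
  constructor
  · ext j k
    simp only [Matrix.conjTranspose_apply, star_trivial, metricCoeff_apply]
    exact metricAt_symm g _ _ _
  · intro v hv
    obtain ⟨E, hE⟩ := h.exists_equiv
    have h1 : dotProduct (star v) (Matrix.mulVec (metricCoeff g Φ x) v)
        = metricAt g (Φ x) (dPar Φ x (WithLp.toLp 2 v)) (dPar Φ x (WithLp.toLp 2 v)) := by
      rw [clm_apply_eq_sum (dPar Φ x), bilin_sum_sum]
      simp only [dotProduct, Matrix.mulVec, star_trivial, metricCoeff_apply, Finset.mul_sum]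
      exact Finset.sum_congr rfl fun a _ => Finset.sum_congr rfl fun b _ => by ring
    rw [h1]
    refine g.pos (Φ x) _ fun h0 => hv ?_
    have h2 : E (WithLp.toLp 2 v) = 0 := by
      have : (E : Euc n →L[ℝ] Euc n) (WithLp.toLp 2 v) = 0 := by rw [← hE]; exact h0
      exact this
    have h3 := (map_eq_zero_iff E E.injective).1 h2
    exact (WithLp.toLp_injective 2) h3

variable {g J} in
lemma IsKahler.endCoeff_sq (hK : IsKahler g J) {Φ : Euc n → M} {x : Euc n} (h : IsParam Φ x) :
    endCoeff J Φ x * endCoeff J Φ x = -1 := by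
  ext l k
  have h1 : endAt J (Φ x) (endAt J (Φ x) (dPar Φ x (stdVec k)))
    = -dPar Φ x (stdVec k) := hK.sq_eq_neg (Φ x) _
  have h2 : -dPar Φ x (stdVec k) = ∑ l, (-(1 : Matrix (Fin n) (Fin n) ℝ)) l k • dPar Φ x (stdVec l) := by
    simp [Matrix.one_apply]
  rw [h.apply_dPar, map_sum, h2] at h1
  simp only [map_smul, h.apply_dPar, Finset.smul_sum, smul_smul] at h1
  rw [Finset.sum_comm] at h1
  simp only [← Finset.sum_smul] at h1
  have e2 := congrFun (h.linearIndependent h1) l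
  rw [← e2, Matrix.mul_apply]
  exact Finset.sum_congr rfl fun a _ => mul_comm _ _

variable {g J} in
lemma IsKahler.endCoeff_orth (hK : IsKahler g J) {Φ : Euc n → M} {x : Euc n} (h : IsParam Φ x) :
    (endCoeff J Φ x).transpose * metricCoeff g Φ x * endCoeff J Φ x = metricCoeff g Φ x := by
  ext j k
  have h1 : metricAt g (Φ x) (endAt J (Φ x) (dPar Φ x (stdVec j)))
    (endAt J (Φ x) (dPar Φ x (stdVec k)))
    = metricCoeff g Φ x j k := hK.orthogonal (Φ x) _ _
  rw [← h1, h.apply_dPar, h.apply_dPar]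
  rw [bilin_sum_sum, Finset.sum_comm]
  simp only [Matrix.mul_apply, Matrix.transpose_apply, metricCoeff_apply, Finset.sum_mul]
  exact Finset.sum_congr rfl fun a _ => Finset.sum_congr rfl fun b _ => by ring

end Metric

end Parametrization

/-! ### Regularity of the components of tensor fields -/

section Regularity

variable {n : ℕ} {M : Type*} [TopologicalSpace M] [ChartedSpace (Euc n) M]
  [IsManifold 𝓘(ℝ, Euc n) ∞ M] (g : Metric2 n M) (J : EndField n M)

/-- The coordinate vector fields of a parametrization, as maps into the tangent bundle. -/
lemma IsParam.contMDiffAt_coordVec {Φ : Euc n → M} {x : Euc n} (h : IsParam Φ x) (k : Fin n) :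
    ContMDiffAt 𝓘(ℝ, Euc n) (𝓘(ℝ, Euc n).prod 𝓘(ℝ, Euc n)) 2
      (fun y => (TotalSpace.mk' (Euc n) (E := fun p : M => TangentSpace 𝓘(ℝ, Euc n) p)
        (Φ y) (coordVec Φ y k))) x := by
  have h1 : ContMDiffAt 𝓘(ℝ, Euc n) 𝓘(ℝ, Euc n →L[ℝ] Euc n) 2
      (inTangentCoordinates 𝓘(ℝ, Euc n) 𝓘(ℝ, Euc n) id Φ
        (mfderiv 𝓘(ℝ, Euc n) 𝓘(ℝ, Euc n) Φ) x) x :=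
    (h.contMDiffAt).mfderiv_const (by norm_cast)
  have h2 : ContMDiffAt 𝓘(ℝ, Euc n) (𝓘(ℝ, Euc n).prod 𝓘(ℝ, Euc n)) 2
      (fun y : Euc n => (TotalSpace.mk' (Euc n) (E := fun p : Euc n => TangentSpace 𝓘(ℝ, Euc n) p)
        y (stdVec k))) x := by
    rw [contMDiffAt_totalSpace]
    refine ⟨contMDiffAt_id, ?_⟩
    simpa using contMDiffAt_const
  exact ContMDiffAt.clm_apply_of_inCoordinates (b₁ := id) (b₂ := Φ) h1 h2 
    (h.contMDiffAt.of_le (by norm_cast))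

lemma IsParam.contDiffAt_metricCoeff {Φ : Euc n → M} {x : Euc n} (h : IsParam Φ x) (j k : Fin n) :
    ContDiffAt ℝ 2 (fun y => metricCoeff g Φ y j k) x := by
  have h3 : ContMDiffAt 𝓘(ℝ, Euc n) (𝓘(ℝ, Euc n).prod 𝓘(ℝ)) 2
      (fun y => TotalSpace.mk' ℝ (E := Bundle.Trivial M ℝ) (Φ y)
        (g.inner (Φ y) (coordVec Φ y j) (coordVec Φ y k))) x := by
    apply ContMDiffAt.clm_bundle_apply₂ (F₁ := Euc n) (F₂ := Euc n)
    · exact ContMDiffAt.comp x g.contMDiff.contMDiffAt (h.contMDiffAt.of_le (by norm_cast))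
    · exact h.contMDiffAt_coordVec j
    · exact h.contMDiffAt_coordVec k
  simp only [contMDiffAt_totalSpace] at h3
  exact h3.2.contDiffAt

variable {g J} in
lemma IsKahler.contDiffAt_kahlerFormCoeff (hK : IsKahler g J) {Φ : Euc n → M} {x : Euc n} (h : IsParam Φ x) (j k : Fin n) :
    ContDiffAt ℝ 1 (fun y => kahlerFormCoeff g J Φ y j k) x := by
  have h2 : ContMDiffAt 𝓘(ℝ, Euc n) (𝓘(ℝ, Euc n).prod 𝓘(ℝ, Euc n)) 1
      (fun y => TotalSpace.mk' (Euc n) (E := fun p : M => TangentSpace 𝓘(ℝ, Euc n) p) (Φ y)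
        (J (Φ y) (coordVec Φ y j))) x := by
    apply ContMDiffAt.clm_bundle_apply (F₁ := Euc n)
    · exact ContMDiffAt.comp x hK.contMDiff.contMDiffAt (h.contMDiffAt.of_le (by norm_cast))
    · exact (h.contMDiffAt_coordVec j).of_le (by norm_cast)
  have h3 : ContMDiffAt 𝓘(ℝ, Euc n) (𝓘(ℝ, Euc n).prod 𝓘(ℝ)) 1
      (fun y => TotalSpace.mk' ℝ (E := Bundle.Trivial M ℝ) (Φ y)
        (g.inner (Φ y) (J (Φ y) (coordVec Φ y j)) (coordVec Φ y k))) x := by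
    apply ContMDiffAt.clm_bundle_apply₂ (F₁ := Euc n) (F₂ := Euc n)
    · exact ContMDiffAt.comp x (g.contMDiff.contMDiffAt.of_le (by norm_cast))
        (h.contMDiffAt.of_le (by norm_cast))
    · exact h2
    · exact (h.contMDiffAt_coordVec k).of_le (by norm_cast)
  simp only [contMDiffAt_totalSpace] at h3
  exact h3.2.contDiffAt

lemma IsParam.contDiffAt_formCoeff {θ : OneForm n M} {Φ : Euc n → M} {x : Euc n} (h : IsParam Φ x)
    (hθ : ContMDiffAt 𝓘(ℝ, Euc n) (𝓘(ℝ, Euc n).prod 𝓘(ℝ, Euc n →L[ℝ] ℝ)) 1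
    (fun p : M => TotalSpace.mk' (Euc n →L[ℝ] ℝ)
      (E := fun p : M => TangentSpace 𝓘(ℝ, Euc n) p →L[ℝ] Bundle.Trivial M ℝ p) p (θ p)) (Φ x))
      (k : Fin n) :
    ContDiffAt ℝ 1 (formCoeff θ Φ k) x := by
  have h3 : ContMDiffAt 𝓘(ℝ, Euc n) (𝓘(ℝ, Euc n).prod 𝓘(ℝ)) 1
      (fun y => TotalSpace.mk' ℝ (E := Bundle.Trivial M ℝ) (Φ y)
        (θ (Φ y) (coordVec Φ y k))) x := by
    apply ContMDiffAt.clm_bundle_apply (F₁ := Euc n)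
    · exact ContMDiffAt.comp x hθ (h.contMDiffAt.of_le (by norm_cast))
    · exact (h.contMDiffAt_coordVec k).of_le (by norm_cast)
  simp only [contMDiffAt_totalSpace] at h3
  exact h3.2.contDiffAt


/-- A one-form is `C¹` at a point if its components in the preferred chart there are. -/
lemma contMDiffAt_oneForm {θ : OneForm n M} {p : M}
    (h : ∀ k, ContDiffAt ℝ 1 (formCoeff θ (chartAt (Euc n) p).symm k) (chartAt (Euc n) p p)) :
    ContMDiffAt 𝓘(ℝ, Euc n) (𝓘(ℝ, Euc n).prod 𝓘(ℝ, Euc n →L[ℝ] ℝ)) 1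
    (fun p : M => TotalSpace.mk' (Euc n →L[ℝ] ℝ)
      (E := fun p : M => TangentSpace 𝓘(ℝ, Euc n) p →L[ℝ] Bundle.Trivial M ℝ p) p (θ p)) p := by
  rw [contMDiffAt_hom_bundle]
  refine ⟨contMDiffAt_id, ?_⟩
  have h1 : ContDiffAt ℝ 1 (fun y => ∑ k, formCoeff θ (chartAt (Euc n) p).symm k y •
      (EuclideanSpace.proj k : Euc n →L[ℝ] ℝ)) (chartAt (Euc n) p p) :=
    ContDiffAt.sum fun k _ => (h k).smul contDiffAt_const
  have h0 : ContMDiffAt 𝓘(ℝ, Euc n) 𝓘(ℝ, Euc n →L[ℝ] ℝ) 1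
    ((fun y => ∑ k, formCoeff θ (chartAt (Euc n) p).symm k y •
      (EuclideanSpace.proj k : Euc n →L[ℝ] ℝ)) ∘ (chartAt (Euc n) p)) p :=
    h1.contMDiffAt.comp p (contMDiffAt_of_mem_maximalAtlas (n := 1)
      (IsManifold.chart_mem_maximalAtlas p) (mem_chart_source _ p))
  refine h0.congr_of_eventuallyEq ?_
  filter_upwards [(chartAt (Euc n) p).open_source.mem_nhds (mem_chart_source _ p)] with q hq
  have h2 := TangentBundle.symmL_trivializationAt (I := 𝓘(ℝ, Euc n)) hq
  have h3 : ∀ v : Euc n, ContinuousLinearMap.inCoordinates (Euc n)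
      (fun p : M => TangentSpace 𝓘(ℝ, Euc n) p) ℝ (Bundle.Trivial M ℝ) p q p q (θ q) v
      = formAt θ q (dPar (chartAt (Euc n) p).symm (chartAt (Euc n) p q) v) := by
    intro v
    simp only [ContinuousLinearMap.inCoordinates, ContinuousLinearMap.comp_apply]
    rw [h2]
    simp [formAt, dPar]
    rfl
  ext v
  refine (h3 v).trans ?_
  rw [clm_apply_eq_sum (dPar (chartAt (Euc n) p).symm (chartAt (Euc n) p q)), map_sum]
  simp only [Function.comp_apply, sum_apply]
  refine Finset.sum_congr rfl fun k _ => ?_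
  have h4 : formCoeff θ (chartAt (Euc n) p).symm k (chartAt (Euc n) p q)
      = formAt θ q (dPar (chartAt (Euc n) p).symm (chartAt (Euc n) p q) (stdVec k)) := by
    rw [formCoeff_apply, (chartAt (Euc n) p).left_inv hq]
  rw [h4, map_smul, smul_eq_mul, mul_comm]
  rfl

/-- The set of points near which `Φ` is a local parametrization. -/
def paramDomain (Φ : Euc n → M) : Set (Euc n) := {x | IsParam Φ x}

omit [IsManifold 𝓘(ℝ, Euc n) ∞ M] in
lemma isOpen_paramDomain (Φ : Euc n → M) : IsOpen (paramDomain Φ) :=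
  isOpen_iff_mem_nhds.2 fun _ h => IsParam.eventually h

lemma isMetricOn_metricCoeff (Φ : Euc n → M) : IsMetricOn (metricCoeff g Φ) (paramDomain Φ) where
  isOpen := isOpen_paramDomain Φ
  smooth _ h j k := IsParam.contDiffAt_metricCoeff g h j k
  posDef _ h := IsParam.posDef_metricCoeff g h

lemma christoffel_congr {G H : Euc n → SqMat n} {x : Euc n} (h : G =ᶠ[𝓝 x] H) (l j k : Fin n) :
    christoffel G l j k x = christoffel H l j k x := by
  have h1 : ∀ a b c, pd c (fun y => G y a b) x = pd c (fun y => H y a b) x := fun a b c =>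
    pd_congr (h.mono fun y hy => by simp [hy]) c
  simp only [christoffel, h1, h.eq_of_nhds]

variable {g J} in
lemma IsKahler.cmatAt_endCoeff (hK : IsKahler g J) {Φ : Euc n → M} {x : Euc n}
    (h : IsParam Φ x) : CMatAt 1 (endCoeff J Φ) x := by
  have hG : CMatAt 1 (metricCoeff g Φ) x :=
    CMatAt.of_le (fun j k => h.contDiffAt_metricCoeff g j k) (by norm_num)
  have hd : (metricCoeff g Φ x).det ≠ 0 := (h.posDef_metricCoeff g).det_pos.ne'
  have h1 : CMatAt 1 (kahlerFormCoeff g J Φ) x := fun j k => hK.contDiffAt_kahlerFormCoeff h j k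
  refine (h1.mul (hG.inv hd)).transpose.congr ?_
  filter_upwards [h.eventually] with y hy
  have hu : IsUnit (metricCoeff g Φ y).det :=
    isUnit_iff_ne_zero.2 (hy.posDef_metricCoeff g).det_pos.ne'
  rw [hy.kahlerFormCoeff_eq, Matrix.mul_assoc, Matrix.mul_nonsing_inv _ hu, Matrix.mul_one,
    Matrix.transpose_transpose]

variable {g J} in
/-- In a local parametrization a Kähler structure is given by a metric and an endomorphism field with
the corresponding properties in coordinates. -/
lemma IsKahler.isKahlerOn (hK : IsKahler g J) (Φ : Euc n → M) :
    IsKahlerOn (metricCoeff g Φ) (endCoeff J Φ) (paramDomain Φ) where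
  toIsMetricOn := isMetricOn_metricCoeff g Φ
  smoothJ _ h := hK.cmatAt_endCoeff h
  sq _ h := hK.endCoeff_sq h
  orth _ h := hK.endCoeff_orth h
  parallel x h j := by
    obtain ⟨e, he, hx, hΦ⟩ := IsParam.exists_chart h
    have h1 : Φ =ᶠ[𝓝 x] e.symm := hΦ.eventuallyEq_of_mem (e.open_target.mem_nhds hx)
    have hG : metricCoeff g Φ =ᶠ[𝓝 x] metricCoeff g e.symm :=
      h1.eventuallyEq_nhds.mono fun y hy => metricCoeff_congr g hy
    have hJ : endCoeff J Φ =ᶠ[𝓝 x] endCoeff J e.symm :=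
      h1.eventuallyEq_nhds.mono fun y hy => endCoeff_congr J hy
    ext l k
    have h2 := hK.parallel e he x hx j k l
    rw [pdM_congr hJ, hJ.eq_of_nhds]
    simp only [Matrix.sub_apply, Matrix.mul_apply, chrM, Matrix.of_apply, pdM_apply,
      christoffel_congr hG]
    rw [Finset.sum_sub_distrib] at h2
    have h3 : ∑ i, endCoeff J e.symm x l i * christoffel (metricCoeff g e.symm) i j k x
      = ∑ i, christoffel (metricCoeff g e.symm) i j k x * endCoeff J e.symm x l i :=
      Finset.sum_congr rfl fun i _ => mul_comm _ _
    rw [h3]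
    linarith

lemma metricCoeff_comp_eventually {Φ Ψ : Euc n → M} {φ : Euc n → Euc n} {x : Euc n}
    (hΨ : IsParam Ψ (φ x)) (hφ : ContDiffAt ℝ ∞ φ x) (h : ∀ᶠ z in 𝓝 x, Φ z = Ψ (φ z)) :
    metricCoeff g Φ =ᶠ[𝓝 x] fun y => (jac φ y).transpose * metricCoeff g Ψ (φ y) * jac φ y := by
  have h3 : ContDiffAt ℝ 1 φ x := hφ.of_le (by norm_cast)
  filter_upwards [h.eventually_nhds, hφ.continuousAt.eventually hΨ.eventually,
    h3.eventually (by norm_num)] with y h1 h2 h4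
  exact metricCoeff_comp g h2 (h4.differentiableAt (by norm_num)) h1

/-- The scalar curvature is the same in all parametrizations. -/
lemma scalarCoord_metricCoeff_eq {Φ Ψ : Euc n → M} {x y : Euc n} (hΦ : IsParam Φ x)
    (hΨ : IsParam Ψ y) (hxy : Φ x = Ψ y) :
    scalarCoord (metricCoeff g Φ) x = scalarCoord (metricCoeff g Ψ) y := by
  obtain ⟨φ, rfl, hφ, h⟩ := hΦ.exists_transition hΨ hxy
  exact scalarCoord_transform (isMetricOn_metricCoeff g Φ) (isMetricOn_metricCoeff g Ψ) hΦ hΨ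
    (hφ.of_le (by norm_cast)) (metricCoeff_comp_eventually g hΨ hφ h)

lemma scalarCurvature_apply {Φ : Euc n → M} {x : Euc n} (h : IsParam Φ x) :
    scalarCurvature g (Φ x) = scalarCoord (metricCoeff g Φ) x := by
  refine scalarCoord_metricCoeff_eq g (isParam_symm_of_mem_maximalAtlas
    (IsManifold.chart_mem_maximalAtlas (Φ x)) (mem_chart_target _ _)) h ?_
  exact (chartAt (Euc n) (Φ x)).left_inv (mem_chart_source _ _)

lemma ricciFormCoeff_eq_ricForm (Φ : Euc n → M) (j k : Fin n) (x : Euc n) :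
    ricciFormCoeff g J Φ j k x = ricForm (metricCoeff g Φ) (endCoeff J Φ) j k x := rfl

/-- The Ricci form is a tensor. -/
lemma ricciFormCoeff_comp {Φ Ψ : Euc n → M} {φ : Euc n → Euc n} {x : Euc n} (hΦ : IsParam Φ x)
    (hΨ : IsParam Ψ (φ x)) (hφ : ContDiffAt ℝ ∞ φ x) (h : ∀ᶠ z in 𝓝 x, Φ z = Ψ (φ z))
    (j k : Fin n) :
    ricciFormCoeff g J Φ j k x
      = ∑ a, ∑ b, jac φ x a j * jac φ x b k * ricciFormCoeff g J Ψ a b (φ x) := by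
  have h1 := ricci_transform (isMetricOn_metricCoeff g Φ) (isMetricOn_metricCoeff g Ψ) hΦ hΨ
    (hφ.of_le (by norm_cast)) (metricCoeff_comp_eventually g hΨ hφ h)
  have h2 := endCoeff_comp J hΦ hΨ (hφ.differentiableAt (by simp)) h
  have e1 : (Matrix.of fun a b => ricci (metricCoeff g Φ) a b x)
      = (jac φ x).transpose * (Matrix.of fun a b => ricci (metricCoeff g Ψ) a b (φ x))
        * jac φ x := by
    ext a b
    rw [Matrix.of_apply, h1]
    simp only [Matrix.mul_apply, Matrix.transpose_apply, Matrix.of_apply, Finset.sum_mul]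
    rw [Finset.sum_comm]
    exact Finset.sum_congr rfl fun c _ => Finset.sum_congr rfl fun d _ => by ring
  have e2 : ∀ (Φ : Euc n → M) x, (Matrix.of fun j k => ricciFormCoeff g J Φ j k x)
      = (endCoeff J Φ x).transpose * (Matrix.of fun a b => ricci (metricCoeff g Φ) a b x) := by
    intro Φ x
    ext a b
    simp only [ricciFormCoeff, Matrix.mul_apply, Matrix.transpose_apply, Matrix.of_apply]
  have e3 : (Matrix.of fun j k => ricciFormCoeff g J Φ j k x)
      = (jac φ x).transpose * (Matrix.of fun j k => ricciFormCoeff g J Ψ j k (φ x)) *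
        jac φ x := by
    rw [e2, e2, e1, ← Matrix.mul_assoc, ← Matrix.mul_assoc, ← Matrix.transpose_mul, h2,
      Matrix.transpose_mul]
    simp only [Matrix.mul_assoc]
  have e4 := congrFun (congrFun e3 j) k
  simp only [Matrix.mul_apply, Matrix.transpose_apply, Matrix.of_apply, Finset.sum_mul] at e4
  rw [e4, Finset.sum_comm]
  exact Finset.sum_congr rfl fun c _ => Finset.sum_congr rfl fun d _ => by ring

/-- The exterior derivative of the pull-back of a one-form is the pull-back of the exterior
derivative. -/
lemma pd_pullback {β : Fin n → Euc n → ℝ} {φ : Euc n → Euc n} {x : Euc n}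
    (hβ : ∀ a, DifferentiableAt ℝ (β a) (φ x)) (hφ : ContDiffAt ℝ 2 φ x) (j k : Fin n) :
    pd j (fun y => ∑ a, jac φ y a k * β a (φ y)) x - pd k (fun y => ∑ a, jac φ y a j * β a (φ y)) x
      = ∑ a, ∑ b, jac φ x a j * jac φ x b k * (pd a (β b) (φ x) - pd b (β a) (φ x)) := by
  have hφ1 : DifferentiableAt ℝ φ x := hφ.differentiableAt (by norm_num)
  have hj : ∀ a k, DifferentiableAt ℝ (fun y => jac φ y a k) x := fun a k =>
    (smooth_jac (r := 1) hφ (by norm_num) a k).differentiableAt (by norm_num)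
  have hb : ∀ a, DifferentiableAt ℝ (fun y => β a (φ y)) x := fun a => (hβ a).comp x hφ1
  have h1 : ∀ j k, pd j (fun y => ∑ a, jac φ y a k * β a (φ y)) x
      = ∑ a, (pd j (fun y => jac φ y a k) x * β a (φ x)) +
        ∑ a, ∑ b, jac φ x a j * jac φ x b k * pd a (β b) (φ x) := by
    intro j k
    rw [pd_sum (f := fun a y => jac φ y a k * β a (φ y)) fun a _ => (hj a k).mul (hb a),
      Finset.sum_comm, ← Finset.sum_add_distrib]
    refine Finset.sum_congr rfl fun a _ => ?_
    rw [pd_mul (hj a k) (hb a), pd_comp (hβ a) hφ1, Finset.mul_sum]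
    congr 1
    exact Finset.sum_congr rfl fun b _ => by simp only [jac, Matrix.of_apply]; ring
  rw [h1 j k, h1 k j]
  have h2 : ∀ a, pd j (fun y => jac φ y a k) x = pd k (fun y => jac φ y a j) x :=
    fun a => pd_jac_symm hφ a _ _
  simp only [h2, mul_sub, Finset.sum_sub_distrib]
  rw [Finset.sum_comm (f := fun a b => jac φ x a j * jac φ x b k * pd b (β a) (φ x)),
    add_sub_add_left_eq_sub]
  congr 1
  exact Finset.sum_congr rfl fun b _ => Finset.sum_congr rfl fun a _ => by ring

omit [IsManifold 𝓘(ℝ, Euc n) ∞ M] in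
lemma formCoeff_comp_eventually (θ : OneForm n M) {Φ Ψ : Euc n → M} {φ : Euc n → Euc n} {x : Euc n}
    (hΨ : IsParam Ψ (φ x)) (hφ : ContDiffAt ℝ ∞ φ x) (h : ∀ᶠ z in 𝓝 x, Φ z = Ψ (φ z))
    (k : Fin n) : formCoeff θ Φ k =ᶠ[𝓝 x] fun y => ∑ a, jac φ y a k * formCoeff θ Ψ a (φ y) := by
  have h3 : ContDiffAt ℝ 1 φ x := hφ.of_le (by norm_cast)
  filter_upwards [h.eventually_nhds, hφ.continuousAt.eventually hΨ.eventually,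
    h3.eventually (by norm_num)] with y h1 h2 h4
  exact formCoeff_comp θ h2 (h4.differentiableAt (by norm_num)) h1 k

omit [IsManifold 𝓘(ℝ, Euc n) ∞ M] in
lemma contDiffAt_formCoeff_of_comp (θ : OneForm n M) {Φ Ψ : Euc n → M} {x y : Euc n}
    (hΦ : IsParam Φ x) (hΨ : IsParam Ψ y) (hxy : Φ x = Ψ y)
    (hθ : ∀ a, ContDiffAt ℝ 1 (formCoeff θ Ψ a) y) (k : Fin n) :
    ContDiffAt ℝ 1 (formCoeff θ Φ k) x := by
  obtain ⟨φ, rfl, hφ, h⟩ := hΦ.exists_transition hΨ hxy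
  refine ContDiffAt.congr_of_eventuallyEq ?_ (formCoeff_comp_eventually θ hΨ hφ h k)
  refine ContDiffAt.sum fun a _ => ContDiffAt.mul ?_ ((hθ a).comp x (hφ.of_le
    (by norm_cast)))
  exact smooth_jac (r := 1) (s := 2) (hφ.of_le (by norm_cast)) (by norm_num) a k

/-- The equation `dθ = ρ` at a point does not depend on the parametrization. -/
lemma d_eq_of_comp (θ : OneForm n M) {Φ Ψ : Euc n → M} {x y : Euc n}
    (hΦ : IsParam Φ x) (hΨ : IsParam Ψ y) (hxy : Φ x = Ψ y)
    (hθ : ∀ a, ContDiffAt ℝ 1 (formCoeff θ Ψ a) y)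
    (hd : ∀ j k, pd j (formCoeff θ Ψ k) y - pd k (formCoeff θ Ψ j) y = ricciFormCoeff g J Ψ j k y)
    (j k : Fin n) :
    pd j (formCoeff θ Φ k) x - pd k (formCoeff θ Φ j) x = ricciFormCoeff g J Φ j k x := by
  obtain ⟨φ, rfl, hφ, h⟩ := hΦ.exists_transition hΨ hxy
  rw [pd_congr (formCoeff_comp_eventually θ hΨ hφ h k),
    pd_congr (formCoeff_comp_eventually θ hΨ hφ h j),
    pd_pullback (fun a => (hθ a).differentiableAt (by norm_num))
      (hφ.of_le (by norm_cast)), ricciFormCoeff_comp g J hΦ hΨ hφ h]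
  simp only [hd]

variable {g J} in
lemma IsRicciPrimitiveOn.contDiffAt_formCoeff {θ : OneForm n M} {U : Set M}
    (hθ : IsRicciPrimitiveOn g J θ U) (hU : IsOpen U) {Φ : Euc n → M} {x : Euc n}
    (h : IsParam Φ x) (hx : Φ x ∈ U) (k : Fin n) : ContDiffAt ℝ 1 (formCoeff θ Φ k) x :=
  h.contDiffAt_formCoeff ((hθ.contMDiffOn (Φ x) hx).contMDiffAt (hU.mem_nhds hx)) k

variable {g J} in
lemma IsRicciPrimitiveOn.pd_formCoeff {θ : OneForm n M} {U : Set M}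
    (hθ : IsRicciPrimitiveOn g J θ U) (hU : IsOpen U) {Φ : Euc n → M} {x : Euc n}
    (h : IsParam Φ x) (hx : Φ x ∈ U) (j k : Fin n) :
    pd j (formCoeff θ Φ k) x - pd k (formCoeff θ Φ j) x = ricciFormCoeff g J Φ j k x := by
  set e := chartAt (Euc n) (Φ x)
  have he := IsManifold.chart_mem_maximalAtlas (I := 𝓘(ℝ, Euc n)) (n := ∞) (Φ x)
  have h1 : e (Φ x) ∈ e.target := mem_chart_target _ _
  have h2 : e.symm (e (Φ x)) = Φ x := e.left_inv (mem_chart_source _ _)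
  have hp : IsParam e.symm (e (Φ x)) := isParam_symm_of_mem_maximalAtlas he h1
  exact d_eq_of_comp g J θ h hp h2.symm
    (fun a => hθ.contDiffAt_formCoeff hU hp (h2.symm ▸ hx) a)
    (hθ.d_eq e he _ h1 (h2.symm ▸ hx)) j k

/-- A form that satisfies `dθ = ρ` in some parametrization near each point of `U` is a primitive of
the Ricci form on `U`. -/
lemma isRicciPrimitiveOn_of_param {θ : OneForm n M} {U : Set M} 
    (h : ∀ p ∈ U, ∃ (Φ : Euc n → M) (x : Euc n), IsParam Φ x ∧ Φ x = p ∧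
      (∀ a, ContDiffAt ℝ 1 (formCoeff θ Φ a) x) ∧
      ∀ j k, pd j (formCoeff θ Φ k) x - pd k (formCoeff θ Φ j) x = ricciFormCoeff g J Φ j k x) :
    IsRicciPrimitiveOn g J θ U where
  contMDiffOn p hp := by
    obtain ⟨Φ, x, hΦ, rfl, h1, -⟩ := h p hp
    refine (contMDiffAt_oneForm fun k => ?_).contMDiffWithinAt
    exact contDiffAt_formCoeff_of_comp θ (isParam_symm_of_mem_maximalAtlas
      (IsManifold.chart_mem_maximalAtlas (Φ x)) (mem_chart_target _ _)) hΦ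
      ((chartAt (Euc n) (Φ x)).left_inv (mem_chart_source _ _)) h1 k
  d_eq e he y hy hyU j k := by
    obtain ⟨Φ, x, hΦ, hx, h1, h2⟩ := h _ hyU
    exact d_eq_of_comp g J θ (isParam_symm_of_mem_maximalAtlas he hy) hΦ hx.symm h1 h2 j k

end Regularity

/-! ### Asymptotic charts -/

section Chart

namespace AsymptoticChart

variable {n : ℕ} {M : Type*} [TopologicalSpace M] [ChartedSpace (Euc n) M]
  (c : AsymptoticChart n M)

lemma isParam {x : Euc n} (hx : c.R < ‖x‖) : IsParam c.toFun x := c.isLocalDiffeomorphOn ⟨x, hx⟩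

lemma subset_paramDomain {r : ℝ} (hr : c.R ≤ r) : {x | r < ‖x‖} ⊆ paramDomain c.toFun :=
  fun _ hx => c.isParam (hr.trans_lt hx)

lemma continuousAt {x : Euc n} (hx : c.R < ‖x‖) : ContinuousAt c.toFun x :=
  (c.isParam hx).contMDiffAt.continuousAt

lemma map_nhds {x : Euc n} (hx : c.R < ‖x‖) : map c.toFun (𝓝 x) = 𝓝 (c.toFun x) := by
  obtain ⟨Ξ, hx', he⟩ := c.isParam hx
  rw [map_congr (he.eventuallyEq_of_mem (Ξ.open_source.mem_nhds hx')), he hx']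
  exact Ξ.toOpenPartialHomeomorph.map_nhds_eq hx'

lemma isOpen_image {V : Set (Euc n)} (hV : IsOpen V) (h : ∀ x ∈ V, c.R < ‖x‖) :
    IsOpen (c.toFun '' V) := by
  refine isOpen_iff_mem_nhds.2 ?_
  rintro _ ⟨x, hx, rfl⟩
  rw [← c.map_nhds (h x hx)]
  exact image_mem_map (hV.mem_nhds hx)

lemma isOpen_tail {r : ℝ} (hr : c.R ≤ r) : IsOpen (c.tail r) :=
  c.isOpen_image (isOpen_lt_norm r) fun _ hx => hr.trans_lt hx

lemma tail_mono {r s : ℝ} (h : r ≤ s) : c.tail s ⊆ c.tail r :=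
  image_mono fun _ hx => h.trans_lt hx

lemma toFun_mem_tail {r : ℝ} {x : Euc n} (hx : r < ‖x‖) : c.toFun x ∈ c.tail r := ⟨x, hx, rfl⟩

lemma apply_act {γ : Euc n ≃ₗᵢ[ℝ] Euc n} (hγ : γ ∈ c.Γ) {x : Euc n} (hx : c.R < ‖x‖) :
    c.toFun (γ x) = c.toFun x :=
  ((c.eq_iff x (γ x) hx (by rwa [γ.norm_map])).2 ⟨γ, hγ, rfl⟩).symm

lemma norm_eq_of_eq {x y : Euc n} (hx : c.R < ‖x‖) (hy : c.R < ‖y‖) (h : c.toFun x = c.toFun y) :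
    ‖x‖ = ‖y‖ := by
  obtain ⟨γ, -, rfl⟩ := (c.eq_iff x y hx hy).1 h
  exact (γ.norm_map x).symm

lemma eventually_apply_act {γ : Euc n ≃ₗᵢ[ℝ] Euc n} (hγ : γ ∈ c.Γ) {x : Euc n} (hx : c.R < ‖x‖) :
    ∀ᶠ z in 𝓝 x, c.toFun z = c.toFun (γ z) := by
  filter_upwards [(isOpen_lt_norm c.R).mem_nhds hx] with z hz using (c.apply_act hγ hz).symm

lemma contDiff_act (γ : Euc n ≃ₗᵢ[ℝ] Euc n) {k : WithTop ℕ∞} : ContDiff ℝ k γ :=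
  γ.toContinuousLinearEquiv.contDiff

lemma jac_act (γ : Euc n ≃ₗᵢ[ℝ] Euc n) (y : Euc n) :
    jac γ y = Matrix.of fun a k => γ (stdVec k) a := by
  ext a k
  have h1 : fderiv ℝ γ y = (γ.toContinuousLinearEquiv : Euc n →L[ℝ] Euc n) :=
    γ.toContinuousLinearEquiv.fderiv
  rw [← fderiv_stdVec_apply ((contDiff_act γ (k := 1)).differentiable (by norm_num) y), h1]
  rfl

/-- The function `|x|` on the end; it is zero elsewhere. -/
def radius (p : M) : ℝ := by
  classical
  exact if h : ∃ x, c.R < ‖x‖ ∧ c.toFun x = p then ‖h.choose‖ else 0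

lemma radius_toFun {x : Euc n} (hx : c.R < ‖x‖) : c.radius (c.toFun x) = ‖x‖ := by
  have h : ∃ y, c.R < ‖y‖ ∧ c.toFun y = c.toFun x := ⟨x, hx, rfl⟩
  rw [radius, dif_pos h]
  exact c.norm_eq_of_eq h.choose_spec.1 hx h.choose_spec.2

lemma mem_tail_iff {r : ℝ} (hr : c.R ≤ r) {p : M} : p ∈ c.tail r ↔ r < c.radius p := by
  constructor
  · rintro ⟨x, hx, rfl⟩
    rwa [c.radius_toFun (hr.trans_lt hx)]
  · intro h
    by_cases h1 : ∃ x, c.R < ‖x‖ ∧ c.toFun x = p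
    · obtain ⟨x, hx, rfl⟩ := h1
      rw [c.radius_toFun hx] at h
      exact c.toFun_mem_tail h
    · rw [radius, dif_neg h1] at h
      exact absurd h (not_lt.2 (c.R_pos.le.trans hr))

/-- Invariant one-forms on `{|x| > r}` descend to the end. -/
lemma exists_oneForm {r : ℝ} (hr : c.R ≤ r) {β : Fin n → Euc n → ℝ}
    (hβ : ∀ γ ∈ c.Γ, ∀ x, r < ‖x‖ → ∀ k, β k x = ∑ a, jac γ x a k * β a (γ x)) :
    ∃ θ : OneForm n M, ∀ x, r < ‖x‖ → ∀ k, formCoeff θ c.toFun k x = β k x := by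
  classical
  let θ : M → (Euc n →L[ℝ] ℝ) := fun p =>
    if h : ∃ x, r < ‖x‖ ∧ c.toFun x = p then
      (∑ k, β k h.choose • (EuclideanSpace.proj k : Euc n →L[ℝ] ℝ)).comp
        (dPar c.toFun h.choose).inverse else 0
  refine ⟨θ, fun x hx k => ?_⟩
  have h : ∃ y, r < ‖y‖ ∧ c.toFun y = c.toFun x := ⟨x, hx, rfl⟩
  obtain ⟨hy, hyx⟩ := h.choose_spec
  have hθ : θ (c.toFun x) = (∑ k, β k h.choose • (EuclideanSpace.proj k : Euc n →L[ℝ] ℝ)).comp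
      (dPar c.toFun h.choose).inverse := dif_pos h
  set y := h.choose
  obtain ⟨γ, hγ, hγx⟩ := (c.eq_iff x y (hr.trans_lt hx) (hr.trans_lt hy)).1 hyx.symm
  have hP : IsParam c.toFun (γ x) := by rw [hγx]; exact c.isParam (hr.trans_lt hy)
  have hd : DifferentiableAt ℝ γ x := (contDiff_act γ (k := 1)).differentiable (by norm_num) x
  have h1 := dPar_comp_stdVec hP hd (c.eventually_apply_act hγ (hr.trans_lt hx)) k
  have h2 : formCoeff θ c.toFun k x = θ (c.toFun x) (dPar c.toFun x (stdVec k)) := rfl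
  obtain ⟨E, hE⟩ := hP.exists_equiv
  rw [h2, hθ, ← hγx, h1, hβ γ hγ x hx k, hE, ContinuousLinearMap.inverse_equiv]
  have hs : ∀ (L : Euc n →L[ℝ] ℝ) (c : ℝ) (v : Euc n), (c • L) v = c * L v := fun L c v => rfl
  simp [stdVec_apply, sum_apply, hs, mul_comm]

end AsymptoticChart

end Chart

section ChartMetric

namespace AsymptoticChart

variable {n : ℕ} {M : Type*} [TopologicalSpace M] [ChartedSpace (Euc n) M]
  [IsManifold 𝓘(ℝ, Euc n) ∞ M] {g : Metric2 n M} {J : EndField n M}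
  {c : AsymptoticChart n M}

lemma isKahlerOn (hK : IsKahler g J) (c : AsymptoticChart n M) {r : ℝ} (hr : c.R ≤ r) :
    IsKahlerOn (metricCoeff g c.toFun) (endCoeff J c.toFun) {x | r < ‖x‖} :=
  (hK.isKahlerOn c.toFun).mono (isOpen_lt_norm r) (c.subset_paramDomain hr)

lemma metricCoeff_act (g : Metric2 n M) (c : AsymptoticChart n M) {γ : Euc n ≃ₗᵢ[ℝ] Euc n}
    (hγ : γ ∈ c.Γ) {x : Euc n} (hx : c.R < ‖x‖) :
    metricCoeff g c.toFun x = (jac γ x).transpose * metricCoeff g c.toFun (γ x) * jac γ x :=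
  metricCoeff_comp g (c.isParam (by rwa [γ.norm_map]))
    ((contDiff_act γ (k := 1)).differentiable (by norm_num) x) (c.eventually_apply_act hγ hx)

omit [IsManifold 𝓘(ℝ, Euc n) ∞ M] in
lemma endCoeff_act (J : EndField n M) (c : AsymptoticChart n M) {γ : Euc n ≃ₗᵢ[ℝ] Euc n}
    (hγ : γ ∈ c.Γ) {x : Euc n} (hx : c.R < ‖x‖) :
    jac γ x * endCoeff J c.toFun x = endCoeff J c.toFun (γ x) * jac γ x :=
  endCoeff_comp J (c.isParam hx) (c.isParam (by rwa [γ.norm_map]))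
    ((contDiff_act γ (k := 1)).differentiable (by norm_num) x) (c.eventually_apply_act hγ hx)

lemma HasFallOff.decayM {τ : ℝ} (h : c.HasFallOff g τ) :
    DecayM τ fun x => metricCoeff g c.toFun x - 1 := fun j k => h.metric j k

lemma HasFallOff.decayM_pdM {τ : ℝ} (h : c.HasFallOff g τ) (l : Fin n) :
    DecayM (τ + 1) (pdM l (metricCoeff g c.toFun)) := fun j k => by
  have := h.deriv j k l
  rw [show -τ - 1 = -(τ + 1) by ring] at this
  exact this

omit [IsManifold 𝓘(ℝ, Euc n) ∞ M] in
/-- Isometries of the group of the end commute with the limit of the complex structure. -/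
lemma jac_mul_limit (hn : 2 ≤ n) {γ : Euc n ≃ₗᵢ[ℝ] Euc n} (hγ : γ ∈ c.Γ) {J₀ : SqMat n}
    (hJ : Tendsto (endCoeff J c.toFun) (Bornology.cobounded (Euc n)) (𝓝 J₀)) (y : Euc n) :
    jac γ y * J₀ = J₀ * jac γ y := by
  have : Nonempty (Fin n) := ⟨⟨0, by omega⟩⟩
  have : NeBot (Bornology.cobounded (Euc n)) := by
    have : Nontrivial (Euc n) := inferInstance
    infer_instance
  have hA : ∀ z, jac γ z = jac γ y := fun z => by rw [jac_act, jac_act]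
  have h1 : Tendsto γ (Bornology.cobounded (Euc n)) (Bornology.cobounded (Euc n)) := by
    rw [← comap_norm_atTop, tendsto_comap_iff]
    refine tendsto_comap.congr fun x => (γ.norm_map x).symm
  refine tendsto_nhds_unique ((tendsto_const_nhds.mul hJ).congr' ?_)
    ((hJ.comp h1).mul tendsto_const_nhds)
  filter_upwards [eventually_lt_norm c.R] with x hx
  rw [← hA x]
  exact endCoeff_act J c hγ hx

end AsymptoticChart

variable {m : ℕ} {M : Type*} [TopologicalSpace M] [ChartedSpace (Euc (2 * m)) M]
  [IsManifold 𝓘(ℝ, Euc (2 * m)) ∞ M] {g : Metric2 (2 * m) M} {J : EndField (2 * m) M}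

/-- On a neighbourhood of infinity, the Ricci form has a primitive for which the flux of
`θ ∧ ω^{m-1}` is asymptotic to that of the mass. -/
lemma AsymptoticChart.exists_primitive (hm : 2 ≤ m) (hK : IsKahler g J)
    (c : AsymptoticChart (2 * m) M) {τ : ℝ} (hτm : (m : ℝ) - 1 < τ) (hc : c.HasFallOff g τ) :
    ∃ r, c.R ≤ r ∧ ∃ θ : OneForm (2 * m) M, IsRicciPrimitiveOn g J θ (c.tail r) ∧
      Tendsto (fun t =>
        sphereFlux (fluxField (metricCoeff g c.toFun) (endCoeff J c.toFun)
          (formCoeff θ c.toFun)) t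
        - (m - 1).factorial / 2 * sphereFlux (massField (metricCoeff g c.toFun)) t)
        atTop (𝓝 0) := by
  set G := metricCoeff g c.toFun
  have hm' : (2 : ℝ) ≤ m := by exact_mod_cast hm
  have hτ : 0 < τ := by linarith
  have hkc := c.isKahlerOn hK le_rfl
  obtain ⟨J₀, hJ, hsq, horth⟩ := hkc.exists_limit_J hτ hc.decayM hc.decayM_pdM (by omega)
  have hJ₀ : J₀.transpose = -J₀ := by
    have h1 : J₀.transpose * J₀ * J₀ = J₀ := by rw [horth, one_mul]
    rw [Matrix.mul_assoc, hsq, Matrix.mul_neg, mul_one] at h1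
    rw [← h1, neg_neg, h1]
  obtain ⟨r, hr, hdet⟩ : ∃ r, c.R ≤ r ∧
      ∀ x, r < ‖x‖ → (gauge (endCoeff J c.toFun) J₀ x).det ≠ 0 := by
    have h1 := eventually_det_gauge hτ hJ hsq
    rw [← comap_norm_atTop, eventually_comap] at h1
    obtain ⟨r, hr⟩ := eventually_atTop.1 h1
    exact ⟨max r c.R, le_max_right _ _, fun x hx =>
      hr ‖x‖ ((le_max_left _ _).trans hx.le) x rfl⟩
  have hk := c.isKahlerOn hK hr
  set β := ricPrim G (endCoeff J c.toFun) J₀ with hβ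
  obtain ⟨θ, hθ⟩ := c.exists_oneForm hr (β := β) fun γ hγ x hx k => by
    have hx0 := hr.trans_lt hx
    have hnear := (isOpen_lt_norm c.R).mem_nhds hx0
    refine ricPrim_equivariant hk hx (by simpa [γ.norm_map] using hx)
      (AsymptoticChart.contDiff_act γ) (A := jac γ x)
      (fun y => by rw [AsymptoticChart.jac_act, AsymptoticChart.jac_act]) ?_ ?_ ?_ k
    · filter_upwards [hnear] with y hy
      rw [show jac γ x = jac γ y by rw [AsymptoticChart.jac_act, AsymptoticChart.jac_act]]
      exact AsymptoticChart.metricCoeff_act g c hγ hy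
    · filter_upwards [hnear] with y hy
      rw [show jac γ x = jac γ y by rw [AsymptoticChart.jac_act, AsymptoticChart.jac_act]]
      exact AsymptoticChart.endCoeff_act J c hγ hy
    · exact AsymptoticChart.jac_mul_limit (by omega) hγ (hJ.tendsto hτ) x
  have hθe : ∀ x, r < ‖x‖ → ∀ k, formCoeff θ c.toFun k =ᶠ[𝓝 x] β k := fun x hx k => by
    filter_upwards [(isOpen_lt_norm r).mem_nhds hx] with y hy using hθ y hy k
  have hR : 0 < r := c.R_pos.trans_le hr
  refine ⟨r, hr, θ, ?_, ?_⟩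
  · refine isRicciPrimitiveOn_of_param g J ?_
    rintro _ ⟨x, hx, rfl⟩
    refine ⟨c.toFun, x, c.isParam (hr.trans_lt hx), rfl, fun a => ?_, fun j k => ?_⟩
    · exact (hk.contDiffAt_ricPrim hx (hdet x hx) a).congr_of_eventuallyEq (hθe x hx a)
    · rw [pd_congr (hθe x hx k), pd_congr (hθe x hx j), ricciFormCoeff_eq_ricForm]
      exact hk.pd_ricPrim hsq hx (hdet x hx) j k
  · have h1 := hk.tendsto_flux_sub hR (by omega) hτ hτm hc.decayM hc.decayM_pdM hJ hsq hJ₀ hdet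
    refine h1.congr' ?_
    filter_upwards [eventually_gt_atTop r] with t ht
    congr 1
    refine sphereFlux_congr (hR.trans ht).le fun a x hx => ?_
    have hx' : r < ‖x‖ := hx ▸ ht
    simp only [fluxField, hθ x hx']
    rfl

end ChartMetric

/-! ### Volume in local parametrizations -/

section Volume

variable {n : ℕ} {M : Type*} [TopologicalSpace M] [ChartedSpace (Euc n) M]
  [IsManifold 𝓘(ℝ, Euc n) ∞ M] (g : Metric2 n M)

/-- The density `√(det g_{jk})` in the parametrization `Φ`. -/
def volDensity (Φ : Euc n → M) (x : Euc n) : ℝ := Real.sqrt (metricCoeff g Φ x).det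

/-- The image under the parametrization `Φ` of the measure `√(det g_{jk}) dx¹ ⋯ dxⁿ` on `U`. -/
def parMeasure [MeasurableSpace M] (Φ : Euc n → M) (U : Set (Euc n)) : Measure M :=
  Measure.map Φ ((volume.restrict U).withDensity fun x => ENNReal.ofReal (volDensity g Φ x))

lemma det_fderiv_eq_det_jac {φ : Euc n → Euc n} {x : Euc n} (hφ : DifferentiableAt ℝ φ x) :
    (fderiv ℝ φ x).det = (jac φ x).det := by
  have h1 : LinearMap.toMatrix (EuclideanSpace.basisFun (Fin n) ℝ).toBasis
      (EuclideanSpace.basisFun (Fin n) ℝ).toBasis (fderiv ℝ φ x : Euc n →ₗ[ℝ] Euc n) = jac φ x := by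
    ext a k
    rw [LinearMap.toMatrix_apply, ← fderiv_stdVec_apply hφ]
    simp [stdVec]
  rw [← h1, LinearMap.det_toMatrix]

lemma volDensity_comp {Φ Ψ : Euc n → M} {φ : Euc n → Euc n} {x : Euc n}
    (hΨ : IsParam Ψ (φ x)) (hφ : DifferentiableAt ℝ φ x) (h : ∀ᶠ z in 𝓝 x, Φ z = Ψ (φ z)) :
    volDensity g Φ x = |(fderiv ℝ φ x).det| * volDensity g Ψ (φ x) := by
  rw [volDensity, metricCoeff_comp g hΨ hφ h, Matrix.det_mul, Matrix.det_mul,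
    Matrix.det_transpose, det_fderiv_eq_det_jac hφ, mul_right_comm, ← pow_two,
    Real.sqrt_mul (sq_nonneg _), Real.sqrt_sq_eq_abs, volDensity]

lemma continuousAt_volDensity {Φ : Euc n → M} {x : Euc n} (h : IsParam Φ x) :
    ContinuousAt (volDensity g Φ) x :=
  ((CMatAt.det (r := 2) fun j k => h.contDiffAt_metricCoeff g j k).continuousAt).sqrt

/-- Change of variables between two parametrizations. -/
lemma lintegral_volDensity_image {Φ Ψ : Euc n → M} {φ : Euc n → Euc n} {S : Set (Euc n)}
    (hS : MeasurableSet S) (hΨ : ∀ x ∈ S, IsParam Ψ (φ x)) (hφ : ∀ x ∈ S, DifferentiableAt ℝ φ x)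
    (h : ∀ x ∈ S, ∀ᶠ z in 𝓝 x, Φ z = Ψ (φ z)) (hi : InjOn φ S) :
    ∫⁻ y in φ '' S, ENNReal.ofReal (volDensity g Ψ y)
      = ∫⁻ x in S, ENNReal.ofReal (volDensity g Φ x) := by
  rw [lintegral_image_eq_lintegral_abs_det_fderiv_mul volume hS
    (fun x hx => (hφ x hx).hasFDerivAt.hasFDerivWithinAt) hi]
  refine setLIntegral_congr_fun hS fun x hx => ?_
  rw [volDensity_comp g (hΨ x hx) (hφ x hx) (h x hx), ENNReal.ofReal_mul (abs_nonneg _)]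

variable [MeasurableSpace M] [BorelSpace M]

omit [IsManifold 𝓘(ℝ, Euc n) ∞ M] in
lemma aemeasurable_param {Φ : Euc n → M} {U : Set (Euc n)} (hU : IsOpen U)
    (hΦ : U ⊆ paramDomain Φ) : AEMeasurable Φ (volume.restrict U) :=
  ContinuousOn.aemeasurable (fun _ hx =>
    (ContMDiffAt.continuousAt (hΦ hx).contMDiffAt).continuousWithinAt) hU.measurableSet

omit [MeasurableSpace M] [BorelSpace M] in
lemma aemeasurable_volDensity {Φ : Euc n → M} {U : Set (Euc n)} (hU : IsOpen U)
    (hΦ : U ⊆ paramDomain Φ) :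
    AEMeasurable (fun x => ENNReal.ofReal (volDensity g Φ x)) (volume.restrict U) :=
  (ContinuousOn.aemeasurable (fun _ hx =>
    (continuousAt_volDensity g (hΦ hx)).continuousWithinAt) hU.measurableSet).ennreal_ofReal

omit [IsManifold 𝓘(ℝ, Euc n) ∞ M] in
lemma measurableSet_preimage_param {Φ : Euc n → M} {U : Set (Euc n)} (hU : IsOpen U)
    (hΦ : U ⊆ paramDomain Φ) {B : Set M} (hB : MeasurableSet B) : MeasurableSet (U ∩ Φ ⁻¹' B) := by
  have hc : ContinuousOn Φ U := fun x hx =>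
    (ContMDiffAt.continuousAt (hΦ hx).contMDiffAt).continuousWithinAt
  have := (continuousOn_iff_continuous_domRestrict.1 hc).measurable hB
  have h2 := hU.measurableSet.subtype_image this
  convert h2 using 1
  ext x
  simp [and_comm]

lemma parMeasure_apply {Φ : Euc n → M} {U : Set (Euc n)} (hU : IsOpen U)
    (hΦ : U ⊆ paramDomain Φ) {B : Set M} (hB : MeasurableSet B) :
    parMeasure g Φ U B = ∫⁻ x in U ∩ Φ ⁻¹' B, ENNReal.ofReal (volDensity g Φ x) := by
  have hm := aemeasurable_param hU hΦ
  have h1 : NullMeasurableSet (Φ ⁻¹' B) (volume.restrict U) := hm.nullMeasurableSet_preimage hB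
  rw [parMeasure, Measure.map_apply_of_aemeasurable
    (hm.mono_ac (withDensity_absolutelyContinuous _ _)) hB, withDensity_apply₀ _ h1,
    Measure.restrict_restrict₀ h1, inter_comm]

lemma parMeasure_chart_le (p : M) : parMeasure g (chartAt (Euc n) p).symm (chartAt (Euc n) p).target
    ≤ riemannianVolume g :=
  le_iSup (fun p : M => parMeasure g (chartAt (Euc n) p).symm (chartAt (Euc n) p).target) p

lemma integral_parMeasure {Φ : Euc n → M} {U : Set (Euc n)} (hU : IsOpen U)
    (hΦ : U ⊆ paramDomain Φ) {h : M → ℝ} (hh : AEStronglyMeasurable h (parMeasure g Φ U)) :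
    ∫ p, h p ∂(parMeasure g Φ U) = ∫ x in U, volDensity g Φ x * h (Φ x) := by
  have hm := aemeasurable_param hU hΦ
  rw [parMeasure, integral_map (hm.mono_ac (withDensity_absolutelyContinuous _ _)) hh,
    integral_withDensity_eq_integral_toReal_smul₀ (aemeasurable_volDensity g hU hΦ)
      (Eventually.of_forall fun _ => ENNReal.ofReal_lt_top)]
  simp only [ENNReal.toReal_ofReal (Real.sqrt_nonneg _), smul_eq_mul, volDensity]

lemma integrableOn_of_parMeasure {Φ : Euc n → M} {U : Set (Euc n)} (hU : IsOpen U)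
    (hΦ : U ⊆ paramDomain Φ) {h : M → ℝ} (hh : Integrable h (parMeasure g Φ U)) :
    IntegrableOn (fun x => volDensity g Φ x * h (Φ x)) U := by
  have hm := aemeasurable_param hU hΦ
  have h1 := hh.comp_aemeasurable (hm.mono_ac (withDensity_absolutelyContinuous _ _))
  rw [integrable_withDensity_iff_integrable_smul₀' (aemeasurable_volDensity g hU hΦ)
      (Eventually.of_forall fun _ => ENNReal.ofReal_lt_top)] at h1
  simpa only [ENNReal.toReal_ofReal (Real.sqrt_nonneg _), smul_eq_mul, volDensity, Function.comp_apply, IntegrableOn]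
    using h1

omit [ChartedSpace (Euc n) M] [IsManifold 𝓘(ℝ, Euc n) ∞ M] in
/-- Measures on a second countable space can be compared locally. -/
lemma measure_le_of_locally [SecondCountableTopology M] {μ ν : Measure M} {O : Set M}
    (h : ∀ p ∈ O, ∃ W, IsOpen W ∧ p ∈ W ∧ ∀ B ⊆ W, MeasurableSet B → μ B ≤ ν B)
    {B : Set M} (hB : MeasurableSet B) (hBO : B ⊆ O) : μ B ≤ ν B := by
  set P : Set (Set M) := {W | W ∈ TopologicalSpace.countableBasis M ∧
    ∀ B ⊆ W, MeasurableSet B → μ B ≤ ν B} ∪ {∅}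
  have hPc : P.Countable := ((TopologicalSpace.countable_countableBasis M).mono
    fun W hW => hW.1).union (countable_singleton _)
  obtain ⟨f, hf⟩ := hPc.exists_eq_range ⟨∅, Or.inr rfl⟩
  have hfP : ∀ i, f i ∈ P := fun i => hf ▸ mem_range_self i
  have hfm : ∀ i, MeasurableSet (f i) := fun i => by
    rcases hfP i with h1 | h1
    · exact (TopologicalSpace.isOpen_of_mem_countableBasis h1.1).measurableSet
    · rw [h1]; exact MeasurableSet.empty
  have hfl : ∀ i, ∀ B ⊆ f i, MeasurableSet B → μ B ≤ ν B := fun i B hB hBm => by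
    rcases hfP i with h1 | h1
    · exact h1.2 B hB hBm
    · rw [h1, subset_empty_iff] at hB
      simp [hB]
  have hcov : B ⊆ ⋃ i, f i := by
    intro p hp
    obtain ⟨W, hW, hpW, hWl⟩ := h p (hBO hp)
    obtain ⟨V, hV, hpV, hVW⟩ :=
      (TopologicalSpace.isBasis_countableBasis M).exists_subset_of_mem_open hpW hW
    have : V ∈ P := Or.inl ⟨hV, fun B hB hBm => hWl B (hB.trans hVW) hBm⟩
    rw [hf] at this
    obtain ⟨i, rfl⟩ := this
    exact mem_iUnion.2 ⟨i, hpV⟩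
  have hBe : B = ⋃ i, B ∩ disjointed f i := by
    rw [← inter_iUnion, iUnion_disjointed, inter_eq_left.2 hcov]
  have hdm : ∀ i, MeasurableSet (B ∩ disjointed f i) := fun i =>
    hB.inter (MeasurableSet.disjointed hfm i)
  have hdd : Pairwise (Function.onFun Disjoint fun i => B ∩ disjointed f i) := fun i j hij =>
    (disjoint_disjointed f hij).mono inter_subset_right inter_subset_right
  rw [hBe, measure_iUnion hdd hdm, measure_iUnion hdd hdm]
  exact ENNReal.tsum_le_tsum fun i =>
    hfl i _ (inter_subset_right.trans (disjointed_subset f i)) (hdm i)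

end Volume

section ChartVolume

namespace AsymptoticChart

variable {n : ℕ} {M : Type*} [TopologicalSpace M] [ChartedSpace (Euc n) M]
  [IsManifold 𝓘(ℝ, Euc n) ∞ M] [MeasurableSpace M] [BorelSpace M]
  (g : Metric2 n M) (c : AsymptoticChart n M)

/-- The image of `√(det g_{jk}) dx¹ ⋯ dxⁿ` under an asymptotic chart, which is `|Γ|` times the
Riemannian measure of the end. -/
def chartMeasure : Measure M := parMeasure g c.toFun {x | c.R < ‖x‖}

/-- Near each point of the end, the measure of an asymptotic chart is `|Γ|` times the Riemannian
measure in a chart of `M`. -/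
lemma exists_chartMeasure_eq {p : M} (hp : p ∈ c.tail c.R) :
    ∃ W, IsOpen W ∧ p ∈ W ∧ ∀ B ⊆ W, MeasurableSet B → c.chartMeasure g B = Nat.card c.Γ *
      parMeasure g (chartAt (Euc n) p).symm (chartAt (Euc n) p).target B := by
  obtain ⟨x₀, hx₀, rfl⟩ := hp
  set e := chartAt (Euc n) (c.toFun x₀)
  have he := IsManifold.chart_mem_maximalAtlas (I := 𝓘(ℝ, Euc n)) (n := ∞) (c.toFun x₀)
  obtain ⟨Ξ, hx₀Ξ, hΞ⟩ := c.isParam hx₀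
  have hex : e.source ∈ 𝓝 (c.toFun x₀) := e.open_source.mem_nhds (mem_chart_source _ _)
  obtain ⟨V, hVs, hV, hx₀V⟩ := mem_nhds_iff.1 (inter_mem (Ξ.open_source.mem_nhds hx₀Ξ)
    (inter_mem ((isOpen_lt_norm c.R).mem_nhds hx₀) ((c.continuousAt hx₀).preimage_mem_nhds hex)))
  have hVR : ∀ x ∈ V, c.R < ‖x‖ := fun x hx => (hVs hx).2.1
  have hVe : ∀ x ∈ V, c.toFun x ∈ e.source := fun x hx => (hVs hx).2.2
  have hinj : InjOn c.toFun V := fun x hx y hy hxy => by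
    rw [hΞ (hVs hx).1, hΞ (hVs hy).1] at hxy
    exact Ξ.toOpenPartialHomeomorph.injOn (hVs hx).1 (hVs hy).1 hxy
  refine ⟨c.toFun '' V, c.isOpen_image hV hVR, ⟨x₀, hx₀V, rfl⟩, fun B hBV hB => ?_⟩
  have hsub := c.subset_paramDomain le_rfl
  have hsube : e.target ⊆ paramDomain e.symm := fun x hx => isParam_symm_of_mem_maximalAtlas he hx
  set S := V ∩ c.toFun ⁻¹' B with hS
  have hSm : MeasurableSet S :=
    measurableSet_preimage_param hV (fun x hx => c.isParam (hVR x hx)) hB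
  have hSR : ∀ x ∈ S, c.R < ‖x‖ := fun x hx => hVR x hx.1
  rw [chartMeasure, parMeasure_apply g (isOpen_lt_norm _) hsub hB,
    parMeasure_apply g e.open_target hsube hB]
  -- the integral over one sheet, in the chart of `M`
  have h1 : ∫⁻ y in e.target ∩ e.symm ⁻¹' B, ENNReal.ofReal (volDensity g e.symm y)
      = ∫⁻ x in S, ENNReal.ofReal (volDensity g c.toFun x) := by
    rw [← lintegral_volDensity_image g (Ψ := e.symm) (φ := e ∘ c.toFun) hSm]
    · congr 2
      ext y
      constructor
      · rintro ⟨hy, hyB⟩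
        obtain ⟨x, hx, hxy⟩ := hBV hyB
        exact ⟨x, ⟨hx, by simpa [hxy] using hyB⟩, by simp [hxy, e.right_inv hy]⟩
      · rintro ⟨x, ⟨hx, hxB⟩, rfl⟩
        exact ⟨e.map_source (hVe x hx), by simpa [e.left_inv (hVe x hx)] using hxB⟩
    · exact fun x hx => hsube (e.map_source (hVe x hx.1))
    · intro x hx
      have := (contMDiffAt_of_mem_maximalAtlas he (hVe x hx.1)).comp x (c.isParam (hSR x hx)).contMDiffAt
      exact this.contDiffAt.differentiableAt (by simp)
    · intro x hx
      filter_upwards [hV.mem_nhds hx.1] with z hz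
      exact (e.left_inv (hVe z hz)).symm
    · intro x hx y hy hxy
      exact hinj hx.1 hy.1 (e.injOn (hVe x hx.1) (hVe y hy.1) hxy)
  -- all sheets contribute equally
  have h2 : ∀ γ : c.Γ, ∫⁻ y in γ.1 '' S, ENNReal.ofReal (volDensity g c.toFun y)
      = ∫⁻ x in S, ENNReal.ofReal (volDensity g c.toFun x) := fun γ =>
    lintegral_volDensity_image g hSm
      (fun x hx => c.isParam (by rw [γ.1.norm_map]; exact hSR x hx))
      (fun x _ => (contDiff_act γ.1 (k := 1)).differentiable (by norm_num) x)
      (fun x hx => c.eventually_apply_act γ.2 (hSR x hx)) γ.1.injective.injOn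
  have h3 : {x | c.R < ‖x‖} ∩ c.toFun ⁻¹' B = ⋃ γ : c.Γ, γ.1 '' S := by
    ext x
    simp only [mem_inter_iff, mem_ofPred_eq, mem_preimage, mem_iUnion, mem_image]
    constructor
    · rintro ⟨hx, hxB⟩
      obtain ⟨y, hy, hyx⟩ := hBV hxB
      obtain ⟨γ, hγ, rfl⟩ := (c.eq_iff y x (hVR y hy) hx).1 hyx
      exact ⟨⟨γ, hγ⟩, y, ⟨hy, by rw [mem_preimage, hyx]; exact hxB⟩, rfl⟩
    · rintro ⟨γ, y, hy, rfl⟩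
      refine ⟨by rw [γ.1.norm_map]; exact hSR y hy, ?_⟩
      rw [c.apply_act γ.2 (hSR y hy)]
      exact hy.2
  have h4 : Pairwise (Function.onFun Disjoint fun γ : c.Γ => γ.1 '' S) := by
    intro γ γ' hne
    refine Set.disjoint_left.2 ?_
    rintro _ ⟨y, hy, rfl⟩ ⟨y', hy', hyy⟩
    have e1 : c.toFun y' = c.toFun y := by
      rw [← c.apply_act γ.2 (hSR y hy), ← c.apply_act γ'.2 (hSR y' hy'), hyy]
    obtain rfl := hinj hy'.1 hy.1 e1
    have hy0 : 0 < ‖y'‖ := c.R_pos.trans (hSR y' hy')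
    refine hne (Subtype.ext ?_)
    have e2 := c.free (γ.1⁻¹ * γ'.1) (c.Γ.mul_mem (c.Γ.inv_mem γ.2) γ'.2) (‖y'‖⁻¹ • y')
      (by rw [norm_smul, norm_inv, norm_norm, inv_mul_cancel₀ hy0.ne']) (by
        rw [map_smul]
        congr 1
        have : (γ.1⁻¹ * γ'.1) y' = γ.1.symm (γ'.1 y') := rfl
        rw [this, hyy, LinearIsometryEquiv.symm_apply_apply])
    exact (inv_mul_eq_one.1 e2)
  have hfin := c.finite
  have h5 : ∀ γ : c.Γ, MeasurableSet (γ.1 '' S) := fun γ => by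
    rw [LinearIsometryEquiv.image_eq_preimage_symm]
    exact γ.1.symm.continuous.measurable hSm
  rw [h3, lintegral_iUnion h5 h4, h1]
  simp only [h2]
  have := Fintype.ofFinite c.Γ
  rw [tsum_fintype, Finset.sum_const, nsmul_eq_mul, Nat.card_eq_fintype_card]
  rfl

lemma chartMeasure_tail_compl {B : Set M} (hB : MeasurableSet B) :
    c.chartMeasure g B = c.chartMeasure g (B ∩ c.tail c.R) := by
  have ht := (c.isOpen_tail le_rfl).measurableSet
  have hsub := c.subset_paramDomain le_rfl
  rw [chartMeasure, parMeasure_apply g (isOpen_lt_norm _) hsub hB,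
    parMeasure_apply g (isOpen_lt_norm _) hsub (hB.inter ht)]
  congr 2
  ext x
  constructor
  · rintro ⟨hx, hxB⟩
    exact ⟨hx, hxB, c.toFun_mem_tail hx⟩
  · rintro ⟨hx, hxB, -⟩
    exact ⟨hx, hxB⟩

variable [SecondCountableTopology M]

lemma chartMeasure_le :
    c.chartMeasure g ≤ (Nat.card c.Γ : ENNReal) • riemannianVolume g := by
  refine Measure.le_iff.2 fun B hB => ?_
  rw [c.chartMeasure_tail_compl g hB]
  refine (measure_le_of_locally (fun p hp => ?_) (hB.inter (c.isOpen_tail le_rfl).measurableSet)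
    inter_subset_right).trans (measure_mono inter_subset_left)
  obtain ⟨W, hW, hpW, h⟩ := c.exists_chartMeasure_eq g hp
  refine ⟨W, hW, hpW, fun B hB hBm => ?_⟩
  rw [h B hB hBm, Measure.smul_apply, smul_eq_mul]
  gcongr
  exact parMeasure_chart_le g p

lemma chartMeasure_le_of_overlap (c' : AsymptoticChart n M) {B : Set M} (hB : MeasurableSet B)
    (hBc : B ⊆ c.tail c.R) (hBc' : B ⊆ c'.tail c'.R) :
    (Nat.card c'.Γ : ENNReal) * c.chartMeasure g B
      ≤ (Nat.card c.Γ : ENNReal) * c'.chartMeasure g B := by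
  refine measure_le_of_locally (μ := (Nat.card c'.Γ : ENNReal) • c.chartMeasure g)
    (ν := (Nat.card c.Γ : ENNReal) • c'.chartMeasure g) (O := B) (fun p hp => ?_) hB subset_rfl
  obtain ⟨W, hW, hpW, h⟩ := c.exists_chartMeasure_eq g (hBc hp)
  obtain ⟨W', hW', hpW', h'⟩ := c'.exists_chartMeasure_eq g (hBc' hp)
  refine ⟨W ∩ W', hW.inter hW', ⟨hpW, hpW'⟩, fun B hB hBm => le_of_eq ?_⟩
  rw [Measure.smul_apply, Measure.smul_apply, smul_eq_mul, smul_eq_mul,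
    h B (hB.trans inter_subset_left) hBm, h' B (hB.trans inter_subset_right) hBm]
  ring

/-- The integral of a function over the intersection of two ends does not depend on the chart. -/
lemma integral_overlap_eq (c' : AsymptoticChart n M) {O : Set M} (hO : IsOpen O)
    (hOc : O ⊆ c.tail c.R) (hOc' : O ⊆ c'.tail c'.R) {h : M → ℝ} (hh : ContinuousOn h O)
    (h0 : ∀ p ∉ O, h p = 0) :
    (Nat.card c.Γ : ℝ)⁻¹ * ∫ x in {x | c.R < ‖x‖}, volDensity g c.toFun x * h (c.toFun x)
      = (Nat.card c'.Γ : ℝ)⁻¹ *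
        ∫ x in {x | c'.R < ‖x‖}, volDensity g c'.toFun x * h (c'.toFun x) := by
  have hm : Measurable h := by
    classical
    have : h = O.piecewise h fun _ => 0 := by
      ext p
      by_cases hp : p ∈ O
      · rw [piecewise_eq_of_mem _ _ _ hp]
      · rw [piecewise_eq_of_notMem _ _ _ hp, h0 p hp]
    rw [this]
    exact hh.measurable_piecewise continuousOn_const hO.measurableSet
  have hfin := c.finite
  have hfin' := c'.finite
  have hr : ((Nat.card c'.Γ : ENNReal) • c.chartMeasure g).restrict O
      = ((Nat.card c.Γ : ENNReal) • c'.chartMeasure g).restrict O := by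
    ext B hB
    have hBO := hB.inter hO.measurableSet
    rw [Measure.restrict_apply hB, Measure.restrict_apply hB, Measure.smul_apply,
      Measure.smul_apply, smul_eq_mul, smul_eq_mul]
    exact le_antisymm
      (c.chartMeasure_le_of_overlap g c' hBO (inter_subset_right.trans hOc)
        (inter_subset_right.trans hOc'))
      (c'.chartMeasure_le_of_overlap g c hBO (inter_subset_right.trans hOc')
        (inter_subset_right.trans hOc))
  have h1 : ∀ μ : Measure M, ∫ p in O, h p ∂μ = ∫ p, h p ∂μ := fun μ =>
    setIntegral_eq_integral_of_forall_compl_eq_zero h0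
  have h2 := congrArg (fun μ : Measure M => ∫ p, h p ∂μ) hr
  simp only [h1, integral_smul_measure, ENNReal.toReal_natCast, smul_eq_mul] at h2
  rw [← integral_parMeasure g (isOpen_lt_norm _) (c.subset_paramDomain le_rfl)
      hm.aestronglyMeasurable,
    ← integral_parMeasure g (isOpen_lt_norm _) (c'.subset_paramDomain le_rfl)
      hm.aestronglyMeasurable]
  have hp : (Nat.card c.Γ : ℝ) ≠ 0 := Nat.cast_ne_zero.2 Nat.card_pos.ne'
  have hp' : (Nat.card c'.Γ : ℝ) ≠ 0 := Nat.cast_ne_zero.2 Nat.card_pos.ne'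
  rw [inv_mul_eq_iff_eq_mul₀ hp, ← mul_assoc, mul_comm (Nat.card c.Γ : ℝ), mul_assoc,
    eq_comm, inv_mul_eq_iff_eq_mul₀ hp', eq_comm]
  exact h2

end AsymptoticChart

end ChartVolume

/-! ### Properness of asymptotic charts -/

section Proper

variable {n : ℕ}

lemma abs_quadratic_le {A : SqMat n} {K : ℝ} (hA : ∀ j k, |A j k| ≤ K) (v : Euc n) :
    |∑ j, ∑ k, v j * v k * A j k| ≤ K * n ^ 2 * ‖v‖ ^ 2 := by
  have hv : ∀ j, |v j| ≤ ‖v‖ := fun j => by simpa using PiLp.norm_apply_le v j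
  calc |∑ j, ∑ k, v j * v k * A j k| ≤ ∑ j : Fin n, ∑ k : Fin n, ‖v‖ * ‖v‖ * K := by
        refine (Finset.abs_sum_le_sum_abs _ _).trans (Finset.sum_le_sum fun j _ =>
          (Finset.abs_sum_le_sum_abs _ _).trans (Finset.sum_le_sum fun k _ => ?_))
        rw [abs_mul, abs_mul]
        gcongr
        exacts [hv j, hv k, hA j k]
    _ = K * n ^ 2 * ‖v‖ ^ 2 := by
        simp only [Finset.sum_const, Finset.card_univ, Fintype.card_fin, nsmul_eq_mul]
        ring

variable {M : Type*} [TopologicalSpace M] [ChartedSpace (Euc n) M]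
  [IsManifold 𝓘(ℝ, Euc n) ∞ M] {g : Metric2 n M} {c : AsymptoticChart n M}

lemma metricAt_dPar (g : Metric2 n M) (Φ : Euc n → M) (x v : Euc n) :
    metricAt g (Φ x) (dPar Φ x v) (dPar Φ x v) = ∑ j, ∑ k, v j * v k * metricCoeff g Φ x j k := by
  rw [clm_apply_eq_sum (dPar Φ x), bilin_sum_sum]
  rfl

namespace AsymptoticChart

/-- Far out in the end, the metric is bounded below by half of the Euclidean one. -/
lemma exists_norm_sq_le {τ : ℝ} (hτ : 0 < τ) (hc : c.HasFallOff g τ) :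
    ∃ r, c.R ≤ r ∧ ∀ x, r < ‖x‖ → ∀ v : Euc n,
      ‖v‖ ^ 2 ≤ 2 * metricAt g (c.toFun x) (dPar c.toFun x v) (dPar c.toFun x v) := by
  set κ : ℝ := 1 / (2 * (n ^ 2 + 1)) with hκ
  have hκ0 : 0 < κ := by positivity
  have h1 : ∀ᶠ x in Bornology.cobounded (Euc n), ∀ j k,
      |metricCoeff g c.toFun x j k - (1 : SqMat n) j k| ≤ κ := by
    refine eventually_all.2 fun j => eventually_all.2 fun k => ?_
    have h2 := ((hc.decayM j k).tendsto_zero hτ).abs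
    rw [abs_zero] at h2
    exact (h2.eventually_lt_const hκ0).mono fun x hx => hx.le
  rw [← comap_norm_atTop, eventually_comap] at h1
  obtain ⟨r, hr⟩ := eventually_atTop.1 h1
  refine ⟨max r c.R, le_max_right _ _, fun x hx v => ?_⟩
  have h2 := abs_quadratic_le (A := metricCoeff g c.toFun x - 1)
    (hr ‖x‖ ((le_max_left _ _).trans hx.le) x rfl) v
  rw [metricAt_dPar]
  have h3 : ∑ j, ∑ k, v j * v k * (metricCoeff g c.toFun x - 1) j k
      = (∑ j, ∑ k, v j * v k * metricCoeff g c.toFun x j k) - ‖v‖ ^ 2 := by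
    simp only [Matrix.sub_apply, mul_sub, Finset.sum_sub_distrib, Matrix.one_apply, mul_ite,
      mul_one, mul_zero, Finset.sum_ite_eq, Finset.mem_univ, if_true]
    rw [EuclideanSpace.real_norm_sq_eq]
    simp only [pow_two]
  rw [h3] at h2
  have h4 : κ * n ^ 2 * ‖v‖ ^ 2 ≤ 1 / 2 * ‖v‖ ^ 2 := by
    gcongr
    rw [hκ, div_mul_eq_mul_div, one_mul, div_le_div_iff₀ (by positivity) (by norm_num)]
    linarith
  have h5 := (abs_le.1 (h2.trans h4)).1
  linarith

/-- In a suitable chart near `q`, the inverse of the asymptotic chart has bounded derivative, so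
that `|x|` has bounded slope on the part of the end near `q`; hence, if points far out in the end
come close to `q`, then `|x|` has a bounded distance from its value at `q`. -/
lemma exists_nhds_disjoint_tail [T2Space M] {τ : ℝ} (hτ : 0 < τ) (hc : c.HasFallOff g τ) (q : M) :
    ∃ W ∈ 𝓝 q, ∃ r, c.R ≤ r ∧ Disjoint (c.tail r) W := by
  obtain ⟨R₀, hR₀, hlow⟩ := exists_norm_sq_le hτ hc
  set e := chartAt (Euc n) q
  have he := IsManifold.chart_mem_maximalAtlas (I := 𝓘(ℝ, Euc n)) (n := ∞) q
  have hq : q ∈ e.source := mem_chart_source _ _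
  have hpar : ∀ y ∈ e.target, IsParam e.symm y := fun y hy => isParam_symm_of_mem_maximalAtlas he hy
  -- an upper bound of the metric near `q`
  set K : ℝ := (∑ j, ∑ k, |metricCoeff g e.symm (e q) j k|) + 1 with hKdef
  have hK0 : 0 ≤ K := by
    have : 0 ≤ ∑ j, ∑ k, |metricCoeff g e.symm (e q) j k| :=
      Finset.sum_nonneg fun _ _ => Finset.sum_nonneg fun _ _ => abs_nonneg _
    positivity
  obtain ⟨C, δ, hC, hδ, hball, hup⟩ : ∃ C δ : ℝ, 0 ≤ C ∧ 0 < δ ∧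
      Metric.ball (e q) δ ⊆ e.target ∧ ∀ y ∈ Metric.ball (e q) δ, ∀ w : Euc n,
        metricAt g (e.symm y) (dPar e.symm y w) (dPar e.symm y w) ≤ C * ‖w‖ ^ 2 := by
    have h1 : ∀ᶠ y in 𝓝 (e q), ∀ j k, |metricCoeff g e.symm y j k| ≤ K := by
      refine eventually_all.2 fun j => eventually_all.2 fun k => ?_
      have h2 := ((hpar _ (e.map_source hq)).contDiffAt_metricCoeff g j k).continuousAt.abs
      refine (h2.eventually_lt continuousAt_const ?_).mono fun y hy => hy.le
      have h3 : |metricCoeff g e.symm (e q) j k| ≤ ∑ j, ∑ k, |metricCoeff g e.symm (e q) j k| :=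
        (Finset.single_le_sum (f := fun k => |metricCoeff g e.symm (e q) j k|)
          (fun _ _ => abs_nonneg _) (Finset.mem_univ k)).trans
        (Finset.single_le_sum (f := fun j => ∑ k, |metricCoeff g e.symm (e q) j k|)
          (fun _ _ => Finset.sum_nonneg fun _ _ => abs_nonneg _) (Finset.mem_univ j))
      linarith
    obtain ⟨δ, hδ, hb⟩ := Metric.eventually_nhds_iff_ball.1
      (h1.and (e.open_target.mem_nhds (e.map_source hq)))
    refine ⟨K * n ^ 2, δ, by positivity, hδ, fun y hy => (hb y hy).2, fun y hy w => ?_⟩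
    rw [metricAt_dPar]
    exact (le_abs_self _).trans (abs_quadratic_le (hb y hy).1 w)
  set C' := Real.sqrt (2 * C) with hC'
  have hC'0 : 0 ≤ C' := Real.sqrt_nonneg _
  -- the derivative of the inverse of the asymptotic chart
  have hder : ∀ y ∈ Metric.ball (e q) δ, ∀ (l : Euc n → Euc n), R₀ < ‖l y‖ →
      DifferentiableAt ℝ l y → (∀ᶠ z in 𝓝 y, e.symm z = c.toFun (l z)) →
      ‖fderiv ℝ l y‖ ≤ C' := by
    intro y hy l hl hd h
    refine ContinuousLinearMap.opNorm_le_bound _ hC'0 fun w => ?_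
    have h1 := hlow (l y) hl (fderiv ℝ l y w)
    have h2 := dPar_comp (c.isParam (hR₀.trans_lt hl)) hd h
    have h3 : dPar c.toFun (l y) (fderiv ℝ l y w) = dPar e.symm y w := by rw [h2]; rfl
    rw [h3, ← h.self_of_nhds] at h1
    have h4 := hup y hy w
    refine abs_le_of_sq_le_sq' ?_ (by positivity) |>.2
    rw [mul_pow, hC', Real.sq_sqrt (by positivity)]
    linarith
  set Λ := C' * δ with hΛ
  have hΛ0 : 0 ≤ Λ := by positivity
  refine ⟨e.source ∩ e ⁻¹' Metric.ball (e q) δ,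
    (e.isOpen_inter_preimage Metric.isOpen_ball).mem_nhds ⟨hq, Metric.mem_ball_self hδ⟩,
    max (R₀ + Λ) (c.radius q + Λ), by linarith [le_max_left (R₀ + Λ) (c.radius q + Λ)],
    Set.disjoint_left.2 ?_⟩
  rintro _ ⟨x₀, hx₀, rfl⟩ ⟨hs, hb⟩
  have hx₀' : max (R₀ + Λ) (c.radius q + Λ) < ‖x₀‖ := hx₀
  obtain ⟨hx1, hx2⟩ := max_lt_iff.1 hx₀'
  set y₀ := e (c.toFun x₀)
  set p : ℝ → Euc n := fun t => y₀ + t • (e q - y₀) with hp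
  have hpb : ∀ t ∈ Icc (0 : ℝ) 1, p t ∈ Metric.ball (e q) δ := fun t ht => by
    have := (convex_ball (e q) δ) hb (Metric.mem_ball_self hδ) (sub_nonneg.2 ht.2) ht.1
      (by ring)
    convert this using 1
    simp only [hp]
    module
  have hpc : Continuous p := by fun_prop
  have hy₀ : ‖e q - y₀‖ ≤ δ := by
    rw [← dist_eq_norm, dist_comm]; exact (Metric.mem_ball.1 hb).le
  -- the parameters for which the point of the segment from `e (c.toFun x₀)` to `e q` has a preimage
  -- in the asymptotic chart with a norm close to that of `x₀`
  set S : Set ℝ := {t | ∃ x, |‖x‖ - ‖x₀‖| ≤ Λ * t ∧ c.toFun x = e.symm (p t)} with hS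
  have hbig : ∀ t ∈ Icc (0 : ℝ) 1, ∀ x : Euc n, |‖x‖ - ‖x₀‖| ≤ Λ * t → R₀ < ‖x‖ := by
    intro t ht x hx
    have h1 := (abs_le.1 hx).1
    have h2 : Λ * t ≤ Λ := mul_le_of_le_one_right hΛ0 ht.2
    linarith
  have hsub : Icc (0 : ℝ) 1 ⊆ S := by
    refine IsClosed.Icc_subset_of_forall_exists_gt ?_ ?_ ?_
    · refine IsSeqClosed.isClosed fun t t₀ ht htt => ?_
      have ht₀ : t₀ ∈ Icc (0 : ℝ) 1 :=
        isClosed_Icc.mem_of_tendsto htt (Eventually.of_forall fun i => (ht i).2)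
      choose x hx hxc using fun i => (ht i).1
      obtain ⟨x', -, φ, hφ, hlim⟩ := tendsto_subseq_of_bounded
        (Metric.isBounded_closedBall (x := (0 : Euc n)) (r := ‖x₀‖ + Λ)) (x := x) fun i => by
          rw [mem_closedBall_zero_iff]
          have h1 := (abs_le.1 (hx i)).2
          have h2 : Λ * t i ≤ Λ := mul_le_of_le_one_right hΛ0 (ht i).2.2
          linarith
      have htφ := htt.comp hφ.tendsto_atTop
      have h1 : |‖x'‖ - ‖x₀‖| ≤ Λ * t₀ :=
        le_of_tendsto_of_tendsto' ((hlim.norm.sub_const _).abs) (htφ.const_mul Λ) fun i => hx (φ i)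
      refine ⟨⟨x', h1, ?_⟩, ht₀⟩
      refine tendsto_nhds_unique
        ((c.continuousAt (hR₀.trans_lt (hbig t₀ ht₀ x' h1))).tendsto.comp hlim) ?_
      have h2 : ContinuousAt e.symm (p t₀) := e.continuousAt_symm (hball (hpb t₀ ht₀))
      refine (h2.tendsto.comp ((hpc.tendsto t₀).comp htφ)).congr fun i => ?_
      exact (hxc (φ i)).symm
    · refine ⟨x₀, by simp, ?_⟩
      simp only [hp, zero_smul, add_zero]
      exact (e.left_inv hs).symm
    · rintro t ⟨⟨x, hx, hxc⟩, ht⟩ b hb'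
      have ht' : t ∈ Icc (0 : ℝ) 1 := ⟨ht.1, ht.2.le⟩
      have hxR := hbig t ht' x hx
      -- lift the path through the asymptotic chart
      obtain ⟨l, hl, hlc, hle⟩ := (hpar _ (hball (hpb t ht'))).exists_transition
        (c.isParam (hR₀.trans_lt hxR)) hxc.symm
      have hlc1 : ContDiffAt ℝ 1 l (p t) := hlc.of_le (by norm_cast)
      have hev : ∀ᶠ z in 𝓝 (p t), e.symm z = c.toFun (l z) ∧ DifferentiableAt ℝ l z ∧
          ‖fderiv ℝ l z‖ ≤ C' := by
        filter_upwards [hle.eventually_nhds, hlc1.eventually (by norm_num),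
          hlc.continuousAt.norm.eventually_const_lt (u := R₀) (by simpa only [hl] using hxR),
          Metric.isOpen_ball.mem_nhds (hpb t ht')] with z h1 h2 h3 h4
        have h5 := h2.differentiableAt (by norm_num)
        exact ⟨h1.self_of_nhds, h5, hder z h4 l h3 h5 h1⟩
      obtain ⟨η, hη, hball'⟩ := Metric.eventually_nhds_iff_ball.1 hev
      have hnear : ∀ᶠ s in 𝓝[>] t, p s ∈ Metric.ball (p t) η ∧ s ∈ Ioc t b := by
        refine ((hpc.continuousAt.eventually (Metric.ball_mem_nhds _ hη)).filter_mono
          nhdsWithin_le_nhds).and ?_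
        exact Ioc_mem_nhdsGT hb'
      obtain ⟨s, hsη, hst⟩ := hnear.exists
      refine ⟨s, ⟨l (p s), ?_, (hball' _ hsη).1.symm⟩, hst⟩
      have h1 : ‖l (p s) - l (p t)‖ ≤ C' * ‖p s - p t‖ :=
        (convex_ball (p t) η).norm_image_sub_le_of_norm_fderiv_le
          (fun z hz => (hball' z hz).2.1) (fun z hz => (hball' z hz).2.2)
          (Metric.mem_ball_self hη) hsη
      have h2 : ‖p s - p t‖ ≤ (s - t) * δ := by
        have : p s - p t = (s - t) • (e q - y₀) := by simp only [hp]; module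
        rw [this, norm_smul, Real.norm_of_nonneg (sub_nonneg.2 hst.1.le)]
        exact mul_le_mul_of_nonneg_left hy₀ (sub_nonneg.2 hst.1.le)
      have h3 : |‖l (p s)‖ - ‖x‖| ≤ Λ * (s - t) := by
        rw [← hl]
        refine (abs_norm_sub_norm_le _ _).trans (h1.trans ?_)
        calc C' * ‖p s - p t‖ ≤ C' * ((s - t) * δ) := by gcongr
          _ = Λ * (s - t) := by rw [hΛ]; ring
      calc |‖l (p s)‖ - ‖x₀‖| ≤ |‖l (p s)‖ - ‖x‖| + |‖x‖ - ‖x₀‖| := abs_sub_le _ _ _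
        _ ≤ Λ * (s - t) + Λ * t := add_le_add h3 hx
        _ = Λ * s := by ring
  obtain ⟨x, hx, hxc⟩ := hsub (right_mem_Icc.2 zero_le_one)
  have hxq : c.toFun x = q := by
    rw [hxc]
    simp only [hp, one_smul, add_sub_cancel]
    exact e.left_inv hq
  have h1 : c.radius q = ‖x‖ := by
    rw [← hxq]
    exact c.radius_toFun (hR₀.trans_lt (hbig 1 (right_mem_Icc.2 zero_le_one) x hx))
  have h2 := (abs_le.1 hx).1
  linarith

/-- Compact sets stay away from infinity in the end. -/
lemma exists_tail_disjoint [T2Space M] {τ : ℝ} (hτ : 0 < τ) (hc : c.HasFallOff g τ) {K : Set M}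
    (hK : IsCompact K) : ∃ r, c.R ≤ r ∧ Disjoint (c.tail r) K := by
  refine hK.induction_on (p := fun s => ∃ r, c.R ≤ r ∧ Disjoint (c.tail r) s)
    ⟨c.R, le_rfl, disjoint_bot_right⟩ ?_ ?_ ?_
  · rintro s t hst ⟨r, hr, h⟩
    exact ⟨r, hr, h.mono_right hst⟩
  · rintro s t ⟨r, hr, h⟩ ⟨r', hr', h'⟩
    exact ⟨max r r', hr.trans (le_max_left _ _), Set.disjoint_union_right.2
      ⟨h.mono_left (c.tail_mono (le_max_left _ _)), h'.mono_left (c.tail_mono (le_max_right _ _))⟩⟩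
  · intro q _
    obtain ⟨W, hW, h⟩ := exists_nhds_disjoint_tail hτ hc q
    exact ⟨W, mem_nhdsWithin_of_mem_nhds hW, h⟩

/-- Each neighbourhood of infinity in one chart of an end contains one of every other chart. -/
lemma exists_tail_subset [T2Space M] {τ : ℝ} (hτ : 0 < τ) (hc : c.HasFallOff g τ)
    {c' : AsymptoticChart n M} (hcc' : c.SameEnd c') (r' : ℝ) :
    ∃ r, c.R ≤ r ∧ c.tail r ⊆ c'.tail r' := by
  obtain ⟨r, hr, hd⟩ := exists_tail_disjoint hτ hc (hcc'.union (c'.isCompact_closure r'))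
  refine ⟨r, hr, fun p hp => ?_⟩
  have hpK := Set.disjoint_left.1 hd hp
  have hp' : p ∈ c'.tail c'.R := by
    by_contra h
    exact hpK (Or.inl (subset_closure (Or.inl ⟨c.tail_mono hr hp, h⟩)))
  obtain ⟨x, hx, rfl⟩ := hp'
  refine c'.toFun_mem_tail ?_
  by_contra h
  exact hpK (Or.inr (subset_closure ⟨x, ⟨hx, not_lt.1 h⟩, rfl⟩))

omit [IsManifold 𝓘(ℝ, Euc n) ∞ M] in
lemma SameEnd.symm {c' : AsymptoticChart n M} (h : c.SameEnd c') : c'.SameEnd c := by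
  rw [SameEnd, symmDiff_comm]
  exact h

end AsymptoticChart

end Proper

/-! ### Averaged fluxes -/

section Average

variable {n : ℕ}

/-- A smooth step from `0` to `1` on the interval `[k, k + 1]`. -/
def step (k s : ℝ) : ℝ := Real.smoothTransition (s - k)

lemma contDiff_step (k : ℝ) {r : ℕ∞} : ContDiff ℝ r (step k) :=
  Real.smoothTransition.contDiff.comp (contDiff_id.sub contDiff_const)

lemma step_eq_zero {k s : ℝ} (h : s ≤ k) : step k s = 0 :=
  Real.smoothTransition.zero_of_nonpos (by linarith)

lemma step_eq_one {k s : ℝ} (h : k + 1 ≤ s) : step k s = 1 :=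
  Real.smoothTransition.one_of_one_le (by linarith)

lemma step_nonneg (k s : ℝ) : 0 ≤ step k s := Real.smoothTransition.nonneg _

lemma step_le_one (k s : ℝ) : step k s ≤ 1 := Real.smoothTransition.le_one _

lemma hasDerivAt_step (k s : ℝ) : HasDerivAt (step k) (deriv (step k) s) s :=
  ((contDiff_step k (r := 1)).differentiable (by norm_num) s).hasDerivAt

lemma deriv_step_nonneg (k s : ℝ) : 0 ≤ deriv (step k) s :=
  Monotone.deriv_nonneg fun _ _ h => Real.smoothTransition.monotone (by linarith)

lemma deriv_step_eq_zero {k s : ℝ} (h : s ≤ k) : deriv (step k) s = 0 :=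
  IsLocalMin.deriv_eq_zero (Eventually.of_forall fun t => by
    rw [step_eq_zero h]; exact step_nonneg k t)

lemma tendsto_step (k : ℝ) : Tendsto (step k) atTop (𝓝 1) :=
  tendsto_const_nhds.congr' ((eventually_ge_atTop (k + 1)).mono fun _ h => (step_eq_one h).symm)

lemma integrableOn_deriv_step (k : ℝ) : IntegrableOn (deriv (step k)) (Ioi 0) :=
  integrableOn_Ioi_deriv_of_nonneg' (fun s _ => hasDerivAt_step k s)
    (fun s _ => deriv_step_nonneg k s) (tendsto_step k)

lemma integral_deriv_step {k : ℝ} (hk : 0 ≤ k) : ∫ s in Ioi 0, deriv (step k) s = 1 := by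
  rw [integral_Ioi_of_hasDerivAt_of_tendsto' (fun s _ => hasDerivAt_step k s)
    (integrableOn_deriv_step k) (tendsto_step k), step_eq_zero hk, sub_zero]

lemma step_norm {k : ℝ} (hk : 0 < k) : ContDiff ℝ 1 (fun x : Euc n => step k ‖x‖) ∧
    ∀ (x : Euc n) (j : Fin n), pd j (fun y => step k ‖y‖) x
      = deriv (step k) ‖x‖ * (x j / ‖x‖) :=
  radial_cutoff (r := k / 2) (k := 1) (by linarith) le_rfl (contDiff_step k) fun s hs => by
    filter_upwards [Iio_mem_nhds (show s < k by linarith)] with t ht using step_eq_zero (le_of_lt ht)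

lemma tsupport_subset_of_eq_zero {f : Euc n → ℝ} {r s : ℝ} (hrs : r < s)
    (h : ∀ x, ‖x‖ < s → f x = 0) : tsupport f ⊆ {x | r < ‖x‖} := by
  have h1 : tsupport f ⊆ {x | s ≤ ‖x‖} := closure_minimal (fun x hx => by
    by_contra hlt
    exact hx (h x (not_le.1 hlt))) (isClosed_le continuous_const continuous_norm)
  exact fun x hx => hrs.trans_le (h1 hx)

lemma hasCompactSupport_of_eq_zero {f : Euc n → ℝ} {N : ℝ} (h : ∀ x, N < ‖x‖ → f x = 0) :
    HasCompactSupport f :=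
  HasCompactSupport.of_support_subset_isCompact (isCompact_closedBall (0 : Euc n) N) fun x hx => by
    rw [mem_closedBall_zero_iff]
    by_contra hlt
    exact hx (h x (not_le.1 hlt))

/-- The average of the fluxes of `V` through spheres, with the derivative of `step k` as weight. -/
def avgFlux (V : Fin n → Euc n → ℝ) (k : ℝ) : ℝ :=
  ∫ x, ∑ a, pd a (fun y => step k ‖y‖) x * V a x

lemma continuous_pd {f : Euc n → ℝ} (hf : ContDiff ℝ 1 f) (a : Fin n) : Continuous (pd a f) :=
  continuous_iff_continuousAt.2 fun _ => continuousAt_pd hf.contDiffAt a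

lemma integrable_pd_mul {ψ : Euc n → ℝ} {V : Fin n → Euc n → ℝ} {r s N : ℝ} (hrs : r < s)
    (hψ : ContDiff ℝ 1 ψ) (h0 : ∀ x, ‖x‖ < s → ψ x = 0) (h1 : ∀ x, N < ‖x‖ → ψ x = 1)
    (hV : ∀ a x, r < ‖x‖ → ContinuousAt (V a) x) (a : Fin n) :
    Integrable fun x => pd a ψ x * V a x := by
  refine integrable_mul_of_tsupport (U := {x | r < ‖x‖}) (continuous_pd hψ a) ?_
    ((tsupport_pd_subset ψ a).trans (tsupport_subset_of_eq_zero hrs h0)) (hV a)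
  refine hasCompactSupport_of_eq_zero (N := N) fun x hx => ?_
  have : ψ =ᶠ[𝓝 x] fun _ => 1 := by
    filter_upwards [(isOpen_lt_norm N).mem_nhds hx] with y hy using h1 y hy
  rw [pd_congr this, pd_const]

lemma avgFlux_eq (hn : 0 < n) {V : Fin n → Euc n → ℝ} {r k : ℝ} (hr : 0 < r) (hrk : r < k)
    (hV : ∀ a x, r < ‖x‖ → ContinuousAt (V a) x) :
    IntegrableOn (fun t => deriv (step k) t * sphereFlux V t) (Ioi 0) ∧
    avgFlux V k = ∫ t in Ioi 0, deriv (step k) t * sphereFlux V t := by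
  have hk := hr.trans hrk
  have hi : Integrable (fun x => ∑ a, pd a (fun y => step k ‖y‖) x * V a x) :=
    integrable_finsetSum _ fun a _ => integrable_pd_mul hrk (step_norm hk).1
      (fun x hx => step_eq_zero hx.le) (N := k + 1) (fun x hx => step_eq_one hx.le) hV a
  have hp := integrable_polar hn hi
  have he : ∀ t ∈ Ioi (0 : ℝ), sphereIntegral
      (fun x => ∑ a, pd a (fun y => step k ‖y‖) x * V a x) t
      = deriv (step k) t * sphereFlux V t := by
    intro t ht
    rw [sphereFlux, ← sphereIntegral_radial_mul _ _ (le_of_lt ht)]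
    refine sphereIntegral_congr (le_of_lt ht) fun x _ => ?_
    rw [Finset.mul_sum]
    exact Finset.sum_congr rfl fun a _ => by rw [(step_norm hk).2]; ring
  exact ⟨hp.1.congr_fun he measurableSet_Ioi,
    hp.2.trans (setIntegral_congr_fun measurableSet_Ioi he)⟩

lemma tendsto_avgFlux (hn : 0 < n) {V : Fin n → Euc n → ℝ} {r L : ℝ} (hr : 0 < r)
    (hV : ∀ a x, r < ‖x‖ → ContinuousAt (V a) x) (hL : Tendsto (sphereFlux V) atTop (𝓝 L)) :
    Tendsto (avgFlux V) atTop (𝓝 L) := by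
  rw [Metric.tendsto_atTop]
  intro ε hε
  obtain ⟨N, hN⟩ := Metric.tendsto_atTop.1 hL (ε / 2) (by positivity)
  refine ⟨max N (r + 1), fun k hk => ?_⟩
  have hrk : r < k := by linarith [(le_max_right _ _).trans hk]
  have hNk : N ≤ k := (le_max_left _ _).trans hk
  obtain ⟨hi, he⟩ := avgFlux_eq hn hr hrk hV
  have hid := integrableOn_deriv_step k
  have h1 : avgFlux V k - L = ∫ t in Ioi 0, deriv (step k) t * (sphereFlux V t - L) := by
    simp only [mul_sub]
    rw [integral_sub hi (hid.mul_const L), integral_mul_const,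
      integral_deriv_step (hr.trans hrk).le, he, one_mul]
  rw [Real.dist_eq, h1]
  have h2 : |∫ t in Ioi 0, deriv (step k) t * (sphereFlux V t - L)|
      ≤ ∫ t in Ioi 0, deriv (step k) t * (ε / 2) := by
    rw [← Real.norm_eq_abs]
    refine norm_integral_le_of_norm_le (hid.mul_const _) (Eventually.of_forall fun t => ?_)
    rw [Real.norm_eq_abs, abs_mul, abs_of_nonneg (deriv_step_nonneg k t)]
    rcases le_total t k with htk | htk
    · rw [deriv_step_eq_zero htk]; simp
    · exact mul_le_mul_of_nonneg_left (hN t (hNk.trans htk)).le (deriv_step_nonneg k t)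
  rw [integral_mul_const, integral_deriv_step (hr.trans hrk).le, one_mul] at h2
  linarith

/-- The integral of `V` against the differential of any cut-off function `ψ` near infinity is close
to an averaged flux, with an error controlled by the divergence of `V`. -/
lemma abs_avgFlux_sub_le {V : Fin n → Euc n → ℝ} {ψ : Euc n → ℝ} {r s j N : ℝ} (hr : 0 < r)
    (hrs : r < s) (hsj : s ≤ j) (hψ : ContDiff ℝ 1 ψ) (h0 : ∀ x, ‖x‖ < s → ψ x = 0)
    (h1 : ∀ x, N < ‖x‖ → ψ x = 1) (hb : ∀ x, 0 ≤ ψ x ∧ ψ x ≤ 1)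
    (hV : ∀ a x, r < ‖x‖ → ContDiffAt ℝ 1 (V a) x)
    (hi : IntegrableOn (fun x => ∑ a, pd a (V a) x) {x | r < ‖x‖}) :
    |avgFlux V j - ∫ x, ∑ a, pd a ψ x * V a x|
      ≤ ∫ x in {x | r < ‖x‖}, |∑ a, pd a (V a) x| := by
  have hj : 0 < j := hr.trans (hrs.trans_le hsj)
  have hsn := step_norm (n := n) hj
  have hVc : ∀ a x, r < ‖x‖ → ContinuousAt (V a) x := fun a x hx => (hV a x hx).continuousAt
  set χ : Euc n → ℝ := fun x => step j ‖x‖ - ψ x with hχ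
  have hχs : ContDiff ℝ 1 χ := hsn.1.sub hψ
  have hχ0 : ∀ x, ‖x‖ < s → χ x = 0 := fun x hx => by
    simp only [hχ, h0 x hx, step_eq_zero (hx.le.trans hsj), sub_zero]
  have hχc : HasCompactSupport χ :=
    hasCompactSupport_of_eq_zero (N := max N (j + 1)) fun x hx => by
      simp only [hχ, h1 x ((le_max_left _ _).trans_lt hx),
        step_eq_one ((le_max_right _ _).trans hx.le), sub_self]
  have hχt : tsupport χ ⊆ {x | r < ‖x‖} := tsupport_subset_of_eq_zero hrs hχ0
  have hχb : ∀ x, |χ x| ≤ 1 := fun x => abs_le.2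
    ⟨by linarith [step_nonneg j ‖x‖, (hb x).2], by linarith [step_le_one j ‖x‖, (hb x).1]⟩
  have i1 : ∀ a, Integrable fun x => pd a (fun y => step j ‖y‖) x * V a x := fun a =>
    integrable_pd_mul (hrs.trans_le hsj) hsn.1 (fun x hx => step_eq_zero hx.le) (N := j + 1)
      (fun x hx => step_eq_one hx.le) hVc a
  have i2 : ∀ a, Integrable fun x => pd a ψ x * V a x := fun a =>
    integrable_pd_mul hrs hψ h0 h1 hVc a
  have i3 : ∀ a, Integrable fun x => χ x * pd a (V a) x := fun a =>
    integrable_mul_of_tsupport hχs.continuous hχc hχt fun x hx => continuousAt_pd (hV a x hx) a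
  have e1 : avgFlux V j - ∫ x, ∑ a, pd a ψ x * V a x = ∑ a, ∫ x, pd a χ x * V a x := by
    rw [avgFlux, integral_finsetSum _ fun a _ => i1 a, integral_finsetSum _ fun a _ => i2 a,
      ← Finset.sum_sub_distrib]
    refine Finset.sum_congr rfl fun a _ => ?_
    rw [← integral_sub (i1 a) (i2 a)]
    refine integral_congr_ae (Eventually.of_forall fun x => ?_)
    have : pd a χ x = pd a (fun y => step j ‖y‖) x - pd a ψ x :=
      pd_sub (hsn.1.differentiable (by norm_num) x) (hψ.differentiable (by norm_num) x) a
    simp only [this]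
    ring
  have e2 : avgFlux V j - ∫ x, ∑ a, pd a ψ x * V a x = -∫ x, χ x * ∑ a, pd a (V a) x := by
    rw [e1]
    simp only [Finset.mul_sum]
    rw [integral_finsetSum _ fun a _ => i3 a, ← Finset.sum_neg_distrib]
    refine Finset.sum_congr rfl fun a _ => ?_
    rw [integral_mul_pd hχs hχc hχt (hV a) a, neg_neg]
  rw [e2, abs_neg]
  have hm : MeasurableSet {x : Euc n | r < ‖x‖} := (isOpen_lt_norm r).measurableSet
  rw [← integral_indicator hm, ← Real.norm_eq_abs]
  refine norm_integral_le_of_norm_le ((integrable_indicator_iff hm).2 hi.abs)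
    (Eventually.of_forall fun x => ?_)
  by_cases hx : r < ‖x‖
  · rw [indicator_of_mem (by exact hx), Real.norm_eq_abs, abs_mul]
    exact mul_le_of_le_one_left (abs_nonneg _) (hχb x)
  · rw [indicator_of_notMem (by exact hx), hχ0 x (by linarith [not_lt.1 hx]), zero_mul, norm_zero]

lemma tendsto_integral_tail {f : Euc n → ℝ} {r : ℝ} (hf : IntegrableOn f {x | r < ‖x‖}) :
    Tendsto (fun s => ∫ x in {x | s < ‖x‖}, |f x|) atTop (𝓝 0) := by
  have h1 := tendsto_setIntegral_of_antitone (μ := volume) (f := fun x => |f x|)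
    (s := fun s : ℝ => {x : Euc n | s < ‖x‖}) (fun s => (isOpen_lt_norm s).measurableSet)
    (fun s t hst x hx => hst.trans_lt hx) ⟨r, hf.abs⟩
  have h2 : (⋂ s : ℝ, {x : Euc n | s < ‖x‖}) = ∅ := by
    refine Set.eq_empty_of_forall_notMem fun x hx => ?_
    exact lt_irrefl ‖x‖ (mem_iInter.1 hx ‖x‖)
  rw [h2, setIntegral_empty] at h1
  exact h1

end Average

/-! ### Fluxes in different charts of an end -/

section Comparison

variable {m : ℕ} {M : Type*} [TopologicalSpace M] [ChartedSpace (Euc (2 * m)) M]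
  [IsManifold 𝓘(ℝ, Euc (2 * m)) ∞ M] {g : Metric2 (2 * m) M} {J : EndField (2 * m) M}

/-- The vector field `W` with `ν ∧ θ ∧ ω^{m-1} = ν(W) dx¹ ⋯ dxⁿ`, in the parametrization `Φ`. -/
def paramFlux (g : Metric2 (2 * m) M) (J : EndField (2 * m) M) (θ : OneForm (2 * m) M)
    (Φ : Euc (2 * m) → M) : Fin (2 * m) → Euc (2 * m) → ℝ :=
  fluxField (metricCoeff g Φ) (endCoeff J Φ) (formCoeff θ Φ)

/-- The pairing of the one-form `θ` with the vector `g⁻¹ Jᵗ du`. In contrast to the components of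
`paramFlux`, it does not depend on the parametrization. -/
def fluxPairing (g : Metric2 (2 * m) M) (J : EndField (2 * m) M) (θ : OneForm (2 * m) M)
    (u : M → ℝ) (Φ : Euc (2 * m) → M) (x : Euc (2 * m)) : ℝ :=
  dotProduct (fun k => formCoeff θ Φ k x)
    (Matrix.mulVec ((metricCoeff g Φ x)⁻¹ * (endCoeff J Φ x).transpose)
      fun a => pd a (fun y => u (Φ y)) x)

/-- The form `du ∧ θ ∧ ω^{m-1}` is a function times the Riemannian volume form. -/
lemma sum_pd_mul_paramFlux (hm : 0 < m) (hK : IsKahler g J) (θ : OneForm (2 * m) M) (u : M → ℝ)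
    {Φ : Euc (2 * m) → M} {x : Euc (2 * m)} (h : IsParam Φ x) :
    ∑ a, pd a (fun y => u (Φ y)) x * paramFlux g J θ Φ a x
      = volDensity g Φ x * (-(m - 1).factorial * fluxPairing g J θ u Φ x) := by
  simp only [paramFlux, fluxField, (hK.isKahlerOn Φ).fluxMat_eq hm h, fluxPairing, dotProduct,
    Matrix.mulVec, Matrix.neg_apply, Matrix.smul_apply, smul_eq_mul, volDensity, Finset.mul_sum]
  rw [Finset.sum_comm]
  exact Finset.sum_congr rfl fun k _ => Finset.sum_congr rfl fun a _ => by ring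

lemma fluxPairing_comp (θ : OneForm (2 * m) M) {u : M → ℝ}
    {Φ Ψ : Euc (2 * m) → M} {φ : Euc (2 * m) → Euc (2 * m)} {x : Euc (2 * m)} (hΦ : IsParam Φ x)
    (hΨ : IsParam Ψ (φ x)) (hφ : DifferentiableAt ℝ φ x) (h : ∀ᶠ z in 𝓝 x, Φ z = Ψ (φ z))
    (hu : DifferentiableAt ℝ (fun y => u (Ψ y)) (φ x)) :
    fluxPairing g J θ u Φ x = fluxPairing g J θ u Ψ (φ x) := by
  set A := jac φ x with hA
  have hAu : IsUnit A.det := isUnit_iff_ne_zero.2 (jac_det_ne hΦ hΨ hφ h)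
  have hG := metricCoeff_comp g hΨ hφ h
  have hJ := endCoeff_comp J hΦ hΨ hφ h
  rw [← hA] at hG hJ
  have e1 : (fun k => formCoeff θ Φ k x)
      = Matrix.vecMul (fun a => formCoeff θ Ψ a (φ x)) A := by
    funext k
    rw [formCoeff_comp θ hΨ hφ h]
    exact Finset.sum_congr rfl fun a _ => mul_comm _ _
  have e2 : (fun a => pd a (fun y => u (Φ y)) x)
      = Matrix.mulVec A.transpose fun a => pd a (fun y => u (Ψ y)) (φ x) := by
    funext a
    have : (fun y => u (Φ y)) =ᶠ[𝓝 x] fun y => u (Ψ (φ y)) := h.mono fun z hz => by simp only [hz]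
    rw [pd_congr this, pd_comp hu hφ]
    rfl
  have hAt : IsUnit A.transpose.det := by rwa [Matrix.det_transpose]
  have e3 : A * ((metricCoeff g Φ x)⁻¹ * (endCoeff J Φ x).transpose) * A.transpose
      = (metricCoeff g Ψ (φ x))⁻¹ * (endCoeff J Ψ (φ x)).transpose := by
    have h1 : (endCoeff J Φ x).transpose * A.transpose
        = A.transpose * (endCoeff J Ψ (φ x)).transpose := by
      rw [← Matrix.transpose_mul, hJ, Matrix.transpose_mul]
    rw [Matrix.mul_assoc, Matrix.mul_assoc, h1, hG, Matrix.mul_inv_rev, Matrix.mul_inv_rev]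
    simp only [← Matrix.mul_assoc]
    rw [Matrix.mul_nonsing_inv _ hAu, one_mul, Matrix.mul_assoc _ _ A.transpose,
      Matrix.nonsing_inv_mul _ hAt, mul_one]
  rw [fluxPairing, fluxPairing, e1, e2, ← Matrix.dotProduct_mulVec, Matrix.mulVec_mulVec,
    Matrix.mulVec_mulVec, ← e3]

/-- The function `fluxPairing` on `M`; it is computed at `p` in the preferred chart at `p`. -/
def pairingAt (g : Metric2 (2 * m) M) (J : EndField (2 * m) M) (θ : OneForm (2 * m) M)
    (u : M → ℝ) (p : M) : ℝ :=
  fluxPairing g J θ u (chartAt (Euc (2 * m)) p).symm (chartAt (Euc (2 * m)) p p)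

lemma pairingAt_apply (θ : OneForm (2 * m) M) {u : M → ℝ}
    {Φ : Euc (2 * m) → M} {x : Euc (2 * m)} (h : IsParam Φ x)
    (hu : DifferentiableAt ℝ (fun y => u (Φ y)) x) :
    pairingAt g J θ u (Φ x) = fluxPairing g J θ u Φ x := by
  have hp : IsParam (chartAt (Euc (2 * m)) (Φ x)).symm (chartAt (Euc (2 * m)) (Φ x) (Φ x)) :=
    isParam_symm_of_mem_maximalAtlas (IsManifold.chart_mem_maximalAtlas (Φ x))
      (mem_chart_target _ _)
  have he : (chartAt (Euc (2 * m)) (Φ x)).symm (chartAt (Euc (2 * m)) (Φ x) (Φ x)) = Φ x :=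
    (chartAt (Euc (2 * m)) (Φ x)).left_inv (mem_chart_source _ _)
  obtain ⟨φ, hφx, hφ, hev⟩ := hp.exists_transition h he
  have h1 := fluxPairing_comp (g := g) (J := J) θ (u := u) hp (by rwa [hφx])
    (hφ.differentiableAt (by simp)) hev (by rwa [hφx])
  rw [pairingAt, h1, hφx]

lemma pd_eq_zero_of_isMin {n : ℕ} {ψ : Euc n → ℝ} {x : Euc n} (h0 : ψ x = 0) (h : ∀ y, 0 ≤ ψ y)
    (a : Fin n) : pd a ψ x = 0 := by
  have : IsLocalMin ψ x := Eventually.of_forall fun y => by rw [h0]; exact h y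
  rw [pd, this.fderiv_eq_zero]
  rfl

namespace AsymptoticChart

variable {c c' : AsymptoticChart (2 * m) M} {θ : OneForm (2 * m) M} {r r' : ℝ}

lemma contDiffAt_paramFlux (hK : IsKahler g J) (hr : c.R ≤ r)
    (hθ : IsRicciPrimitiveOn g J θ (c.tail r)) (a : Fin (2 * m)) {x : Euc (2 * m)}
    (hx : r < ‖x‖) : ContDiffAt ℝ 1 (paramFlux g J θ c.toFun a) x :=
  (c.isKahlerOn hK hr).smooth_fluxField hx
    (fun k => hθ.contDiffAt_formCoeff (c.isOpen_tail hr) (c.isParam (hr.trans_lt hx))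
      (c.toFun_mem_tail hx) k) a

lemma div_paramFlux (hm : 0 < m) (hK : IsKahler g J) (hr : c.R ≤ r)
    (hθ : IsRicciPrimitiveOn g J θ (c.tail r)) {x : Euc (2 * m)} (hx : r < ‖x‖) :
    ∑ a, pd a (paramFlux g J θ c.toFun a) x
      = (m - 1).factorial / 2 *
        (volDensity g c.toFun x * scalarCurvature g (c.toFun x)) := by
  have hp := c.isParam (hr.trans_lt hx)
  have ht := c.toFun_mem_tail hx
  rw [scalarCurvature_apply g hp, mul_comm (volDensity g c.toFun x)]
  exact (c.isKahlerOn hK hr).div_fluxField_of_primitive hm hx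
    (fun k => hθ.contDiffAt_formCoeff (c.isOpen_tail hr) hp ht k)
    (fun j k => hθ.pd_formCoeff (c.isOpen_tail hr) hp ht j k)

section Integrability

variable [SecondCountableTopology M] [MeasurableSpace M] [BorelSpace M]

/-- The divergence of the flux field of a primitive of the Ricci form is a multiple of the scalar
curvature density, hence integrable near infinity. -/
lemma integrableOn_div (hm : 0 < m) (hK : IsKahler g J)
    (hs : Integrable (scalarCurvature g) (riemannianVolume g)) (hr : c.R ≤ r)
    (hθ : IsRicciPrimitiveOn g J θ (c.tail r)) :
    IntegrableOn (fun x => ∑ a, pd a (paramFlux g J θ c.toFun a) x) {x | r < ‖x‖} := by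
  have h1 : Integrable (scalarCurvature g) (c.chartMeasure g) :=
    (hs.smul_measure (ENNReal.natCast_ne_top (Nat.card c.Γ))).mono_measure (c.chartMeasure_le g)
  have h2 := integrableOn_of_parMeasure g (isOpen_lt_norm _) (c.subset_paramDomain le_rfl) h1
  have h3 := (h2.mono_set (s := {x | r < ‖x‖}) fun x hx => hr.trans_lt hx).const_mul
    ((m - 1).factorial / 2)
  exact IntegrableOn.congr_fun h3 (fun x hx => (div_paramFlux hm hK hr hθ hx).symm)
    (isOpen_lt_norm r).measurableSet

lemma exists_tendsto_flux (hm : 0 < m) (hK : IsKahler g J)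
    (hs : Integrable (scalarCurvature g) (riemannianVolume g)) (hr : c.R ≤ r)
    (hθ : IsRicciPrimitiveOn g J θ (c.tail r)) :
    ∃ L, Tendsto (sphereFlux (paramFlux g J θ c.toFun)) atTop (𝓝 L) :=
  exists_tendsto_sphereFlux (by omega) (c.R_pos.trans_le hr)
    (fun a _ hx => contDiffAt_paramFlux hK hr hθ a hx) (integrableOn_div hm hK hs hr hθ)

end Integrability

/-- The limit of the fluxes does not depend on the primitive of the Ricci form. -/
lemma tendsto_flux_of_primitive (hm : 2 ≤ m) (hK : IsKahler g J) (hr : c.R ≤ r) (hr' : c.R ≤ r')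
    {θ' : OneForm (2 * m) M} (hθ : IsRicciPrimitiveOn g J θ (c.tail r))
    (hθ' : IsRicciPrimitiveOn g J θ' (c.tail r')) {L : ℝ}
    (hL : Tendsto (sphereFlux (paramFlux g J θ c.toFun)) atTop (𝓝 L)) :
    Tendsto (sphereFlux (paramFlux g J θ' c.toFun)) atTop (𝓝 L) := by
  set s := max r r'
  have hs : c.R ≤ s := hr.trans (le_max_left _ _)
  have hs0 : 0 < s := c.R_pos.trans_le hs
  have hrs : ∀ x : Euc (2 * m), s < ‖x‖ → r < ‖x‖ := fun x hx => (le_max_left _ _).trans_lt hx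
  have hrs' : ∀ x : Euc (2 * m), s < ‖x‖ → r' < ‖x‖ := fun x hx => (le_max_right _ _).trans_lt hx
  have h1 : ∀ k x, s < ‖x‖ → ContDiffAt ℝ 1 (formCoeff θ c.toFun k) x := fun k x hx =>
    hθ.contDiffAt_formCoeff (c.isOpen_tail hr) (c.isParam (hs.trans_lt hx))
      (c.toFun_mem_tail (hrs x hx)) k
  have h2 : ∀ k x, s < ‖x‖ → ContDiffAt ℝ 1 (formCoeff θ' c.toFun k) x := fun k x hx =>
    hθ'.contDiffAt_formCoeff (c.isOpen_tail hr') (c.isParam (hs.trans_lt hx))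
      (c.toFun_mem_tail (hrs' x hx)) k
  set β : Fin (2 * m) → Euc (2 * m) → ℝ :=
    fun k x => formCoeff θ' c.toFun k x - formCoeff θ c.toFun k x with hβ
  have hk := c.isKahlerOn hK hs
  have hβs : ∀ k x, s < ‖x‖ → ContDiffAt ℝ 1 (β k) x := fun k x hx =>
    (h2 k x hx).sub (h1 k x hx)
  have h0 := hk.sphereFlux_closed hm hs0 (β := β) hβs fun j k x hx => by
      have e1 := hθ.pd_formCoeff (c.isOpen_tail hr) (c.isParam (hs.trans_lt hx))
        (c.toFun_mem_tail (hrs x hx)) j k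
      have e2 := hθ'.pd_formCoeff (c.isOpen_tail hr') (c.isParam (hs.trans_lt hx))
        (c.toFun_mem_tail (hrs' x hx)) j k
      have e3 : ∀ j k, pd j (β k) x
          = pd j (formCoeff θ' c.toFun k) x - pd j (formCoeff θ c.toFun k) x := fun j k =>
        pd_sub ((h2 k x hx).differentiableAt (by norm_num))
          ((h1 k x hx).differentiableAt (by norm_num)) j
      rw [e3, e3]
      linarith
  refine hL.congr' ?_
  filter_upwards [h0, eventually_gt_atTop s] with t ht hst
  have e1 : sphereFlux (paramFlux g J θ' c.toFun) t = sphereFlux (fun a x =>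
      paramFlux g J θ c.toFun a x +
        fluxField (metricCoeff g c.toFun) (endCoeff J c.toFun) β a x) t := by
    congr 1
    funext a x
    simp only [paramFlux, fluxField, hβ, ← Finset.sum_add_distrib]
    exact Finset.sum_congr rfl fun k _ => by ring
  rw [e1, sphereFlux_add hs0.le hst
    (fun a x hx => (contDiffAt_paramFlux hK hr hθ a (hrs x hx)).continuousAt)
    (fun a x hx => (hk.smooth_fluxField hx (fun k => hβs k x hx) a).continuousAt), ht, add_zero]

omit [IsManifold 𝓘(ℝ, Euc (2 * m)) ∞ M] in
/-- In a chart of the end, a function of the radius in another chart is smooth far out. -/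
lemma contDiffAt_step_radius {k : ℝ} (hk : 0 < k) {x : Euc (2 * m)} (hx : c'.R < ‖x‖)
    (hxc : c'.toFun x ∈ c.tail c.R) :
    ContDiffAt ℝ 1 (fun y => step k (c.radius (c'.toFun y))) x := by
  obtain ⟨y, hy, hyx⟩ := hxc
  obtain ⟨φ, hφx, hφ, h⟩ := (c'.isParam hx).exists_transition (c.isParam hy) hyx.symm
  have hφ1 : ContDiffAt ℝ 1 φ x := hφ.of_le (by norm_cast)
  refine (((step_norm hk).1.contDiffAt (x := φ x)).comp x hφ1).congr_of_eventuallyEq ?_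
  filter_upwards [h, hφ.continuousAt.norm.eventually_const_lt (u := c.R)
    (show c.R < ‖φ x‖ by rw [hφx]; exact hy)] with z hz hzR
  rw [hz, c.radius_toFun hzR]
  rfl

variable [T2Space M] [SecondCountableTopology M] [MeasurableSpace M] [BorelSpace M]

omit [T2Space M] in
/-- The integral over the end of `θ ∧ ω^{m-1}` against the differential of a cut-off function, in two
charts. -/
lemma avgFlux_eq_integral (hm : 0 < m) (hK : IsKahler g J) (hr : c.R ≤ r) (hr' : c'.R ≤ r')
    (hθ : IsRicciPrimitiveOn g J θ (c.tail r)) {k : ℝ} (hk : r < k)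
    (hkc : c.tail k ⊆ c'.tail r') {ψ : Euc (2 * m) → ℝ} (hψ0 : ∀ x, 0 ≤ ψ x)
    (hψ : ∀ x, r' < ‖x‖ → ψ =ᶠ[𝓝 x] fun y => step k (c.radius (c'.toFun y)))
    (hψ1 : ∀ x, ‖x‖ ≤ r' → ψ x = 0) :
    (Nat.card c.Γ : ℝ)⁻¹ * avgFlux (paramFlux g J θ c.toFun) k
      = (Nat.card c'.Γ : ℝ)⁻¹ * ∫ x, ∑ a, pd a ψ x * paramFlux g J θ c'.toFun a x := by
  classical
  have hk0 : 0 < k := (c.R_pos.trans_le hr).trans hk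
  have hRk : c.R ≤ k := hr.trans hk.le
  set u : M → ℝ := fun p => step k (c.radius p) with hu
  set O := c.tail k with hO
  have hOo : IsOpen O := c.isOpen_tail hRk
  set h : M → ℝ := fun p => if p ∈ O then -(m - 1).factorial * pairingAt g J θ u p else 0 with hh
  have huc : ∀ x, c.R < ‖x‖ → (fun y => u (c.toFun y)) =ᶠ[𝓝 x] fun y => step k ‖y‖ := by
    intro x hx
    filter_upwards [(isOpen_lt_norm c.R).mem_nhds hx] with y hy
    simp only [hu, c.radius_toFun hy]
  have hmem : ∀ x, c.R < ‖x‖ → (c.toFun x ∈ O ↔ k < ‖x‖) := fun x hx => by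
    rw [hO, c.mem_tail_iff hRk, c.radius_toFun hx]
  -- in the first chart the cut-off function is radial
  have h1 : ∀ x, c.R < ‖x‖ → volDensity g c.toFun x * h (c.toFun x)
      = ∑ a, pd a (fun y => step k ‖y‖) x * paramFlux g J θ c.toFun a x := by
    intro x hx
    by_cases hkx : k < ‖x‖
    · have e1 : h (c.toFun x) = -(m - 1).factorial * pairingAt g J θ u (c.toFun x) :=
        if_pos ((hmem x hx).2 hkx)
      have e2 : DifferentiableAt ℝ (fun y => u (c.toFun y)) x :=
        (((step_norm hk0).1.differentiable (by norm_num) x).congr_of_eventuallyEq (huc x hx))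
      rw [e1, pairingAt_apply θ (c.isParam hx) e2,
        ← sum_pd_mul_paramFlux hm hK θ u (c.isParam hx)]
      exact Finset.sum_congr rfl fun a _ => by rw [pd_congr (huc x hx)]
    · have e1 : h (c.toFun x) = 0 := if_neg fun hc => hkx ((hmem x hx).1 hc)
      rw [e1, mul_zero, eq_comm]
      refine Finset.sum_eq_zero fun a _ => ?_
      rw [pd_eq_zero_of_isMin (step_eq_zero (not_lt.1 hkx)) (fun y => step_nonneg k ‖y‖), zero_mul]
  -- in the second chart it is `ψ`, which attains its minimum `0` outside `O`
  have h2 : ∀ x, c'.R < ‖x‖ → volDensity g c'.toFun x * h (c'.toFun x)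
      = ∑ a, pd a ψ x * paramFlux g J θ c'.toFun a x := by
    intro x hx
    by_cases hxO : c'.toFun x ∈ O
    · have hx' : r' < ‖x‖ := by
        have := (c'.mem_tail_iff hr').1 (hkc hxO)
        rwa [c'.radius_toFun hx] at this
      have e1 : h (c'.toFun x) = -(m - 1).factorial * pairingAt g J θ u (c'.toFun x) :=
        if_pos hxO
      have e2 : DifferentiableAt ℝ (fun y => u (c'.toFun y)) x :=
        (contDiffAt_step_radius hk0 hx (c.tail_mono hRk hxO)).differentiableAt (by norm_num)
      rw [e1, pairingAt_apply θ (c'.isParam hx) e2,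
        ← sum_pd_mul_paramFlux hm hK θ u (c'.isParam hx)]
      exact Finset.sum_congr rfl fun a _ => by rw [pd_congr (hψ x hx')]
    · have e1 : h (c'.toFun x) = 0 := if_neg hxO
      have e2 : ψ x = 0 := by
        by_cases hx' : r' < ‖x‖
        · rw [(hψ x hx').eq_of_nhds]
          exact step_eq_zero (not_lt.1 fun hlt => hxO ((c.mem_tail_iff hRk).2 hlt))
        · exact hψ1 x (not_lt.1 hx')
      rw [e1, mul_zero, eq_comm]
      exact Finset.sum_eq_zero fun a _ => by rw [pd_eq_zero_of_isMin e2 hψ0, zero_mul]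
  have hcont : ContinuousOn h O := by
    rintro _ ⟨x, hx, rfl⟩
    have hxk : k < ‖x‖ := hx
    have hxR : c.R < ‖x‖ := hRk.trans_lt hxk
    refine ContinuousAt.continuousWithinAt ?_
    rw [ContinuousAt, ← c.map_nhds hxR, tendsto_map'_iff]
    have hd : ContinuousAt (volDensity g c.toFun) x := continuousAt_volDensity g (c.isParam hxR)
    have hd0 : ∀ y, c.R < ‖y‖ → volDensity g c.toFun y ≠ 0 := fun y hy =>
      (Real.sqrt_pos.2 ((c.isParam hy).posDef_metricCoeff g).det_pos).ne'
    have hF : ContinuousAt (fun x => (∑ a, pd a (fun y => step k ‖y‖) x *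
        paramFlux g J θ c.toFun a x) / volDensity g c.toFun x) x := by
      refine ContinuousAt.div (tendsto_finsetSum _ fun a _ => Tendsto.mul ?_ ?_) hd (hd0 x hxR)
      · exact continuousAt_pd (step_norm hk0).1.contDiffAt a
      · exact (contDiffAt_paramFlux hK hr hθ a (hk.trans hxk)).continuousAt
    have he : ∀ y, c.R < ‖y‖ → (∑ a, pd a (fun y => step k ‖y‖) y *
        paramFlux g J θ c.toFun a y) / volDensity g c.toFun y = h (c.toFun y) := fun y hy => by
      rw [← h1 y hy, mul_div_cancel_left₀ _ (hd0 y hy)]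
    have hT := hF.tendsto
    simp only [he x hxR] at hT
    refine hT.congr' ?_
    filter_upwards [(isOpen_lt_norm c.R).mem_nhds hxR] with y hy using he y hy
  have key := c.integral_overlap_eq g c' hOo (c.tail_mono hRk)
    (hkc.trans (c'.tail_mono hr')) hcont fun p hp => if_neg hp
  rw [setIntegral_congr_fun (isOpen_lt_norm c.R).measurableSet fun x hx => h1 x hx,
    setIntegral_congr_fun (isOpen_lt_norm c'.R).measurableSet fun x hx => h2 x hx,
    setIntegral_eq_integral_of_forall_compl_eq_zero,
    setIntegral_eq_integral_of_forall_compl_eq_zero] at key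
  · exact key
  · intro x hx
    have hx' : ‖x‖ ≤ r' := (not_lt.1 hx).trans hr'
    exact Finset.sum_eq_zero fun a _ => by rw [pd_eq_zero_of_isMin (hψ1 x hx') hψ0, zero_mul]
  · intro x hx
    have hx' : ‖x‖ ≤ k := (not_lt.1 hx).trans hRk
    exact Finset.sum_eq_zero fun a _ => by
      rw [pd_eq_zero_of_isMin (step_eq_zero hx') (fun y => step_nonneg k ‖y‖), zero_mul]

/-- The limits of the fluxes in two charts of the same end agree up to the orders of the groups:
averaged fluxes in the two charts differ by the integral of a multiple of the scalar curvature over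
a region far out. -/
lemma flux_limit_eq (hm : 0 < m) (hK : IsKahler g J)
    (hs : Integrable (scalarCurvature g) (riemannianVolume g)) {τ τ' : ℝ} (hτ : 0 < τ)
    (hτ' : 0 < τ') (hc : c.HasFallOff g τ) (hc' : c'.HasFallOff g τ') (hcc' : c.SameEnd c')
    (hr : c.R ≤ r) (hr' : c'.R ≤ r') (hθ : IsRicciPrimitiveOn g J θ (c.tail r))
    (hθ' : IsRicciPrimitiveOn g J θ (c'.tail r')) {L L' : ℝ}
    (hL : Tendsto (sphereFlux (paramFlux g J θ c.toFun)) atTop (𝓝 L))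
    (hL' : Tendsto (sphereFlux (paramFlux g J θ c'.toFun)) atTop (𝓝 L')) :
    (Nat.card c.Γ : ℝ)⁻¹ * L = (Nat.card c'.Γ : ℝ)⁻¹ * L' := by
  have hn : 0 < 2 * m := by omega
  set V := paramFlux g J θ c.toFun
  set V' := paramFlux g J θ c'.toFun with hV'
  have hVs : ∀ a x, r < ‖x‖ → ContDiffAt ℝ 1 (V a) x := fun a x hx =>
    contDiffAt_paramFlux hK hr hθ a hx
  have hVs' : ∀ a x, r' < ‖x‖ → ContDiffAt ℝ 1 (V' a) x := fun a x hx =>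
    contDiffAt_paramFlux hK hr' hθ' a hx
  have hi := integrableOn_div hm hK hs hr' hθ'
  have hA := tendsto_avgFlux hn (c.R_pos.trans_le hr) (fun a x hx => (hVs a x hx).continuousAt) hL
  have hA' := tendsto_avgFlux hn (c'.R_pos.trans_le hr')
    (fun a x hx => (hVs' a x hx).continuousAt) hL'
  obtain ⟨a₀, ha₀, hsub⟩ := exists_tail_subset hτ' hc' hcc'.symm r
  have hfin := c'.finite
  have hp' : (Nat.card c'.Γ : ℝ) ≠ 0 := Nat.cast_ne_zero.2 Nat.card_pos.ne'
  -- A cut-off function of the radius in the first chart, rising from `0` to `1` beyond `k` and hence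
  -- supported where the second radius exceeds `ρ`, serves as a cut-off function in both charts.
  have claim : ∀ ρ, max r' a₀ ≤ ρ → |L' - Nat.card c'.Γ * ((Nat.card c.Γ : ℝ)⁻¹ * L)|
      ≤ ∫ x in {x | ρ < ‖x‖}, |∑ a, pd a (V' a) x| := by
    intro ρ hρ
    have hr'ρ : r' ≤ ρ := (le_max_left _ _).trans hρ
    have ha₀ρ : a₀ ≤ ρ := (le_max_right _ _).trans hρ
    have hRρ : c'.R ≤ ρ := hr'.trans hr'ρ
    obtain ⟨k₀, hk₀, hk₀c⟩ := exists_tail_subset hτ hc hcc' (ρ + 1)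
    have hlim : Tendsto (fun k => |L' - Nat.card c'.Γ * ((Nat.card c.Γ : ℝ)⁻¹ * avgFlux V k)|)
        atTop (𝓝 |L' - Nat.card c'.Γ * ((Nat.card c.Γ : ℝ)⁻¹ * L)|) :=
      (tendsto_const_nhds.sub ((hA.const_mul _).const_mul _)).abs
    refine le_of_tendsto hlim ?_
    filter_upwards [eventually_gt_atTop (max k₀ r)] with k hk
    have hrk : r < k := (le_max_right _ _).trans_lt hk
    have hRk : c.R ≤ k := hr.trans hrk.le
    have hk0 : 0 < k := (c.R_pos.trans_le hr).trans hrk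
    have hkc : c.tail k ⊆ c'.tail (ρ + 1) :=
      (c.tail_mono ((le_max_left _ _).trans hk.le)).trans hk₀c
    obtain ⟨N, -, hN⟩ := exists_tail_subset hτ' hc' hcc'.symm (k + 1)
    set ψ : Euc (2 * m) → ℝ := fun x => if ρ < ‖x‖ then step k (c.radius (c'.toFun x)) else 0
      with hψ
    have hψe : ∀ x, ρ < ‖x‖ → ψ =ᶠ[𝓝 x] fun y => step k (c.radius (c'.toFun y)) := by
      intro x hx
      filter_upwards [(isOpen_lt_norm ρ).mem_nhds hx] with y hy using if_pos hy
    have hψb : ∀ x, 0 ≤ ψ x ∧ ψ x ≤ 1 := by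
      intro x
      simp only [hψ]
      split_ifs
      exacts [⟨step_nonneg _ _, step_le_one _ _⟩, ⟨le_rfl, zero_le_one⟩]
    have hψ0 : ∀ x, ‖x‖ < ρ + 1 → ψ x = 0 := by
      intro x hx
      simp only [hψ]
      split_ifs with h
      · refine step_eq_zero (not_lt.1 fun hlt => ?_)
        have h1 := hkc ((c.mem_tail_iff hRk).2 hlt)
        rw [c'.mem_tail_iff (by linarith), c'.radius_toFun (hRρ.trans_lt h)] at h1
        linarith
      · rfl
    have hψ1 : ∀ x, max N ρ < ‖x‖ → ψ x = 1 := by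
      intro x hx
      have h1 : ρ < ‖x‖ := (le_max_right _ _).trans_lt hx
      have h2 := hN (c'.toFun_mem_tail ((le_max_left _ _).trans_lt hx))
      rw [c.mem_tail_iff (by linarith)] at h2
      simp only [hψ, if_pos h1]
      exact step_eq_one h2.le
    have hψs : ContDiff ℝ 1 ψ := by
      refine contDiff_iff_contDiffAt.2 fun x => ?_
      rcases lt_or_ge ρ ‖x‖ with hx | hx
      · exact (contDiffAt_step_radius hk0 (hRρ.trans_lt hx) (c.tail_mono hr
          (hsub (c'.toFun_mem_tail (ha₀ρ.trans_lt hx))))).congr_of_eventuallyEq (hψe x hx)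
      · have : ψ =ᶠ[𝓝 x] fun _ => 0 := by
          have ho : IsOpen {y : Euc (2 * m) | ‖y‖ < ρ + 1} :=
            isOpen_lt continuous_norm continuous_const
          filter_upwards [ho.mem_nhds (show ‖x‖ < ρ + 1 by linarith)] with y hy using hψ0 y hy
        exact contDiffAt_const.congr_of_eventuallyEq this
    have e1 := avgFlux_eq_integral hm hK hr hRρ hθ hrk
      (hkc.trans (c'.tail_mono (by linarith))) (fun x => (hψb x).1) hψe
      (fun x hx => hψ0 x (by linarith))
    have e2 : (Nat.card c'.Γ : ℝ) * ((Nat.card c.Γ : ℝ)⁻¹ * avgFlux V k)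
        = ∫ x, ∑ a, pd a ψ x * V' a x := by
      rw [e1, mul_inv_cancel_left₀ hp']
    rw [e2]
    refine le_of_tendsto ((hA'.sub_const _).abs) ?_
    filter_upwards [eventually_ge_atTop (ρ + 1)] with j hj
    exact abs_avgFlux_sub_le (c'.R_pos.trans_le hRρ) (by linarith) hj hψs hψ0 hψ1 hψb
      (fun a x hx => hVs' a x (hr'ρ.trans_lt hx))
      (hi.mono_set fun x hx => hr'ρ.trans_lt hx)
  have h0 : |L' - Nat.card c'.Γ * ((Nat.card c.Γ : ℝ)⁻¹ * L)| ≤ 0 :=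
    ge_of_tendsto (tendsto_integral_tail hi) ((eventually_ge_atTop (max r' a₀)).mono claim)
  have h1 := sub_eq_zero.1 (abs_nonpos_iff.1 h0)
  rw [h1, inv_mul_cancel_left₀ hp']

end AsymptoticChart

end Comparison

/-! ### The mass and the Ricci form -/

section Mass

variable {m : ℕ} {M : Type*} [TopologicalSpace M] [ChartedSpace (Euc (2 * m)) M]
  [IsManifold 𝓘(ℝ, Euc (2 * m)) ∞ M] {g : Metric2 (2 * m) M} {J : EndField (2 * m) M}

lemma IsRicciPrimitiveOn.mono {θ : OneForm (2 * m) M} {U V : Set M}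
    (h : IsRicciPrimitiveOn g J θ U) (hV : V ⊆ U) : IsRicciPrimitiveOn g J θ V :=
  ⟨h.contMDiffOn.mono hV, fun e he x hx hxV => h.d_eq e he x hx (hV hxV)⟩

namespace AsymptoticChart

variable {c : AsymptoticChart (2 * m) M} {θ : OneForm (2 * m) M} {r L : ℝ}

lemma massIntegral_eq (hm : 0 < m) (g : Metric2 (2 * m) M) (c : AsymptoticChart (2 * m) M)
    (t : ℝ) : c.massIntegral g t = (m - 1).factorial / (4 * (2 * m - 1) * Real.pi ^ m) *
      ((Nat.card c.Γ : ℝ)⁻¹ * sphereFlux (massField (metricCoeff g c.toFun)) t) := by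
  obtain ⟨l, rfl⟩ : ∃ l, m = l + 1 := ⟨m - 1, by omega⟩
  have h1 : ((2 * (l + 1) : ℕ) : ℝ) / 2 = (l : ℝ) + 1 := by push_cast; ring
  have h2 : Real.pi ^ ((l : ℝ) + 1) = Real.pi ^ (l + 1) := by
    rw [← Real.rpow_natCast]; push_cast; rfl
  rw [massIntegral, h1, Real.Gamma_nat_eq_factorial, h2, sphereFlux, Nat.add_sub_cancel]
  congr 3
  · push_cast; rfl
  · funext x
    exact Finset.sum_congr rfl fun a _ => mul_comm _ _

lemma formIntegral_eq (hm : 0 < m) (hK : IsKahler g J) (θ : OneForm (2 * m) M) {t : ℝ}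
    (ht : c.R < t) : c.formIntegral g J θ t
      = (Nat.card c.Γ : ℝ)⁻¹ * sphereFlux (paramFlux g J θ c.toFun) t := by
  rw [formIntegral, sphereFlux]
  congr 1
  refine sphereIntegral_congr (c.R_pos.trans ht).le fun x hx => ?_
  have hxR : c.R < ‖x‖ := by rwa [hx]
  rw [(c.isParam hxR).kahlerFormCoeff_eq]
  exact (c.isKahlerOn hK le_rfl).fluxDensity_eq_fluxField hm hxR fun k => formCoeff θ c.toFun k

/-- The mass is determined by the limit of the fluxes of any primitive of the Ricci form. -/
lemma hasMass_of_tendsto_flux (hm : 2 ≤ m) (hK : IsKahler g J) {τ : ℝ} (hτ : (m : ℝ) - 1 < τ)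
    (hc : c.HasFallOff g τ) (hr : c.R ≤ r) (hθ : IsRicciPrimitiveOn g J θ (c.tail r))
    (hL : Tendsto (sphereFlux (paramFlux g J θ c.toFun)) atTop (𝓝 L)) :
    c.HasMass g (1 / (2 * (2 * (m : ℝ) - 1) * Real.pi ^ m) * ((Nat.card c.Γ : ℝ)⁻¹ * L)) := by
  obtain ⟨r₀, hr₀, θ₀, hθ₀, hd⟩ := exists_primitive hm hK c hτ hc
  have h1 := tendsto_flux_of_primitive hm hK hr hr₀ hθ hθ₀ hL
  have h2 := (((h1.sub hd).const_mul (Nat.card c.Γ : ℝ)⁻¹).const_mul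
    (1 / (2 * (2 * (m : ℝ) - 1) * Real.pi ^ m)))
  rw [sub_zero] at h2
  refine h2.congr fun t => ?_
  have hm' : (2 * (m : ℝ) - 1) ≠ 0 := by
    have : (2 : ℝ) ≤ m := by exact_mod_cast hm
    linarith
  have hpi : Real.pi ^ m ≠ 0 := pow_ne_zero _ Real.pi_ne_zero
  rw [massIntegral_eq (by omega), paramFlux, sub_sub_cancel]
  field_simp
  ring

lemma tendsto_formIntegral (hm : 0 < m) (hK : IsKahler g J)
    (hL : Tendsto (sphereFlux (paramFlux g J θ c.toFun)) atTop (𝓝 L)) :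
    Tendsto (c.formIntegral g J θ) atTop (𝓝 ((Nat.card c.Γ : ℝ)⁻¹ * L)) := by
  refine (hL.const_mul _).congr' ?_
  filter_upwards [eventually_gt_atTop c.R] with t ht using (formIntegral_eq hm hK θ ht).symm

end AsymptoticChart

end Mass

end KahlerMass

end

theorem mainTheorem6 (m : ℕ) (hm : 2 ≤ m)
    {M : Type*} [TopologicalSpace M] [T2Space M] [SecondCountableTopology M]
    [MeasurableSpace M] [BorelSpace M]
    [ChartedSpace (KahlerMass.Euc (2 * m)) M]
    [IsManifold 𝓘(ℝ, KahlerMass.Euc (2 * m)) ∞ M]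
    (g : KahlerMass.Metric2 (2 * m) M) (J : KahlerMass.EndField (2 * m) M)
    (hK : KahlerMass.IsKahler g J)
    (hs : Integrable (KahlerMass.scalarCurvature g) (KahlerMass.riemannianVolume g))
    (c : KahlerMass.AsymptoticChart (2 * m) M) (ε : ℝ) (hε : 0 < ε)
    (hc : c.HasFallOff g ((m : ℝ) - 1 + ε)) :
    ∃ μ : ℝ,
      c.HasMass g μ ∧
      (∃ r : ℝ, c.R ≤ r ∧ ∃ θ : KahlerMass.OneForm (2 * m) M,
        KahlerMass.IsRicciPrimitiveOn g J θ (c.tail r)) ∧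
      (∀ r : ℝ, c.R ≤ r → ∀ θ : KahlerMass.OneForm (2 * m) M,
        KahlerMass.IsRicciPrimitiveOn g J θ (c.tail r) →
          Tendsto (fun ϱ : ℝ =>
            1 / (2 * (2 * (m : ℝ) - 1) * Real.pi ^ m) * c.formIntegral g J θ ϱ) atTop (𝓝 μ)) ∧
      (∀ c' : KahlerMass.AsymptoticChart (2 * m) M, c.SameEnd c' →
        ∀ ε' : ℝ, 0 < ε' → c'.HasFallOff g ((m : ℝ) - 1 + ε') → c'.HasMass g μ) := by
  have hm0 : 0 < m := by omega
  have hτ : (m : ℝ) - 1 < (m : ℝ) - 1 + ε := by linarith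
  have hm1 : (2 : ℝ) ≤ m := by exact_mod_cast hm
  obtain ⟨r, hr, θ, hθ, -⟩ := KahlerMass.AsymptoticChart.exists_primitive hm hK c hτ hc
  obtain ⟨L, hL⟩ := KahlerMass.AsymptoticChart.exists_tendsto_flux hm0 hK hs hr hθ
  refine ⟨1 / (2 * (2 * (m : ℝ) - 1) * Real.pi ^ m) * ((Nat.card c.Γ : ℝ)⁻¹ * L),
    KahlerMass.AsymptoticChart.hasMass_of_tendsto_flux hm hK hτ hc hr hθ hL,
    ⟨r, hr, θ, hθ⟩, ?_, ?_⟩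
  · intro r' hr' θ' hθ'
    exact (KahlerMass.AsymptoticChart.tendsto_formIntegral hm0 hK
      (KahlerMass.AsymptoticChart.tendsto_flux_of_primitive hm hK hr hr' hθ hθ' hL)).const_mul _
  · intro c' hcc' ε' hε' hc'
    have hτ' : (m : ℝ) - 1 < (m : ℝ) - 1 + ε' := by linarith
    -- The given primitive also serves in the second chart, as the spheres there leave every
    -- relatively compact set.
    obtain ⟨r', hr', hsub⟩ := KahlerMass.AsymptoticChart.exists_tail_subset (by linarith) hc'
      hcc'.symm r
    have hθ' := hθ.mono hsub
    obtain ⟨L', hL'⟩ := KahlerMass.AsymptoticChart.exists_tendsto_flux hm0 hK hs hr' hθ'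
    rw [KahlerMass.AsymptoticChart.flux_limit_eq hm0 hK hs (by linarith) (by linarith) hc hc' hcc'
      hr hr' hθ hθ' hL hL']
    exact KahlerMass.AsymptoticChart.hasMass_of_tendsto_flux hm hK hτ' hc' hr' hθ' hL'
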